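/- Let $k$ be an algebraically closed field, $q\in k\setminus\{0,1\}$, $d,\ell\ge 0$ integers, and $\mathbf Q=(Q_1,\dots,Q_\ell)\in(k^*)^\ell$. Put $P=k[x_1^{\pm1},\dots,x_d^{\pm1}]$, on which $\mathfrak S_d$ acts by permuting the variables; $l$ denotes the length function of $\mathfrak S_d$. **The Hecke algebra.** Let $J^{\ell,d}$ be the set of $\mathbf c\in\{0,1\}^{\ell+d}$ with $\sum_i c_i=\ell$ ($0$ is called black, $1$ red); $s_r$ permutes the entries. $H=H_{d,\mathbf Q}(q)$ is the $k$-algebra generated by $e(\mathbf c)$ ($\mathbf c\in J^{\ell,d}$), $T_r$ ($1\le r<\ell+d$), $X_i,X_i'$ ($1\le i\le\ell+d$) with relations: the $e(\mathbf c)$ are orthogonal idempotents with sum $1$; $X_i,X'_i$ commute with all $e(\mathbf c)$, the $X_i$ commute with each other, the $X'_i$ commute with each other; $X_ie(\mathbf c)=X'_ie(\mathbf c)=0$ if $c_i=1$ and $X_iX_i'e(\mathbf c)=X_i'X_ie(\mathbf c)=e(\mathbf c)$ if $c_i=0$; $T_rT_s=T_sT_r$ if $|r-s|>1$; $T_rX_i=X_iT_r$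 if $i\ne r,r+1$; $T_re(\mathbf c)=e(s_r\mathbf c)T_r$, and $T_re(\mathbf c)=0$ if $c_r=c_{r+1}=1$; if $c_r=c_{r+1}=0$ then $$(T_rX_{r+1}-X_rT_r)e(\mathbf c)=(q-1)X_{r+1}e(\mathbf c),\quad (T_rX_r-X_{r+1}T_r)e(\mathbf c)=-(q-1)X_{r+1}e(\mathbf c),\quad T_r^2e(\mathbf c)=((q-1)T_r+q)e(\mathbf c),$$ otherwise $(T_rX_{r+1}-X_rT_r)e(\mathbf c)=(T_rX_r-X_{r+1}T_r)e(\mathbf c)=0$; $T_r^2e(\mathbf c)=(X_r-Q_t)e(\mathbf c)$ if $c_r=0,c_{r+1}=1$, and $T_r^2e(\mathbf c)=(X_{r+1}-Q_t)e(\mathbf c)$ if $c_r=1,c_{r+1}=0$, where the red entry among $c_r,c_{r+1}$ is the $t$-th red entry of $\mathbf c$; finally $(T_rT_{r+1}T_r-T_{r+1}T_rT_{r+1})e(\mathbf c)$ is $0$ if $c_{r+1}=0$ and is $(1-q)X_{r+2}e(\mathbf c)$ if $c_{r+1}=1$, $c_r=c_{r+2}=0$. For $\mathbf c\in J^{\ell,d}$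 let $1_{\mathbf c}<\dots<d_{\mathbf c}$ be the black positions. For $w\in\mathfrak S_d$ with reduced expression $w=s_{k_1}\cdots s_{k_m}$ put $T_w^{\mathbf c}=T_{(k_1)_{\mathbf c}}\cdots T_{(k_m)_{\mathbf c}}e(\mathbf c)$ (used only when every $s_{k_i}$ exchanges black strands that are adjacent in $\mathbf c$). A Laurent polynomial is viewed as an element of $H$ by $x_i=\sum_{\mathbf c}X_{i_{\mathbf c}}e(\mathbf c)$. **Multicompositions.** Let $\mathcal C^\ell_d$ be the set of tuples $\lambda=(\lambda^{(0)},\dots,\lambda^{(\ell)})$ of finite (possibly empty) sequences of positive integers with total sum $d$. Let $\overline\lambda$ be the concatenation, a composition of $d$, let $\mathfrak S_\lambda\subset\mathfrak S_d$ be its Young subgroup with longest element $w_\lambda$, and let $\mathbf c_\lambda\in J^{\ell,d}$ be the sequence: $|\lambda^{(0)}|$ black, one red, $|\lambda^{(1)}|$ black, one red, …, $|\lambda^{(\ell)}|$ black. Put $m_\lambda=\sum_{w\in\mathfrak S_\lambda}(-q)^{l(w_\lambda)-l(w)}T_w^{\mathbf c_\lambda}$ and $$S=S_{d,\mathbf Q}(q)=\operatorname{End}_H\Big(\bigoplus_{\lambda\in\mathcal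 C^\ell_d}m_\lambda H\Big)\qquad\text{(right $H$-modules)}.$$ **Special elements of $S$.** Each of the following is a well-defined homomorphism between summands, extended by zero to the other summands. The idempotent $e(\lambda)$ is the projection to $m_\lambda H$. For $g\in P^{\mathfrak S_\lambda}$, $g\,e(\lambda)\colon m_\lambda h\mapsto g\,m_\lambda h$. If $\mu$ is a split of $\lambda$, i.e. arises by replacing one entry $a+b$ of one $\lambda^{(t)}$ by two entries $a,b>0$, the split $\lambda\to\mu$ is the inclusion $m_\lambda H\subset m_\mu H$ and the merge $\mu\to\lambda$ is $m_\mu h\mapsto m_\lambda h$. If $\mu$ is a left crossing of $\lambda$, i.e. arises by moving the first entry $a$ of $\lambda^{(t)}$ to the end of $\lambda^{(t-1)}$ ($1\le t\le\ell$), let $p$ be the position of the $t$-th red entry of $\mathbf c_\lambda$; the left crossing $\lambda\to\mu$ is left multiplication by $T_{p+a-1}\cdots T_{p+1}T_p\,e(\mathbf c_\lambda)$, and the right crossing $\mu\to\lambda$ is left multiplication by $T_pT_{p+1}\cdots T_{p+a-1}\,e(\mathbf c_\mu)$. **Operators.** $\partial_r(f)=(f-s_r(f))/(x_r-x_{r+1})$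 and $\partial_w=\partial_{k_1}\cdots\partial_{k_m}$ for a reduced expression of $w$. If the entry $a+b$ of $\lambda$ occupies the indices $o+1,\dots,o+a+b$ in $\{1,\dots,d\}$ (the blocks of $\overline\lambda$), let $\overleftarrow p'_{a,b}=\prod_{o<i\le o+a<j\le o+a+b}(x_j-qx_i)$ and $D_{a,b}=\partial_{w_{a,b}}$, where $w_{a,b}(o+i)=o+i+b$ for $1\le i\le a$, $w_{a,b}(o+a+j)=o+j$ for $1\le j\le b$, and $w_{a,b}$ fixes all other indices. **Embedding.** Let $\omega=(1,\dots,1,0,\dots,0)\in J^{\ell,d}$, $n_t=\sum_{i<t}|\lambda^{(i)}|$, $\mathfrak r_\lambda=R_1R_2\cdots R_\ell\,e(\omega)$ with $R_t=T_{t+n_t-1}\cdots T_{t+1}T_t$, $\overrightarrow p_\lambda=\prod(x_i-qx_j)$ over all $i<j$ in the same block of $\overline\lambda$, and $$\Phi_\lambda(f)=\mathfrak r_\lambda\Big(\sum_{w\in\mathfrak S_\lambda}(-q)^{l(w_\lambda)-l(w)}T_w^{\omega}\Big)\,\overrightarrow p_\lambda f\,\Big(\sum_{w}T_w^{\omega}\Big)\qquad(f\in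 P^{\mathfrak S_\lambda}),$$ the last sum being over the shortest representatives $w$ of the cosets $\mathfrak S_\lambda\backslash\mathfrak S_d$. **Proposition.** There is a unique action of the $k$-algebra $S_{d,\mathbf Q}(q)$ on $\mathrm{sP}=\bigoplus_{\lambda\in\mathcal C_d^\ell}P^{\mathfrak S_\lambda}e(\lambda)$ such that * $e(\lambda)$ acts as the projection to $P^{\mathfrak S_\lambda}e(\lambda)$; * $g\,e(\lambda)$, $g\in P^{\mathfrak S_\lambda}$, sends $fe(\lambda)$ to $gfe(\lambda)$; * a split $\lambda\to\mu$ sends $fe(\lambda)$ to $\overleftarrow p'_{a,b}f\,e(\mu)$, and the merge $\mu\to\lambda$ sends $fe(\mu)$ to $D_{a,b}(f)e(\lambda)$; * a left crossing $\lambda\to\mu$ sends $fe(\lambda)$ to $fe(\mu)$; * a right crossing $\mu\to\lambda$ sends $fe(\mu)$ to $\prod_{i}(x_i-Q_t)\,f\,e(\lambda)$, the product over the $a$ indices $i\in\{n_t+1,\dots,n_t+a\}$ of the moved block $\lambda^{(t)}_1$, and each of these elements sends the other summands of $\mathrm{sP}$ to zero. This representation is faithful. Moreover $\Phi_\lambda$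 takes values in $m_\lambda H$, and the linear map $\mathrm{sP}\to\bigoplus_\lambda m_\lambda H$, $fe(\lambda)\mapsto\Phi_\lambda(f)$, is injective and commutes with the action of $S_{d,\mathbf Q}(q)$. -/

import Mathlib

open scoped DirectSum

noncomputable section

namespace AffineSchur

/-! ### The symmetric group: simple transpositions, length, reduced words -/

/-- The simple transposition exchanging `r` and `r + 1` (positions are counted from `0`). -/
def simpleRefl {d : ℕ} (r : Fin (d - 1)) : Equiv.Perm (Fin d) :=
  Equiv.swap ⟨r, by omega⟩ ⟨r + 1, by omega⟩

theorem exists_word {d : ℕ} (w : Equiv.Perm (Fin d)) :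
    ∃ L : List (Fin (d - 1)), (L.map simpleRefl).prod = w := by
  cases d with
  | zero => exact ⟨[], Subsingleton.elim _ _⟩
  | succ n =>
    have hw : w ∈ Submonoid.closure
        (Set.range fun i : Fin n => Equiv.swap i.castSucc i.succ) := by
      rw [Equiv.Perm.mclosure_swap_castSucc_succ]; trivial
    induction hw using Submonoid.closure_induction with
    | mem x hx =>
      obtain ⟨i, rfl⟩ := hx
      exact ⟨[i], by simp only [List.map_cons, List.map_nil, List.prod_singleton]; rfl⟩
    | one => exact ⟨[], rfl⟩
    | mul x y _ _ hx hy =>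
      obtain ⟨L, rfl⟩ := hx
      obtain ⟨M, rfl⟩ := hy
      exact ⟨L ++ M, by simp⟩

/-- The length of a permutation: the least length of a word in the simple transpositions. -/
def len {d : ℕ} (w : Equiv.Perm (Fin d)) : ℕ :=
  sInf {n | ∃ L : List (Fin (d - 1)), (L.map simpleRefl).prod = w ∧ L.length = n}

theorem exists_reducedWord {d : ℕ} (w : Equiv.Perm (Fin d)) :
    ∃ L : List (Fin (d - 1)), (L.map simpleRefl).prod = w ∧ L.length = len w := by
  obtain ⟨L, hL⟩ := exists_word w
  exact Nat.sInf_mem (s := {n | ∃ L : List (Fin (d - 1)),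
    (L.map simpleRefl).prod = w ∧ L.length = n}) ⟨_, L, hL, rfl⟩

/-- A fixed reduced expression of `w`. -/
def reducedWord {d : ℕ} (w : Equiv.Perm (Fin d)) : List (Fin (d - 1)) :=
  (exists_reducedWord w).choose

/-- The parabolic (Young) subgroup of permutations preserving every block of the composition. -/
def young {d : ℕ} (κ : Composition d) : Subgroup (Equiv.Perm (Fin d)) where
  carrier := {w | ∀ i, κ.index (w i) = κ.index i}
  mul_mem' := fun {a b} ha hb i => (ha (b i)).trans (hb i)
  one_mem' := fun _ => rfl
  inv_mem' := fun {a} ha i => by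
    have h := ha (a⁻¹ i)
    have h' : a (a⁻¹ i) = i := a.apply_symm_apply i
    rw [h'] at h
    exact h.symm

instance {d : ℕ} (κ : Composition d) : DecidablePred (· ∈ young κ) :=
  fun w => inferInstanceAs (Decidable (∀ i, κ.index (w i) = κ.index i))

/-- The length of the longest element of the parabolic subgroup. -/
def youngMaxLen {d : ℕ} (κ : Composition d) : ℕ :=
  (Finset.univ.filter (· ∈ young κ)).sup len

/-- `w` is of minimal length in its coset `(young κ) w`. -/
def IsShortest {d : ℕ} (κ : Composition d) (w : Equiv.Perm (Fin d)) : Prop :=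
  ∀ u ∈ young κ, len w ≤ len (u * w)

/-- The permutation which moves the `a` entries `o, …, o+a-1` past the following `b` entries,
keeping the order inside both groups, and fixes everything else: `o+i ↦ o+i+b` for `i < a` and
`o+a+j ↦ o+j` for `j < b`. (It is the identity if the entries do not fit into `d`.) -/
def blockSwap (d o a b : ℕ) : Equiv.Perm (Fin d) where
  toFun i := if h : o + a + b ≤ d ∧ o ≤ i ∧ i < o + a then ⟨i + b, by omega⟩
    else if o + a + b ≤ d ∧ o + a ≤ i ∧ i < o + a + b then ⟨i - a, by omega⟩ else i
  invFun i := if h : o + a + b ≤ d ∧ o ≤ i ∧ i < o + b then ⟨i + a, by omega⟩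
    else if o + a + b ≤ d ∧ o + b ≤ i ∧ i < o + a + b then ⟨i - b, by omega⟩ else i
  left_inv i := by
    ext
    by_cases h0 : o + a + b ≤ d
    · by_cases h1 : (o : ℕ) ≤ i ∧ (i : ℕ) < o + a
      · have h2 : ¬ ((i : ℕ) + b < o + b) := by omega
        have h3 : (i : ℕ) + b < o + a + b := by omega
        have h4 : o + b ≤ (i : ℕ) + b := by omega
        simp [h0, h1, h2, h3, h4]
      · by_cases h2 : o + a ≤ (i : ℕ) ∧ (i : ℕ) < o + a + b
        · have h3 : o ≤ (i : ℕ) - a := by omega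
          have h4 : (i : ℕ) - a < o + b := by omega
          have h5 : (i : ℕ) - a + a = i := by omega
          simp [h0, h1, h2, h3, h4, h5]
        · have h3 : ¬ (o ≤ (i : ℕ) ∧ (i : ℕ) < o + b) := by omega
          have h4 : ¬ (o + b ≤ (i : ℕ) ∧ (i : ℕ) < o + a + b) := by omega
          simp [h0, h1, h2, h3, h4]
    · simp [h0]
  right_inv i := by
    ext
    by_cases h0 : o + a + b ≤ d
    · by_cases h1 : (o : ℕ) ≤ i ∧ (i : ℕ) < o + b
      · have h2 : ¬ ((i : ℕ) + a < o + a) := by omega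
        have h3 : (i : ℕ) + a < o + a + b := by omega
        have h4 : o + a ≤ (i : ℕ) + a := by omega
        simp [h0, h1, h2, h3, h4]
      · by_cases h2 : o + b ≤ (i : ℕ) ∧ (i : ℕ) < o + a + b
        · have h3 : o ≤ (i : ℕ) - b := by omega
          have h4 : (i : ℕ) - b < o + a := by omega
          have h5 : (i : ℕ) - b + b = i := by omega
          simp [h0, h1, h2, h3, h4, h5]
        · have h3 : ¬ (o ≤ (i : ℕ) ∧ (i : ℕ) < o + a) := by omega
          have h4 : ¬ (o + a ≤ (i : ℕ) ∧ (i : ℕ) < o + a + b) := by omega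
          simp [h0, h1, h2, h3, h4]
    · simp [h0]

/-! ### Laurent polynomials and Demazure operators -/

/-- The ring `k[x₁^{±1}, …, x_d^{±1}]` of Laurent polynomials, as the group algebra of `ℤ^d`. -/
abbrev Laurent (k : Type*) [Field k] (d : ℕ) : Type _ := AddMonoidAlgebra k (Fin d → ℤ)

/-- The variable `x i`. -/
def x {k : Type*} [Field k] {d : ℕ} (i : Fin d) : Laurent k d :=
  AddMonoidAlgebra.single (Pi.single i 1) 1

/-- The action of a permutation on Laurent polynomials: the `k`-algebra endomorphism with
`x i ↦ x (w i)`. -/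
def permute {k : Type*} [Field k] {d : ℕ} (w : Equiv.Perm (Fin d)) :
    Laurent k d →ₐ[k] Laurent k d :=
  AddMonoidAlgebra.mapDomainAlgHom k k
    (⟨⟨fun a i => a (w.symm i), rfl⟩, fun _ _ => rfl⟩ : (Fin d → ℤ) →+ (Fin d → ℤ))

theorem permute_x {k : Type*} [Field k] {d : ℕ} (w : Equiv.Perm (Fin d)) (i : Fin d) :
    permute w (x i : Laurent k d) = x (w i) := by
  have h : (fun j => (Pi.single i 1 : Fin d → ℤ) (w.symm j)) = Pi.single (w i) 1 := by
    funext j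
    simp only [Pi.single_apply, Equiv.symm_apply_eq]
  simp only [permute, x, AddMonoidAlgebra.mapDomainAlgHom_apply, AddMonoidAlgebra.mapDomain_single]
  exact congrArg (fun a => AddMonoidAlgebra.single a (1 : k)) h

theorem exists_demazure {k : Type*} [Field k] {d : ℕ} (r : Fin (d - 1)) (f : Laurent k d) :
    ∃ g : Laurent k d,
      (x ⟨r, by omega⟩ - x ⟨r + 1, by omega⟩) * g = f - permute (simpleRefl r) f := by
  set i : Fin d := ⟨r, by omega⟩
  set j : Fin d := ⟨r + 1, by omega⟩
  let I : Ideal (Laurent k d) := Ideal.span {x i - x j}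
  have key : Ideal.Quotient.mkₐ k I = (Ideal.Quotient.mkₐ k I).comp (permute (simpleRefl r)) := by
    refine AddMonoidAlgebra.algHom_ext' ?_ (Subsingleton.elim (α := k →ₐ[k] Laurent k d ⧸ I) _ _)
    apply MonoidHom.toAdditiveRight.injective
    apply AddMonoidHom.functions_ext'
    intro s
    apply AddMonoidHom.ext_int
    have hs : Ideal.Quotient.mkₐ k I (x s) =
        Ideal.Quotient.mkₐ k I (permute (simpleRefl r) (x s)) := by
      rw [permute_x]
      have hij : Ideal.Quotient.mkₐ k I (x i) = Ideal.Quotient.mkₐ k I (x j) :=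
        Ideal.Quotient.eq.2 (Ideal.subset_span rfl)
      by_cases h1 : s = i
      · rw [h1, show simpleRefl r i = j from Equiv.swap_apply_left _ _, hij]
      · by_cases h2 : s = j
        · rw [h2, show simpleRefl r j = i from Equiv.swap_apply_right _ _, hij]
        · rw [show simpleRefl r s = s from Equiv.swap_apply_of_ne_of_ne h1 h2]
    exact hs
  have h := DFunLike.congr_fun key f
  obtain ⟨g, hg⟩ := Ideal.mem_span_singleton'.1 (Ideal.Quotient.eq.1 h)
  exact ⟨g, by rw [mul_comm]; exact hg⟩

theorem demazure_unique {k : Type*} [Field k] {d : ℕ} (r : Fin (d - 1)) (f g g' : Laurent k d)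
    (hg : (x ⟨r, by omega⟩ - x ⟨r + 1, by omega⟩) * g = f - permute (simpleRefl r) f)
    (hg' : (x ⟨r, by omega⟩ - x ⟨r + 1, by omega⟩) * g' = f - permute (simpleRefl r) f) :
    g = g' := by
  refine mul_left_cancel₀ (sub_ne_zero.2 fun h => ?_) (hg.trans hg'.symm)
  have h1 := AddMonoidAlgebra.single_left_injective one_ne_zero h
  have h2 := congrFun h1 ⟨r, by omega⟩
  simp at h2

/-- The Demazure operator `f ↦ (f - s_r f) / (x_r - x_{r+1})`. -/
def demazure {k : Type*} [Field k] {d : ℕ} (r : Fin (d - 1)) (f : Laurent k d) : Laurent k d :=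
  (exists_demazure r f).choose

/-- The Demazure operator `∂_w = ∂_{k₁} ⋯ ∂_{kₘ}` for a reduced expression
`w = s_{k₁} ⋯ s_{kₘ}`. -/
def demazurePerm {k : Type*} [Field k] {d : ℕ} (w : Equiv.Perm (Fin d)) (f : Laurent k d) :
    Laurent k d :=
  (reducedWord w).foldr demazure f

/-- The operator `D_{a,b}` in the variables `x_o, …, x_{o+a+b-1}`. -/
def blockDemazure {k : Type*} [Field k] {d : ℕ} (o a b : ℕ) (f : Laurent k d) : Laurent k d :=
  demazurePerm (blockSwap d o a b) f

/-- The polynomial `∏ (x_i - q x_j)` over `i < j` in the same block of `κ`. -/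
def pRight {k : Type*} [Field k] {d : ℕ} (q : k) (κ : Composition d) : Laurent k d :=
  ∏ p ∈ Finset.univ.filter (fun p : Fin d × Fin d => p.1 < p.2 ∧ κ.index p.1 = κ.index p.2),
    (x p.1 - q • x p.2)

/-- The polynomial `∏ (x_j - q x_i)` over `i` in the group `o, …, o+a-1` and `j` in the group
`o+a, …, o+a+b-1`. -/
def pLeftPrime {k : Type*} [Field k] {d : ℕ} (q : k) (o a b : ℕ) : Laurent k d :=
  ∏ p ∈ Finset.univ.filter (fun p : Fin d × Fin d =>
      (o ≤ (p.1 : ℕ) ∧ (p.1 : ℕ) < o + a) ∧ (o + a ≤ (p.2 : ℕ) ∧ (p.2 : ℕ) < o + a + b)),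
    (x p.2 - q • x p.1)

/-! ### Colour sequences and multicompositions -/

/-- The tuples in `{0,1}^{ℓ+d}` with sum `ℓ`; `0` is black, `1` is red. -/
abbrev Col (ℓ d : ℕ) : Type := {c : Fin (ℓ + d) → Fin 2 // ∑ i, (c i : ℕ) = ℓ}

/-- The left one of the two adjacent positions numbered by `r`. -/
def lo {n : ℕ} (r : Fin (n - 1)) : Fin n := ⟨r, by omega⟩

/-- The right one of the two adjacent positions numbered by `r`. -/
def hi {n : ℕ} (r : Fin (n - 1)) : Fin n := ⟨r + 1, by omega⟩

/-- The colour sequence `s_r(c)`. -/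
def Col.swap {ℓ d : ℕ} (r : Fin (ℓ + d - 1)) (c : Col ℓ d) : Col ℓ d :=
  ⟨fun i => c.1 (simpleRefl r i), by
    rw [Equiv.sum_comp (simpleRefl r) (fun i => (c.1 i : ℕ))]; exact c.2⟩

theorem Col.card_black {ℓ d : ℕ} (c : Col ℓ d) :
    (Finset.univ.filter (fun i => c.1 i = 0)).card = d := by
  have h1 := Finset.card_filter_add_card_filter_not (s := (Finset.univ : Finset (Fin (ℓ + d))))
    (fun i => c.1 i = 0)
  have h2 : (Finset.univ.filter (fun i => ¬ c.1 i = 0)).card = ℓ := by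
    rw [Finset.card_filter]
    refine Eq.trans (Finset.sum_congr rfl fun i _ => ?_) c.2
    generalize c.1 i = z
    fin_cases z <;> simp
  simp only [Finset.card_univ, Fintype.card_fin] at h1
  omega

/-- The position of the `r`-th black entry of `c`, counted from the left. -/
def Col.blackPos {ℓ d : ℕ} (c : Col ℓ d) (r : Fin d) : Fin (ℓ + d) :=
  (Finset.univ.filter (fun i => c.1 i = 0)).orderEmbOfFin c.card_black r

/-- An `(ℓ+1)`-composition of `d`: an `(ℓ+1)`-tuple of compositions (finite sequences of positive
integers, possibly empty) of total size `d`. -/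
@[ext] structure MultiComp (ℓ d : ℕ) where
  parts : Fin (ℓ + 1) → List ℕ
  parts_pos : ∀ t, ∀ n ∈ parts t, 0 < n
  sum_parts : ∑ t, (parts t).sum = d

instance (ℓ d : ℕ) : DecidableEq (MultiComp ℓ d) := fun a b =>
  decidable_of_iff (a.parts = b.parts) MultiComp.ext_iff.symm

/-- The concatenation of the components of `lam`, a composition of `d`. -/
def MultiComp.concat {ℓ d : ℕ} (lam : MultiComp ℓ d) : Composition d where
  blocks := (List.ofFn lam.parts).flatten
  blocks_pos := by
    intro n hn
    obtain ⟨l, hl, hn⟩ := List.mem_flatten.1 hn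
    obtain ⟨t, rfl⟩ := (List.mem_ofFn' _ _).1 hl
    exact lam.parts_pos t n hn
  blocks_sum := by
    rw [List.sum_flatten, List.map_ofFn, List.sum_ofFn]
    exact lam.sum_parts

/-- `|λ^{(0)}| + … + |λ^{(t-1)}|`: the number of black strands to the left of the component `t`. -/
def MultiComp.before {ℓ d : ℕ} (lam : MultiComp ℓ d) (t : Fin (ℓ + 1)) : ℕ :=
  ∑ s ∈ Finset.Iio t, (lam.parts s).sum

/-- The number of black strands to the left of the red strand `t`; the red strand `t` separates the
components `t.castSucc` and `t.succ`. -/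
def MultiComp.blacksLeft {ℓ d : ℕ} (lam : MultiComp ℓ d) (t : Fin ℓ) : ℕ :=
  lam.before t.succ

/-- The position of the red strand `t` among all strands of `e⁰(λ)`. -/
def MultiComp.redPos {ℓ d : ℕ} (lam : MultiComp ℓ d) (t : Fin ℓ) : ℕ :=
  t + lam.blacksLeft t

theorem MultiComp.redPos_strictMono {ℓ d : ℕ} (lam : MultiComp ℓ d) : StrictMono lam.redPos := by
  intro s t hst
  have h : lam.blacksLeft s ≤ lam.blacksLeft t :=
    Finset.sum_le_sum_of_subset (f := fun s => (lam.parts s).sum)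
      (Finset.Iio_subset_Iio (Fin.succ_le_succ_iff.2 hst.le))
  have : (s : ℕ) < t := hst
  unfold MultiComp.redPos
  omega

theorem MultiComp.redPos_lt {ℓ d : ℕ} (lam : MultiComp ℓ d) (t : Fin ℓ) :
    lam.redPos t < ℓ + d := by
  have h : lam.blacksLeft t ≤ d := by
    refine le_of_le_of_eq ?_ lam.sum_parts
    exact Finset.sum_le_sum_of_subset (f := fun s => (lam.parts s).sum)
      (Finset.subset_univ (Finset.Iio t.succ))
  unfold MultiComp.redPos
  omega

/-- The colour sequence of `e⁰(λ)`: `|λ^{(0)}|` black strands, the first red strand, `|λ^{(1)}|`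
black strands, the second red strand, and so on. -/
def MultiComp.col {ℓ d : ℕ} (lam : MultiComp ℓ d) : Col ℓ d :=
  ⟨fun i => if ∃ t, lam.redPos t = i then 1 else 0, by
    have h : (Finset.univ.filter fun i : Fin (ℓ + d) => ∃ t, lam.redPos t = i) =
        Finset.univ.image fun t : Fin ℓ => (⟨lam.redPos t, lam.redPos_lt t⟩ : Fin (ℓ + d)) := by
      ext i
      simp [Fin.ext_iff]
    calc _ = (Finset.univ.filter fun i : Fin (ℓ + d) => ∃ t, lam.redPos t = i).card := by
          rw [Finset.card_filter]
          exact Finset.sum_congr rfl fun i _ => by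
            by_cases hi : ∃ t, lam.redPos t = i <;> simp only [hi, if_true, if_false] <;> rfl
      _ = ℓ := by
          rw [h, Finset.card_image_of_injective, Finset.card_univ, Fintype.card_fin]
          intro s t hst
          exact lam.redPos_strictMono.injective (Fin.ext_iff.1 hst)⟩

/-- The sequence `ω = (1, …, 1, 0, …, 0)`. -/
def omega (ℓ d : ℕ) : Col ℓ d :=
  ⟨fun i => if (i : ℕ) < ℓ then 1 else 0, by
    rw [Fin.sum_univ_add]
    simp⟩

/-- `mu` is obtained from `lam` by splitting the entry `a + b` of the component `t` which comes after
the entries `l₁` and before the entries `l₂`. -/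
def IsSplit {ℓ d : ℕ} (lam mu : MultiComp ℓ d) (t : Fin (ℓ + 1)) (l₁ : List ℕ) (a b : ℕ)
    (l₂ : List ℕ) : Prop :=
  lam.parts t = l₁ ++ (a + b) :: l₂ ∧ mu.parts t = l₁ ++ a :: b :: l₂ ∧
    ∀ s, s ≠ t → mu.parts s = lam.parts s

/-- `mu` is obtained from `lam` by moving the first entry `a` of the component to the right of the
red strand `t` to the end of the component to the left of that red strand. -/
def IsLeftCrossing {ℓ d : ℕ} (lam mu : MultiComp ℓ d) (t : Fin ℓ) (a : ℕ) : Prop :=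
  lam.parts t.succ = a :: mu.parts t.succ ∧
    mu.parts t.castSucc = lam.parts t.castSucc ++ [a] ∧
    ∀ s, s ≠ t.castSucc → s ≠ t.succ → mu.parts s = lam.parts s

/-! ### The higher level affine Hecke algebra -/

/-- The generators of the higher level affine Hecke algebra. -/
inductive HGen (ℓ d : ℕ) : Type
  | e (c : Col ℓ d)
  | T (r : Fin (ℓ + d - 1))
  | X (i : Fin (ℓ + d))
  | X' (i : Fin (ℓ + d))

namespace HGen

/-- The generators, in the free algebra. -/
abbrev fe {k : Type*} [Field k] {ℓ d : ℕ} (c : Col ℓ d) : FreeAlgebra k (HGen ℓ d) :=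
  FreeAlgebra.ι k (HGen.e c)

/-- The generators, in the free algebra. -/
abbrev fT {k : Type*} [Field k] {ℓ d : ℕ} (r : Fin (ℓ + d - 1)) : FreeAlgebra k (HGen ℓ d) :=
  FreeAlgebra.ι k (HGen.T r)

/-- The generators, in the free algebra. -/
abbrev fX {k : Type*} [Field k] {ℓ d : ℕ} (i : Fin (ℓ + d)) : FreeAlgebra k (HGen ℓ d) :=
  FreeAlgebra.ι k (HGen.X i)

/-- The generators, in the free algebra. -/
abbrev fX' {k : Type*} [Field k] {ℓ d : ℕ} (i : Fin (ℓ + d)) : FreeAlgebra k (HGen ℓ d) :=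
  FreeAlgebra.ι k (HGen.X' i)

end HGen

open HGen in
/-- The defining relations of the `ℓ`-affine Hecke algebra. Positions are counted from `0`, and so are
the parameters `Q`. -/
inductive HRel {k : Type*} [Field k] {ℓ : ℕ} (d : ℕ) (q : k) (Q : Fin ℓ → k) :
    FreeAlgebra k (HGen ℓ d) → FreeAlgebra k (HGen ℓ d) → Prop
  | sum_e : HRel d q Q (∑ c, fe c) 1
  | e_mul_self (c) : HRel d q Q (fe c * fe c) (fe c)
  | e_mul_ne (b c) (h : b ≠ c) : HRel d q Q (fe b * fe c) 0
  | X_red (i c) (h : c.1 i = 1) : HRel d q Q (fX i * fe c) 0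
  | X'_red (i c) (h : c.1 i = 1) : HRel d q Q (fX' i * fe c) 0
  | X_X' (i c) (h : c.1 i = 0) : HRel d q Q (fX i * fX' i * fe c) (fe c)
  | X'_X (i c) (h : c.1 i = 0) : HRel d q Q (fX' i * fX i * fe c) (fe c)
  | X_e (i c) : HRel d q Q (fX i * fe c) (fe c * fX i)
  | X'_e (i c) : HRel d q Q (fX' i * fe c) (fe c * fX' i)
  | X_comm (i j) : HRel d q Q (fX i * fX j) (fX j * fX i)
  | X'_comm (i j) : HRel d q Q (fX' i * fX' j) (fX' j * fX' i)
  | T_comm (r s : Fin (ℓ + d - 1)) (h : (r : ℕ) + 1 < s) : HRel d q Q (fT r * fT s) (fT s * fT r)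
  | T_X_comm (r i) (h : i ≠ lo r) (h' : i ≠ hi r) : HRel d q Q (fT r * fX i) (fX i * fT r)
  | T_red (r c) (h : c.1 (lo r) = 1) (h' : c.1 (hi r) = 1) : HRel d q Q (fT r * fe c) 0
  | T_e (r c) : HRel d q Q (fT r * fe c) (fe (Col.swap r c) * fT r)
  | T_X_hi_black (r c) (h : c.1 (lo r) = 0) (h' : c.1 (hi r) = 0) :
      HRel d q Q ((fT r * fX (hi r) - fX (lo r) * fT r) * fe c) ((q - 1) • (fX (hi r) * fe c))
  | T_X_hi_other (r c) (h : ¬ (c.1 (lo r) = 0 ∧ c.1 (hi r) = 0)) :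
      HRel d q Q ((fT r * fX (hi r) - fX (lo r) * fT r) * fe c) 0
  | T_X_lo_black (r c) (h : c.1 (lo r) = 0) (h' : c.1 (hi r) = 0) :
      HRel d q Q ((fT r * fX (lo r) - fX (hi r) * fT r) * fe c) (-(q - 1) • (fX (hi r) * fe c))
  | T_X_lo_other (r c) (h : ¬ (c.1 (lo r) = 0 ∧ c.1 (hi r) = 0)) :
      HRel d q Q ((fT r * fX (lo r) - fX (hi r) * fT r) * fe c) 0
  | T_sq_black (r c) (h : c.1 (lo r) = 0) (h' : c.1 (hi r) = 0) :
      HRel d q Q (fT r * fT r * fe c) ((q - 1) • (fT r * fe c) + q • fe c)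
  | T_sq_black_red (r c) (t : Fin ℓ) (h : c.1 (lo r) = 0) (h' : c.1 (hi r) = 1)
      (ht : ∑ j ∈ Finset.Iic (hi r), (c.1 j : ℕ) = t + 1) :
      HRel d q Q (fT r * fT r * fe c) (fX (lo r) * fe c - Q t • fe c)
  | T_sq_red_black (r c) (t : Fin ℓ) (h : c.1 (lo r) = 1) (h' : c.1 (hi r) = 0)
      (ht : ∑ j ∈ Finset.Iic (lo r), (c.1 j : ℕ) = t + 1) :
      HRel d q Q (fT r * fT r * fe c) (fX (hi r) * fe c - Q t • fe c)
  | braid_black (r s : Fin (ℓ + d - 1)) (c) (hs : (s : ℕ) = r + 1) (h : c.1 (hi r) = 0) :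
      HRel d q Q ((fT r * fT s * fT r - fT s * fT r * fT s) * fe c) 0
  | braid_red (r s : Fin (ℓ + d - 1)) (c) (hs : (s : ℕ) = r + 1) (h : c.1 (hi r) = 1)
      (h0 : c.1 (lo r) = 0) (h2 : c.1 (hi s) = 0) :
      HRel d q Q ((fT r * fT s * fT r - fT s * fT r * fT s) * fe c) ((1 - q) • (fX (hi s) * fe c))

/-- The `ℓ`-affine Hecke algebra `H_{d,Q}(q)`. -/
abbrev Hecke {k : Type*} [Field k] {ℓ : ℕ} (d : ℕ) (q : k) (Q : Fin ℓ → k) : Type _ :=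
  RingQuot (HRel d q Q)

namespace Hecke

variable {k : Type*} [Field k] {ℓ : ℕ} (d : ℕ) (q : k) (Q : Fin ℓ → k)

/-- The image of a generator in the algebra. -/
def gen (g : HGen ℓ d) : Hecke d q Q :=
  RingQuot.mkAlgHom k (HRel d q Q) (FreeAlgebra.ι k g)

/-- The crossing of the strands at the positions `m` and `m + 1` (zero if there are no such
positions). -/
def T (m : ℕ) : Hecke d q Q :=
  if h : m < ℓ + d - 1 then gen d q Q (HGen.T ⟨m, h⟩) else 0

/-- For `w = s_{k₁} ⋯ s_{kₘ}` reduced, the product `T_{k₁} ⋯ T_{kₘ} e(c)`, where `T_r` is the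
crossing which starts at the position of the `r`-th black strand of `c`. (It is only used
for `w` in a parabolic subgroup all of whose blocks are adjacent strands in `c`.) -/
def Tw (c : Col ℓ d) (w : Equiv.Perm (Fin d)) : Hecke d q Q :=
  ((reducedWord w).map fun r : Fin (d - 1) => T d q Q (c.blackPos ⟨r, by omega⟩)).prod * gen d q Q (HGen.e c)

/-- `∑_{w ∈ 𝔖_κ} (-q)^{l(w_κ) - l(w)} T_w` on the black strands of `c`. -/
def mSum (c : Col ℓ d) (κ : Composition d) : Hecke d q Q :=
  ∑ w ∈ Finset.univ.filter (· ∈ young κ), (-q) ^ (youngMaxLen κ - len w) • Tw d q Q c w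

open Classical in
/-- `n'_κ = ∑ T_w` over the shortest representatives `w` of the cosets `𝔖_κ \ 𝔖_d`, on the black
strands of `c`. -/
def nPrime (c : Col ℓ d) (κ : Composition d) : Hecke d q Q :=
  ∑ w ∈ Finset.univ.filter (IsShortest κ), Tw d q Q c w

/-- The element `x_i = ∑_c X_{i_c} e(c)`, where `i_c` is the position of the `i`-th black strand. -/
def xElt (i : Fin d) : Hecke d q Q :=
  ∑ c : Col ℓ d, gen d q Q (HGen.X (c.blackPos i)) * gen d q Q (HGen.e c)

/-- The inverse of `x_i`. -/
def xInv (i : Fin d) : Hecke d q Q :=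
  ∑ c : Col ℓ d, gen d q Q (HGen.X' (c.blackPos i)) * gen d q Q (HGen.e c)

/-- The image of a Laurent polynomial under `x_i ↦ x_i`. -/
def poly (f : Laurent k d) : Hecke d q Q :=
  Finsupp.linearCombination k
    (fun a : Fin d → ℤ => (List.ofFn fun i =>
      if 0 ≤ a i then xElt d q Q i ^ (a i).toNat else xInv d q Q i ^ (-a i).toNat).prod)
    f.coeff

variable {d}

/-- The element `m_λ`. -/
def m (lam : MultiComp ℓ d) : Hecke d q Q := mSum d q Q lam.col lam.concat

/-- The diagram with top `e⁰(λ)` and bottom `ω` in which the red strands move to their positions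
across the black ones, with no other crossings and no dots: the last red strand moves first, the
red strand `t` by the crossings `T_t`, `T_{t+1}`, …. -/
def rElt (lam : MultiComp ℓ d) : Hecke d q Q :=
  (List.ofFn fun t : Fin ℓ =>
    ((List.range (lam.blacksLeft t)).reverse.map fun j => T d q Q (t + j)).prod).prod *
  gen d q Q (HGen.e (omega ℓ d))

/-- `Φ_λ(f) = r_λ ι(m_λ p_λ f n'_λ)`, where `ι` adds `ℓ` red strands on the left. -/
def Phi (lam : MultiComp ℓ d) (f : Laurent k d) : Hecke d q Q :=
  rElt q Q lam * (mSum d q Q (omega ℓ d) lam.concat * poly d q Q (pRight q lam.concat * f) *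
    nPrime d q Q (omega ℓ d) lam.concat)

/-- Left multiplication by the diagram in which the `a` black strands to the right of the red
strand `t` of `e⁰(λ)` cross to its left. -/
def leftCrossing (lam : MultiComp ℓ d) (t : Fin ℓ) (a : ℕ) : Hecke d q Q :=
  ((List.range a).reverse.map fun j => T d q Q (lam.redPos t + j)).prod *
    gen d q Q (HGen.e lam.col)

/-- The mirror diagram: the `a` black strands to the left of the red strand `t` of `e⁰(μ)`
cross to its right, where `μ` is a left crossing of `λ`. -/
def rightCrossing (lam mu : MultiComp ℓ d) (t : Fin ℓ) (a : ℕ) : Hecke d q Q :=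
  ((List.range a).map fun j => T d q Q (lam.redPos t + j)).prod *
    gen d q Q (HGen.e mu.col)

/-- The right ideal `m_λ H`, as a right module. -/
abbrev mIdeal (lam : MultiComp ℓ d) : Submodule (Hecke d q Q)ᵐᵒᵖ (Hecke d q Q) :=
  Submodule.span (Hecke d q Q)ᵐᵒᵖ {m q Q lam}

end Hecke

/-! ### The affine Schur algebra and its polynomial representation -/

section Schur

variable {k : Type*} [Field k] {ℓ : ℕ} (d : ℕ) (q : k) (Q : Fin ℓ → k)

/-- The right `H`-module `⨁_λ m_λ H`. -/
abbrev DefMod : Type _ := ⨁ lam : MultiComp ℓ d, Hecke.mIdeal q Q lam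

/-- The affine Schur algebra `S_{d,Q}(q)` of level `ℓ`. -/
abbrev Schur : Type _ := Module.End (Hecke d q Q)ᵐᵒᵖ (DefMod d q Q)

/-- The `λ`-th summand inside `⨁_λ m_λ H`. -/
abbrev inMod (lam : MultiComp ℓ d) : Hecke.mIdeal q Q lam →ₗ[(Hecke d q Q)ᵐᵒᵖ] DefMod d q Q :=
  DirectSum.lof (Hecke d q Q)ᵐᵒᵖ (MultiComp ℓ d) (fun lam => Hecke.mIdeal q Q lam) lam

/-- The idempotent `e(λ)`: the projection to the summand `m_λ H`. -/
def idem (lam : MultiComp ℓ d) : Schur d q Q :=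
  (inMod d q Q lam).comp
    (DirectSum.component (Hecke d q Q)ᵐᵒᵖ (MultiComp ℓ d) (fun lam => Hecke.mIdeal q Q lam) lam)

/-- `φ` is the element of the Schur algebra given by the homomorphism
`m_λ H → m_μ H`, `m_λ h ↦ y h`, and by zero on the other summands. -/
def IsMap (lam mu : MultiComp ℓ d) (y : Hecke d q Q) (φ : Schur d q Q) : Prop :=
  (∀ (u : Hecke.mIdeal q Q lam) (h : Hecke d q Q), (u : Hecke d q Q) = Hecke.m q Q lam * h →
    ∃ v : Hecke.mIdeal q Q mu, (v : Hecke d q Q) = y * h ∧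
      φ (inMod d q Q lam u) = inMod d q Q mu v) ∧
  ∀ nu, nu ≠ lam → ∀ u, φ (inMod d q Q nu u) = 0

end Schur

section PolRep

/-- The Laurent polynomials invariant under `𝔖_λ`. -/
def invariants (k : Type*) [Field k] {ℓ d : ℕ} (lam : MultiComp ℓ d) :
    Subalgebra k (Laurent k d) where
  carrier := {f | ∀ w ∈ young lam.concat, permute w f = f}
  mul_mem' := fun hf hg w hw => by rw [map_mul, hf w hw, hg w hw]
  add_mem' := fun hf hg w hw => by rw [map_add, hf w hw, hg w hw]
  algebraMap_mem' := fun r w _ => (permute w).commutes r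

/-- The vector space `sP = ⨁_λ k[x₁^{±1}, …, x_d^{±1}]^{𝔖_λ} e(λ)`. -/
abbrev PolSpace (k : Type*) [Field k] (ℓ d : ℕ) : Type _ :=
  ⨁ lam : MultiComp ℓ d, invariants k lam

/-- The element `f e(λ)`. -/
abbrev inPol {k : Type*} [Field k] {ℓ d : ℕ} (lam : MultiComp ℓ d) :
    invariants k lam →ₗ[k] PolSpace k ℓ d :=
  DirectSum.lof k (MultiComp ℓ d) (fun lam => invariants k lam) lam

/-- The operator `A` sends `f e(λ)` to `F(f) e(μ)`, and the other summands to zero. -/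
def ActsAs {k : Type*} [Field k] {ℓ d : ℕ} (A : Module.End k (PolSpace k ℓ d))
    (lam mu : MultiComp ℓ d) (F : Laurent k d → Laurent k d) : Prop :=
  (∀ f : invariants k lam, ∃ g : invariants k mu, (g : Laurent k d) = F f ∧
    A (inPol lam f) = inPol mu g) ∧
  ∀ nu, nu ≠ lam → ∀ f, A (inPol nu f) = 0

/-- The polynomial `∏ (x_i - Q_t)` over the `a` indices `i` following the red strand `t` of `λ`. -/
def crossPoly {k : Type*} [Field k] {ℓ d : ℕ} (Q : Fin ℓ → k) (lam : MultiComp ℓ d) (t : Fin ℓ)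
    (a : ℕ) : Laurent k d :=
  ∏ i ∈ Finset.univ.filter (fun i : Fin d =>
      lam.blacksLeft t ≤ (i : ℕ) ∧ (i : ℕ) < lam.blacksLeft t + a),
    (x i - algebraMap k (Laurent k d) (Q t))

variable {k : Type*} [Field k] {ℓ : ℕ} (d : ℕ) (q : k) (Q : Fin ℓ → k)

/-- The polynomials `g e(λ)`, the splits, the merges, the left crossings and the right crossings are
well defined elements of the Schur algebra. -/
structure GeneratorsExist : Prop where
  poly : ∀ (lam : MultiComp ℓ d) (g : invariants k lam),
    ∃! φ, IsMap d q Q lam lam (Hecke.poly d q Q g * Hecke.m q Q lam) φ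
  split : ∀ (lam mu : MultiComp ℓ d) t l₁ a b l₂, IsSplit lam mu t l₁ a b l₂ →
    ∃! φ, IsMap d q Q lam mu (Hecke.m q Q lam) φ
  merge : ∀ (lam mu : MultiComp ℓ d) t l₁ a b l₂, IsSplit lam mu t l₁ a b l₂ →
    ∃! φ, IsMap d q Q mu lam (Hecke.m q Q lam) φ
  left : ∀ (lam mu : MultiComp ℓ d) t a, IsLeftCrossing lam mu t a →
    ∃! φ, IsMap d q Q lam mu (Hecke.leftCrossing q Q lam t a * Hecke.m q Q lam) φ
  right : ∀ (lam mu : MultiComp ℓ d) t a, IsLeftCrossing lam mu t a →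
    ∃! φ, IsMap d q Q mu lam (Hecke.rightCrossing q Q lam mu t a * Hecke.m q Q mu) φ

variable {d}

/-- The prescribed action of the idempotents, polynomials, splits, merges and crossings. -/
structure IsPolRep (ρ : Schur d q Q →ₐ[k] Module.End k (PolSpace k ℓ d)) : Prop where
  idem : ∀ lam : MultiComp ℓ d, ActsAs (ρ (idem d q Q lam)) lam lam fun f => f
  poly : ∀ (lam : MultiComp ℓ d) (g : invariants k lam) φ,
    IsMap d q Q lam lam (Hecke.poly d q Q g * Hecke.m q Q lam) φ →
    ActsAs (ρ φ) lam lam fun f => g * f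
  split : ∀ (lam mu : MultiComp ℓ d) t l₁ a b l₂, IsSplit lam mu t l₁ a b l₂ → ∀ φ,
    IsMap d q Q lam mu (Hecke.m q Q lam) φ →
    ActsAs (ρ φ) lam mu fun f => pLeftPrime q (lam.before t + l₁.sum) a b * f
  merge : ∀ (lam mu : MultiComp ℓ d) t l₁ a b l₂, IsSplit lam mu t l₁ a b l₂ → ∀ φ,
    IsMap d q Q mu lam (Hecke.m q Q lam) φ →
    ActsAs (ρ φ) mu lam fun f => blockDemazure (lam.before t + l₁.sum) a b f
  left : ∀ (lam mu : MultiComp ℓ d) t a, IsLeftCrossing lam mu t a → ∀ φ,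
    IsMap d q Q lam mu (Hecke.leftCrossing q Q lam t a * Hecke.m q Q lam) φ →
    ActsAs (ρ φ) lam mu fun f => f
  right : ∀ (lam mu : MultiComp ℓ d) t a, IsLeftCrossing lam mu t a → ∀ φ,
    IsMap d q Q mu lam (Hecke.rightCrossing q Q lam mu t a * Hecke.m q Q mu) φ →
    ActsAs (ρ φ) mu lam fun f => crossPoly Q lam t a * f

end PolRep

end AffineSchur

end

/-!
The Hecke algebra `H` has a polynomial representation `⨁_c P e(c)`: dots act by the variables, two
black strands cross by a Demazure–Lusztig operator, a black and a red strand cross by `1` or by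
`x_i - Q_t`, depending on the direction. It is faithful. By Matsumoto's theorem (`BraidRel.prod_eq`)
products along reduced words do not depend on the word, and by induction on the number of crossings
the diagrams of reduced words with dots at the bottom span `H` (`exists_eq_sum_tauWord`). Over the
fraction field of `P` the operator of such a diagram becomes a combination of permutations with a
nonzero leading coefficient, so a combination of diagrams which acts by zero is zero
(`act_injective`). From then on identities in `H` are checked on operators (`IsOp`, `IsOp.eq`).

Let `∂` be the Demazure operator of the longest element of the Young subgroup of `λ`. The element
`m_λ` acts as the antisymmetrizer, which is `f ↦ p ∂(f)` with `p = ∏ (x_j - q x_i)` over the pairs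
`i < j` in a block (`antisym_apply`), while the symmetrizer is `f ↦ ∂(∏ (x_i - q x_j) f)`
(`sym_apply`). The factorizations of antisymmetrizers along cosets show that the special elements of
the Schur algebra `S` exist (`generatorsExist`), and both formulas together show that `Φ_λ(f)` acts
as `v ↦ p f (∑_w T_w)(v)`, where `w` runs over all permutations (`isOp_Phi`).

The values of `∑_w T_w` on polynomials are symmetric, and symmetric polynomials are central in `H`
(`act_smul_of_symmetric`). It follows that `m_λ h ∑_w T_w` is `Φ_λ(f)` for some invariant `f`
(`m_mul_mul_nAll`), and all `Φ_λ(f)` arise in this way, because `∂` maps onto the invariants. So the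
image of `f e(λ) ↦ Φ_λ(f)` is the right multiple of `⨁_λ m_λ H` by `∑_w T_w`, which is stable under
`S`. As the map is injective, `S` acts on the source (`exists_polAction`). The formulas for the
special elements are identities of operators (`isPolRep_of_embedding`). The action is faithful since
an endomorphism which vanishes on `m_λ g 𝔯_λ ∑_w T_w` for all polynomials `g` vanishes on `m_λ`: the
symmetric polynomial `(∑_w T_w)(v)`, which is not zero for a suitable `v`, can be cancelled
(`polAction_injective`).

Two actions with the given formulas are equal (`IsPolRep.unique`). Splits and right crossings
act injectively, merges and left crossings surjectively, and every `λ` is connected with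
`(∅, …, ∅, (1, …, 1))` by such steps (`multiComp_induction`), so only the endomorphisms of the
summand of the latter matter. These are generated by the polynomials and the crossings of black
strands (`agreeOn_finest`), and up to the constant `q` such a crossing is a merge followed by a
split (`agreeAt_tau`).
-/

noncomputable section

namespace AffineSchur

/-! ### Reduced words in the symmetric group -/

section Perms

variable {d : ℕ}

theorem lo_lt_hi {n : ℕ} (r : Fin (n - 1)) : lo r < hi r := Nat.lt_succ_self _

theorem simpleRefl_lo (r : Fin (d - 1)) : simpleRefl r (lo r) = hi r := Equiv.swap_apply_left _ _

theorem simpleRefl_hi (r : Fin (d - 1)) : simpleRefl r (hi r) = lo r := Equiv.swap_apply_right _ _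

theorem simpleRefl_of_ne {r : Fin (d - 1)} {i : Fin d} (h : i ≠ lo r) (h' : i ≠ hi r) :
    simpleRefl r i = i := Equiv.swap_apply_of_ne_of_ne h h'

@[simp] theorem simpleRefl_mul_self (r : Fin (d - 1)) : simpleRefl r * simpleRefl r = 1 :=
  Equiv.swap_mul_self _ _

@[simp] theorem simpleRefl_inv (r : Fin (d - 1)) : (simpleRefl r)⁻¹ = simpleRefl r :=
  Equiv.swap_inv _ _

@[simp] theorem simpleRefl_simpleRefl (r : Fin (d - 1)) (i : Fin d) :
    simpleRefl r (simpleRefl r i) = i := Equiv.swap_apply_self _ _ _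

theorem simpleRefl_val (r : Fin (d - 1)) (i : Fin d) :
    (simpleRefl r i : ℕ) = if (i : ℕ) = r then (r : ℕ) + 1
      else if (i : ℕ) = (r : ℕ) + 1 then (r : ℕ) else i := by
  unfold simpleRefl
  rw [Equiv.swap_apply_def]
  simp only [Fin.ext_iff]
  split_ifs <;> rfl

theorem simpleRefl_far {n : ℕ} {r s : Fin (n - 1)} (h : (r : ℕ) + 1 < s ∨ (s : ℕ) + 1 < r) :
    simpleRefl r (lo s) = lo s ∧ simpleRefl r (hi s) = hi s := by
  constructor <;>
  · apply Fin.ext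
    rw [simpleRefl_val]
    have e1 : ((lo s : Fin n) : ℕ) = s := rfl
    have e2 : ((hi s : Fin n) : ℕ) = s + 1 := rfl
    simp only [e1, e2]
    split_ifs <;> omega

/-- A simple transposition keeps the order of every pair but the one it exchanges. -/
theorem simpleRefl_lt {r : Fin (d - 1)} {i j : Fin d} (h : i < j)
    (hne : ¬ (i = lo r ∧ j = hi r)) : simpleRefl r i < simpleRefl r j := by
  rw [Fin.lt_def, simpleRefl_val, simpleRefl_val]
  have h1 : (i : ℕ) < j := h
  have h2 : ¬ ((i : ℕ) = r ∧ (j : ℕ) = r + 1) := fun h => hne ⟨Fin.ext h.1, Fin.ext h.2⟩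
  split_ifs <;> omega

theorem simpleRefl_comm {r s : Fin (d - 1)} (h : (r : ℕ) + 1 < s) :
    simpleRefl r * simpleRefl s = simpleRefl s * simpleRefl r := by
  ext i
  simp only [Equiv.Perm.mul_apply, simpleRefl_val]
  split_ifs <;> omega

theorem simpleRefl_braid {r s : Fin (d - 1)} (h : (s : ℕ) = r + 1) :
    simpleRefl r * simpleRefl s * simpleRefl r = simpleRefl s * simpleRefl r * simpleRefl s := by
  have e : lo s = hi r := Fin.ext h
  have h1 : lo r ≠ hi r := (lo_lt_hi r).ne
  have h2 : hi r ≠ hi s := by rw [← e]; exact (lo_lt_hi s).ne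
  have h3 : lo r ≠ hi s := ((lo_lt_hi r).trans (e ▸ lo_lt_hi s)).ne
  have hs : simpleRefl s = Equiv.swap (hi r) (hi s) := by rw [← e]; rfl
  have hr : simpleRefl r = Equiv.swap (lo r) (hi r) := rfl
  rw [hs, hr, Equiv.swap_mul_swap_mul_swap h1 h3, Equiv.swap_comm (lo r) (hi r),
    Equiv.swap_comm (hi r) (hi s),
    Equiv.swap_mul_swap_mul_swap h2.symm h3.symm, Equiv.swap_comm (lo r)]

/-- `r` is a left ascent of `w`, i.e. `s_r w` is longer than `w`. -/
def IsAscent (w : Equiv.Perm (Fin d)) (r : Fin (d - 1)) : Prop := w⁻¹ (lo r) < w⁻¹ (hi r)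

theorem inv_simpleRefl_mul (w : Equiv.Perm (Fin d)) (r : Fin (d - 1)) (i : Fin d) :
    (simpleRefl r * w)⁻¹ i = w⁻¹ (simpleRefl r i) := by
  rw [mul_inv_rev, simpleRefl_inv]; rfl

theorem isAscent_simpleRefl_mul {w : Equiv.Perm (Fin d)} {r : Fin (d - 1)} :
    IsAscent (simpleRefl r * w) r ↔ ¬ IsAscent w r := by
  have hne : w⁻¹ (lo r) ≠ w⁻¹ (hi r) := fun h => (lo_lt_hi r).ne (w⁻¹.injective h)
  simp only [IsAscent, inv_simpleRefl_mul, simpleRefl_lo, simpleRefl_hi]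
  constructor
  · exact fun h => h.not_gt
  · exact fun h => lt_of_le_of_ne (not_lt.1 h) hne.symm

/-- The pairs of values `i < j` which `w` takes in the wrong order. -/
def inversions (w : Equiv.Perm (Fin d)) : Finset (Fin d × Fin d) :=
  Finset.univ.filter fun p => p.1 < p.2 ∧ w⁻¹ p.2 < w⁻¹ p.1

/-- Raising the length by `s_r` adds exactly one inversion, the pair `(r, r + 1)`. -/
theorem inversions_simpleRefl_mul {w : Equiv.Perm (Fin d)} {r : Fin (d - 1)} (h : IsAscent w r) :
    inversions (simpleRefl r * w) = insert (lo r, hi r) ((inversions w).map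
      ((simpleRefl r).prodCongr (simpleRefl r)).toEmbedding) := by
  ext ⟨i, j⟩
  simp only [inversions, Finset.mem_insert, Finset.mem_map_equiv, Finset.mem_filter,
    Finset.mem_univ, true_and, inv_simpleRefl_mul, Prod.mk.injEq]
  have hs : (((simpleRefl r).prodCongr (simpleRefl r)).symm (i, j)) =
      (simpleRefl r i, simpleRefl r j) := rfl
  rw [hs]
  constructor
  · rintro ⟨h1, h2⟩
    by_cases hne : i = lo r ∧ j = hi r
    · exact Or.inl hne
    · exact Or.inr ⟨simpleRefl_lt h1 hne, h2⟩
  · rintro (⟨rfl, rfl⟩ | ⟨h1, h2⟩)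
    · rw [simpleRefl_lo, simpleRefl_hi]
      exact ⟨lo_lt_hi r, h⟩
    · refine ⟨?_, h2⟩
      have hne : ¬ (simpleRefl r i = lo r ∧ simpleRefl r j = hi r) := by
        rintro ⟨e1, e2⟩
        simp only [e1, e2] at h2
        exact absurd h h2.not_gt
      simpa using simpleRefl_lt h1 hne

theorem lo_hi_notMem_map_inversions {w : Equiv.Perm (Fin d)} {r : Fin (d - 1)} :
    (lo r, hi r) ∉ (inversions w).map
      ((simpleRefl r).prodCongr (simpleRefl r)).toEmbedding := by
  rw [Finset.mem_map_equiv]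
  have hs : (((simpleRefl r).prodCongr (simpleRefl r)).symm (lo r, hi r)) =
      (simpleRefl r (lo r), simpleRefl r (hi r)) := rfl
  rw [hs, simpleRefl_lo, simpleRefl_hi]
  simp only [inversions, Finset.mem_filter, not_and]
  exact fun _ h => absurd h (lo_lt_hi r).not_gt

theorem prod_inversions_simpleRefl_mul {M : Type*} [CommMonoid M] (F : Fin d × Fin d → M)
    {w : Equiv.Perm (Fin d)} {r : Fin (d - 1)} (h : IsAscent w r) :
    ∏ p ∈ inversions (simpleRefl r * w), F p =
      F (lo r, hi r) * ∏ p ∈ inversions w, F (simpleRefl r p.1, simpleRefl r p.2) := by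
  rw [inversions_simpleRefl_mul h, Finset.prod_insert lo_hi_notMem_map_inversions,
    Finset.prod_map]
  rfl

theorem card_inversions_of_isAscent {w : Equiv.Perm (Fin d)} {r : Fin (d - 1)}
    (h : IsAscent w r) :
    (inversions (simpleRefl r * w)).card = (inversions w).card + 1 := by
  rw [inversions_simpleRefl_mul h, Finset.card_insert_of_notMem lo_hi_notMem_map_inversions,
    Finset.card_map]

theorem card_inversions_of_not_isAscent {w : Equiv.Perm (Fin d)} {r : Fin (d - 1)}
    (h : ¬ IsAscent w r) :
    (inversions (simpleRefl r * w)).card + 1 = (inversions w).card := by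
  have h1 := card_inversions_of_isAscent (isAscent_simpleRefl_mul.2 h)
  rw [← mul_assoc, simpleRefl_mul_self, one_mul] at h1
  exact h1.symm

theorem card_inversions_prod_le (L : List (Fin (d - 1))) :
    (inversions (L.map simpleRefl).prod).card ≤ L.length := by
  induction L with
  | nil =>
    rw [List.map_nil, List.prod_nil, List.length_nil, Nat.le_zero, Finset.card_eq_zero]
    refine Finset.filter_eq_empty_iff.2 fun p _ h => ?_
    exact absurd h.1 h.2.not_gt
  | cons a L ih =>
    rw [List.map_cons, List.prod_cons, List.length_cons]
    by_cases h : IsAscent (L.map simpleRefl).prod a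
    · rw [card_inversions_of_isAscent h]; omega
    · have := card_inversions_of_not_isAscent h; omega

theorem eq_one_of_strictMono {w : Equiv.Perm (Fin d)} (h : StrictMono w) : w = 1 := by
  have h1 : (h.orderIsoOfSurjective w w.surjective) = OrderIso.refl _ := Subsingleton.elim _ _
  ext i
  have := congrArg (fun e : Fin d ≃o Fin d => e i) h1
  exact congrArg Fin.val this

/-- A relation holding between neighbours holds between all pairs in an interval. -/
theorem rel_of_adjacent (R : Fin d → Fin d → Prop) (htrans : ∀ a b c, R a b → R b c → R a c)
    {i j : Fin d} (hij : i < j)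
    (h : ∀ r : Fin (d - 1), i ≤ lo r → hi r ≤ j → R (lo r) (hi r)) : R i j := by
  obtain ⟨i, hi'⟩ := i
  obtain ⟨j, hj⟩ := j
  have hlt : i < j := hij
  obtain ⟨n, rfl⟩ : ∃ n, j = i + n + 1 := ⟨j - i - 1, by omega⟩
  clear hij hlt
  induction n with
  | zero => exact h ⟨i, by omega⟩ le_rfl le_rfl
  | succ n ih =>
    refine htrans _ ⟨i + n + 1, by omega⟩ _ (ih (by omega) fun r h1 h2 => h r h1 (h2.trans ?_)) ?_
    · exact Fin.mk_le_mk.2 (show i + n + 1 ≤ i + (n + 1) + 1 by omega)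
    · exact h ⟨i + n + 1, by omega⟩ (Fin.mk_le_mk.2 (show i ≤ i + n + 1 by omega)) le_rfl

theorem eq_one_of_forall_isAscent {w : Equiv.Perm (Fin d)} (h : ∀ r, IsAscent w r) : w = 1 := by
  rw [← inv_eq_one]
  refine eq_one_of_strictMono fun i j hij => ?_
  exact rel_of_adjacent (fun a b => w⁻¹ a < w⁻¹ b) (fun _ _ _ => lt_trans) hij fun r _ _ => h r

/-- Removing left descents one after the other writes `w` as a word of as many letters as `w` has
inversions. -/
theorem exists_word_length_eq (w : Equiv.Perm (Fin d)) :
    ∃ L : List (Fin (d - 1)), (L.map simpleRefl).prod = w ∧ L.length = (inversions w).card := by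
  generalize hn : (inversions w).card = n
  induction n generalizing w with
  | zero =>
    refine ⟨[], ?_, rfl⟩
    rw [List.map_nil, List.prod_nil]
    symm
    refine eq_one_of_forall_isAscent fun r => ?_
    by_contra h
    have := card_inversions_of_not_isAscent h
    omega
  | succ n ih =>
    -- without a left descent `w` would be the identity, which has no inversions
    by_cases h : ∀ r, IsAscent w r
    · rw [eq_one_of_forall_isAscent h] at hn
      have := card_inversions_prod_le (d := d) []
      simp only [List.map_nil, List.prod_nil, List.length_nil] at this
      omega
    · obtain ⟨r, hr⟩ := not_forall.1 h
      have h1 := card_inversions_of_not_isAscent hr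
      obtain ⟨L, hL, hL'⟩ := ih (simpleRefl r * w) (by omega)
      refine ⟨r :: L, ?_, by rw [List.length_cons, hL']⟩
      rw [List.map_cons, List.prod_cons, hL, ← mul_assoc, simpleRefl_mul_self, one_mul]

/-- The length is the number of inversions. -/
theorem len_eq_card_inversions (w : Equiv.Perm (Fin d)) : len w = (inversions w).card := by
  apply le_antisymm
  · exact Nat.sInf_le (exists_word_length_eq w)
  · obtain ⟨L, hL, hL'⟩ := exists_reducedWord w
    rw [← hL', ← hL]
    exact card_inversions_prod_le L

theorem len_of_isAscent {w : Equiv.Perm (Fin d)} {r : Fin (d - 1)} (h : IsAscent w r) :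
    len (simpleRefl r * w) = len w + 1 := by
  rw [len_eq_card_inversions, len_eq_card_inversions, card_inversions_of_isAscent h]

theorem len_of_not_isAscent {w : Equiv.Perm (Fin d)} {r : Fin (d - 1)} (h : ¬ IsAscent w r) :
    len (simpleRefl r * w) + 1 = len w := by
  rw [len_eq_card_inversions, len_eq_card_inversions, card_inversions_of_not_isAscent h]

theorem len_le_length {w : Equiv.Perm (Fin d)} {L : List (Fin (d - 1))}
    (h : (L.map simpleRefl).prod = w) : len w ≤ L.length := by
  rw [len_eq_card_inversions, ← h]
  exact card_inversions_prod_le L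

@[simp] theorem len_one : len (1 : Equiv.Perm (Fin d)) = 0 :=
  Nat.le_zero.1 (len_le_length (L := []) rfl)

theorem eq_one_of_len_eq_zero {w : Equiv.Perm (Fin d)} (h : len w = 0) : w = 1 := by
  refine eq_one_of_forall_isAscent fun r => ?_
  by_contra hr
  have := len_of_not_isAscent hr
  omega

theorem prod_map_simpleRefl_reverse (L : List (Fin (d - 1))) :
    (L.reverse.map simpleRefl).prod = ((L.map simpleRefl).prod)⁻¹ := by
  induction L with
  | nil => simp
  | cons a L ih =>
    rw [List.reverse_cons, List.map_append, List.prod_append, ih, List.map_singleton,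
      List.prod_singleton, List.map_cons, List.prod_cons, mul_inv_rev, simpleRefl_inv]

theorem len_inv_le (w : Equiv.Perm (Fin d)) : len w⁻¹ ≤ len w := by
  obtain ⟨L, hL, hL'⟩ := exists_reducedWord w
  rw [← hL', ← List.length_reverse]
  exact len_le_length (by rw [prod_map_simpleRefl_reverse, hL])

@[simp] theorem len_inv (w : Equiv.Perm (Fin d)) : len w⁻¹ = len w :=
  le_antisymm (len_inv_le w) (by simpa using len_inv_le w⁻¹)

theorem reducedWord_prod (w : Equiv.Perm (Fin d)) : ((reducedWord w).map simpleRefl).prod = w :=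
  (exists_reducedWord w).choose_spec.1

theorem reducedWord_length (w : Equiv.Perm (Fin d)) : (reducedWord w).length = len w :=
  (exists_reducedWord w).choose_spec.2

/-- A permutation is built from the identity by simple transpositions raising the length. -/
theorem perm_induction {p : Equiv.Perm (Fin d) → Prop} (one : p 1)
    (mul : ∀ r w, IsAscent w r → p w → p (simpleRefl r * w)) (w) : p w := by
  generalize hn : len w = n
  induction n generalizing w with
  | zero => rw [eq_one_of_len_eq_zero hn]; exact one
  | succ n ih =>
    by_cases h : ∀ r, IsAscent w r
    · rw [eq_one_of_forall_isAscent h]; exact one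
    · obtain ⟨r, hr⟩ := not_forall.1 h
      have h1 := len_of_not_isAscent hr
      have h2 := mul r _ (isAscent_simpleRefl_mul.2 hr) (ih (simpleRefl r * w) (by omega))
      rwa [← mul_assoc, simpleRefl_mul_self, one_mul] at h2

/-- The braid relations of type `A`. -/
structure BraidRel {M : Type*} [Monoid M] (F : Fin (d - 1) → M) : Prop where
  comm : ∀ r s : Fin (d - 1), (r : ℕ) + 1 < s → F r * F s = F s * F r
  braid : ∀ r s : Fin (d - 1), (s : ℕ) = r + 1 → F r * F s * F r = F s * F r * F s

/-- The first letter of a reduced word is a left descent, and the rest of the word is reduced. -/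
theorem not_isAscent_of_reduced {a : Fin (d - 1)} {A : List (Fin (d - 1))}
    (h : (a :: A).length = len ((a :: A).map simpleRefl).prod) :
    ¬ IsAscent ((a :: A).map simpleRefl).prod a ∧
      A.length = len (A.map simpleRefl).prod := by
  have h0 := len_le_length (L := A) rfl
  simp only [List.map_cons, List.prod_cons, List.length_cons] at h ⊢
  rw [isAscent_simpleRefl_mul, not_not]
  by_cases hA : IsAscent (A.map simpleRefl).prod a
  · have := len_of_isAscent hA
    exact ⟨hA, by omega⟩
  · have := len_of_not_isAscent hA
    omega

/-- **Matsumoto's theorem** for the symmetric group: a product satisfying the braid relations is the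
same along all reduced words of a permutation. The proof is by induction on the length. Words with
the first letters `a ≠ b` are both compared with reduced words which begin with a common element
of the dihedral group generated by `s_a` and `s_b`: `s_a s_b` if `a` and `b` are not adjacent, and
`s_a s_b s_a = s_b s_a s_b` if they are. -/
theorem BraidRel.prod_eq {M : Type*} [Monoid M] {F : Fin (d - 1) → M} (hF : BraidRel F)
    {L L' : List (Fin (d - 1))} (h : (L.map simpleRefl).prod = (L'.map simpleRefl).prod)
    (hL : L.length = len (L.map simpleRefl).prod)
    (hL' : L'.length = len (L'.map simpleRefl).prod) : (L.map F).prod = (L'.map F).prod := by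
  generalize hn : L.length = n
  induction n using Nat.strong_induction_on generalizing L L' with
  | _ n ih =>
  have hlen : L.length = L'.length := by rw [hL, hL', h]
  rcases L with _ | ⟨a, A⟩
  · rw [List.length_eq_zero_iff.1 hlen.symm]
  rcases L' with _ | ⟨b, B⟩
  · simp at hlen
  obtain ⟨ha, hA⟩ := not_isAscent_of_reduced hL
  obtain ⟨hb, hB⟩ := not_isAscent_of_reduced hL'
  rw [← h] at hb
  set w := ((a :: A).map simpleRefl).prod with hw
  have hwA : (A.map simpleRefl).prod = simpleRefl a * w := by
    rw [hw, List.map_cons, List.prod_cons, ← mul_assoc, simpleRefl_mul_self, one_mul]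
  have hwB : (B.map simpleRefl).prod = simpleRefl b * w := by
    rw [h, List.map_cons, List.prod_cons, ← mul_assoc, simpleRefl_mul_self, one_mul]
  simp only [List.length_cons] at hn hlen hL
  -- the claim for two words which start in the same way, up to the induction hypothesis
  have step : ∀ {a : Fin (d - 1)} {A C : List (Fin (d - 1))},
      A.length + 1 = n → ¬ IsAscent w a →
      (A.map simpleRefl).prod = simpleRefl a * w → (C.map simpleRefl).prod = simpleRefl a * w →
      A.length = C.length → (A.map F).prod = (C.map F).prod := by
    intro a A C h1 h2 h3 h4 h5
    have h6 := len_of_not_isAscent h2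
    refine ih A.length (by omega) (h3.trans h4.symm) ?_ ?_ rfl
    · rw [h3]; omega
    · rw [h4]; omega
  have hlw : len w = n := by omega
  have main : ∀ {a b : Fin (d - 1)} {A B : List (Fin (d - 1))}, (a : ℕ) < b →
      A.length + 1 = n → B.length + 1 = n → ¬ IsAscent w a → ¬ IsAscent w b →
      (A.map simpleRefl).prod = simpleRefl a * w → (B.map simpleRefl).prod = simpleRefl b * w →
      ((a :: A).map F).prod = ((b :: B).map F).prod := by
    intro a b A B hab hA hB ha hb hwA hwB
    have ha1 := len_of_not_isAscent ha
    have hb1 := len_of_not_isAscent hb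
    have hinj := w⁻¹.injective
    rcases Nat.lt_or_ge (a + 1) b with hfar | hnear
    · have h2 : ¬ IsAscent (simpleRefl a * w) b := by
        unfold IsAscent at hb ⊢
        rw [inv_simpleRefl_mul, inv_simpleRefl_mul,
          (simpleRefl_far (Or.inl hfar)).1, (simpleRefl_far (Or.inl hfar)).2]
        exact hb
      -- `w` has the reduced words `a b C` and `b a C`
      have h3 := len_of_not_isAscent h2
      obtain ⟨C, hC, hC'⟩ := exists_reducedWord (simpleRefl b * (simpleRefl a * w))
      have e1 : (A.map F).prod = ((b :: C).map F).prod := by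
        refine step hA ha hwA ?_ (by simp only [List.length_cons]; omega)
        rw [List.map_cons, List.prod_cons, hC, ← mul_assoc, simpleRefl_mul_self, one_mul]
      have e2 : (B.map F).prod = ((a :: C).map F).prod := by
        refine step hB hb hwB ?_ (by simp only [List.length_cons]; omega)
        rw [List.map_cons, List.prod_cons, hC, ← mul_assoc (simpleRefl b),
          ← simpleRefl_comm hfar]
        simp only [← mul_assoc, simpleRefl_mul_self, one_mul]
      rw [List.map_cons, List.prod_cons, e1]
      conv_rhs => rw [List.map_cons, List.prod_cons, e2]
      simp only [List.map_cons, List.prod_cons]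
      rw [← mul_assoc, ← mul_assoc, hF.comm a b hfar]
    · have hb' : (b : ℕ) = a + 1 := by omega
      have elo : lo b = hi a := Fin.ext hb'
      have fix1 : simpleRefl a (hi b) = hi b := by
        apply simpleRefl_of_ne <;>
        · intro h
          have := congrArg Fin.val h
          simp only [lo, hi] at this
          omega
      have fix2 : simpleRefl b (lo a) = lo a := by
        apply simpleRefl_of_ne <;>
        · intro h
          have := congrArg Fin.val h
          simp only [lo, hi] at this
          omega
      -- `w⁻¹` reverses the order of the three positions `a < a + 1 < a + 2`
      have ha2 : w⁻¹ (hi a) < w⁻¹ (lo a) := lt_of_le_of_ne (not_lt.1 ha)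
        fun h => (lo_lt_hi a).ne' (hinj h)
      have hb2 : w⁻¹ (hi b) < w⁻¹ (hi a) := by
        rw [← elo]
        exact lt_of_le_of_ne (not_lt.1 hb) fun h => (lo_lt_hi b).ne' (hinj h)
      have h2 : ¬ IsAscent (simpleRefl a * w) b := by
        unfold IsAscent
        rw [inv_simpleRefl_mul, inv_simpleRefl_mul, fix1, elo, simpleRefl_hi]
        exact (hb2.trans ha2).not_gt
      have h3 : ¬ IsAscent (simpleRefl b * (simpleRefl a * w)) a := by
        unfold IsAscent
        rw [inv_simpleRefl_mul, inv_simpleRefl_mul, inv_simpleRefl_mul, inv_simpleRefl_mul,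
          fix2, simpleRefl_lo, ← elo, simpleRefl_lo, fix1]
        rw [elo]
        exact hb2.not_gt
      -- `w` has the reduced words `a b a C` and `b a b C`
      have h4 := len_of_not_isAscent h2
      have h5 := len_of_not_isAscent h3
      obtain ⟨C, hC, hC'⟩ :=
        exists_reducedWord (simpleRefl a * (simpleRefl b * (simpleRefl a * w)))
      have e1 : (A.map F).prod = ((b :: a :: C).map F).prod := by
        refine step hA ha hwA ?_ (by simp only [List.length_cons]; omega)
        simp only [List.map_cons, List.prod_cons, hC]
        simp only [← mul_assoc, simpleRefl_mul_self, one_mul]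
      have e2 : (B.map F).prod = ((a :: b :: C).map F).prod := by
        refine step hB hb hwB ?_ (by simp only [List.length_cons]; omega)
        simp only [List.map_cons, List.prod_cons, hC]
        have : simpleRefl a * (simpleRefl b * (simpleRefl a * w)) =
            simpleRefl b * (simpleRefl a * (simpleRefl b * w)) := by
          simp only [← mul_assoc]
          rw [simpleRefl_braid hb']
        rw [this]
        simp only [← mul_assoc, simpleRefl_mul_self, one_mul]
      rw [List.map_cons, List.prod_cons, e1]
      conv_rhs => rw [List.map_cons, List.prod_cons, e2]
      simp only [List.map_cons, List.prod_cons]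
      rw [← mul_assoc, ← mul_assoc, ← mul_assoc, ← mul_assoc, hF.braid a b hb']
  rcases lt_trichotomy (a : ℕ) b with hab | hab | hab
  · exact main hab hn (by omega) ha hb hwA hwB
  · obtain rfl := Fin.ext hab
    rw [List.map_cons, List.map_cons, List.prod_cons, List.prod_cons,
      step hn ha hwA hwB (by omega)]
  · exact (main hab (by omega) hn hb ha hwB hwA).symm

/-- The product `F_{k₁} ⋯ F_{kₘ}` over the fixed reduced expression of `w`. -/
def wordProd {M : Type*} [Monoid M] (F : Fin (d - 1) → M) (w : Equiv.Perm (Fin d)) : M :=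
  ((reducedWord w).map F).prod

@[simp] theorem wordProd_one {M : Type*} [Monoid M] (F : Fin (d - 1) → M) : wordProd F 1 = 1 := by
  have : (reducedWord (1 : Equiv.Perm (Fin d))).length = 0 := by rw [reducedWord_length, len_one]
  rw [wordProd, List.length_eq_zero_iff.1 this, List.map_nil, List.prod_nil]

theorem BraidRel.wordProd_mul {M : Type*} [Monoid M] {F : Fin (d - 1) → M} (hF : BraidRel F)
    {u v : Equiv.Perm (Fin d)} (h : len (u * v) = len u + len v) :
    wordProd F (u * v) = wordProd F u * wordProd F v := by
  have e : ((reducedWord u ++ reducedWord v).map simpleRefl).prod = u * v := by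
    rw [List.map_append, List.prod_append, reducedWord_prod, reducedWord_prod]
  have := hF.prod_eq (L := reducedWord (u * v)) (L' := reducedWord u ++ reducedWord v)
    (by rw [e, reducedWord_prod]) (by rw [reducedWord_prod, reducedWord_length])
    (by rw [e, List.length_append, reducedWord_length, reducedWord_length, h])
  rw [wordProd, this, List.map_append, List.prod_append, wordProd, wordProd]

theorem len_simpleRefl (r : Fin (d - 1)) : len (simpleRefl r) = 1 := by
  have h := len_of_isAscent (w := 1) (r := r) (lo_lt_hi r)
  rwa [mul_one, len_one] at h

theorem wordProd_simpleRefl {M : Type*} [Monoid M] (F : Fin (d - 1) → M) (r : Fin (d - 1)) :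
    wordProd F (simpleRefl r) = F r := by
  have h1 := reducedWord_prod (simpleRefl r)
  have h2 := (reducedWord_length (simpleRefl r)).trans (len_simpleRefl r)
  obtain ⟨s, hs⟩ := List.length_eq_one_iff.1 h2
  rw [hs, List.map_singleton, List.prod_singleton] at h1
  rw [wordProd, hs, List.map_singleton, List.prod_singleton]
  have h3 : simpleRefl s (lo r) = hi r := by rw [h1, simpleRefl_lo]
  have h4 := congrArg Fin.val h3
  rw [simpleRefl_val] at h4
  have h5 : ((lo r : Fin d) : ℕ) = r := rfl
  have h6 : ((hi r : Fin d) : ℕ) = r + 1 := rfl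
  rw [h5, h6] at h4
  have : s = r := by
    apply Fin.ext
    split_ifs at h4 <;> omega
  rw [this]

theorem BraidRel.wordProd_simpleRefl_mul {M : Type*} [Monoid M] {F : Fin (d - 1) → M}
    (hF : BraidRel F) {w : Equiv.Perm (Fin d)} {r : Fin (d - 1)} (h : IsAscent w r) :
    wordProd F (simpleRefl r * w) = F r * wordProd F w := by
  rw [hF.wordProd_mul, wordProd_simpleRefl]
  rw [len_of_isAscent h, len_simpleRefl, add_comm]

end Perms

/-! ### Young subgroups and their cosets -/

section Young

variable {d : ℕ} {κ : Composition d}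

theorem index_mono (κ : Composition d) : Monotone κ.index := by
  intro i j hij
  by_contra h
  have h1 : (κ.index j : ℕ) + 1 ≤ κ.index i := Nat.succ_le_of_lt (not_le.1 h)
  have h2 : κ.sizeUpTo (κ.index j).succ ≤ κ.sizeUpTo (κ.index i) := κ.monotone_sizeUpTo h1
  have h3 := κ.sizeUpTo_index_le i
  have h4 := κ.lt_sizeUpTo_index_succ j
  have h5 : (i : ℕ) ≤ j := hij
  omega

theorem index_eq_of_mem_Icc {i j a : Fin d} (h : κ.index i = κ.index j) (hi : i ≤ a) (hj : a ≤ j) :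
    κ.index a = κ.index i :=
  le_antisymm ((index_mono κ hj).trans h.ge) (index_mono κ hi)

/-- An element of a Young subgroup keeps the order of two positions in different blocks. -/
theorem lt_of_mem_young {w : Equiv.Perm (Fin d)} (hw : w ∈ young κ) {i j : Fin d}
    (h : κ.index i < κ.index j) : w i < w j := by
  by_contra hn
  have := index_mono κ (not_lt.1 hn)
  rw [hw, hw] at this
  exact absurd h this.not_gt

theorem simpleRefl_mem_young {r : Fin (d - 1)} (h : κ.index (lo r) = κ.index (hi r)) :
    simpleRefl r ∈ young κ := by
  intro i
  by_cases h1 : i = lo r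
  · rw [h1, simpleRefl_lo, h]
  · by_cases h2 : i = hi r
    · rw [h2, simpleRefl_hi, h]
    · rw [simpleRefl_of_ne h1 h2]

theorem index_eq_of_not_isAscent {w : Equiv.Perm (Fin d)} (hw : w ∈ young κ) {r : Fin (d - 1)}
    (h : ¬ IsAscent w r) : κ.index (lo r) = κ.index (hi r) := by
  by_contra hne
  exact h (lt_of_mem_young (inv_mem hw)
    (lt_of_le_of_ne (index_mono κ (lo_lt_hi r).le) hne))

/-- An element of a Young subgroup is built by simple transpositions of this subgroup. -/
theorem young_induction {p : Equiv.Perm (Fin d) → Prop} (one : p 1)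
    (mul : ∀ r w, κ.index (lo r) = κ.index (hi r) → w ∈ young κ → IsAscent w r → p w →
      p (simpleRefl r * w)) {w} (hw : w ∈ young κ) : p w := by
  induction w using perm_induction with
  | one => exact one
  | mul r w hr ih =>
    have h := index_eq_of_not_isAscent hw (isAscent_simpleRefl_mul.not.2 (not_not.2 hr))
    have h1 := mul_mem (simpleRefl_mem_young h) hw
    rw [← mul_assoc, simpleRefl_mul_self, one_mul] at h1
    exact mul r w h h1 hr (ih h1)

theorem index_eq_of_mem_word {L : List (Fin (d - 1))} (hL : (L.map simpleRefl).prod ∈ young κ)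
    (h : L.length = len (L.map simpleRefl).prod) {r : Fin (d - 1)} (hr : r ∈ L) :
    κ.index (lo r) = κ.index (hi r) := by
  induction L with
  | nil => simp at hr
  | cons a A ih =>
    obtain ⟨h1, h2⟩ := not_isAscent_of_reduced h
    have h3 := index_eq_of_not_isAscent hL h1
    rcases List.mem_cons.1 hr with rfl | hr
    · exact h3
    · refine ih ?_ h2 hr
      have h4 := mul_mem (simpleRefl_mem_young h3) hL
      rwa [List.map_cons, List.prod_cons, ← mul_assoc, simpleRefl_mul_self, one_mul] at h4

theorem index_eq_of_mem_reducedWord {w : Equiv.Perm (Fin d)} (hw : w ∈ young κ)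
    {r : Fin (d - 1)} (hr : r ∈ reducedWord w) : κ.index (lo r) = κ.index (hi r) :=
  index_eq_of_mem_word (by rwa [reducedWord_prod])
    (by rw [reducedWord_prod, reducedWord_length]) hr

/-- Lengths add up in `u * v` if `u` is in the Young subgroup and `v⁻¹` increases on every block. -/
theorem len_mul_of_isAscent {v : Equiv.Perm (Fin d)}
    (hv : ∀ r, κ.index (lo r) = κ.index (hi r) → IsAscent v r) {u : Equiv.Perm (Fin d)}
    (hu : u ∈ young κ) : len (u * v) = len u + len v := by
  refine young_induction (p := fun u => len (u * v) = len u + len v) (by simp) ?_ hu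
  · intro r w h hw hr ih
    have h1 : IsAscent (w * v) r := by
      have hlt : w⁻¹ (lo r) < w⁻¹ (hi r) := hr
      change (w * v)⁻¹ (lo r) < (w * v)⁻¹ (hi r)
      rw [mul_inv_rev]
      refine rel_of_adjacent (fun a b => v⁻¹ a < v⁻¹ b) (fun _ _ _ => lt_trans) hlt
        fun s hs hs' => hv s ?_
      have hw' := inv_mem hw
      have e : κ.index (w⁻¹ (lo r)) = κ.index (w⁻¹ (hi r)) := by rw [hw', hw', h]
      rw [index_eq_of_mem_Icc e hs ((lo_lt_hi s).le.trans hs'),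
        index_eq_of_mem_Icc e (hs.trans (lo_lt_hi s).le) hs']
    rw [mul_assoc, len_of_isAscent h1, ih, len_of_isAscent hr]
    omega

/-- The shortest representatives `v` of the cosets are those with `v⁻¹` increasing on every block.
-/
theorem isShortest_iff {w : Equiv.Perm (Fin d)} :
    IsShortest κ w ↔ ∀ r, κ.index (lo r) = κ.index (hi r) → IsAscent w r := by
  constructor
  · intro h r hr
    by_contra hn
    have h1 := h _ (simpleRefl_mem_young hr)
    have h2 := len_of_not_isAscent hn
    omega
  · intro h u hu
    rw [len_mul_of_isAscent h hu]
    omega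

theorem IsShortest.len_mul {u v : Equiv.Perm (Fin d)} (hv : IsShortest κ v) (hu : u ∈ young κ) :
    len (u * v) = len u + len v := len_mul_of_isAscent (isShortest_iff.1 hv) hu

theorem exists_isShortest (κ : Composition d) (w : Equiv.Perm (Fin d)) :
    ∃ u ∈ young κ, IsShortest κ (u * w) := by
  obtain ⟨u, hu, hmin⟩ := Finset.exists_min_image
    (Finset.univ.filter (· ∈ young κ)) (fun u => len (u * w)) ⟨1, by simp [one_mem]⟩
  simp only [Finset.mem_filter, Finset.mem_univ, true_and] at hu hmin
  refine ⟨u, hu, fun u' hu' => ?_⟩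
  rw [← mul_assoc]
  exact hmin _ (mul_mem hu' hu)

theorem IsShortest.unique {u u' v v' : Equiv.Perm (Fin d)} (hu : u ∈ young κ) (hu' : u' ∈ young κ)
    (hv : IsShortest κ v) (hv' : IsShortest κ v') (h : u * v = u' * v') : u = u' ∧ v = v' := by
  have e1 : v' = (u'⁻¹ * u) * v := by rw [mul_assoc, h, inv_mul_cancel_left]
  have e2 : v = (u⁻¹ * u') * v' := by rw [mul_assoc, ← h, inv_mul_cancel_left]
  have h1 := hv.len_mul (mul_mem (inv_mem hu') hu)
  have h2 := hv'.len_mul (mul_mem (inv_mem hu) hu')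
  rw [← e1] at h1
  rw [← e2] at h2
  have h3 := eq_one_of_len_eq_zero (w := u'⁻¹ * u) (by omega)
  refine ⟨(inv_mul_eq_one.1 h3).symm, ?_⟩
  rw [h3, one_mul] at e1
  exact e1.symm

open Classical in
/-- The sum over a union of cosets of a Young subgroup, as a sum over the subgroup and the
shortest representatives. -/
theorem sum_coset {M : Type*} [AddCommMonoid M] (A : Finset (Equiv.Perm (Fin d)))
    (hA : ∀ u ∈ young κ, ∀ w ∈ A, u * w ∈ A) (F : Equiv.Perm (Fin d) → M) :
    ∑ w ∈ A, F w = ∑ u ∈ Finset.univ.filter (· ∈ young κ),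
      ∑ v ∈ A.filter (IsShortest κ), F (u * v) := by
  rw [← Finset.sum_product']
  symm
  refine Finset.sum_bij (fun p _ => p.1 * p.2) ?_ ?_ ?_ fun _ _ => rfl
  · rintro ⟨u, v⟩ h
    simp only [Finset.mem_product, Finset.mem_filter, Finset.mem_univ, true_and] at h
    exact hA u h.1 v h.2.1
  · rintro ⟨u, v⟩ h ⟨u', v'⟩ h' e
    simp only [Finset.mem_product, Finset.mem_filter, Finset.mem_univ, true_and] at h h'
    obtain ⟨e1, e2⟩ := IsShortest.unique h.1 h'.1 h.2.2 h'.2.2 e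
    rw [e1, e2]
  · intro w hw
    obtain ⟨u, hu, h⟩ := exists_isShortest κ w
    refine ⟨(u⁻¹, u * w), ?_, inv_mul_cancel_left u w⟩
    simp only [Finset.mem_product, Finset.mem_filter, Finset.mem_univ, true_and]
    exact ⟨inv_mem hu, hA u hu w hw, h⟩

theorem exists_longest (κ : Composition d) :
    ∃ w ∈ young κ, len w = youngMaxLen κ := by
  obtain ⟨w, hw, h⟩ := Finset.exists_mem_eq_sup (Finset.univ.filter (· ∈ young κ))
    ⟨1, by simp [one_mem]⟩ len
  simp only [Finset.mem_filter, Finset.mem_univ, true_and] at hw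
  exact ⟨w, hw, h.symm⟩

/-- The longest element of a Young subgroup. -/
def longest (κ : Composition d) : Equiv.Perm (Fin d) := (exists_longest κ).choose

theorem longest_mem (κ : Composition d) : longest κ ∈ young κ := (exists_longest κ).choose_spec.1

theorem len_longest (κ : Composition d) : len (longest κ) = youngMaxLen κ :=
  (exists_longest κ).choose_spec.2

theorem len_le_youngMaxLen {w : Equiv.Perm (Fin d)} (hw : w ∈ young κ) : len w ≤ youngMaxLen κ :=
  Finset.le_sup (f := len) (by simp [hw])

theorem len_lt_youngMaxLen {w : Equiv.Perm (Fin d)} (hw : w ∈ young κ) {r : Fin (d - 1)}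
    (hr : κ.index (lo r) = κ.index (hi r)) (h : IsAscent w r) : len w + 1 ≤ youngMaxLen κ := by
  rw [← len_of_isAscent h]
  exact len_le_youngMaxLen (mul_mem (simpleRefl_mem_young hr) hw)

/-- `w⁻¹` reverses the order in each block of `κ`. -/
def Reverses (κ : Composition d) (w : Equiv.Perm (Fin d)) : Prop :=
  ∀ i j, i < j → κ.index i = κ.index j → w⁻¹ j < w⁻¹ i

theorem longest_reverses (κ : Composition d) : Reverses κ (longest κ) := by
  intro i j hij h
  refine rel_of_adjacent (fun a b => (longest κ)⁻¹ b < (longest κ)⁻¹ a)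
    (fun _ _ _ h h' => lt_trans h' h) hij fun r hr hr' => ?_
  have e : κ.index (lo r) = κ.index (hi r) := by
    rw [index_eq_of_mem_Icc h hr ((lo_lt_hi r).le.trans hr'),
      index_eq_of_mem_Icc h (hr.trans (lo_lt_hi r).le) hr']
  by_contra hn
  have h1 : IsAscent (longest κ) r := lt_of_le_of_ne (not_lt.1 hn)
    fun h => (lo_lt_hi r).ne ((longest κ)⁻¹.injective h)
  have := len_lt_youngMaxLen (longest_mem κ) e h1
  rw [len_longest] at this
  omega

theorem Reverses.lt_iff {w : Equiv.Perm (Fin d)} (hw : Reverses κ w) {i j : Fin d}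
    (h : κ.index i = κ.index j) : w⁻¹ i < w⁻¹ j ↔ j < i := by
  rcases lt_trichotomy i j with h1 | h1 | h1
  · exact iff_of_false (hw i j h1 h).not_gt h1.not_gt
  · simp [h1]
  · exact iff_of_true (hw j i h1 h.symm) h1

/-- An element of the Young subgroup is determined by its reversing the order in every block. -/
theorem Reverses.eq {w w' : Equiv.Perm (Fin d)} (hw : Reverses κ w) (hw' : Reverses κ w')
    (h : w ∈ young κ) (h' : w' ∈ young κ) : w = w' := by
  rw [← inv_mul_eq_one]
  refine eq_one_of_strictMono fun i j hij => ?_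
  have e : ∀ a, κ.index (w' a) = κ.index a := h'
  change w⁻¹ (w' i) < w⁻¹ (w' j)
  by_cases hb : κ.index i = κ.index j
  · rw [hw.lt_iff (by rw [e, e, hb]), ← hw'.lt_iff (by rw [e, e, hb])]
    simpa using hij
  · have h1 := lt_of_le_of_ne (index_mono κ hij.le) hb
    exact lt_of_mem_young (mul_mem (inv_mem h) h') h1

theorem inversions_longest (κ : Composition d) : inversions (longest κ) =
    Finset.univ.filter (fun p : Fin d × Fin d => p.1 < p.2 ∧ κ.index p.1 = κ.index p.2) := by
  ext ⟨i, j⟩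
  simp only [inversions, Finset.mem_filter, Finset.mem_univ, true_and]
  refine and_congr_right fun hij => ⟨fun h => ?_, fun h => longest_reverses κ i j hij h⟩
  by_contra hne
  have h1 := lt_of_le_of_ne (index_mono κ hij.le) hne
  exact absurd h (lt_of_mem_young (inv_mem (longest_mem κ)) h1).not_gt

end Young

/-! ### Demazure and Demazure–Lusztig operators -/

section Operators

variable {k : Type*} [Field k] {d : ℕ}

theorem permute_one (f : Laurent k d) : permute 1 f = f := by
  have h : (permute 1 : Laurent k d →ₐ[k] Laurent k d) = AlgHom.id k _ := by
    apply AddMonoidAlgebra.algHom_ext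
    intro a
    simp only [permute, AddMonoidAlgebra.mapDomainAlgHom_apply, AddMonoidAlgebra.mapDomain_single]
    rfl
    exact Subsingleton.elim (α := k →ₐ[k] Laurent k d) _ _
  rw [h]; rfl

theorem permute_mul (v w : Equiv.Perm (Fin d)) (f : Laurent k d) :
    permute (v * w) f = permute v (permute w f) := by
  have h : (permute (v * w) : Laurent k d →ₐ[k] Laurent k d) = (permute v).comp (permute w) := by
    apply AddMonoidAlgebra.algHom_ext
    intro a
    simp only [AlgHom.comp_apply, permute, AddMonoidAlgebra.mapDomainAlgHom_apply,
      AddMonoidAlgebra.mapDomain_single]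
    rfl
    exact Subsingleton.elim (α := k →ₐ[k] Laurent k d) _ _
  rw [h]; rfl

theorem permute_injective (w : Equiv.Perm (Fin d)) :
    Function.Injective (permute w : Laurent k d → Laurent k d) := by
  intro f g h
  have := congrArg (permute w⁻¹) h
  rwa [← permute_mul, ← permute_mul, inv_mul_cancel, permute_one, permute_one] at this

theorem x_injective : Function.Injective (x : Fin d → Laurent k d) := by
  intro i j h
  have h1 := AddMonoidAlgebra.single_left_injective (R := k) one_ne_zero h
  by_contra hne
  have h2 := congrFun h1 i
  rw [Pi.single_eq_same, Pi.single_eq_of_ne hne] at h2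
  exact one_ne_zero h2

theorem x_sub_x_ne_zero {i j : Fin d} (h : i ≠ j) : (x i - x j : Laurent k d) ≠ 0 :=
  sub_ne_zero.2 fun e => h (x_injective e)

theorem x_sub_smul_x_ne_zero {i j : Fin d} (h : i ≠ j) (c : k) :
    (x i - c • x j : Laurent k d) ≠ 0 := by
  intro e
  have h1 : (Pi.single i 1 : Fin d → ℤ) ≠ Pi.single j 1 := by
    intro e'
    have h2 := congrFun e' i
    rw [Pi.single_eq_same, Pi.single_eq_of_ne h] at h2
    exact one_ne_zero h2
  have h3 := congrArg (fun f : Laurent k d => f.coeff (Pi.single i 1)) e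
  simp [x, h1.symm] at h3

theorem sub_mul_demazure (r : Fin (d - 1)) (f : Laurent k d) :
    (x (lo r) - x (hi r)) * demazure r f = f - permute (simpleRefl r) f :=
  (exists_demazure r f).choose_spec

theorem demazure_eq {r : Fin (d - 1)} {f g : Laurent k d}
    (h : (x (lo r) - x (hi r)) * g = f - permute (simpleRefl r) f) : demazure r f = g :=
  demazure_unique r f _ _ (sub_mul_demazure r f) h

/-- The Demazure operator as a linear map. -/
def demazureL (r : Fin (d - 1)) : Module.End k (Laurent k d) where
  toFun := demazure r
  map_add' f g := demazure_eq (by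
    rw [mul_add, sub_mul_demazure, sub_mul_demazure, map_add]; ring)
  map_smul' c f := demazure_eq (by
    rw [mul_smul_comm, RingHom.id_apply, sub_mul_demazure, map_smul, smul_sub])

@[simp] theorem demazureL_apply (r : Fin (d - 1)) (f : Laurent k d) :
    demazureL r f = demazure r f := rfl

theorem demazure_mul (r : Fin (d - 1)) (f g : Laurent k d) :
    demazure r (f * g) = demazure r f * g + permute (simpleRefl r) f * demazure r g := by
  refine demazure_eq ?_
  rw [map_mul]
  linear_combination g * sub_mul_demazure r f + permute (simpleRefl r) f * sub_mul_demazure r g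

theorem demazure_of_permute_eq {r : Fin (d - 1)} {f : Laurent k d}
    (h : permute (simpleRefl r) f = f) : demazure r f = 0 :=
  demazure_eq (by rw [h, mul_zero, sub_self])

theorem permute_demazure (r : Fin (d - 1)) (f : Laurent k d) :
    permute (simpleRefl r) (demazure r f) = demazure r f := by
  refine mul_left_cancel₀ (x_sub_x_ne_zero (k := k) (lo_lt_hi r).ne) ?_
  have h := congrArg (permute (simpleRefl r)) (sub_mul_demazure r f)
  rw [map_mul, map_sub, map_sub, permute_x, permute_x, simpleRefl_lo, simpleRefl_hi, ← permute_mul,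
    simpleRefl_mul_self, permute_one] at h
  linear_combination -h - sub_mul_demazure r f

theorem demazure_demazure (r : Fin (d - 1)) (f : Laurent k d) : demazure r (demazure r f) = 0 :=
  demazure_of_permute_eq (permute_demazure r f)

/-- The Demazure–Lusztig operator, by which a black crossing acts on polynomials. -/
def lusztig (q : k) (r : Fin (d - 1)) : Module.End k (Laurent k d) :=
  q • 1 + LinearMap.mulLeft k (x (hi r) - q • x (lo r)) * demazureL r

theorem lusztig_apply (q : k) (r : Fin (d - 1)) (f : Laurent k d) :
    lusztig q r f = q • f + (x (hi r) - q • x (lo r)) * demazure r f := rfl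

/-- The operator `T_r + 1` factors through the Demazure operator; the quadratic relation and the
invariance of symmetrized polynomials follow from this. -/
theorem lusztig_add (q : k) (r : Fin (d - 1)) (f : Laurent k d) :
    lusztig q r f + f = demazure r ((x (lo r) - q • x (hi r)) * f) := by
  symm
  refine demazure_eq ?_
  rw [lusztig_apply, map_mul, map_sub, map_smul, permute_x, permute_x, simpleRefl_lo,
    simpleRefl_hi]
  simp only [Algebra.smul_def]
  linear_combination (x (hi r) - (algebraMap k (Laurent k d)) q * x (lo r)) * sub_mul_demazure r f

theorem lusztig_sq (q : k) (r : Fin (d - 1)) :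
    lusztig q r * lusztig q r = (q - 1) • lusztig q r + q • (1 : Module.End k (Laurent k d)) := by
  refine LinearMap.ext fun f => ?_
  have h := lusztig_apply q r (lusztig q r f + f)
  rw [lusztig_add, demazure_demazure, mul_zero, add_zero, ← lusztig_add, map_add] at h
  simp only [Module.End.mul_apply, LinearMap.add_apply, LinearMap.smul_apply, Module.End.one_apply]
  rw [eq_sub_of_add_eq h, smul_add, sub_smul, one_smul]
  abel

theorem lusztig_mul (q : k) (r : Fin (d - 1)) (f g : Laurent k d) :
    lusztig q r (f * g) = permute (simpleRefl r) f * lusztig q r g +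
      (1 - q) • (x (hi r) * demazure r f * g) := by
  rw [lusztig_apply, lusztig_apply, demazure_mul]
  simp only [Algebra.smul_def, map_sub, map_one]
  linear_combination -(algebraMap k (Laurent k d) q) * g * sub_mul_demazure r f

theorem lusztig_mul_of_permute_eq (q : k) {r : Fin (d - 1)} {f : Laurent k d}
    (h : permute (simpleRefl r) f = f) (g : Laurent k d) :
    lusztig q r (f * g) = f * lusztig q r g := by
  rw [lusztig_mul, h, demazure_of_permute_eq h, mul_zero, zero_mul, smul_zero, add_zero]

theorem demazure_mul_of_permute_eq {r : Fin (d - 1)} {f : Laurent k d}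
    (h : permute (simpleRefl r) f = f) (g : Laurent k d) :
    demazure r (f * g) = f * demazure r g := by
  rw [demazure_mul, h, demazure_of_permute_eq h, zero_mul, zero_add]

theorem demazure_x_lo (r : Fin (d - 1)) : demazure r (x (lo r) : Laurent k d) = 1 :=
  demazure_eq (by rw [permute_x, simpleRefl_lo, mul_one])

theorem demazure_x_hi (r : Fin (d - 1)) : demazure r (x (hi r) : Laurent k d) = -1 :=
  demazure_eq (by rw [permute_x, simpleRefl_hi]; ring)

theorem lusztig_x_hi (q : k) (r : Fin (d - 1)) (f : Laurent k d) :
    lusztig q r (x (hi r) * f) = x (lo r) * lusztig q r f + (q - 1) • (x (hi r) * f) := by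
  rw [lusztig_mul, permute_x, simpleRefl_hi, demazure_x_hi]
  simp only [Algebra.smul_def, map_sub, map_one]
  ring

theorem lusztig_x_lo (q : k) (r : Fin (d - 1)) (f : Laurent k d) :
    lusztig q r (x (lo r) * f) = x (hi r) * lusztig q r f - (q - 1) • (x (hi r) * f) := by
  rw [lusztig_mul, permute_x, simpleRefl_lo, demazure_x_lo]
  simp only [Algebra.smul_def, map_sub, map_one]
  ring

/-! ### Operators as combinations of permutations over the fraction field -/

/-- The field of rational functions. -/
abbrev Rat (k : Type*) [Field k] (d : ℕ) : Type _ := FractionRing (Laurent k d)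

/-- A Laurent polynomial as a rational function. -/
abbrev toRat (k : Type*) [Field k] (d : ℕ) : Laurent k d →+* Rat k d :=
  algebraMap (Laurent k d) (Rat k d)

theorem toRat_injective : Function.Injective (toRat k d) := IsFractionRing.injective _ _

/-- The action of a permutation on rational functions. -/
def ratPermute (w : Equiv.Perm (Fin d)) : Rat k d →+* Rat k d :=
  IsFractionRing.map (A := Laurent k d) (B := Laurent k d) (K := Rat k d) (L := Rat k d)
    (j := (permute w : Laurent k d →ₐ[k] Laurent k d).toRingHom) (permute_injective w)

@[simp] theorem ratPermute_toRat (w : Equiv.Perm (Fin d)) (f : Laurent k d) :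
    ratPermute w (toRat k d f) = toRat k d (permute w f) := by
  rw [ratPermute, IsFractionRing.map]
  exact IsLocalization.map_eq _ _

theorem ratPermute_mul (v w : Equiv.Perm (Fin d)) (a : Rat k d) :
    ratPermute (v * w) a = ratPermute v (ratPermute w a) := by
  have h : (ratPermute (v * w) : Rat k d →+* Rat k d) = (ratPermute v).comp (ratPermute w) := by
    refine IsLocalization.ringHom_ext (nonZeroDivisors (Laurent k d)) (RingHom.ext fun f => ?_)
    simp only [RingHom.comp_apply]
    rw [ratPermute_toRat, ratPermute_toRat, ratPermute_toRat, permute_mul]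
  rw [h]; rfl

theorem ratPermute_one (a : Rat k d) : ratPermute 1 a = a := by
  have h : (ratPermute 1 : Rat k d →+* Rat k d) = RingHom.id _ := by
    refine IsLocalization.ringHom_ext (nonZeroDivisors (Laurent k d)) (RingHom.ext fun f => ?_)
    simp only [RingHom.comp_apply]
    rw [ratPermute_toRat, permute_one]; rfl
  rw [h]; rfl

/-- The difference `x_r - x_{r+1}` as a rational function. -/
def ratRoot (k : Type*) [Field k] {d : ℕ} (r : Fin (d - 1)) : Rat k d :=
  toRat k d (x (lo r) - x (hi r))

theorem ratRoot_ne_zero (r : Fin (d - 1)) : ratRoot k r ≠ 0 := fun h =>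
  x_sub_x_ne_zero (k := k) (lo_lt_hi r).ne (toRat_injective (h.trans (map_zero _).symm))

theorem toRat_demazure (r : Fin (d - 1)) (f : Laurent k d) : toRat k d (demazure r f) =
    (toRat k d f - ratPermute (simpleRefl r) (toRat k d f)) / ratRoot k r := by
  rw [eq_div_iff (ratRoot_ne_zero r), ratPermute_toRat, ← map_sub, ← sub_mul_demazure, map_mul,
    mul_comm, ratRoot]

theorem demazureL_comm {r s : Fin (d - 1)} (h : (r : ℕ) + 1 < s) :
    (demazureL r * demazureL s : Module.End k (Laurent k d)) = demazureL s * demazureL r := by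
  refine LinearMap.ext fun f => ?_
  refine toRat_injective (k := k) (d := d) ?_
  have hroot : ∀ {a b : Fin (d - 1)}, (a : ℕ) + 1 < b ∨ (b : ℕ) + 1 < a →
      ratPermute (simpleRefl a) (ratRoot k b) = ratRoot k b := by
    intro a b h
    rw [ratRoot, ratPermute_toRat, map_sub, permute_x, permute_x, (simpleRefl_far h).1,
      (simpleRefl_far h).2]
  simp only [Module.End.mul_apply, demazureL_apply, toRat_demazure, map_div₀, map_sub,
    hroot (Or.inl h), hroot (a := s) (b := r) (Or.inr h), ← ratPermute_mul, simpleRefl_comm h]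
  field_simp [ratRoot_ne_zero (k := k) r, ratRoot_ne_zero (k := k) s]
  ring

theorem lusztig_comm (q : k) {r s : Fin (d - 1)} (h : (r : ℕ) + 1 < s) :
    lusztig q r * lusztig q s = lusztig q s * lusztig q r := by
  have hp : ∀ {a b : Fin (d - 1)}, (a : ℕ) + 1 < b ∨ (b : ℕ) + 1 < a →
      permute (simpleRefl a) (x (hi b) - q • x (lo b) : Laurent k d) = x (hi b) - q • x (lo b) := by
    intro a b h
    rw [map_sub, map_smul, permute_x, permute_x, (simpleRefl_far h).1,
      (simpleRefl_far h).2]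
  refine LinearMap.ext fun f => ?_
  have h1 : demazure r (demazure s f) = demazure s (demazure r f) :=
    LinearMap.congr_fun (demazureL_comm h) f
  simp only [Module.End.mul_apply, lusztig_apply]
  rw [← demazureL_apply r, map_add, map_smul, demazureL_apply, demazureL_apply,
    demazure_mul_of_permute_eq (hp (Or.inl h)), ← demazureL_apply s (_ + _), map_add, map_smul,
    demazureL_apply, demazureL_apply, demazure_mul_of_permute_eq (hp (Or.inr h)), h1]
  simp only [Algebra.smul_def]
  ring

/-- The braid relation for Demazure–Lusztig operators, as an identity of operators on a field `K`
with two automorphisms which permute the elements `X`, `Y`, `Z` like simple transpositions. -/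
theorem braid_of_rational {K : Type*} [Field K] {X Y Z q : K} (h1 : X - Y ≠ 0) (h2 : Y - Z ≠ 0)
    (h3 : X - Z ≠ 0) {σ τ : K →+* K} (hσσ : ∀ a, σ (σ a) = a) (hττ : ∀ a, τ (τ a) = a)
    (hb : ∀ a, σ (τ (σ a)) = τ (σ (τ a))) (hX : σ X = Y) (hY : σ Y = X) (hZ : σ Z = Z)
    (hX' : τ X = X) (hY' : τ Y = Z) (hZ' : τ Z = Y) (hq : σ q = q) (hq' : τ q = q)
    {S T : K → K} (hS : ∀ a, S a = (1 - q) * Y / (X - Y) * a + (q * X - Y) / (X - Y) * σ a)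
    (hT : ∀ a, T a = (1 - q) * Z / (Y - Z) * a + (q * Y - Z) / (Y - Z) * τ a) (a : K) :
    S (T (S a)) = T (S (T a)) := by
  have h1' : Y - X ≠ 0 := by rw [← neg_sub]; exact neg_ne_zero.2 h1
  have h2' : Z - Y ≠ 0 := by rw [← neg_sub]; exact neg_ne_zero.2 h2
  have h3' : Z - X ≠ 0 := by rw [← neg_sub]; exact neg_ne_zero.2 h3
  -- both sides are combinations of the six translates of `a`, treated as independent symbols
  simp only [hS, hT, map_add, map_mul, map_div₀, map_sub, map_one, hσσ, hττ, hX, hY, hZ, hX', hY',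
    hZ', hq, hq', hb]
  generalize σ (τ a) = a1
  generalize τ (σ a) = a2
  generalize τ (σ (τ a)) = a3
  generalize σ a = a4
  generalize τ a = a5
  field_simp
  ring

/-- The braid relation for Demazure operators, in the same setting. -/
theorem braid_demazure_of_rational {K : Type*} [Field K] {X Y Z : K} (h1 : X - Y ≠ 0)
    (h2 : Y - Z ≠ 0) (h3 : X - Z ≠ 0) {σ τ : K →+* K} (hσσ : ∀ a, σ (σ a) = a)
    (hττ : ∀ a, τ (τ a) = a)
    (hb : ∀ a, σ (τ (σ a)) = τ (σ (τ a))) (hX : σ X = Y) (hY : σ Y = X) (hZ : σ Z = Z)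
    (hX' : τ X = X) (hY' : τ Y = Z) (hZ' : τ Z = Y)
    {S T : K → K} (hS : ∀ a, S a = (a - σ a) / (X - Y))
    (hT : ∀ a, T a = (a - τ a) / (Y - Z)) (a : K) :
    S (T (S a)) = T (S (T a)) := by
  have h1' : Y - X ≠ 0 := by rw [← neg_sub]; exact neg_ne_zero.2 h1
  have h2' : Z - Y ≠ 0 := by rw [← neg_sub]; exact neg_ne_zero.2 h2
  have h3' : Z - X ≠ 0 := by rw [← neg_sub]; exact neg_ne_zero.2 h3
  simp only [hS, hT, map_div₀, map_sub, hσσ, hττ, hX, hY, hZ, hX', hY', hZ', hb]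
  generalize σ (τ a) = a1
  generalize τ (σ a) = a2
  generalize τ (σ (τ a)) = a3
  generalize σ a = a4
  generalize τ a = a5
  field_simp
  ring

theorem toRat_lusztig (q : k) (r : Fin (d - 1)) (f : Laurent k d) :
    toRat k d (lusztig q r f) =
      (1 - toRat k d (algebraMap k _ q)) * toRat k d (x (hi r)) / ratRoot k r * toRat k d f +
      (toRat k d (algebraMap k _ q) * toRat k d (x (lo r)) - toRat k d (x (hi r))) / ratRoot k r *
        ratPermute (simpleRefl r) (toRat k d f) := by
  have h := ratRoot_ne_zero (k := k) r
  rw [lusztig_apply, Algebra.smul_def, Algebra.smul_def, map_add, map_mul, map_mul, map_sub,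
    map_mul, toRat_demazure]
  field_simp
  rw [ratRoot, map_sub]
  ring

theorem ratPermute_algebraMap (w : Equiv.Perm (Fin d)) (c : k) :
    ratPermute w (toRat k d (algebraMap k _ c)) = toRat k d (algebraMap k _ c) := by
  rw [ratPermute_toRat, AlgHom.commutes]

theorem adjacent_facts {r s : Fin (d - 1)} (h : (s : ℕ) = r + 1) :
    simpleRefl r (lo r) = lo s ∧ simpleRefl r (lo s) = lo r ∧ simpleRefl r (hi s) = hi s ∧
    simpleRefl s (lo r) = lo r ∧ simpleRefl s (lo s) = hi s ∧ simpleRefl s (hi s) = lo s ∧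
    hi r = lo s ∧ lo r ≠ hi s := by
  have e : hi r = lo s := Fin.ext h.symm
  have h3 : lo r ≠ hi s := ((lo_lt_hi r).trans (e ▸ lo_lt_hi s)).ne
  refine ⟨by rw [simpleRefl_lo, e], by rw [← e, simpleRefl_hi], ?_, ?_, simpleRefl_lo s,
    simpleRefl_hi s, e, h3⟩
  · exact simpleRefl_of_ne h3.symm (e ▸ (lo_lt_hi s).ne')
  · exact simpleRefl_of_ne (e ▸ (lo_lt_hi r).ne) h3

theorem braidRel_lusztig (q : k) :
    BraidRel (lusztig q : Fin (d - 1) → Module.End k (Laurent k d)) where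
  comm _ _ h := lusztig_comm q h
  braid r s h := by
    obtain ⟨e1, e2, e3, e4, e5, e6, e7, hne⟩ := adjacent_facts h
    refine LinearMap.ext fun f => toRat_injective (k := k) (d := d) ?_
    have key := fun a => braid_of_rational (K := Rat k d) (X := toRat k d (x (lo r)))
      (Y := toRat k d (x (lo s))) (Z := toRat k d (x (hi s)))
      (q := toRat k d (algebraMap k _ q)) (σ := ratPermute (simpleRefl r))
      (τ := ratPermute (simpleRefl s))
      (by rw [← map_sub, ← e7]; exact ratRoot_ne_zero r)
      (by rw [← map_sub]; exact ratRoot_ne_zero s)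
      (by rw [← map_sub]
          exact fun h => x_sub_x_ne_zero hne (toRat_injective (h.trans (map_zero _).symm)))
      (fun a => by rw [← ratPermute_mul, simpleRefl_mul_self, ratPermute_one])
      (fun a => by rw [← ratPermute_mul, simpleRefl_mul_self, ratPermute_one])
      (fun a => by simp only [← ratPermute_mul, ← mul_assoc, simpleRefl_braid h])
      (by rw [ratPermute_toRat, permute_x, e1]) (by rw [ratPermute_toRat, permute_x, e2])
      (by rw [ratPermute_toRat, permute_x, e3]) (by rw [ratPermute_toRat, permute_x, e4])
      (by rw [ratPermute_toRat, permute_x, e5]) (by rw [ratPermute_toRat, permute_x, e6])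
      (ratPermute_algebraMap _ _) (ratPermute_algebraMap _ _)
      (fun _ => rfl) (fun _ => rfl) a
    simp only [Module.End.mul_apply, toRat_lusztig, ratRoot, e7, map_sub]
    exact key _

theorem braidRel_demazureL :
    BraidRel (demazureL : Fin (d - 1) → Module.End k (Laurent k d)) where
  comm _ _ h := demazureL_comm h
  braid r s h := by
    obtain ⟨e1, e2, e3, e4, e5, e6, e7, hne⟩ := adjacent_facts h
    refine LinearMap.ext fun f => toRat_injective (k := k) (d := d) ?_
    have key := fun a => braid_demazure_of_rational (K := Rat k d) (X := toRat k d (x (lo r)))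
      (Y := toRat k d (x (lo s))) (Z := toRat k d (x (hi s)))
      (σ := ratPermute (simpleRefl r)) (τ := ratPermute (simpleRefl s))
      (by rw [← map_sub, ← e7]; exact ratRoot_ne_zero r)
      (by rw [← map_sub]; exact ratRoot_ne_zero s)
      (by rw [← map_sub]
          exact fun h => x_sub_x_ne_zero hne (toRat_injective (h.trans (map_zero _).symm)))
      (fun a => by rw [← ratPermute_mul, simpleRefl_mul_self, ratPermute_one])
      (fun a => by rw [← ratPermute_mul, simpleRefl_mul_self, ratPermute_one])
      (fun a => by simp only [← ratPermute_mul, ← mul_assoc, simpleRefl_braid h])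
      (by rw [ratPermute_toRat, permute_x, e1]) (by rw [ratPermute_toRat, permute_x, e2])
      (by rw [ratPermute_toRat, permute_x, e3]) (by rw [ratPermute_toRat, permute_x, e4])
      (by rw [ratPermute_toRat, permute_x, e5]) (by rw [ratPermute_toRat, permute_x, e6])
      (fun _ => rfl) (fun _ => rfl) a
    simp only [Module.End.mul_apply, demazureL_apply, toRat_demazure, ratRoot, e7, map_sub]
    exact key _

theorem demazurePerm_eq (w : Equiv.Perm (Fin d)) (f : Laurent k d) :
    demazurePerm w f = wordProd demazureL w f := by
  unfold demazurePerm wordProd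
  induction reducedWord w with
  | nil => rfl
  | cons a L ih => rw [List.foldr_cons, ih, List.map_cons, List.prod_cons]; rfl

end Operators

section Expansions

variable {k : Type*} [Field k] {d : ℕ}

/-- The map `O` is the combination `∑ a_w w` of permutations. -/
def IsExpansion (O : Laurent k d → Rat k d) (a : Equiv.Perm (Fin d) → Rat k d) : Prop :=
  ∀ f, O f = ∑ w, a w * toRat k d (permute w f)

/-- Linear independence of automorphisms: the coefficients of a combination of permutations are
determined by the map. -/
theorem IsExpansion.unique {O : Laurent k d → Rat k d} {a b : Equiv.Perm (Fin d) → Rat k d}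
    (ha : IsExpansion O a) (hb : IsExpansion O b) : a = b := by
  let φ : Equiv.Perm (Fin d) → (Laurent k d →* Rat k d) := fun w =>
    ((toRat k d).comp (permute w : Laurent k d →ₐ[k] Laurent k d).toRingHom).toMonoidHom
  have hφ : Function.Injective φ := by
    intro v w h
    ext i
    have h1 := DFunLike.congr_fun h (x i)
    have h2 : toRat k d (permute v (x i)) = toRat k d (permute w (x i)) := h1
    have h3 := toRat_injective h2
    rw [permute_x, permute_x] at h3
    exact congrArg Fin.val (x_injective h3)
  have hli := (linearIndependent_monoidHom (Laurent k d) (Rat k d)).comp φ hφ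
  rw [Fintype.linearIndependent_iff] at hli
  funext w
  rw [← sub_eq_zero]
  refine hli (fun w => a w - b w) ?_ w
  funext f
  simp only [Finset.sum_apply, Pi.smul_apply, smul_eq_mul, sub_mul, Finset.sum_sub_distrib,
    Pi.zero_apply]
  rw [sub_eq_zero]
  exact (ha f).symm.trans (hb f)

theorem sum_mul_toRat_simpleRefl (r : Fin (d - 1)) (a : Equiv.Perm (Fin d) → Rat k d)
    (f : Laurent k d) :
    ratPermute (simpleRefl r) (∑ w, a w * toRat k d (permute w f)) =
      ∑ w, ratPermute (simpleRefl r) (a (simpleRefl r * w)) * toRat k d (permute w f) := by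
  rw [map_sum, ← Equiv.sum_comp (Equiv.mulLeft (simpleRefl r))]
  refine Finset.sum_congr rfl fun w _ => ?_
  rw [map_mul, ratPermute_toRat, Equiv.coe_mulLeft, ← permute_mul, ← mul_assoc,
    simpleRefl_mul_self, one_mul]

/-- The expansion of an operator followed by `∂_r`. -/
theorem IsExpansion.demazure {O : Laurent k d → Laurent k d} {a : Equiv.Perm (Fin d) → Rat k d}
    (h : IsExpansion (fun f => toRat k d (O f)) a) (r : Fin (d - 1)) :
    IsExpansion (fun f => toRat k d (demazure r (O f)))
      fun w => (a w - ratPermute (simpleRefl r) (a (simpleRefl r * w))) / ratRoot k r := by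
  intro f
  have hf : toRat k d (O f) = _ := h f
  simp only [toRat_demazure]
  rw [hf, sum_mul_toRat_simpleRefl, ← Finset.sum_sub_distrib, Finset.sum_div]
  exact Finset.sum_congr rfl fun w _ => by ring

/-- The product of `x_j - q x_i` over the inversions `i < j` of `w`. -/
def pInv (q : k) (w : Equiv.Perm (Fin d)) : Laurent k d :=
  ∏ p ∈ inversions w, (x p.2 - q • x p.1)

theorem pInv_ne_zero (q : k) (w : Equiv.Perm (Fin d)) : pInv q w ≠ 0 := by
  refine Finset.prod_ne_zero_iff.2 fun p hp => ?_
  simp only [inversions, Finset.mem_filter] at hp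
  exact x_sub_smul_x_ne_zero hp.2.1.ne' q

theorem pInv_simpleRefl_mul (q : k) {w : Equiv.Perm (Fin d)} {r : Fin (d - 1)}
    (h : IsAscent w r) : pInv q (simpleRefl r * w) =
      (x (hi r) - q • x (lo r)) * permute (simpleRefl r) (pInv q w) := by
  rw [pInv, prod_inversions_simpleRefl_mul _ h, pInv, map_prod]
  congr 1
  refine Finset.prod_congr rfl fun p _ => ?_
  rw [map_sub, map_smul, permute_x, permute_x]

/-- Both the operator `T_w` and the operator `∂_w` are combinations of `w` and of shorter
permutations, and their leading coefficients differ by the product over the inversions of `w`.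
If `w` is in a Young subgroup, then only elements of this subgroup occur. -/
theorem exists_expansions (q : k) (w : Equiv.Perm (Fin d)) :
    ∃ a b : Equiv.Perm (Fin d) → Rat k d,
      IsExpansion (fun f => toRat k d (wordProd (lusztig q) w f)) a ∧
      IsExpansion (fun f => toRat k d (wordProd demazureL w f)) b ∧
      (∀ v, v ≠ w → a v ≠ 0 → len v < len w) ∧ (∀ v, v ≠ w → b v ≠ 0 → len v < len w) ∧
      a w = toRat k d (pInv q w) * b w ∧ b w ≠ 0 ∧
      ∀ κ : Composition d, w ∈ young κ → ∀ v, v ∉ young κ → a v = 0 ∧ b v = 0 := by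
  induction w using perm_induction with
  | one =>
    refine ⟨Pi.single 1 1, Pi.single 1 1, ?_, ?_, ?_, ?_, ?_, ?_, ?_⟩
    · intro f
      simp [Pi.single_apply, permute_one]
    · intro f
      simp [Pi.single_apply, permute_one]
    · exact fun v hv h => absurd (Pi.single_eq_of_ne hv 1) h
    · exact fun v hv h => absurd (Pi.single_eq_of_ne hv 1) h
    · have : inversions (1 : Equiv.Perm (Fin d)) = ∅ := by
        rw [← Finset.card_eq_zero, ← len_eq_card_inversions, len_one]
      rw [pInv, this, Finset.prod_empty, map_one, one_mul]
    · rw [Pi.single_eq_same]; exact one_ne_zero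
    · intro κ _ v hv
      have : v ≠ 1 := fun h => hv (h ▸ one_mem _)
      exact ⟨Pi.single_eq_of_ne this 1, Pi.single_eq_of_ne this 1⟩
  | mul r w hr ih =>
    obtain ⟨a, b, ha, hb, la, lb, hab, hb0, hy⟩ := ih
    have hlen := len_of_isAscent hr
    set s := simpleRefl r with hs
    have hss : ∀ v, s * (s * v) = v := fun v => by
      rw [← mul_assoc, hs, simpleRefl_mul_self, one_mul]
    have hsw : s * w ≠ w := fun h => by rw [h] at hlen; omega
    -- a permutation other than `s w` in the support of `c` or of its translate by `s` is shorter
    -- than `s w`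
    have hlt : ∀ v, v ≠ s * w → (v = w ∨ len v < len w) ∨ (s * v = w ∨ len (s * v) < len w) →
        len v < len (s * w) := by
      intro v hv h
      rcases h with (h | h) | (h | h)
      · rw [h]; omega
      · omega
      · exact absurd (by rw [← h, hss]) hv
      · by_cases h1 : IsAscent v r
        · have := len_of_isAscent h1; rw [← hs] at this; omega
        · have := len_of_not_isAscent h1; rw [← hs] at this; omega
    have ha' := ha.demazure r
    have hb' := hb.demazure r
    -- the effect of `∂_r` on the coefficients
    set D : (Equiv.Perm (Fin d) → Rat k d) → Equiv.Perm (Fin d) → Rat k d := fun a v =>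
      (a v - ratPermute s (a (s * v))) / ratRoot k r with hD
    have hDsupp : ∀ c : Equiv.Perm (Fin d) → Rat k d, (∀ v, v ≠ w → c v ≠ 0 → len v < len w) →
        ∀ v, v ≠ s * w → D c v ≠ 0 → len v < len (s * w) := by
      intro c hc v hv h
      refine hlt v hv ?_
      by_contra hn
      rw [not_or, not_or, not_or] at hn
      have h1 : c v = 0 := by
        by_contra h1; exact hn.1.2 (hc v hn.1.1 h1)
      have h2 : c (s * v) = 0 := by
        by_contra h2; exact hn.2.2 (hc _ hn.2.1 h2)
      exact h (by simp only [hD, h1, h2, map_zero, sub_zero, zero_div])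
    have hzero : ∀ c : Equiv.Perm (Fin d) → Rat k d, (∀ v, v ≠ w → c v ≠ 0 → len v < len w) →
        c (s * w) = 0 := by
      intro c hc
      by_contra h
      have := hc _ hsw h
      omega
    -- the leading coefficient is carried over from `w` to `s w`
    have hDlead : ∀ c : Equiv.Perm (Fin d) → Rat k d, (∀ v, v ≠ w → c v ≠ 0 → len v < len w) →
        D c (s * w) = - ratPermute s (c w) / ratRoot k r := by
      intro c hc
      simp only [hD]
      rw [hzero c hc, hss, zero_sub]
    -- the coefficients of `T_r T_w`, where `T_r = q + (x_{r+1} - q x_r) ∂_r`, and those of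
    -- `∂_r ∂_w`
    refine ⟨fun v => toRat k d (algebraMap k _ q) * a v +
      toRat k d (x (hi r) - q • x (lo r)) * D a v, D b, ?_, ?_, ?_, ?_, ?_, ?_, ?_⟩
    · intro f
      have h1 : toRat k d _ = _ := ha f
      have h2 : toRat k d _ = _ := ha' f
      simp only
      rw [(braidRel_lusztig q).wordProd_simpleRefl_mul hr, Module.End.mul_apply, lusztig_apply,
        map_add, Algebra.smul_def, map_mul, map_mul, h2, h1, Finset.mul_sum, Finset.mul_sum,
        ← Finset.sum_add_distrib]
      exact Finset.sum_congr rfl fun v _ => by ring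
    · rw [braidRel_demazureL.wordProd_simpleRefl_mul hr]
      exact hb'
    · intro v hv h
      by_cases h1 : D a v = 0
      · simp only [h1, mul_zero, add_zero] at h
        have h2 := right_ne_zero_of_mul h
        by_cases hvw : v = w
        · rw [hvw]; omega
        · have := la v hvw h2; omega
      · exact hDsupp a la v hv h1
    · exact hDsupp b lb
    · simp only
      rw [hzero a la, mul_zero, zero_add, hDlead a la, hDlead b lb, hab, pInv_simpleRefl_mul q hr,
        map_mul, map_mul, ratPermute_toRat]
      ring
    · rw [hDlead b lb]
      refine div_ne_zero (neg_ne_zero.2 ?_) (ratRoot_ne_zero r)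
      exact (map_ne_zero _).2 hb0
    · intro κ hκ v hv
      have h1 := index_eq_of_not_isAscent hκ (isAscent_simpleRefl_mul.not.2 (not_not.2 hr))
      have h2 := simpleRefl_mem_young h1
      have h3 : w ∈ young κ := (Subgroup.mul_mem_cancel_left _ h2).1 hκ
      have h4 : s * v ∉ young κ := fun h => hv ((Subgroup.mul_mem_cancel_left _ h2).1 h)
      obtain ⟨e1, e2⟩ := hy κ h3 v hv
      obtain ⟨e3, e4⟩ := hy κ h3 _ h4
      simp only [hD, e1, e2, e3, e4, map_zero, sub_zero, zero_div, mul_zero, add_zero, and_self]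

/-- If the values of the operator are fixed by `u`, then the coefficient of `u w` is the translate
of the coefficient of `w`. -/
theorem IsExpansion.eq_ratPermute {O : Laurent k d → Rat k d} {a : Equiv.Perm (Fin d) → Rat k d}
    (h : IsExpansion O a) {u : Equiv.Perm (Fin d)} (hu : ∀ f, ratPermute u (O f) = O f)
    (w : Equiv.Perm (Fin d)) : a (u * w) = ratPermute u (a w) := by
  have h1 : IsExpansion O fun w => ratPermute u (a (u⁻¹ * w)) := by
    intro f
    rw [← hu f, h f, map_sum, ← Equiv.sum_comp (Equiv.mulLeft u⁻¹)]
    refine Finset.sum_congr rfl fun w _ => ?_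
    rw [map_mul, ratPermute_toRat, Equiv.coe_mulLeft, ← permute_mul, mul_inv_cancel_left]
  have h2 := congrFun (h.unique h1) (u * w)
  rwa [inv_mul_cancel_left] at h2

/-- Two combinations of the elements of a Young subgroup with invariant values are equal if their
coefficients at the longest element are. -/
theorem IsExpansion.eq_of_longest {κ : Composition d} {O O' : Laurent k d → Rat k d}
    {a a' : Equiv.Perm (Fin d) → Rat k d} (h : IsExpansion O a) (h' : IsExpansion O' a')
    (hy : ∀ v, v ∉ young κ → a v = 0) (hy' : ∀ v, v ∉ young κ → a' v = 0)
    (hu : ∀ u ∈ young κ, ∀ f, ratPermute u (O f) = O f)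
    (hu' : ∀ u ∈ young κ, ∀ f, ratPermute u (O' f) = O' f)
    (e : a (longest κ) = a' (longest κ)) : O = O' := by
  have haa : a = a' := by
    funext w
    by_cases hw : w ∈ young κ
    · have hm := mul_mem hw (inv_mem (longest_mem κ))
      have h1 := h.eq_ratPermute (hu _ hm) (longest κ)
      have h2 := h'.eq_ratPermute (hu' _ hm) (longest κ)
      rw [inv_mul_cancel_right] at h1 h2
      rw [h1, h2, e]
    · rw [hy w hw, hy' w hw]
  funext f
  rw [h f, h' f, haa]

end Expansions

/-! ### Symmetrizers and antisymmetrizers of Young subgroups -/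

section Symmetrizers

variable {k : Type*} [Field k] {d : ℕ} {κ : Composition d}

theorem permute_eq_of_forall_simpleRefl {f : Laurent k d}
    (h : ∀ r, κ.index (lo r) = κ.index (hi r) → permute (simpleRefl r) f = f)
    {w : Equiv.Perm (Fin d)} (hw : w ∈ young κ) : permute w f = f := by
  refine young_induction (p := fun w => permute w f = f) (permute_one f) ?_ hw
  intro r w hr _ _ ih
  rw [permute_mul, ih, h r hr]

theorem ratPermute_eq_of_forall_simpleRefl {f : Rat k d}
    (h : ∀ r, κ.index (lo r) = κ.index (hi r) → ratPermute (simpleRefl r) f = f)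
    {w : Equiv.Perm (Fin d)} (hw : w ∈ young κ) : ratPermute w f = f := by
  refine young_induction (p := fun w => ratPermute w f = f) (ratPermute_one f) ?_ hw
  intro r w hr _ _ ih
  rw [ratPermute_mul, ih, h r hr]

/-- The longest element of a Young subgroup is `s_r` times a shorter element, for every `s_r` in the
subgroup. -/
theorem not_isAscent_longest {r : Fin (d - 1)} (hr : κ.index (lo r) = κ.index (hi r)) :
    IsAscent (simpleRefl r * longest κ) r := by
  rw [isAscent_simpleRefl_mul]
  exact fun h => absurd h (longest_reverses κ _ _ (lo_lt_hi r) hr).not_gt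

/-- The Demazure operator of the longest element of a Young subgroup. -/
def youngDemazure (κ : Composition d) : Module.End k (Laurent k d) := wordProd demazureL (longest κ)

theorem exists_youngDemazure_eq {r : Fin (d - 1)} (hr : κ.index (lo r) = κ.index (hi r))
    (f : Laurent k d) : ∃ g, youngDemazure κ f = demazure r g := by
  have h := braidRel_demazureL (k := k) (d := d).wordProd_simpleRefl_mul (not_isAscent_longest hr)
  rw [← mul_assoc, simpleRefl_mul_self, one_mul] at h
  exact ⟨wordProd demazureL (simpleRefl r * longest κ) f, by rw [youngDemazure, h]; rfl⟩

theorem permute_youngDemazure (κ : Composition d) {w : Equiv.Perm (Fin d)} (hw : w ∈ young κ)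
    (f : Laurent k d) : permute w (youngDemazure κ f) = youngDemazure κ f := by
  refine permute_eq_of_forall_simpleRefl (fun r hr => ?_) hw
  obtain ⟨g, hg⟩ := exists_youngDemazure_eq hr f
  rw [hg, permute_demazure]

/-- The pairs `i < j` in the same block. -/
def blockPairs (κ : Composition d) : Finset (Fin d × Fin d) :=
  Finset.univ.filter (fun p : Fin d × Fin d => p.1 < p.2 ∧ κ.index p.1 = κ.index p.2)

theorem mem_blockPairs {i j : Fin d} : (i, j) ∈ blockPairs κ ↔ i < j ∧ κ.index i = κ.index j := by
  simp [blockPairs]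

/-- The product of `x_j - q x_i` over `i < j` in the same block of `κ`. -/
def pLeft (q : k) (κ : Composition d) : Laurent k d := ∏ p ∈ blockPairs κ, (x p.2 - q • x p.1)

theorem pLeft_eq_pInv (q : k) (κ : Composition d) : pLeft q κ = pInv q (longest κ) := by
  rw [pLeft, pInv, inversions_longest, blockPairs]

theorem pLeft_ne_zero (q : k) (κ : Composition d) : pLeft q κ ≠ 0 := by
  rw [pLeft_eq_pInv]; exact pInv_ne_zero q _

/-- The longest element reverses every block, and so it exchanges `∏ (x_i - q x_j)` with
`∏ (x_j - q x_i)`, both over the pairs `i < j` in a block. -/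
theorem permute_longest_pRight (q : k) (κ : Composition d) :
    permute (longest κ) (pRight q κ) = pLeft q κ := by
  have hy : ∀ i, κ.index (longest κ i) = κ.index i := longest_mem κ
  have hinv : ∀ i, (longest κ)⁻¹ (longest κ i) = i := (longest κ).symm_apply_apply
  have hrev : ∀ {i j : Fin d}, κ.index i = κ.index j → (longest κ i < longest κ j ↔ j < i) := by
    intro i j h
    have := (longest_reverses κ).lt_iff (i := longest κ i) (j := longest κ j) (by rw [hy, hy, h])
    simp only [hinv] at this
    rcases lt_trichotomy i j with h1 | h1 | h1
    · exact iff_of_false (this.1 h1).not_gt h1.not_gt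
    · simp [h1]
    · refine iff_of_true ?_ h1
      have := (longest_reverses κ).lt_iff (i := longest κ j) (j := longest κ i)
        (by rw [hy, hy, h])
      simp only [hinv] at this
      exact this.1 h1
  rw [pRight, map_prod, pLeft]
  refine Finset.prod_nbij' (fun p => (longest κ p.2, longest κ p.1))
    (fun p => ((longest κ)⁻¹ p.2, (longest κ)⁻¹ p.1)) ?_ ?_ ?_ ?_ ?_
  · rintro ⟨i, j⟩ h
    simp only [Finset.mem_filter, Finset.mem_univ, true_and] at h
    rw [mem_blockPairs, hrev h.2.symm, hy, hy]
    exact ⟨h.1, h.2.symm⟩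
  · rintro ⟨i, j⟩ h
    rw [mem_blockPairs] at h
    have hy' : ∀ i, κ.index ((longest κ)⁻¹ i) = κ.index i := inv_mem (longest_mem κ)
    simp only [Finset.mem_filter, Finset.mem_univ, true_and, hy']
    exact ⟨longest_reverses κ i j h.1 h.2, h.2.symm⟩
  · rintro ⟨i, j⟩ _; simp
  · rintro ⟨i, j⟩ _; simp
  · rintro ⟨i, j⟩ _
    rw [map_sub, map_smul, permute_x, permute_x]

/-- Up to the factor of the pair `(r, r + 1)`, the product `∏ (x_j - q x_i)` is fixed by `s_r`. -/
theorem exists_pLeft_eq (q : k) {r : Fin (d - 1)} (hr : κ.index (lo r) = κ.index (hi r)) :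
    ∃ p, pLeft q κ = (x (hi r) - q • x (lo r)) * p ∧ permute (simpleRefl r) p = p := by
  have hmem : (lo r, hi r) ∈ blockPairs κ := mem_blockPairs.2 ⟨lo_lt_hi r, hr⟩
  refine ⟨∏ p ∈ (blockPairs κ).erase (lo r, hi r), (x p.2 - q • x p.1), ?_, ?_⟩
  · rw [pLeft, ← Finset.mul_prod_erase _ _ hmem]
  · rw [map_prod]
    have hy := simpleRefl_mem_young hr
    have hm : ∀ p ∈ (blockPairs κ).erase (lo r, hi r),
        (simpleRefl r p.1, simpleRefl r p.2) ∈ (blockPairs κ).erase (lo r, hi r) := by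
      rintro ⟨i, j⟩ h
      rw [Finset.mem_erase, mem_blockPairs, Ne, Prod.mk.injEq] at h
      rw [Finset.mem_erase, mem_blockPairs, Ne, Prod.mk.injEq, hy, hy]
      refine ⟨?_, simpleRefl_lt h.2.1 h.1, h.2.2⟩
      rintro ⟨e1, e2⟩
      have h1 := congrArg (simpleRefl r) e1
      have h2 := congrArg (simpleRefl r) e2
      simp only [simpleRefl_simpleRefl, simpleRefl_lo, simpleRefl_hi] at h1 h2
      rw [h1, h2] at h
      exact absurd h.2.1 (lo_lt_hi r).not_gt
    refine Finset.prod_nbij' (fun p => (simpleRefl r p.1, simpleRefl r p.2))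
      (fun p => (simpleRefl r p.1, simpleRefl r p.2)) hm hm ?_ ?_ ?_
    · rintro ⟨i, j⟩ _; simp
    · rintro ⟨i, j⟩ _; simp
    · rintro ⟨i, j⟩ _
      rw [map_sub, map_smul, permute_x, permute_x]

open Classical in
/-- A sum over a Young subgroup containing `s_r`, as a sum over the pairs `{w, s_r w}`. -/
theorem sum_young_pairs {M : Type*} [AddCommMonoid M] {r : Fin (d - 1)}
    (hr : κ.index (lo r) = κ.index (hi r)) (F : Equiv.Perm (Fin d) → M) :
    ∑ w ∈ Finset.univ.filter (· ∈ young κ), F w =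
      ∑ w ∈ Finset.univ.filter (fun w => w ∈ young κ ∧ IsAscent w r),
        (F w + F (simpleRefl r * w)) := by
  rw [← Finset.sum_filter_add_sum_filter_not _ (fun w => IsAscent w r), Finset.sum_add_distrib,
    Finset.filter_filter, Finset.filter_filter]
  congr 1
  have hm := simpleRefl_mem_young hr
  refine Finset.sum_nbij' (fun w => simpleRefl r * w) (fun w => simpleRefl r * w) ?_ ?_ ?_ ?_ ?_
  · intro w h
    simp only [Finset.mem_filter, Finset.mem_univ, true_and] at h ⊢
    exact ⟨mul_mem hm h.1, isAscent_simpleRefl_mul.2 h.2⟩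
  · intro w h
    simp only [Finset.mem_filter, Finset.mem_univ, true_and] at h ⊢
    exact ⟨mul_mem hm h.1, isAscent_simpleRefl_mul.not.2 (not_not.2 h.2)⟩
  · intro w _
    rw [← mul_assoc, simpleRefl_mul_self, one_mul]
  · intro w _
    rw [← mul_assoc, simpleRefl_mul_self, one_mul]
  · intro w _
    rw [← mul_assoc, simpleRefl_mul_self, one_mul]

/-- The operator `∑ (-q)^{l(w_κ) - l(w)} T_w`, the sum over the Young subgroup. -/
def antisym (q : k) (κ : Composition d) : Module.End k (Laurent k d) :=
  ∑ w ∈ Finset.univ.filter (· ∈ young κ), (-q) ^ (youngMaxLen κ - len w) • wordProd (lusztig q) w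

/-- The operator `∑ T_w`, the sum over the Young subgroup. -/
def sym (q : k) (κ : Composition d) : Module.End k (Laurent k d) :=
  ∑ w ∈ Finset.univ.filter (· ∈ young κ), wordProd (lusztig q) w

/-- The terms of `w` and `s_r w` in the antisymmetrizer combine to a multiple of `T_r - q`, the
operator `(x_{r+1} - q x_r) ∂_r`. -/
theorem exists_antisym_eq (q : k) {r : Fin (d - 1)} (hr : κ.index (lo r) = κ.index (hi r))
    (f : Laurent k d) : ∃ g, antisym q κ f = (x (hi r) - q • x (lo r)) * demazure r g := by
  classical
  refine ⟨∑ w ∈ Finset.univ.filter (fun w => w ∈ young κ ∧ IsAscent w r),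
    (-q) ^ (youngMaxLen κ - len w - 1) • wordProd (lusztig q) w f, ?_⟩
  rw [antisym, sum_young_pairs hr, ← demazureL_apply, map_sum, Finset.mul_sum,
    LinearMap.sum_apply]
  refine Finset.sum_congr rfl fun w hw => ?_
  simp only [Finset.mem_filter, Finset.mem_univ, true_and] at hw
  have h1 := len_lt_youngMaxLen hw.1 hr hw.2
  obtain ⟨n, hn⟩ := Nat.exists_eq_add_of_le h1
  rw [len_of_isAscent hw.2, hn, (braidRel_lusztig q).wordProd_simpleRefl_mul hw.2,
    show len w + 1 + n - len w = n + 1 by omega, show len w + 1 + n - (len w + 1) = n by omega,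
    Nat.add_sub_cancel, LinearMap.add_apply, LinearMap.smul_apply, LinearMap.smul_apply,
    Module.End.mul_apply, lusztig_apply, map_smul, demazureL_apply, smul_add, pow_succ,
    mul_smul_comm, mul_smul, neg_smul, smul_neg]
  abel

/-- The terms of `w` and `s_r w` in the symmetrizer combine to `(1 + T_r) T_w`, and `1 + T_r` takes
its values in the image of `∂_r`. -/
theorem exists_sym_eq (q : k) {r : Fin (d - 1)} (hr : κ.index (lo r) = κ.index (hi r))
    (f : Laurent k d) : ∃ g, sym q κ f = demazure r g := by
  classical
  refine ⟨(x (lo r) - q • x (hi r)) *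
    ∑ w ∈ Finset.univ.filter (fun w => w ∈ young κ ∧ IsAscent w r), wordProd (lusztig q) w f, ?_⟩
  rw [← lusztig_add, map_sum, ← Finset.sum_add_distrib, sym, sum_young_pairs hr,
    LinearMap.sum_apply]
  refine Finset.sum_congr rfl fun w hw => ?_
  simp only [Finset.mem_filter, Finset.mem_univ, true_and] at hw
  rw [(braidRel_lusztig q).wordProd_simpleRefl_mul hw.2, LinearMap.add_apply, add_comm]
  rfl

theorem permute_sym (q : k) {w : Equiv.Perm (Fin d)} (hw : w ∈ young κ)
    (f : Laurent k d) : permute w (sym q κ f) = sym q κ f := by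
  refine permute_eq_of_forall_simpleRefl (fun r hr => ?_) hw
  obtain ⟨g, hg⟩ := exists_sym_eq q hr f
  rw [hg, permute_demazure]

/-- The antisymmetrizer is the Demazure operator of the longest element followed by the
multiplication by `∏ (x_j - q x_i)`: after division by this product, both operators are combinations
of elements of the Young subgroup, have invariant values, and have the same coefficient at the
longest element. -/
theorem antisym_apply (q : k) (κ : Composition d) (f : Laurent k d) :
    antisym q κ f = pLeft q κ * youngDemazure κ f := by
  choose a b ha hb la lb hab hb0 hy using exists_expansions (k := k) (d := d) q
  have hp : toRat k d (pLeft q κ) ≠ 0 := fun h =>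
    pLeft_ne_zero q κ (toRat_injective (h.trans (map_zero _).symm))
  have h1 : IsExpansion (fun f => toRat k d (antisym q κ f) / toRat k d (pLeft q κ)) fun v =>
      (∑ w ∈ Finset.univ.filter (· ∈ young κ),
        toRat k d (algebraMap k _ ((-q) ^ (youngMaxLen κ - len w))) * a w v) /
          toRat k d (pLeft q κ) := by
    intro f
    simp only [antisym, LinearMap.sum_apply, LinearMap.smul_apply, map_sum]
    simp only [Algebra.smul_def, map_mul, Finset.sum_div, Finset.sum_mul]
    rw [Finset.sum_comm]
    refine Finset.sum_congr rfl fun w _ => ?_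
    have h2 : toRat k d _ = _ := ha w f
    rw [h2, Finset.mul_sum, Finset.sum_div]
    exact Finset.sum_congr rfl fun v _ => by ring
  have h2 := hb (longest κ)
  have key := h1.eq_of_longest (κ := κ) h2 ?_ ?_ ?_ ?_ ?_
  · have := congrFun key f
    rw [div_eq_iff hp, ← map_mul] at this
    rw [toRat_injective this, mul_comm]; rfl
  -- only elements of the Young subgroup occur
  · intro v hv
    rw [Finset.sum_eq_zero, zero_div]
    intro w hw
    simp only [Finset.mem_filter, Finset.mem_univ, true_and] at hw
    rw [(hy w κ hw v hv).1, mul_zero]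
  · exact fun v hv => (hy _ κ (longest_mem κ) v hv).2
  -- the quotient by `∏ (x_j - q x_i)` has invariant values
  · intro u hu f
    refine ratPermute_eq_of_forall_simpleRefl (fun r hr => ?_) hu
    obtain ⟨g, hg⟩ := exists_antisym_eq q hr f
    obtain ⟨p, hp1, hp2⟩ := exists_pLeft_eq q hr
    have h0 : toRat k d (x (hi r) - q • x (lo r)) ≠ 0 := fun h =>
      x_sub_smul_x_ne_zero (lo_lt_hi r).ne' q (toRat_injective (h.trans (map_zero _).symm))
    simp only [hg, hp1]
    rw [map_mul, map_mul, mul_div_mul_left _ _ h0, map_div₀, ratPermute_toRat, ratPermute_toRat,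
      permute_demazure, hp2]
  · intro u hu f
    rw [ratPermute_toRat]
    exact congrArg _ (permute_youngDemazure κ hu f)
  -- only the longest element itself contributes to the coefficient at the longest element
  · rw [Finset.sum_eq_single (longest κ), len_longest, Nat.sub_self, pow_zero, map_one, map_one,
      one_mul, hab, ← pLeft_eq_pInv, mul_div_cancel_left₀ _ hp]
    · intro w hw hne
      simp only [Finset.mem_filter, Finset.mem_univ, true_and] at hw
      have : a w (longest κ) = 0 := by
        by_contra h
        have h3 := la w _ hne.symm h
        have h4 := len_le_youngMaxLen hw
        rw [len_longest] at h3
        omega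
      rw [this, mul_zero]
    · intro h
      exact absurd (by simp [longest_mem]) h

/-- The symmetrizer is the multiplication by `∏ (x_i - q x_j)` followed by the Demazure operator of
the longest element; the proof compares coefficients at the longest element. -/
theorem sym_apply (q : k) (κ : Composition d) (f : Laurent k d) :
    sym q κ f = youngDemazure κ (pRight q κ * f) := by
  choose a b ha hb la lb hab hb0 hy using exists_expansions (k := k) (d := d) q
  have h1 : IsExpansion (fun f => toRat k d (sym q κ f)) fun v =>
      ∑ w ∈ Finset.univ.filter (· ∈ young κ), a w v := by
    intro f
    simp only [sym, LinearMap.sum_apply, map_sum, Finset.sum_mul]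
    rw [Finset.sum_comm]
    exact Finset.sum_congr rfl fun w _ => ha w f
  have h2 : IsExpansion (fun f => toRat k d (youngDemazure κ (pRight q κ * f))) fun v =>
      b (longest κ) v * toRat k d (permute v (pRight q κ)) := by
    intro f
    have h2 : toRat k d (youngDemazure κ (pRight q κ * f)) = _ := hb (longest κ) (pRight q κ * f)
    simp only
    rw [h2]
    refine Finset.sum_congr rfl fun v _ => ?_
    rw [map_mul, map_mul, mul_assoc]
  have key := h1.eq_of_longest (κ := κ) h2 ?_ ?_ ?_ ?_ ?_
  · exact toRat_injective (congrFun key f)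
  · intro v hv
    refine Finset.sum_eq_zero fun w hw => ?_
    simp only [Finset.mem_filter, Finset.mem_univ, true_and] at hw
    exact (hy w κ hw v hv).1
  · intro v hv
    rw [(hy _ κ (longest_mem κ) v hv).2, zero_mul]
  · intro u hu f
    rw [ratPermute_toRat, permute_sym q hu]
  · intro u hu f
    rw [ratPermute_toRat]
    exact congrArg _ (permute_youngDemazure κ hu _)
  -- only the longest element itself contributes to the coefficient at the longest element
  · rw [Finset.sum_eq_single (longest κ), hab, ← pLeft_eq_pInv, permute_longest_pRight, mul_comm]
    · intro w hw hne
      simp only [Finset.mem_filter, Finset.mem_univ, true_and] at hw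
      by_contra h
      have h3 := la w _ hne.symm h
      have h4 := len_le_youngMaxLen hw
      rw [len_longest] at h3
      omega
    · intro h
      exact absurd (by simp [longest_mem]) h

end Symmetrizers

/-! ### Factorizations along cosets of Young subgroups -/

section Cosets

variable {k : Type*} [Field k] {d : ℕ} {κ κ' : Composition d}

/-- The operator `∑ T_w` over the whole symmetric group. -/
def symAll (k : Type*) [Field k] (d : ℕ) (q : k) : Module.End k (Laurent k d) :=
  ∑ w, wordProd (lusztig q) w

open Classical in
/-- The operator `∑ T_w` over the shortest coset representatives. -/
def symCoset (q : k) (κ : Composition d) : Module.End k (Laurent k d) :=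
  ∑ w ∈ Finset.univ.filter (IsShortest κ), wordProd (lusztig q) w

theorem symAll_eq (q : k) (κ : Composition d) : symAll k d q = sym q κ * symCoset q κ := by
  classical
  rw [symAll, sum_coset (κ := κ) Finset.univ (fun _ _ _ _ => Finset.mem_univ _), sym, symCoset,
    Finset.sum_mul]
  refine Finset.sum_congr rfl fun u hu => ?_
  simp only [Finset.mem_filter, Finset.mem_univ, true_and] at hu
  rw [Finset.mul_sum]
  refine Finset.sum_congr rfl fun v hv => ?_
  simp only [Finset.mem_filter, Finset.mem_univ, true_and] at hv
  rw [(braidRel_lusztig q).wordProd_mul (hv.len_mul hu)]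

theorem index_single (hd : 0 < d) (i j : Fin d) :
    (Composition.single d hd).index i = (Composition.single d hd).index j := by
  apply Fin.ext
  have h1 := ((Composition.single d hd).index i).2
  have h2 := ((Composition.single d hd).index j).2
  simp only [Composition.single_length] at h1 h2
  omega

theorem permute_symAll (q : k) (w : Equiv.Perm (Fin d)) (f : Laurent k d) :
    permute w (symAll k d q f) = symAll k d q f := by
  induction w using perm_induction with
  | one => exact permute_one _
  | mul r w _ ih =>
    rw [permute_mul, ih]
    -- any composition with `r` and `r + 1` in the same block will do
    rw [symAll_eq q (Composition.single d (lo r).pos)]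
    exact permute_sym q (simpleRefl_mem_young (index_single _ _ _)) _

/-- The coefficient of `∑ T_w` at a permutation of maximal length is that of a single `T_w`, which
is not zero. -/
theorem exists_symAll_ne_zero (q : k) : ∃ f, symAll k d q f ≠ 0 := by
  by_contra hn
  have hn' : ∀ f, symAll k d q f = 0 := by simpa using hn
  choose a b ha hb la lb hab hb0 hy using exists_expansions (k := k) (d := d) q
  have h1 : IsExpansion (fun f => toRat k d (symAll k d q f)) fun v => ∑ w, a w v := by
    intro f
    simp only [symAll, LinearMap.sum_apply, map_sum, Finset.sum_mul]
    rw [Finset.sum_comm]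
    exact Finset.sum_congr rfl fun w _ => ha w f
  have h2 : IsExpansion (fun f => toRat k d (symAll k d q f)) fun _ => 0 := by
    intro f
    simp [hn' f]
  obtain ⟨w, -, hw⟩ := Finset.exists_max_image Finset.univ (len (d := d)) ⟨1, Finset.mem_univ _⟩
  have h3 := congrFun (h1.unique h2) w
  rw [Finset.sum_eq_single w, hab] at h3
  · rcases mul_eq_zero.1 h3 with h | h
    · exact pInv_ne_zero q w (toRat_injective (h.trans (map_zero _).symm))
    · exact hb0 w h
  · intro v _ hv
    by_contra h
    have h4 := la v w hv.symm h
    have h5 := hw v (Finset.mem_univ _)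
    omega
  · exact fun h => absurd (Finset.mem_univ _) h

open Classical in
/-- The elements of the Young subgroup of `κ` which are shortest in their cosets of the Young
subgroup of `κ'`. -/
def cosetTerms (κ' κ : Composition d) : Finset (Equiv.Perm (Fin d)) :=
  (Finset.univ.filter (· ∈ young κ)).filter (IsShortest κ')

theorem mem_cosetTerms {w : Equiv.Perm (Fin d)} :
    w ∈ cosetTerms κ' κ ↔ w ∈ young κ ∧ IsShortest κ' w := by simp [cosetTerms]

theorem sum_young_coset (h : young κ' ≤ young κ) {M : Type*} [AddCommMonoid M]
    (F : Equiv.Perm (Fin d) → M) :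
    ∑ w ∈ Finset.univ.filter (· ∈ young κ), F w = ∑ u ∈ Finset.univ.filter (· ∈ young κ'),
      ∑ v ∈ cosetTerms κ' κ, F (u * v) := by
  refine sum_coset _ (fun u hu w hw => ?_) F
  simp only [Finset.mem_filter, Finset.mem_univ, true_and] at hw ⊢
  exact mul_mem (h hu) hw

theorem pow_len_mul (h : young κ' ≤ young κ) (q : k) {u v : Equiv.Perm (Fin d)}
    (hu : u ∈ young κ') (hv : v ∈ cosetTerms κ' κ) :
    (-q) ^ (youngMaxLen κ - len (u * v)) = (-q) ^ (youngMaxLen κ' - len u) *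
      (-q) ^ (youngMaxLen κ - youngMaxLen κ' - len v) := by
  rw [mem_cosetTerms] at hv
  have h1 := hv.2.len_mul hu
  have h2 := hv.2.len_mul (longest_mem κ')
  have h3 := len_le_youngMaxLen (mul_mem (h (longest_mem κ')) hv.1)
  have h4 := len_le_youngMaxLen hu
  rw [len_longest] at h2
  rw [← pow_add]
  congr 1
  omega

/-- The antisymmetrizer of a larger Young subgroup is a multiple of that of a smaller one from the
right-hand side. -/
theorem antisym_eq_mul (h : young κ' ≤ young κ) (q : k) : antisym q κ = antisym q κ' *
    ∑ v ∈ cosetTerms κ' κ,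
      (-q) ^ (youngMaxLen κ - youngMaxLen κ' - len v) • wordProd (lusztig q) v := by
  rw [antisym, sum_young_coset h, antisym, Finset.sum_mul]
  refine Finset.sum_congr rfl fun u hu => ?_
  simp only [Finset.mem_filter, Finset.mem_univ, true_and] at hu
  rw [Finset.mul_sum]
  refine Finset.sum_congr rfl fun v hv => ?_
  rw [pow_len_mul h q hu hv, smul_mul_smul_comm,
    (braidRel_lusztig q).wordProd_mul ((mem_cosetTerms.1 hv).2.len_mul hu)]

theorem len_inv_mul {u v : Equiv.Perm (Fin d)} (hv : IsShortest κ v) (hu : u ∈ young κ) :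
    len (v⁻¹ * u⁻¹) = len v⁻¹ + len u⁻¹ := by
  rw [← mul_inv_rev, len_inv, len_inv, len_inv, hv.len_mul hu, add_comm]

/-- The factorization on the other side, from the representatives `v⁻¹` of the left cosets. -/
theorem antisym_eq_mul' (h : young κ' ≤ young κ) (q : k) : antisym q κ =
    (∑ v ∈ cosetTerms κ' κ, (-q) ^ (youngMaxLen κ - youngMaxLen κ' - len v) •
      wordProd (lusztig q) v⁻¹) * antisym q κ' := by
  have hinv : ∀ (κ : Composition d), antisym q κ = ∑ w ∈ Finset.univ.filter (· ∈ young κ),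
      (-q) ^ (youngMaxLen κ - len w) • wordProd (lusztig q) w⁻¹ := by
    intro κ
    rw [antisym]
    refine Finset.sum_nbij' (fun w => w⁻¹) (fun w => w⁻¹) ?_ ?_ ?_ ?_ ?_ <;> simp
  rw [hinv, sum_young_coset h, hinv κ', Finset.mul_sum]
  refine Finset.sum_congr rfl fun u hu => ?_
  simp only [Finset.mem_filter, Finset.mem_univ, true_and] at hu
  rw [Finset.sum_mul]
  refine Finset.sum_congr rfl fun v hv => ?_
  rw [pow_len_mul h q hu hv, smul_mul_smul_comm, mul_inv_rev,
    (braidRel_lusztig q).wordProd_mul (len_inv_mul (mem_cosetTerms.1 hv).2 hu), mul_comm]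

/-- A product over a Young subgroup commutes with a polynomial with which its factors commute. -/
theorem wordProd_mul_of_forall (F : Fin (d - 1) → Module.End k (Laurent k d))
    {f : Laurent k d} {w : Equiv.Perm (Fin d)} (hw : w ∈ young κ)
    (h : ∀ r, κ.index (lo r) = κ.index (hi r) → ∀ g, F r (f * g) = f * F r g) (g : Laurent k d) :
    wordProd F w (f * g) = f * wordProd F w g := by
  have h1 : ∀ r ∈ reducedWord w, κ.index (lo r) = κ.index (hi r) :=
    fun r hr => index_eq_of_mem_reducedWord hw hr
  unfold wordProd
  generalize reducedWord w = L at h1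
  induction L with
  | nil => rfl
  | cons a L ih =>
    rw [List.map_cons, List.prod_cons, Module.End.mul_apply,
      ih fun r hr => h1 r (List.mem_cons_of_mem _ hr), h a (h1 a List.mem_cons_self)]
    rfl

theorem youngDemazure_mul {f : Laurent k d}
    (hf : ∀ w ∈ young κ, permute w f = f) (g : Laurent k d) :
    youngDemazure κ (f * g) = f * youngDemazure κ g :=
  wordProd_mul_of_forall demazureL (longest_mem κ)
    (fun _ hr => demazure_mul_of_permute_eq (hf _ (simpleRefl_mem_young hr))) g

theorem antisym_mul (q : k) {f : Laurent k d} (hf : ∀ w ∈ young κ, permute w f = f)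
    (g : Laurent k d) : antisym q κ (f * g) = f * antisym q κ g := by
  rw [antisym_apply, antisym_apply, youngDemazure_mul hf, mul_left_comm]

/-- The Demazure operator of a permutation which takes the longest element of a Young subgroup to
that of a larger one. -/
theorem demazurePerm_youngDemazure {v : Equiv.Perm (Fin d)} (hv : IsShortest κ' v⁻¹)
    (h : v * longest κ' = longest κ) (f : Laurent k d) :
    demazurePerm v (youngDemazure κ' f) = youngDemazure κ f := by
  have h1 := len_inv_mul hv (inv_mem (longest_mem κ'))
  rw [inv_inv, inv_inv] at h1
  rw [demazurePerm_eq, youngDemazure, youngDemazure, ← h, braidRel_demazureL.wordProd_mul h1]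
  rfl

end Cosets

/-! ### The polynomial representation of the Hecke algebra -/

section ColourCounts

variable {ℓ d : ℕ}

theorem fin_two_cases (z : Fin 2) : z = 0 ∨ z = 1 := by fin_cases z <;> simp

theorem fin_two_ne_zero {z : Fin 2} (h : z ≠ 0) : z = 1 := (fin_two_cases z).resolve_left h

@[simp] theorem Col.swap_apply (r : Fin (ℓ + d - 1)) (c : Col ℓ d) (i : Fin (ℓ + d)) :
    (Col.swap r c).1 i = c.1 (simpleRefl r i) := rfl

@[simp] theorem Col.swap_swap (r : Fin (ℓ + d - 1)) (c : Col ℓ d) :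
    Col.swap r (Col.swap r c) = c := by
  apply Subtype.ext
  funext i
  rw [Col.swap_apply, Col.swap_apply, simpleRefl_simpleRefl]

theorem Col.swap_lo (r : Fin (ℓ + d - 1)) (c : Col ℓ d) : (Col.swap r c).1 (lo r) = c.1 (hi r) := by
  rw [Col.swap_apply, simpleRefl_lo]

theorem Col.swap_hi (r : Fin (ℓ + d - 1)) (c : Col ℓ d) : (Col.swap r c).1 (hi r) = c.1 (lo r) := by
  rw [Col.swap_apply, simpleRefl_hi]

theorem Col.swap_of_eq {r : Fin (ℓ + d - 1)} {c : Col ℓ d} (h : c.1 (lo r) = c.1 (hi r)) :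
    Col.swap r c = c := by
  apply Subtype.ext
  funext i
  rw [Col.swap_apply]
  by_cases h1 : i = lo r
  · rw [h1, simpleRefl_lo, h]
  · by_cases h2 : i = hi r
    · rw [h2, simpleRefl_hi, h]
    · rw [simpleRefl_of_ne h1 h2]

/-- The number of black entries of `c` among the first `i` entries. -/
def Col.nb (c : Col ℓ d) (i : ℕ) : ℕ :=
  (Finset.univ.filter fun j : Fin (ℓ + d) => (j : ℕ) < i ∧ c.1 j = 0).card

/-- The number of red entries of `c` among the first `i` entries. -/
def Col.nr (c : Col ℓ d) (i : ℕ) : ℕ :=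
  ∑ j ∈ Finset.univ.filter (fun j : Fin (ℓ + d) => (j : ℕ) < i), (c.1 j : ℕ)

theorem Col.filter_lt_succ (i : Fin (ℓ + d)) :
    Finset.univ.filter (fun j : Fin (ℓ + d) => (j : ℕ) < i + 1) =
      insert i (Finset.univ.filter fun j : Fin (ℓ + d) => (j : ℕ) < i) := by
  ext j
  simp only [Finset.mem_filter, Finset.mem_univ, true_and, Finset.mem_insert, Fin.ext_iff]
  omega

theorem Col.nb_succ (c : Col ℓ d) (i : Fin (ℓ + d)) :
    c.nb (i + 1) = c.nb i + if c.1 i = 0 then 1 else 0 := by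
  simp only [Col.nb, ← Finset.filter_filter]
  rw [Col.filter_lt_succ, Finset.filter_insert]
  split_ifs with h
  · rw [Finset.card_insert_of_notMem (by simp)]
  · rfl

theorem Col.nr_succ (c : Col ℓ d) (i : Fin (ℓ + d)) : c.nr (i + 1) = c.nr i + c.1 i := by
  rw [Col.nr, Col.filter_lt_succ, Finset.sum_insert (by simp), Col.nr, add_comm]

theorem Col.nb_succ_of_black {c : Col ℓ d} {i : Fin (ℓ + d)} (h : c.1 i = 0) :
    c.nb (i + 1) = c.nb i + 1 := by rw [Col.nb_succ, if_pos h]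

theorem Col.nb_succ_of_red {c : Col ℓ d} {i : Fin (ℓ + d)} (h : c.1 i = 1) :
    c.nb (i + 1) = c.nb i := by rw [Col.nb_succ, if_neg (by rw [h]; decide), add_zero]

theorem Col.nb_mono (c : Col ℓ d) : Monotone c.nb := fun _ _ h =>
  Finset.card_le_card fun _ hj => by
    simp only [Finset.mem_filter, Finset.mem_univ, true_and] at hj ⊢
    exact ⟨hj.1.trans_le h, hj.2⟩

theorem Col.nb_le (c : Col ℓ d) (i : ℕ) : c.nb i ≤ d := by
  refine le_of_le_of_eq (Finset.card_le_card fun j hj => ?_) c.card_black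
  simp only [Finset.mem_filter, Finset.mem_univ, true_and] at hj ⊢
  exact hj.2

theorem Col.nb_lt {c : Col ℓ d} {i : Fin (ℓ + d)} (h : c.1 i = 0) : c.nb i < d := by
  have h1 := Col.nb_succ_of_black h
  have h2 := c.nb_le (i + 1)
  omega

theorem Col.nb_add_nr (c : Col ℓ d) {i : ℕ} (h : i ≤ ℓ + d) : c.nb i + c.nr i = i := by
  induction i with
  | zero => simp [Col.nb, Col.nr]
  | succ i ih =>
    have h1 := c.nb_succ ⟨i, h⟩
    have h2 := c.nr_succ ⟨i, h⟩
    have h3 := ih (by omega)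
    simp only at h1 h2
    rw [h1, h2]
    rcases fin_two_cases (c.1 ⟨i, h⟩) with e | e <;> rw [e] <;> simp <;> omega

theorem Col.nr_eq (c : Col ℓ d) {i : ℕ} (h : i ≤ ℓ + d) : c.nr i = i - c.nb i := by
  have := c.nb_add_nr h
  omega

theorem Col.sum_Iic (c : Col ℓ d) (i : Fin (ℓ + d)) :
    ∑ j ∈ Finset.Iic i, (c.1 j : ℕ) = c.nr (i + 1) := by
  rw [Col.nr]
  refine Finset.sum_congr ?_ fun _ _ => rfl
  ext j
  simp only [Finset.mem_Iic, Finset.mem_filter, Finset.mem_univ, true_and, Fin.le_def]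
  omega

theorem Col.nb_swap_of_le (c : Col ℓ d) {r : Fin (ℓ + d - 1)} {i : ℕ} (h : i ≤ r) :
    (Col.swap r c).nb i = c.nb i := by
  unfold Col.nb
  congr 1
  refine Finset.filter_congr fun j _ => and_congr_right fun hj => ?_
  rw [Col.swap_apply, simpleRefl_of_ne]
  · exact fun h' => by have := congrArg Fin.val h'; simp only [lo] at this; omega
  · exact fun h' => by have := congrArg Fin.val h'; simp only [hi] at this; omega

theorem Col.nb_swap_of_ge (c : Col ℓ d) {r : Fin (ℓ + d - 1)} {i : ℕ} (h : r + 2 ≤ i) :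
    (Col.swap r c).nb i = c.nb i := by
  unfold Col.nb
  refine Finset.card_nbij' (fun j => simpleRefl r j) (fun j => simpleRefl r j) ?_ ?_ ?_ ?_
  · intro j hj
    simp only [Finset.mem_coe, Finset.mem_filter, Finset.mem_univ, true_and] at hj ⊢
    refine ⟨?_, hj.2⟩
    have := hj.1
    rw [simpleRefl_val]
    split_ifs <;> omega
  · intro j hj
    simp only [Finset.mem_coe, Finset.mem_filter, Finset.mem_univ, true_and] at hj ⊢
    refine ⟨?_, ?_⟩
    · have := hj.1
      rw [simpleRefl_val]
      split_ifs <;> omega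
    · rw [Col.swap_apply, simpleRefl_simpleRefl]
      exact hj.2
  · intro j _; simp
  · intro j _; simp

theorem Col.nr_swap_of_le (c : Col ℓ d) {r : Fin (ℓ + d - 1)} {i : ℕ} (h : i ≤ r) :
    (Col.swap r c).nr i = c.nr i := by
  have := r.2
  rw [Col.nr_eq _ (by omega), Col.nr_eq _ (by omega), Col.nb_swap_of_le c h]

theorem Col.nr_swap_of_ge (c : Col ℓ d) {r : Fin (ℓ + d - 1)} {i : ℕ} (h : r + 2 ≤ i)
    (h' : i ≤ ℓ + d) : (Col.swap r c).nr i = c.nr i := by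
  rw [Col.nr_eq _ h', Col.nr_eq _ h', Col.nb_swap_of_ge c h]

end ColourCounts

section Rep

variable {k : Type*} [Field k] {ℓ d : ℕ}

/-- The variable `x_n`, or zero if there is no such variable. Indexing by natural numbers lets the
variable of a strand be given by the number of black strands to its left. -/
def xN (k : Type*) [Field k] (d n : ℕ) : Laurent k d := if h : n < d then x ⟨n, h⟩ else 0

/-- The inverse of the variable `x_n`, or zero if there is no such variable. -/
def xInvN (k : Type*) [Field k] (d n : ℕ) : Laurent k d :=
  if h : n < d then AddMonoidAlgebra.single (-Pi.single ⟨n, h⟩ 1) 1 else 0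

theorem xN_eq {n : ℕ} (h : n < d) : xN k d n = x ⟨n, h⟩ := dif_pos h

theorem xN_mul_xInvN {n : ℕ} (h : n < d) : xN k d n * xInvN k d n = 1 := by
  rw [xN, xInvN, dif_pos h, dif_pos h, x, AddMonoidAlgebra.single_mul_single, add_neg_cancel,
    mul_one]
  rfl

/-- The Demazure–Lusztig operator in the variables `x_n` and `x_{n+1}`, or zero. -/
def lusztigN (q : k) (d n : ℕ) : Module.End k (Laurent k d) :=
  if h : n < d - 1 then lusztig q ⟨n, h⟩ else 0

/-- The parameter `Q_n`, or zero. -/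
def paramN (Q : Fin ℓ → k) (n : ℕ) : k := if h : n < ℓ then Q ⟨n, h⟩ else 0

/-- The operator of a crossing of strands of the colours `a` and `b` with `n` black and `m` red
strands to their left: a Demazure–Lusztig operator for two black strands, the multiplication by
`x_n - Q_m` for a black strand which passes a red one from left to right, the identity in the other
direction, and zero for two red strands. -/
def crossOp (q : k) (Q : Fin ℓ → k) (d : ℕ) (a b : Fin 2) (n m : ℕ) : Module.End k (Laurent k d) :=
  if a = 0 then if b = 0 then lusztigN q d n
    else LinearMap.mulLeft k (xN k d n - algebraMap k _ (paramN Q m))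
  else if b = 0 then 1 else 0

variable (q : k) (Q : Fin ℓ → k)

@[simp] theorem crossOp_zero_zero (n m : ℕ) : crossOp q Q d 0 0 n m = lusztigN q d n := rfl

@[simp] theorem crossOp_zero_one (n m : ℕ) : crossOp q Q d 0 1 n m =
    LinearMap.mulLeft k (xN k d n - algebraMap k _ (paramN Q m)) := rfl

@[simp] theorem crossOp_one_zero (n m : ℕ) : crossOp q Q d 1 0 n m = 1 := rfl

@[simp] theorem crossOp_one_one (n m : ℕ) : crossOp q Q d 1 1 n m = 0 := rfl

theorem lusztigN_mul {n : ℕ} {f : Laurent k d}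
    (hf : ∀ h : n < d - 1, permute (simpleRefl ⟨n, h⟩) f = f) (g : Laurent k d) :
    lusztigN q d n (f * g) = f * lusztigN q d n g := by
  unfold lusztigN
  split_ifs with h
  · exact lusztig_mul_of_permute_eq q (hf h) g
  · simp

theorem permute_xN {n j : ℕ} (h : n < d - 1) (h1 : j ≠ n) (h2 : j ≠ n + 1) :
    permute (simpleRefl ⟨n, h⟩) (xN k d j) = xN k d j := by
  unfold xN
  split_ifs with hj
  · rw [permute_x, simpleRefl_of_ne]
    · exact fun h' => h1 (congrArg Fin.val h')
    · exact fun h' => h2 (congrArg Fin.val h')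
  · exact map_zero _

theorem lusztigN_xN_mul {n j : ℕ} (h1 : j ≠ n) (h2 : j ≠ n + 1) (g : Laurent k d) :
    lusztigN q d n (xN k d j * g) = xN k d j * lusztigN q d n g :=
  lusztigN_mul q (fun h => permute_xN h h1 h2) g

/-- The number of black strands among two strands of the colours `a` and `b`. -/
def blacks (a b : Fin 2) : ℕ := (if a = 0 then 1 else 0) + if b = 0 then 1 else 0

/-- A crossing commutes with the dots on the other strands. -/
theorem crossOp_xN_mul {a b : Fin 2} {n m j : ℕ} (h : j < n ∨ n + blacks a b ≤ j)
    (g : Laurent k d) :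
    crossOp q Q d a b n m (xN k d j * g) = xN k d j * crossOp q Q d a b n m g := by
  rcases fin_two_cases a with rfl | rfl <;> rcases fin_two_cases b with rfl | rfl <;>
    simp [blacks, -AddMonoidAlgebra.coe_algebraMap] at h ⊢
  · exact lusztigN_xN_mul q (by omega) (by omega) g
  · ring

theorem lusztigN_comm {n n' : ℕ} (h : n + 2 ≤ n') (g : Laurent k d) :
    lusztigN q d n (lusztigN q d n' g) = lusztigN q d n' (lusztigN q d n g) := by
  unfold lusztigN
  split_ifs with h1 h2 h2
  · exact LinearMap.congr_fun (lusztig_comm q (r := ⟨n, h1⟩) (s := ⟨n', h2⟩) h) g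
  all_goals simp

/-- Distant crossings commute. -/
theorem crossOp_comm {a b a' b' : Fin 2} {n m n' m' : ℕ} (h : n + blacks a b ≤ n')
    (g : Laurent k d) :
    crossOp q Q d a b n m (crossOp q Q d a' b' n' m' g) =
      crossOp q Q d a' b' n' m' (crossOp q Q d a b n m g) := by
  rcases fin_two_cases a' with rfl | rfl <;> rcases fin_two_cases b' with rfl | rfl
  · rcases fin_two_cases a with rfl | rfl <;> rcases fin_two_cases b with rfl | rfl <;>
      simp [blacks, -AddMonoidAlgebra.coe_algebraMap] at h ⊢
    · exact lusztigN_comm q h g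
    · rw [sub_mul, sub_mul, map_sub, lusztigN_xN_mul q (by omega) (by omega),
        ← Algebra.smul_def, ← Algebra.smul_def, map_smul]
  · simp only [crossOp_zero_one, LinearMap.mulLeft_apply, sub_mul, map_sub]
    rw [crossOp_xN_mul q Q (Or.inr h), ← Algebra.smul_def, map_smul, Algebra.smul_def]
  · simp
  · simp

theorem lusztigN_sq {n : ℕ} (h : n + 1 < d) (g : Laurent k d) :
    lusztigN q d n (lusztigN q d n g) = (q - 1) • lusztigN q d n g + q • g := by
  rw [lusztigN, dif_pos (show n < d - 1 by omega)]
  have h1 := LinearMap.congr_fun (lusztig_sq (k := k) q (⟨n, by omega⟩ : Fin (d - 1))) g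
  rwa [Module.End.mul_apply, LinearMap.add_apply, LinearMap.smul_apply, LinearMap.smul_apply,
    Module.End.one_apply] at h1

theorem lusztigN_xN {n : ℕ} (h : n + 1 < d) (g : Laurent k d) :
    lusztigN q d n (xN k d n * g) =
      xN k d (n + 1) * lusztigN q d n g - (q - 1) • (xN k d (n + 1) * g) := by
  rw [lusztigN, dif_pos (show n < d - 1 by omega), xN_eq (show n < d by omega), xN_eq h]
  exact lusztig_x_lo q ⟨n, by omega⟩ g

theorem lusztigN_xN_succ {n : ℕ} (h : n + 1 < d) (g : Laurent k d) :
    lusztigN q d n (xN k d (n + 1) * g) =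
      xN k d n * lusztigN q d n g + (q - 1) • (xN k d (n + 1) * g) := by
  rw [lusztigN, dif_pos (show n < d - 1 by omega), xN_eq (show n < d by omega), xN_eq h]
  exact lusztig_x_hi q ⟨n, by omega⟩ g

theorem lusztigN_braid {n : ℕ} (h : n + 2 < d) (g : Laurent k d) :
    lusztigN q d n (lusztigN q d (n + 1) (lusztigN q d n g)) =
      lusztigN q d (n + 1) (lusztigN q d n (lusztigN q d (n + 1) g)) := by
  have h1 := (braidRel_lusztig (k := k) (d := d) q).braid ⟨n, by omega⟩ ⟨n + 1, by omega⟩ rfl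
  rw [lusztigN, lusztigN, dif_pos (show n < d - 1 by omega),
    dif_pos (show n + 1 < d - 1 by omega)]
  exact LinearMap.congr_fun h1 g

/-- The space `⨁_c P e(c)` of the polynomial representation of the Hecke algebra. -/
abbrev PolRep (k : Type*) [Field k] (ℓ d : ℕ) : Type _ := Col ℓ d → Laurent k d

/-- The action of a generator on the polynomial representation. The dot on a black strand is the
multiplication by the variable of this strand, whose index is the number of black strands to the
left; a crossing goes from the colours `s_r c` to the colours `c`. -/
def genAct : HGen ℓ d → Module.End k (PolRep k ℓ d)
  | HGen.e c => LinearMap.single k (fun _ => Laurent k d) c ∘ₗ LinearMap.proj c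
  | HGen.T r => LinearMap.pi fun c =>
      crossOp q Q d ((Col.swap r c).1 (lo r)) ((Col.swap r c).1 (hi r)) ((Col.swap r c).nb r)
        ((Col.swap r c).nr r) ∘ₗ LinearMap.proj (Col.swap r c)
  | HGen.X i => LinearMap.pi fun c =>
      (if c.1 i = 0 then LinearMap.mulLeft k (xN k d (c.nb i)) else 0) ∘ₗ LinearMap.proj c
  | HGen.X' i => LinearMap.pi fun c =>
      (if c.1 i = 0 then LinearMap.mulLeft k (xInvN k d (c.nb i)) else 0) ∘ₗ LinearMap.proj c

theorem genAct_e_single (b c : Col ℓ d) (f : Laurent k d) :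
    genAct q Q (HGen.e b) (Pi.single c f) = if b = c then Pi.single c f else 0 := by
  split_ifs with h
  · subst h
    simp [genAct]
  · simp [genAct, Pi.single_eq_of_ne h]

theorem genAct_T_single (r : Fin (ℓ + d - 1)) (c : Col ℓ d) (f : Laurent k d) :
    genAct q Q (HGen.T r) (Pi.single c f) = Pi.single (Col.swap r c)
      (crossOp q Q d (c.1 (lo r)) (c.1 (hi r)) (c.nb r) (c.nr r) f) := by
  funext b
  simp only [genAct, LinearMap.pi_apply, LinearMap.comp_apply, LinearMap.proj_apply]
  by_cases h : b = Col.swap r c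
  · subst h
    simp only [Col.swap_swap, Pi.single_eq_same]
  · have h' : Col.swap r b ≠ c := fun h' => h (by rw [← h', Col.swap_swap])
    rw [Pi.single_eq_of_ne h', Pi.single_eq_of_ne h, map_zero]

theorem genAct_X_single (i : Fin (ℓ + d)) (c : Col ℓ d) (f : Laurent k d) :
    genAct q Q (HGen.X i) (Pi.single c f) =
      if c.1 i = 0 then Pi.single c (xN k d (c.nb i) * f) else 0 := by
  funext b
  simp only [genAct, LinearMap.pi_apply, LinearMap.comp_apply, LinearMap.proj_apply]
  by_cases h : b = c
  · subst h
    split_ifs <;> simp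
  · rw [Pi.single_eq_of_ne h, map_zero]
    split_ifs <;> simp [Pi.single_eq_of_ne h]

theorem genAct_X'_single (i : Fin (ℓ + d)) (c : Col ℓ d) (f : Laurent k d) :
    genAct q Q (HGen.X' i) (Pi.single c f) =
      if c.1 i = 0 then Pi.single c (xInvN k d (c.nb i) * f) else 0 := by
  funext b
  simp only [genAct, LinearMap.pi_apply, LinearMap.comp_apply, LinearMap.proj_apply]
  by_cases h : b = c
  · subst h
    split_ifs <;> simp
  · rw [Pi.single_eq_of_ne h, map_zero]
    split_ifs <;> simp [Pi.single_eq_of_ne h]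

/-- Two operators which are the same on `P e(c)` are equal after multiplication with `e(c)`. -/
theorem mul_genAct_e_eq {A B : Module.End k (PolRep k ℓ d)} {c : Col ℓ d}
    (h : ∀ f, A (Pi.single c f) = B (Pi.single c f)) :
    A * genAct q Q (HGen.e c) = B * genAct q Q (HGen.e c) := by
  refine LinearMap.pi_ext fun b f => ?_
  rw [Module.End.mul_apply, Module.End.mul_apply, genAct_e_single]
  split_ifs with hb
  · rw [← hb, h]
  · rw [map_zero, map_zero]

theorem paramN_eq (t : Fin ℓ) : paramN Q t = Q t := dif_pos t.2

theorem crossOp_black_nb {c : Col ℓ d} {r : Fin (ℓ + d - 1)} :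
    c.nb (r + 1 + 1) = c.nb r + blacks (c.1 (lo r)) (c.1 (hi r)) := by
  have h1 := c.nb_succ (lo r)
  have h2 := c.nb_succ (hi r)
  have e1 : ((lo r : Fin (ℓ + d)) : ℕ) = r := rfl
  have e2 : ((hi r : Fin (ℓ + d)) : ℕ) = r + 1 := rfl
  rw [e1] at h1
  rw [e2] at h2
  rw [h2, h1, blacks, add_assoc]

end Rep

section Relations

variable {k : Type*} [Field k] {ℓ d : ℕ} (q : k) (Q : Fin ℓ → k)

/-- The action of the free algebra on the polynomial representation. -/
def freeAct (d : ℕ) : FreeAlgebra k (HGen ℓ d) →ₐ[k] Module.End k (PolRep k ℓ d) :=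
  FreeAlgebra.lift k (genAct q Q)

theorem freeAct_ι (g : HGen ℓ d) : freeAct q Q d (FreeAlgebra.ι k g) = genAct q Q g :=
  FreeAlgebra.lift_ι_apply _ _

theorem Col.nb_hi_of_black {c : Col ℓ d} {r : Fin (ℓ + d - 1)} (h : c.1 (lo r) = 0) :
    c.nb (hi r) = c.nb r + 1 := Col.nb_succ_of_black (i := lo r) h

theorem Col.nb_hi_of_red {c : Col ℓ d} {r : Fin (ℓ + d - 1)} (h : c.1 (lo r) = 1) :
    c.nb (hi r) = c.nb r := Col.nb_succ_of_red (i := lo r) h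

theorem Col.nb_lo (c : Col ℓ d) (r : Fin (ℓ + d - 1)) : c.nb (lo r) = c.nb r := rfl

theorem act_T_comm {r s : Fin (ℓ + d - 1)} (h : (r : ℕ) + 1 < s) :
    genAct q Q (HGen.T r) * genAct q Q (HGen.T s) =
      (genAct q Q (HGen.T s) * genAct q Q (HGen.T r) : Module.End k (PolRep k ℓ d)) := by
  refine LinearMap.pi_ext fun c f => ?_
  have e1 := simpleRefl_far (Or.inl h)
  have e2 := simpleRefl_far (r := s) (s := r) (Or.inr h)
  have hswap : Col.swap r (Col.swap s c) = Col.swap s (Col.swap r c) := by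
    apply Subtype.ext
    funext i
    have := DFunLike.congr_fun (simpleRefl_comm h) i
    exact congrArg c.1 this.symm
  have hs := s.2
  rw [Module.End.mul_apply, Module.End.mul_apply, genAct_T_single, genAct_T_single,
    genAct_T_single, genAct_T_single, hswap]
  simp only [Col.swap_apply, e1, e2]
  rw [Col.nb_swap_of_le c (show (r : ℕ) ≤ s by omega),
    Col.nb_swap_of_ge c (show (r : ℕ) + 2 ≤ s by omega),
    Col.nr_swap_of_le c (show (r : ℕ) ≤ s by omega),
    Col.nr_swap_of_ge c (show (r : ℕ) + 2 ≤ s by omega) (by omega), crossOp_comm]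
  rw [← crossOp_black_nb]
  exact c.nb_mono (by omega)

theorem act_T_X_comm {r : Fin (ℓ + d - 1)} {i : Fin (ℓ + d)} (h : i ≠ lo r) (h' : i ≠ hi r) :
    genAct q Q (HGen.T r) * genAct q Q (HGen.X i) =
      (genAct q Q (HGen.X i) * genAct q Q (HGen.T r) : Module.End k (PolRep k ℓ d)) := by
  refine LinearMap.pi_ext fun c f => ?_
  rw [Module.End.mul_apply, Module.End.mul_apply, genAct_T_single, genAct_X_single,
    genAct_X_single, Col.swap_apply, simpleRefl_of_ne h h']
  split_ifs with hc
  · rw [genAct_T_single]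
    have h1 : (i : ℕ) ≠ r := fun e => h (Fin.ext e)
    have h2 : (i : ℕ) ≠ r + 1 := fun e => h' (Fin.ext e)
    rcases lt_or_ge (i : ℕ) r with hi | hi
    · rw [Col.nb_swap_of_le c hi.le, crossOp_xN_mul]
      left
      have h3 := Col.nb_succ_of_black hc
      have h4 := c.nb_mono (show (i : ℕ) + 1 ≤ r by omega)
      omega
    · rw [Col.nb_swap_of_ge c (show (r : ℕ) + 2 ≤ i by omega), crossOp_xN_mul]
      right
      rw [← crossOp_black_nb]
      exact c.nb_mono (by omega)
  · rw [map_zero]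

/-- The braid relation of the polynomial representation, for all eight colourings of three adjacent
strands. The only one with a defect is black–red–black. -/
theorem act_braid {r s : Fin (ℓ + d - 1)} {c : Col ℓ d} (hs : (s : ℕ) = r + 1)
    (f : Laurent k d) :
    (genAct q Q (HGen.T r) * genAct q Q (HGen.T s) * genAct q Q (HGen.T r) -
      genAct q Q (HGen.T s) * genAct q Q (HGen.T r) * genAct q Q (HGen.T s) :
        Module.End k (PolRep k ℓ d)) (Pi.single c f) =
      if c.1 (lo r) = 0 ∧ c.1 (hi r) = 1 ∧ c.1 (hi s) = 0 then
        ((1 - q) • genAct q Q (HGen.X (hi s)) : Module.End k (PolRep k ℓ d)) (Pi.single c f)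
      else 0 := by
  obtain ⟨e1, e2, e3, e4, e5, e6, e7, -⟩ := adjacent_facts hs
  have hsw : Col.swap r (Col.swap s (Col.swap r c)) = Col.swap s (Col.swap r (Col.swap s c)) := by
    apply Subtype.ext
    funext i
    have := DFunLike.congr_fun (simpleRefl_braid hs) i
    exact congrArg c.1 this
  have hlen := s.2
  rw [LinearMap.sub_apply]
  simp only [Module.End.mul_apply, genAct_T_single, LinearMap.smul_apply, genAct_X_single]
  simp only [Col.swap_apply, e7, e1, e2, e3, e4, e5, e6, hsw, ← Pi.single_sub]
  have hss : ∀ (c : Col ℓ d), c.nb s = c.nb r + if c.1 (lo r) = 0 then 1 else 0 := by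
    intro c
    rw [hs]
    exact c.nb_succ (lo r)
  have hrr : ∀ (c : Col ℓ d), c.nr s = c.nr r + c.1 (lo r) := by
    intro c
    rw [hs]
    exact c.nr_succ (lo r)
  have hle : (r : ℕ) ≤ s := by omega
  have h3 : c.nb (s + 1 + 1) = c.nb r + (if c.1 (lo r) = 0 then 1 else 0) +
      blacks (c.1 (lo s)) (c.1 (hi s)) := by
    rw [crossOp_black_nb, hss]
  have h4 : c.nb (hi s) = c.nb r + (if c.1 (lo r) = 0 then 1 else 0) +
      if c.1 (lo s) = 0 then 1 else 0 := by
    rw [← hss]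
    exact c.nb_succ (lo s)
  have h5 := c.nb_le (s + 1 + 1)
  simp only [hss, hrr, Col.nb_swap_of_le _ hle, Col.nb_swap_of_le _ le_rfl,
    Col.nr_swap_of_le _ hle, Col.nr_swap_of_le _ le_rfl, Col.swap_apply, e1, e5, h4]
  rw [h3] at h5
  generalize c.nb r = n at *
  generalize c.nr r = m at *
  -- the cases which remain are black–black–black, black–black–red and black–red–black
  rcases fin_two_cases (c.1 (lo r)) with a0 | a0 <;>
  rcases fin_two_cases (c.1 (lo s)) with a1 | a1 <;>
  rcases fin_two_cases (c.1 (hi s)) with a2 | a2 <;>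
  simp [a0, a1, a2, blacks, -AddMonoidAlgebra.coe_algebraMap] at h5 ⊢
  · rw [lusztigN_braid q (by omega), sub_self]
  · rw [← mul_assoc, ← mul_assoc, lusztigN_mul, sub_self]
    intro hn
    rw [map_mul, map_sub, map_sub, AlgHom.commutes, xN_eq (show n < d by omega), xN_eq h5,
      permute_x, permute_x]
    have e8 : simpleRefl (⟨n, hn⟩ : Fin (d - 1)) ⟨n, by omega⟩ = ⟨n + 1, h5⟩ := simpleRefl_lo _
    have e9 : simpleRefl (⟨n, hn⟩ : Fin (d - 1)) ⟨n + 1, h5⟩ = ⟨n, by omega⟩ := simpleRefl_hi _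
    rw [e8, e9, mul_comm]
  · have e8 : Col.swap r (Col.swap s c) = Col.swap s c := by
      refine Col.swap_of_eq ?_
      rw [e7, Col.swap_lo, Col.swap_apply, e4, a0, a2]
    rw [e8, Col.swap_swap, ← Pi.single_smul, sub_mul, map_sub, lusztigN_xN q h5, sub_mul,
      ← Algebra.smul_def, ← Algebra.smul_def, map_smul, sub_smul, sub_smul]
    congr 1
    abel

/-- The defining relations of the Hecke algebra hold in the polynomial representation. -/
theorem freeAct_eq_of_rel {a b : FreeAlgebra k (HGen ℓ d)} (h : HRel d q Q a b) :
    freeAct q Q d a = freeAct q Q d b := by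
  cases h with
  | sum_e =>
    rw [map_sum, map_one]
    refine LinearMap.pi_ext fun c f => ?_
    rw [LinearMap.sum_apply, Finset.sum_eq_single c, freeAct_ι, genAct_e_single, if_pos rfl]
    · rfl
    · intro b _ hb
      rw [freeAct_ι, genAct_e_single, if_neg hb]
    · exact fun h => absurd (Finset.mem_univ _) h
  | e_mul_self c =>
    rw [map_mul, freeAct_ι]
    refine (mul_genAct_e_eq q Q fun f => ?_).trans (one_mul _)
    rw [genAct_e_single, if_pos rfl, Module.End.one_apply]
  | e_mul_ne b c h =>
    rw [map_mul, map_zero, freeAct_ι, freeAct_ι]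
    refine (mul_genAct_e_eq q Q (B := 0) fun f => ?_).trans (zero_mul _)
    rw [genAct_e_single, if_neg h, LinearMap.zero_apply]
  | X_red i c h =>
    rw [map_mul, map_zero, freeAct_ι, freeAct_ι]
    refine (mul_genAct_e_eq q Q (B := 0) fun f => ?_).trans (zero_mul _)
    rw [genAct_X_single, if_neg (by rw [h]; decide), LinearMap.zero_apply]
  | X'_red i c h =>
    rw [map_mul, map_zero, freeAct_ι, freeAct_ι]
    refine (mul_genAct_e_eq q Q (B := 0) fun f => ?_).trans (zero_mul _)
    rw [genAct_X'_single, if_neg (by rw [h]; decide), LinearMap.zero_apply]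
  | X_X' i c h =>
    rw [map_mul, map_mul, freeAct_ι, freeAct_ι, freeAct_ι]
    refine (mul_genAct_e_eq q Q fun f => ?_).trans (one_mul _)
    rw [Module.End.mul_apply, genAct_X'_single, if_pos h, genAct_X_single, if_pos h, ← mul_assoc,
      xN_mul_xInvN (Col.nb_lt h), one_mul, Module.End.one_apply]
  | X'_X i c h =>
    rw [map_mul, map_mul, freeAct_ι, freeAct_ι, freeAct_ι]
    refine (mul_genAct_e_eq q Q fun f => ?_).trans (one_mul _)
    rw [Module.End.mul_apply, genAct_X_single, if_pos h, genAct_X'_single, if_pos h, ← mul_assoc,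
      mul_comm (xInvN _ _ _), xN_mul_xInvN (Col.nb_lt h), one_mul, Module.End.one_apply]
  | X_e i c =>
    rw [map_mul, map_mul, freeAct_ι, freeAct_ι]
    refine LinearMap.pi_ext fun b f => ?_
    rw [Module.End.mul_apply, Module.End.mul_apply, genAct_e_single, genAct_X_single]
    split_ifs <;> simp [genAct_e_single, genAct_X_single, *]
  | X'_e i c =>
    rw [map_mul, map_mul, freeAct_ι, freeAct_ι]
    refine LinearMap.pi_ext fun b f => ?_
    rw [Module.End.mul_apply, Module.End.mul_apply, genAct_e_single, genAct_X'_single]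
    split_ifs <;> simp [genAct_e_single, genAct_X'_single, *]
  | X_comm i j =>
    rw [map_mul, map_mul, freeAct_ι, freeAct_ι]
    refine LinearMap.pi_ext fun b f => ?_
    rw [Module.End.mul_apply, Module.End.mul_apply, genAct_X_single, genAct_X_single]
    split_ifs <;> simp [genAct_X_single, mul_left_comm, *]
  | X'_comm i j =>
    rw [map_mul, map_mul, freeAct_ι, freeAct_ι]
    refine LinearMap.pi_ext fun b f => ?_
    rw [Module.End.mul_apply, Module.End.mul_apply, genAct_X'_single, genAct_X'_single]
    split_ifs <;> simp [genAct_X'_single, mul_left_comm, *]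
  | T_comm r s h =>
    rw [map_mul, map_mul, freeAct_ι, freeAct_ι]
    exact act_T_comm q Q h
  | T_X_comm r i h h' =>
    rw [map_mul, map_mul, freeAct_ι, freeAct_ι]
    exact act_T_X_comm q Q h h'
  | T_red r c h h' =>
    rw [map_mul, map_zero, freeAct_ι, freeAct_ι]
    refine (mul_genAct_e_eq q Q (B := 0) fun f => ?_).trans (zero_mul _)
    rw [genAct_T_single, h, h', crossOp_one_one, LinearMap.zero_apply, LinearMap.zero_apply,
      Pi.single_zero]
  | T_e r c =>
    rw [map_mul, map_mul, freeAct_ι, freeAct_ι, freeAct_ι]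
    refine LinearMap.pi_ext fun b f => ?_
    rw [Module.End.mul_apply, Module.End.mul_apply, genAct_e_single, genAct_T_single,
      genAct_e_single]
    have h1 : Col.swap r c = Col.swap r b ↔ c = b :=
      ⟨fun h => by rw [← Col.swap_swap r c, h, Col.swap_swap], fun h => by rw [h]⟩
    simp only [h1]
    split_ifs
    · rw [genAct_T_single]
    · rw [map_zero]
  | T_X_hi_black r c h h' =>
    simp only [map_mul, map_sub, map_smul, freeAct_ι]
    rw [← smul_mul_assoc]
    refine mul_genAct_e_eq q Q fun f => ?_
    have h1 := Col.nb_hi_of_black h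
    have h2 := Col.nb_lt h'
    rw [LinearMap.sub_apply, Module.End.mul_apply, Module.End.mul_apply, LinearMap.smul_apply,
      genAct_X_single, if_pos h', genAct_T_single, genAct_T_single, genAct_X_single,
      Col.swap_of_eq (h.trans h'.symm), if_pos h, h, h', crossOp_zero_zero, ← Pi.single_sub, h1,
      Col.nb_lo, lusztigN_xN_succ q (by omega), ← Pi.single_smul]
    congr 1
    abel
  | T_X_hi_other r c h =>
    simp only [map_mul, map_sub, map_zero, freeAct_ι]
    refine (mul_genAct_e_eq q Q (B := 0) fun f => ?_).trans (zero_mul _)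
    rw [LinearMap.sub_apply, Module.End.mul_apply, Module.End.mul_apply,
      genAct_X_single, genAct_T_single, genAct_X_single, Col.swap_lo, LinearMap.zero_apply]
    split_ifs with h'
    · have h1 := fin_two_ne_zero fun h1 => h ⟨h1, h'⟩
      rw [genAct_T_single, h1, h', Col.nb_hi_of_red h1, Col.nb_lo, Col.nb_swap_of_le c le_rfl,
        crossOp_one_zero, Module.End.one_apply, Module.End.one_apply, sub_self]
    · rw [map_zero, sub_self]
  | T_X_lo_black r c h h' =>
    simp only [map_mul, map_sub, map_smul, freeAct_ι]
    rw [← smul_mul_assoc]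
    refine mul_genAct_e_eq q Q fun f => ?_
    have h1 := Col.nb_hi_of_black h
    have h2 := Col.nb_lt h'
    rw [LinearMap.sub_apply, Module.End.mul_apply, Module.End.mul_apply, LinearMap.smul_apply,
      genAct_X_single, if_pos h, genAct_T_single, genAct_T_single, genAct_X_single,
      Col.swap_of_eq (h.trans h'.symm), if_pos h', h, h', crossOp_zero_zero, ← Pi.single_sub,
      Col.nb_lo, lusztigN_xN q (by omega), genAct_X_single, if_pos h', h1, ← Pi.single_smul,
      neg_smul]
    congr 1
    abel
  | T_X_lo_other r c h =>
    simp only [map_mul, map_sub, map_zero, freeAct_ι]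
    refine (mul_genAct_e_eq q Q (B := 0) fun f => ?_).trans (zero_mul _)
    rw [LinearMap.sub_apply, Module.End.mul_apply, Module.End.mul_apply,
      genAct_X_single, genAct_T_single, genAct_X_single, Col.swap_hi, LinearMap.zero_apply]
    split_ifs with h'
    · have h1 := fin_two_ne_zero fun h1 => h ⟨h', h1⟩
      have h2 : (Col.swap r c).nb (hi r) = c.nb r := by
        rw [Col.nb_hi_of_red (by rw [Col.swap_lo, h1]), Col.nb_swap_of_le c le_rfl]
      rw [genAct_T_single, h1, h', h2, Col.nb_lo, crossOp_zero_one, LinearMap.mulLeft_apply,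
        LinearMap.mulLeft_apply, mul_left_comm, sub_self]
    · rw [map_zero, sub_self]
  | T_sq_black r c h h' =>
    simp only [map_mul, map_add, map_smul, freeAct_ι]
    have e : (q - 1) • (genAct q Q (HGen.T r) * genAct q Q (HGen.e c)) + q • genAct q Q (HGen.e c) =
        ((q - 1) • genAct q Q (HGen.T r) + q • (1 : Module.End k (PolRep k ℓ d))) *
          genAct q Q (HGen.e c) := by
      rw [add_mul, smul_mul_assoc, smul_mul_assoc, one_mul]
    rw [e]
    refine mul_genAct_e_eq q Q fun f => ?_
    have h1 := Col.nb_hi_of_black h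
    have h2 := Col.nb_lt h'
    rw [Module.End.mul_apply, LinearMap.add_apply, LinearMap.smul_apply, LinearMap.smul_apply,
      Module.End.one_apply, genAct_T_single, Col.swap_of_eq (h.trans h'.symm), genAct_T_single,
      Col.swap_of_eq (h.trans h'.symm), h, h', crossOp_zero_zero, lusztigN_sq q (by omega),
      Pi.single_add, Pi.single_smul, Pi.single_smul]
  | T_sq_black_red r c t h h' ht =>
    simp only [map_mul, map_sub, map_smul, freeAct_ι]
    have e : genAct q Q (HGen.X (lo r)) * genAct q Q (HGen.e c) - Q t • genAct q Q (HGen.e c) =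
        (genAct q Q (HGen.X (lo r)) - Q t • (1 : Module.End k (PolRep k ℓ d))) *
          genAct q Q (HGen.e c) := by
      rw [sub_mul, smul_mul_assoc, one_mul]
    rw [e]
    refine mul_genAct_e_eq q Q fun f => ?_
    have h1 : c.nr r = t := by
      rw [Col.sum_Iic, Col.nr_succ] at ht
      have h2 : c.nr (hi r) = c.nr (lo r) + c.1 (lo r) := c.nr_succ (lo r)
      rw [h2, h, h'] at ht
      exact Nat.succ.inj ht
    rw [Module.End.mul_apply, LinearMap.sub_apply, LinearMap.smul_apply, Module.End.one_apply,
      genAct_T_single, genAct_T_single, Col.swap_swap, Col.swap_lo, Col.swap_hi, h, h',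
      genAct_X_single, if_pos h, h1, crossOp_zero_one, crossOp_one_zero, Module.End.one_apply,
      LinearMap.mulLeft_apply, paramN_eq, sub_mul, ← Algebra.smul_def, Pi.single_sub,
      Pi.single_smul, Col.nb_lo]
  | T_sq_red_black r c t h h' ht =>
    simp only [map_mul, map_sub, map_smul, freeAct_ι]
    have e : genAct q Q (HGen.X (hi r)) * genAct q Q (HGen.e c) - Q t • genAct q Q (HGen.e c) =
        (genAct q Q (HGen.X (hi r)) - Q t • (1 : Module.End k (PolRep k ℓ d))) *
          genAct q Q (HGen.e c) := by
      rw [sub_mul, smul_mul_assoc, one_mul]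
    rw [e]
    refine mul_genAct_e_eq q Q fun f => ?_
    have h1 : c.nr r = t := by
      rw [Col.sum_Iic, Col.nr_succ, h] at ht
      exact Nat.succ.inj ht
    rw [Module.End.mul_apply, LinearMap.sub_apply, LinearMap.smul_apply, Module.End.one_apply,
      genAct_T_single, genAct_T_single, Col.swap_swap, Col.swap_lo, Col.swap_hi, h, h',
      genAct_X_single, if_pos h', Col.nr_swap_of_le c le_rfl, Col.nb_swap_of_le c le_rfl, h1,
      crossOp_zero_one, crossOp_one_zero, Module.End.one_apply,
      LinearMap.mulLeft_apply, paramN_eq, sub_mul, ← Algebra.smul_def, Pi.single_sub,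
      Pi.single_smul, Col.nb_hi_of_red h]
  | braid_black r s c hs h =>
    simp only [map_mul, map_sub, map_zero, freeAct_ι]
    refine (mul_genAct_e_eq q Q (B := 0) fun f => ?_).trans (zero_mul _)
    rw [act_braid q Q hs, if_neg, LinearMap.zero_apply]
    rw [h]
    exact fun h' => absurd h'.2.1 (by decide)
  | braid_red r s c hs h h0 h2 =>
    simp only [map_mul, map_sub, map_smul, freeAct_ι]
    rw [← smul_mul_assoc]
    refine mul_genAct_e_eq q Q fun f => ?_
    rw [act_braid q Q hs, if_pos ⟨h0, h, h2⟩]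

/-- The polynomial representation of the Hecke algebra. -/
def act (d : ℕ) : Hecke d q Q →ₐ[k] Module.End k (PolRep k ℓ d) :=
  RingQuot.liftAlgHom k ⟨freeAct q Q d, fun _ _ h => freeAct_eq_of_rel q Q h⟩

theorem act_gen (g : HGen ℓ d) : act q Q d (Hecke.gen d q Q g) = genAct q Q g := by
  rw [act, Hecke.gen, RingQuot.liftAlgHom_mkAlgHom_apply, freeAct_ι]

/-- An identity between elements of the free algebra which is a defining relation. -/
theorem mk_eq_of_rel {a b : FreeAlgebra k (HGen ℓ d)} (h : HRel d q Q a b) :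
    RingQuot.mkAlgHom k (HRel d q Q) a = RingQuot.mkAlgHom k (HRel d q Q) b :=
  RingQuot.mkAlgHom_rel k h

end Relations

/-! ### Laurent polynomials inside the Hecke algebra -/

namespace Hecke

section Basic

variable {k : Type*} [Field k] {ℓ d : ℕ} (q : k) (Q : Fin ℓ → k)

/-- The idempotent `e(c)`. -/
abbrev E (c : Col ℓ d) : Hecke d q Q := gen d q Q (HGen.e c)

/-- The crossing `T_r`. -/
abbrev tau (r : Fin (ℓ + d - 1)) : Hecke d q Q := gen d q Q (HGen.T r)

/-- The dot `X_i`. -/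
abbrev dot (i : Fin (ℓ + d)) : Hecke d q Q := gen d q Q (HGen.X i)

/-- The inverse dot `X'_i`. -/
abbrev dot' (i : Fin (ℓ + d)) : Hecke d q Q := gen d q Q (HGen.X' i)

theorem sum_E : ∑ c : Col ℓ d, E q Q c = 1 := by
  have h1 := mk_eq_of_rel q Q (HRel.sum_e (d := d) (q := q) (Q := Q))
  simp only [map_sum, map_one] at h1
  exact h1

theorem E_mul_E (b c : Col ℓ d) : E q Q b * E q Q c = if b = c then E q Q c else 0 := by
  split_ifs with h
  · subst h
    have h1 := mk_eq_of_rel q Q (HRel.e_mul_self (q := q) (Q := Q) b)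
    simp only [map_mul] at h1
    exact h1
  · have h1 := mk_eq_of_rel q Q (HRel.e_mul_ne (q := q) (Q := Q) b c h)
    simp only [map_mul, map_zero] at h1
    exact h1

theorem E_mul_self (c : Col ℓ d) : E q Q c * E q Q c = E q Q c := by rw [E_mul_E, if_pos rfl]

variable {q Q} in
/-- An element is determined by its products with the idempotents. -/
theorem ext_E {y z : Hecke d q Q} (h : ∀ c, y * E q Q c = z * E q Q c) : y = z := by
  rw [← mul_one y, ← mul_one z, ← sum_E, Finset.mul_sum, Finset.mul_sum]
  exact Finset.sum_congr rfl fun c _ => h c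

theorem dot_mul_E (i : Fin (ℓ + d)) (c : Col ℓ d) : dot q Q i * E q Q c = E q Q c * dot q Q i := by
  have h1 := mk_eq_of_rel q Q (HRel.X_e (q := q) (Q := Q) i c)
  simp only [map_mul] at h1
  exact h1

theorem dot'_mul_E (i : Fin (ℓ + d)) (c : Col ℓ d) :
    dot' q Q i * E q Q c = E q Q c * dot' q Q i := by
  have h1 := mk_eq_of_rel q Q (HRel.X'_e (q := q) (Q := Q) i c)
  simp only [map_mul] at h1
  exact h1

theorem dot_mul_dot (i j : Fin (ℓ + d)) : dot q Q i * dot q Q j = dot q Q j * dot q Q i := by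
  have h1 := mk_eq_of_rel q Q (HRel.X_comm (q := q) (Q := Q) i j)
  simp only [map_mul] at h1
  exact h1

theorem tau_mul_E (r : Fin (ℓ + d - 1)) (c : Col ℓ d) :
    tau q Q r * E q Q c = E q Q (Col.swap r c) * tau q Q r := by
  have h1 := mk_eq_of_rel q Q (HRel.T_e (q := q) (Q := Q) r c)
  simp only [map_mul] at h1
  exact h1

variable {q Q}

theorem tau_mul_E_red {r : Fin (ℓ + d - 1)} {c : Col ℓ d} (h : c.1 (lo r) = 1)
    (h' : c.1 (hi r) = 1) : tau q Q r * E q Q c = 0 := by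
  have h1 := mk_eq_of_rel q Q (HRel.T_red (q := q) (Q := Q) r c h h')
  simp only [map_mul, map_zero] at h1
  exact h1

theorem dot_mul_E_red {i : Fin (ℓ + d)} {c : Col ℓ d} (h : c.1 i = 1) :
    dot q Q i * E q Q c = 0 := by
  have h1 := mk_eq_of_rel q Q (HRel.X_red (q := q) (Q := Q) i c h)
  simp only [map_mul, map_zero] at h1
  exact h1

theorem dot'_mul_E_red {i : Fin (ℓ + d)} {c : Col ℓ d} (h : c.1 i = 1) :
    dot' q Q i * E q Q c = 0 := by
  have h1 := mk_eq_of_rel q Q (HRel.X'_red (q := q) (Q := Q) i c h)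
  simp only [map_mul, map_zero] at h1
  exact h1

theorem dot_mul_dot'_mul_E {i : Fin (ℓ + d)} {c : Col ℓ d} (h : c.1 i = 0) :
    dot q Q i * dot' q Q i * E q Q c = E q Q c := by
  have h1 := mk_eq_of_rel q Q (HRel.X_X' (q := q) (Q := Q) i c h)
  simp only [map_mul] at h1
  exact h1

theorem dot'_mul_dot_mul_E {i : Fin (ℓ + d)} {c : Col ℓ d} (h : c.1 i = 0) :
    dot' q Q i * dot q Q i * E q Q c = E q Q c := by
  have h1 := mk_eq_of_rel q Q (HRel.X'_X (q := q) (Q := Q) i c h)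
  simp only [map_mul] at h1
  exact h1

theorem tau_mul_dot {r : Fin (ℓ + d - 1)} {i : Fin (ℓ + d)} (h : i ≠ lo r) (h' : i ≠ hi r) :
    tau q Q r * dot q Q i = dot q Q i * tau q Q r := by
  have h1 := mk_eq_of_rel q Q (HRel.T_X_comm (q := q) (Q := Q) r i h h')
  simp only [map_mul] at h1
  exact h1

theorem tau_mul_tau {r s : Fin (ℓ + d - 1)} (h : (r : ℕ) + 1 < s) :
    tau q Q r * tau q Q s = tau q Q s * tau q Q r := by
  have h1 := mk_eq_of_rel q Q (HRel.T_comm (q := q) (Q := Q) r s h)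
  simp only [map_mul] at h1
  exact h1

theorem eq_add_neg_smul_of_sub_eq {R : Type*} [Ring R] [Algebra k R] {u v w : R} {a : k}
    (h : u - v = a • w) : v = u + -a • w := by
  rw [neg_smul, ← h, ← sub_eq_add_neg, sub_sub_cancel]

/-- A dot moves through a crossing, up to a multiple of a dot without the crossing; here from the
left position at the top. -/
theorem exists_dot_lo_mul_tau (r : Fin (ℓ + d - 1)) (c : Col ℓ d) :
    ∃ a : k, dot q Q (lo r) * tau q Q r * E q Q c =
      tau q Q r * dot q Q (hi r) * E q Q c + a • (dot q Q (hi r) * E q Q c) ∧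
      (a ≠ 0 → c.1 (hi r) = 0) := by
  by_cases h : c.1 (lo r) = 0 ∧ c.1 (hi r) = 0
  · have := mk_eq_of_rel q Q (HRel.T_X_hi_black (q := q) (Q := Q) r c h.1 h.2)
    simp only [map_mul, map_sub, map_smul, sub_mul] at this
    exact ⟨-(q - 1), eq_add_neg_smul_of_sub_eq this, fun _ => h.2⟩
  · have := mk_eq_of_rel q Q (HRel.T_X_hi_other (q := q) (Q := Q) r c h)
    simp only [map_mul, map_sub, map_zero, sub_mul] at this
    refine ⟨0, ?_, fun h => absurd rfl h⟩
    rw [zero_smul, add_zero]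
    exact (sub_eq_zero.1 this).symm

/-- A dot moves through a crossing, up to a multiple of a dot without the crossing; here from the
right position at the top. -/
theorem exists_dot_hi_mul_tau (r : Fin (ℓ + d - 1)) (c : Col ℓ d) :
    ∃ a : k, dot q Q (hi r) * tau q Q r * E q Q c =
      tau q Q r * dot q Q (lo r) * E q Q c + a • (dot q Q (hi r) * E q Q c) ∧
      (a ≠ 0 → c.1 (hi r) = 0) := by
  by_cases h : c.1 (lo r) = 0 ∧ c.1 (hi r) = 0
  · have := mk_eq_of_rel q Q (HRel.T_X_lo_black (q := q) (Q := Q) r c h.1 h.2)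
    simp only [map_mul, map_sub, map_smul, sub_mul] at this
    have h1 := eq_add_neg_smul_of_sub_eq this
    rw [neg_neg] at h1
    exact ⟨q - 1, h1, fun _ => h.2⟩
  · have := mk_eq_of_rel q Q (HRel.T_X_lo_other (q := q) (Q := Q) r c h)
    simp only [map_mul, map_sub, map_zero, sub_mul] at this
    refine ⟨0, ?_, fun h => absurd rfl h⟩
    rw [zero_smul, add_zero]
    exact (sub_eq_zero.1 this).symm

end Basic

end Hecke

section BlackPos

variable {ℓ d : ℕ}

theorem Col.blackPos_black (c : Col ℓ d) (i : Fin d) : c.1 (c.blackPos i) = 0 := by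
  have := Finset.orderEmbOfFin_mem _ c.card_black i
  exact (Finset.mem_filter.1 this).2

theorem Col.blackPos_strictMono (c : Col ℓ d) : StrictMono c.blackPos :=
  (Finset.orderEmbOfFin _ c.card_black).strictMono

theorem Col.exists_blackPos {c : Col ℓ d} {p : Fin (ℓ + d)} (h : c.1 p = 0) :
    ∃ i, c.blackPos i = p := by
  have := Finset.range_orderEmbOfFin _ c.card_black
  have h1 : p ∈ Set.range (Finset.orderEmbOfFin _ c.card_black) := by
    rw [this]
    simpa using h
  exact h1

theorem Col.nb_blackPos (c : Col ℓ d) (i : Fin d) : c.nb (c.blackPos i) = i := by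
  have h : (Finset.univ.filter fun j : Fin (ℓ + d) => (j : ℕ) < c.blackPos i ∧ c.1 j = 0) =
      (Finset.Iio i).image c.blackPos := by
    ext j
    simp only [Finset.mem_filter, Finset.mem_univ, true_and, Finset.mem_image, Finset.mem_Iio]
    constructor
    · rintro ⟨h1, h2⟩
      obtain ⟨i', rfl⟩ := Col.exists_blackPos h2
      exact ⟨i', c.blackPos_strictMono.lt_iff_lt.1 h1, rfl⟩
    · rintro ⟨i', h1, rfl⟩
      exact ⟨c.blackPos_strictMono h1, c.blackPos_black i'⟩
  rw [Col.nb, h, Finset.card_image_of_injective _ c.blackPos_strictMono.injective, Fin.card_Iio]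

/-- The `i`-th black position is the black position with `i` black positions to its left. -/
theorem Col.blackPos_eq_iff {c : Col ℓ d} {i : Fin d} {p : Fin (ℓ + d)} :
    c.blackPos i = p ↔ c.1 p = 0 ∧ c.nb p = i := by
  constructor
  · rintro rfl
    exact ⟨c.blackPos_black i, c.nb_blackPos i⟩
  · rintro ⟨h1, h2⟩
    obtain ⟨j, rfl⟩ := Col.exists_blackPos h1
    rw [c.nb_blackPos, ← Fin.ext_iff] at h2
    rw [h2]

end BlackPos

namespace Hecke

section Poly

theorem prod_ofFn_mul {M : Type*} [Monoid M] {n : ℕ} (F G : Fin n → M)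
    (h : ∀ i j, Commute (G i) (F j)) :
    (List.ofFn fun i => F i * G i).prod = (List.ofFn F).prod * (List.ofFn G).prod := by
  induction n with
  | zero => simp
  | succ n ih =>
    rw [List.ofFn_succ, List.ofFn_succ, List.ofFn_succ, List.prod_cons, List.prod_cons,
      List.prod_cons, ih (fun i => F i.succ) (fun i => G i.succ) fun i j => h i.succ j.succ]
    have h1 : Commute (G 0) (List.ofFn fun i : Fin n => F i.succ).prod :=
      Commute.list_prod_right _ _ fun y hy => by
        obtain ⟨j, rfl⟩ := (List.mem_ofFn' _ _).1 hy
        exact h 0 j.succ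
    rw [mul_assoc, ← mul_assoc (G 0), h1.eq]
    simp only [mul_assoc]

variable {k : Type*} [Field k] {ℓ d : ℕ} (q : k) (Q : Fin ℓ → k)

theorem xElt_mul_E (i : Fin d) (c : Col ℓ d) :
    xElt d q Q i * E q Q c = dot q Q (c.blackPos i) * E q Q c := by
  rw [xElt, Finset.sum_mul, Finset.sum_eq_single c]
  · rw [mul_assoc, E_mul_self]
  · intro b _ hb
    rw [mul_assoc, E_mul_E, if_neg hb, mul_zero]
  · exact fun h => absurd (Finset.mem_univ c) h

theorem xInv_mul_E (i : Fin d) (c : Col ℓ d) :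
    xInv d q Q i * E q Q c = dot' q Q (c.blackPos i) * E q Q c := by
  rw [xInv, Finset.sum_mul, Finset.sum_eq_single c]
  · rw [mul_assoc, E_mul_self]
  · intro b _ hb
    rw [mul_assoc, E_mul_E, if_neg hb, mul_zero]
  · exact fun h => absurd (Finset.mem_univ c) h

theorem E_mul_xElt (i : Fin d) (c : Col ℓ d) :
    E q Q c * xElt d q Q i = xElt d q Q i * E q Q c := by
  rw [xElt_mul_E, xElt, Finset.mul_sum, Finset.sum_eq_single c]
  · rw [← mul_assoc, ← dot_mul_E, mul_assoc, E_mul_self]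
  · intro b _ hb
    rw [← mul_assoc, ← dot_mul_E, mul_assoc, E_mul_E, if_neg hb.symm, mul_zero]
  · exact fun h => absurd (Finset.mem_univ c) h

theorem E_mul_xInv (i : Fin d) (c : Col ℓ d) :
    E q Q c * xInv d q Q i = xInv d q Q i * E q Q c := by
  rw [xInv_mul_E, xInv, Finset.mul_sum, Finset.sum_eq_single c]
  · rw [← mul_assoc, ← dot'_mul_E, mul_assoc, E_mul_self]
  · intro b _ hb
    rw [← mul_assoc, ← dot'_mul_E, mul_assoc, E_mul_E, if_neg hb.symm, mul_zero]
  · exact fun h => absurd (Finset.mem_univ c) h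

theorem xElt_mul_xInv (i : Fin d) : xElt d q Q i * xInv d q Q i = 1 := by
  refine ext_E fun c => ?_
  rw [mul_assoc, ← E_mul_xInv, ← mul_assoc, xElt_mul_E, mul_assoc, E_mul_xInv, xInv_mul_E,
    ← mul_assoc, dot_mul_dot'_mul_E (c.blackPos_black i), one_mul]

theorem xInv_mul_xElt (i : Fin d) : xInv d q Q i * xElt d q Q i = 1 := by
  refine ext_E fun c => ?_
  rw [mul_assoc, ← E_mul_xElt, ← mul_assoc, xInv_mul_E, mul_assoc, E_mul_xElt, xElt_mul_E,
    ← mul_assoc, dot'_mul_dot_mul_E (c.blackPos_black i), one_mul]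

theorem xElt_mul_xElt (i j : Fin d) :
    xElt d q Q i * xElt d q Q j = xElt d q Q j * xElt d q Q i := by
  refine ext_E fun c => ?_
  rw [mul_assoc, ← E_mul_xElt, ← mul_assoc, xElt_mul_E, mul_assoc, E_mul_xElt, xElt_mul_E,
    mul_assoc (xElt d q Q j), ← E_mul_xElt q Q i, ← mul_assoc (xElt d q Q j), xElt_mul_E,
    mul_assoc (dot q Q _) (E q Q c), E_mul_xElt, xElt_mul_E, ← mul_assoc, ← mul_assoc,
    dot_mul_dot]

/-- The unit `x_i` of the Hecke algebra. -/
def xUnit (i : Fin d) : (Hecke d q Q)ˣ :=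
  ⟨xElt d q Q i, xInv d q Q i, xElt_mul_xInv q Q i, xInv_mul_xElt q Q i⟩

theorem xUnit_commute (i j : Fin d) : Commute (xUnit q Q i) (xUnit q Q j) :=
  Units.ext (xElt_mul_xElt q Q i j)

/-- The monomials, as a homomorphism from `ℤ^d`. -/
def monomialHom : Multiplicative (Fin d → ℤ) →* Hecke d q Q where
  toFun a := (((List.ofFn fun i => xUnit q Q i ^ (Multiplicative.toAdd a i)).prod :
    (Hecke d q Q)ˣ) : Hecke d q Q)
  map_one' := by
    have : (List.ofFn fun i : Fin d => xUnit q Q i ^ (Multiplicative.toAdd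
        (1 : Multiplicative (Fin d → ℤ)) i)) = List.replicate d 1 := by
      rw [← List.ofFn_const]
      congr 1
      funext i
      exact zpow_zero _
    rw [this, List.prod_replicate, one_pow, Units.val_one]
  map_mul' a b := by
    rw [← Units.val_mul, ← prod_ofFn_mul]
    · simp only [toAdd_mul, Pi.add_apply, zpow_add]
    · exact fun i j => ((xUnit_commute q Q i j).zpow_zpow _ _)

/-- The homomorphism from Laurent polynomials with `x_i ↦ x_i`. -/
def polyHom : Laurent k d →ₐ[k] Hecke d q Q :=
  AddMonoidAlgebra.lift k (Hecke d q Q) (Fin d → ℤ) (monomialHom q Q)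

/-- The monomials of `poly`, which are written with `x_i` or `x_i⁻¹` according to the sign of the
exponent, are those of the homomorphism. -/
theorem monomialHom_apply (a : Fin d → ℤ) : monomialHom q Q (Multiplicative.ofAdd a) =
    (List.ofFn fun i => if 0 ≤ a i then xElt d q Q i ^ (a i).toNat
      else xInv d q Q i ^ (-a i).toNat).prod := by
  have h : ∀ L : List (Hecke d q Q)ˣ, ((L.prod : (Hecke d q Q)ˣ) : Hecke d q Q) =
      (L.map Units.val).prod := fun L => map_list_prod (Units.coeHom _) L
  change (((List.ofFn fun i => xUnit q Q i ^ (a i)).prod : (Hecke d q Q)ˣ) : Hecke d q Q) = _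
  rw [h, List.map_ofFn]
  congr 2
  funext i
  simp only [Function.comp_apply]
  split_ifs with hi
  · obtain ⟨n, hn⟩ := Int.eq_ofNat_of_zero_le hi
    rw [hn, zpow_natCast, Units.val_pow_eq_pow_val, Int.toNat_natCast]; rfl
  · obtain ⟨n, hn⟩ := Int.eq_ofNat_of_zero_le (a := -a i) (by omega)
    have hn' : a i = -(n : ℤ) := by omega
    rw [hn', zpow_neg, zpow_natCast, neg_neg, Int.toNat_natCast, ← inv_pow,
      Units.val_pow_eq_pow_val]; rfl

/-- The map `poly` is multiplicative. -/
theorem poly_eq (f : Laurent k d) : poly d q Q f = polyHom q Q f := by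
  rw [poly, polyHom, AddMonoidAlgebra.lift_apply, Finsupp.linearCombination_apply]
  simp only [monomialHom_apply]

theorem poly_x (i : Fin d) : poly d q Q (x i) = xElt d q Q i := by
  rw [poly_eq, polyHom, x, AddMonoidAlgebra.lift_single, one_smul]
  change (((List.ofFn fun j => xUnit q Q j ^ ((Pi.single i 1 : Fin d → ℤ) j)).prod :
    (Hecke d q Q)ˣ) : Hecke d q Q) = _
  have : (fun j => xUnit q Q j ^ ((Pi.single i 1 : Fin d → ℤ) j)) =
      fun j => if j = i then xUnit q Q i else 1 := by
    funext j
    by_cases h : j = i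
    · subst h; simp
    · simp [h]
  rw [this]
  have key : ∀ {n : ℕ} {M : Type _} [Monoid M] (i : Fin n) (u : M),
      (List.ofFn fun j : Fin n => if j = i then u else 1).prod = u := by
    intro n M _ i u
    induction n with
    | zero => exact i.elim0
    | succ n ih =>
      rw [List.ofFn_succ, List.prod_cons]
      refine Fin.cases ?_ (fun i => ?_) i
      · simp [List.ofFn_const, Fin.succ_ne_zero]
      · simp only [(Fin.succ_ne_zero i).symm, if_false, one_mul, Fin.succ_inj]
        exact ih i
  rw [key]
  rfl

/-- An induction principle for Laurent polynomials: a subalgebra which contains the variables and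
their inverses is everything. -/
theorem laurent_mem {A : Subalgebra k (Laurent k d)} (hx : ∀ i, x i ∈ A)
    (hinv : ∀ i, AddMonoidAlgebra.single (-Pi.single i 1) 1 ∈ A) (f : Laurent k d) : f ∈ A := by
  have key : ∀ a : Fin d → ℤ, (AddMonoidAlgebra.single a 1 : Laurent k d) ∈ A := by
    have hadd : ∀ a b : Fin d → ℤ, (AddMonoidAlgebra.single a 1 : Laurent k d) ∈ A →
        (AddMonoidAlgebra.single b 1 : Laurent k d) ∈ A →
        (AddMonoidAlgebra.single (a + b) 1 : Laurent k d) ∈ A := by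
      intro a b ha hb
      have := A.mul_mem ha hb
      rwa [AddMonoidAlgebra.single_mul_single, one_mul] at this
    have hn : ∀ (n : ℕ) (a : Fin d → ℤ), (AddMonoidAlgebra.single a 1 : Laurent k d) ∈ A →
        (AddMonoidAlgebra.single (n • a) 1 : Laurent k d) ∈ A := by
      intro n a ha
      have := A.pow_mem ha n
      rwa [AddMonoidAlgebra.single_pow, one_pow] at this
    intro a
    rw [← Finset.univ_sum_single a]
    refine Finset.sum_induction _ (fun a => (AddMonoidAlgebra.single a 1 : Laurent k d) ∈ A) hadd
      A.one_mem fun i _ => ?_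
    obtain ⟨n, hn' | hn'⟩ := Int.eq_nat_or_neg (a i)
    · have := hn n _ (hx i)
      rwa [← Pi.single_smul, nsmul_eq_mul, mul_one, ← hn'] at this
    · have := hn n _ (hinv i)
      rwa [smul_neg, ← Pi.single_smul, nsmul_eq_mul, mul_one, ← Pi.single_neg, ← hn'] at this
  induction f using AddMonoidAlgebra.induction_linear with
  | zero => exact A.zero_mem
  | add f g hf hg => exact A.add_mem hf hg
  | single a b =>
    have := A.smul_mem (key a) b
    rwa [AddMonoidAlgebra.smul_single, smul_eq_mul, mul_one] at this

theorem x_mul_inv (i : Fin d) :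
    (x i : Laurent k d) * AddMonoidAlgebra.single (-Pi.single i 1) 1 = 1 := by
  rw [x, AddMonoidAlgebra.single_mul_single, add_neg_cancel, one_mul]; rfl

theorem poly_mul (f g : Laurent k d) : poly d q Q (f * g) = poly d q Q f * poly d q Q g := by
  simp only [poly_eq, map_mul]

theorem poly_add (f g : Laurent k d) : poly d q Q (f + g) = poly d q Q f + poly d q Q g := by
  simp only [poly_eq, map_add]

theorem poly_one : poly d q Q (1 : Laurent k d) = 1 := by simp only [poly_eq, map_one]

theorem poly_xInv (i : Fin d) :
    poly d q Q (AddMonoidAlgebra.single (-Pi.single i 1) 1) = xInv d q Q i := by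
  have := poly_mul q Q (x i) (AddMonoidAlgebra.single (-Pi.single i 1) 1)
  rw [x_mul_inv, poly_one, poly_x] at this
  calc _ = xInv d q Q i * (xElt d q Q i * poly d q Q (AddMonoidAlgebra.single (-Pi.single i 1) 1))
      := by rw [← mul_assoc, xInv_mul_xElt, one_mul]
    _ = _ := by rw [← this, mul_one]

theorem poly_algebraMap (a : k) :
    poly d q Q (algebraMap k (Laurent k d) a) = algebraMap k (Hecke d q Q) a := by
  rw [poly_eq, AlgHom.commutes]

theorem E_mul_poly (c : Col ℓ d) (f : Laurent k d) :
    E q Q c * poly d q Q f = poly d q Q f * E q Q c := by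
  let A : Subalgebra k (Laurent k d) :=
    (Subalgebra.centralizer k {E q Q c}).comap (polyHom q Q)
  have hA : ∀ f, f ∈ A ↔ E q Q c * poly d q Q f = poly d q Q f * E q Q c := by
    intro f
    simp only [A, Subalgebra.mem_comap, Subalgebra.mem_centralizer_iff, Set.mem_singleton_iff,
      forall_eq, poly_eq]
  refine (hA f).1 (laurent_mem (fun i => (hA _).2 ?_) (fun i => (hA _).2 ?_) f)
  · rw [poly_x, E_mul_xElt]
  · rw [poly_xInv, E_mul_xInv]

end Poly

end Hecke

/-! ### A spanning set of the Hecke algebra -/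

section Move

variable {ℓ d : ℕ}

/-- The colour sequence at the top of a diagram with the underlying permutation `W` and the colour
sequence `c` at the bottom. -/
def Col.move (W : Equiv.Perm (Fin (ℓ + d))) (c : Col ℓ d) : Col ℓ d :=
  ⟨fun i => c.1 (W⁻¹ i), by rw [Equiv.sum_comp W⁻¹ (fun i => (c.1 i : ℕ))]; exact c.2⟩

theorem Col.move_apply (W : Equiv.Perm (Fin (ℓ + d))) (c : Col ℓ d) (i : Fin (ℓ + d)) :
    (c.move W).1 (W i) = c.1 i := by
  exact congrArg c.1 (W.symm_apply_apply i)

theorem Col.move_one (c : Col ℓ d) : c.move 1 = c := rfl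

theorem Col.move_mul (V W : Equiv.Perm (Fin (ℓ + d))) (c : Col ℓ d) :
    c.move (V * W) = (c.move W).move V := by
  apply Subtype.ext
  funext i
  change c.1 ((V * W)⁻¹ i) = c.1 (W⁻¹ (V⁻¹ i))
  rw [mul_inv_rev]; rfl

theorem Col.move_simpleRefl (r : Fin (ℓ + d - 1)) (c : Col ℓ d) :
    c.move (simpleRefl r) = Col.swap r c := by
  apply Subtype.ext
  funext i
  change c.1 ((simpleRefl r)⁻¹ i) = c.1 (simpleRefl r i)
  rw [simpleRefl_inv]

theorem Col.exists_blackPerm (W : Equiv.Perm (Fin (ℓ + d))) (c : Col ℓ d) :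
    ∃ σ : Equiv.Perm (Fin d), ∀ i, (c.move W).blackPos (σ i) = W (c.blackPos i) := by
  have h : ∀ i, ∃ j, (c.move W).blackPos j = W (c.blackPos i) := fun i =>
    Col.exists_blackPos (by rw [Col.move_apply, c.blackPos_black])
  choose σ hσ using h
  have hinj : Function.Injective σ := fun i j hij => by
    have h1 := (hσ i).symm.trans ((congrArg _ hij).trans (hσ j))
    exact c.blackPos_strictMono.injective (W.injective h1)
  exact ⟨Equiv.ofBijective σ (Finite.injective_iff_bijective.1 hinj), hσ⟩

/-- The permutation of the black strands in a diagram with the underlying permutation `W`. -/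
def Col.blackPerm (W : Equiv.Perm (Fin (ℓ + d))) (c : Col ℓ d) : Equiv.Perm (Fin d) :=
  (c.exists_blackPerm W).choose

theorem Col.blackPos_blackPerm (W : Equiv.Perm (Fin (ℓ + d))) (c : Col ℓ d) (i : Fin d) :
    (c.move W).blackPos (c.blackPerm W i) = W (c.blackPos i) :=
  (c.exists_blackPerm W).choose_spec i

theorem Col.blackPerm_mul (V W : Equiv.Perm (Fin (ℓ + d))) (c : Col ℓ d) :
    c.blackPerm (V * W) = (c.move W).blackPerm V * c.blackPerm W := by
  ext i
  have h1 := c.blackPos_blackPerm (V * W) i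
  have h2 := (c.move W).blackPos_blackPerm V (c.blackPerm W i)
  rw [c.blackPos_blackPerm, ← Col.move_mul] at h2
  exact congrArg Fin.val ((c.move (V * W)).blackPos_strictMono.injective (h1.trans h2.symm))

theorem Col.blackPerm_one (c : Col ℓ d) : c.blackPerm 1 = 1 := by
  ext i
  exact congrArg Fin.val (c.blackPos_strictMono.injective (c.blackPos_blackPerm 1 i))

theorem Col.nr_le (c : Col ℓ d) (i : ℕ) : c.nr i ≤ ℓ :=
  (Finset.sum_le_sum_of_subset (Finset.filter_subset _ _)).trans_eq c.2

theorem Col.exists_red_number {c : Col ℓ d} {i : Fin (ℓ + d)} (h : c.1 i = 1) :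
    ∃ t : Fin ℓ, ∑ j ∈ Finset.Iic i, (c.1 j : ℕ) = t + 1 := by
  have h1 := c.nr_succ i
  have h2 := c.nr_le (i + 1)
  have h3 : ((c.1 i : Fin 2) : ℕ) = 1 := by rw [h]; rfl
  exact ⟨⟨c.nr i, by omega⟩, by rw [Col.sum_Iic, h1, h3]⟩

end Move

namespace Hecke

section Span

variable {k : Type*} [Field k] {ℓ d : ℕ} (q : k) (Q : Fin ℓ → k)

variable {q Q} in
theorem E_mul_tau (r : Fin (ℓ + d - 1)) (c : Col ℓ d) :
    E q Q c * tau q Q r = tau q Q r * E q Q (Col.swap r c) := by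
  rw [tau_mul_E, Col.swap_swap]

theorem dot_mul_E_eq (c : Col ℓ d) (i : Fin d) :
    dot q Q (c.blackPos i) * E q Q c = poly d q Q (x i) * E q Q c := by
  rw [poly_x, xElt_mul_E]

theorem exists_dot_mul_E (c : Col ℓ d) (p : Fin (ℓ + d)) :
    ∃ f : Laurent k d, dot q Q p * E q Q c = poly d q Q f * E q Q c := by
  rcases fin_two_cases (c.1 p) with h | h
  · obtain ⟨i, rfl⟩ := Col.exists_blackPos h
    exact ⟨x i, dot_mul_E_eq q Q c i⟩
  · exact ⟨0, by rw [dot_mul_E_red h, poly_eq, map_zero, zero_mul]⟩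

theorem exists_dot'_mul_E (c : Col ℓ d) (p : Fin (ℓ + d)) :
    ∃ f : Laurent k d, dot' q Q p * E q Q c = poly d q Q f * E q Q c := by
  rcases fin_two_cases (c.1 p) with h | h
  · obtain ⟨i, rfl⟩ := Col.exists_blackPos h
    exact ⟨_, by rw [poly_xInv q Q i, xInv_mul_E]⟩
  · exact ⟨0, by rw [dot'_mul_E_red h, poly_eq, map_zero, zero_mul]⟩

/-- A variable moves through a crossing, up to a term without the crossing. -/
theorem exists_x_mul_tau (r : Fin (ℓ + d - 1)) (c : Col ℓ d) (j : Fin d) :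
    ∃ g : Laurent k d, poly d q Q (x (c.blackPerm (simpleRefl r) j)) * tau q Q r * E q Q c =
      tau q Q r * poly d q Q (x j) * E q Q c + poly d q Q g * E q Q c := by
  have h1 : poly d q Q (x (c.blackPerm (simpleRefl r) j)) * tau q Q r * E q Q c =
      dot q Q (simpleRefl r (c.blackPos j)) * tau q Q r * E q Q c := by
    rw [mul_assoc, tau_mul_E, ← mul_assoc, ← dot_mul_E_eq, ← Col.move_simpleRefl,
      Col.blackPos_blackPerm, mul_assoc, Col.move_simpleRefl, ← tau_mul_E, ← mul_assoc]
  rw [h1, mul_assoc (tau q Q r), ← dot_mul_E_eq, ← mul_assoc]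
  by_cases hl : c.blackPos j = lo r
  · obtain ⟨a, ha, ha'⟩ := exists_dot_hi_mul_tau (q := q) (Q := Q) r c
    rw [hl, simpleRefl_lo, ha]
    obtain ⟨f, hf⟩ := exists_dot_mul_E q Q c (hi r)
    exact ⟨a • f, by rw [hf, poly_eq, poly_eq, map_smul, smul_mul_assoc]⟩
  · by_cases hh : c.blackPos j = hi r
    · obtain ⟨a, ha, ha'⟩ := exists_dot_lo_mul_tau (q := q) (Q := Q) r c
      rw [hh, simpleRefl_hi, ha]
      obtain ⟨f, hf⟩ := exists_dot_mul_E q Q c (hi r)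
      exact ⟨a • f, by rw [hf, poly_eq, poly_eq, map_smul, smul_mul_assoc]⟩
    · refine ⟨0, ?_⟩
      rw [simpleRefl_of_ne hl hh, tau_mul_dot hl hh, poly_eq, map_zero, zero_mul, add_zero]

/-- A Laurent polynomial moves through a crossing, up to a term without the crossing. -/
theorem exists_poly_mul_tau (r : Fin (ℓ + d - 1)) (c : Col ℓ d) (f : Laurent k d) :
    ∃ f' g : Laurent k d, poly d q Q f * tau q Q r * E q Q c =
      tau q Q r * poly d q Q f' * E q Q c + poly d q Q g * E q Q c := by
  -- the polynomials with the claimed property, for `f' = σ f`, form a subalgebra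
  let σ : Equiv.Perm (Fin d) := (c.blackPerm (simpleRefl r))⁻¹
  let p : Laurent k d → Prop := fun f => ∃ g : Laurent k d, poly d q Q f * tau q Q r * E q Q c =
    tau q Q r * poly d q Q (permute σ f) * E q Q c + poly d q Q g * E q Q c
  have hmul : ∀ f g, p f → p g → p (f * g) := by
    rintro f g ⟨f', hf⟩ ⟨g', hg⟩
    refine ⟨f' * permute σ g + f * g', ?_⟩
    calc poly d q Q (f * g) * tau q Q r * E q Q c
        = poly d q Q f * (poly d q Q g * tau q Q r * E q Q c) := by
          rw [poly_mul]; simp only [mul_assoc]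
      _ = poly d q Q f * tau q Q r * E q Q c * poly d q Q (permute σ g) +
            poly d q Q f * (poly d q Q g' * E q Q c) := by
          rw [hg, mul_add, mul_assoc (tau q Q r), ← E_mul_poly]; simp only [mul_assoc]
      _ = _ := by
          rw [hf, map_mul, poly_add, add_mul, add_mul, poly_mul, poly_mul, poly_mul, add_assoc]
          congr 1
          · rw [mul_assoc _ (E q Q c), E_mul_poly]; simp only [mul_assoc]
          · congr 1
            · rw [mul_assoc _ (E q Q c), E_mul_poly]; simp only [mul_assoc]
            · simp only [mul_assoc]
  have hadd : ∀ f g, p f → p g → p (f + g) := by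
    rintro f g ⟨f', hf⟩ ⟨g', hg⟩
    refine ⟨f' + g', ?_⟩
    rw [poly_add, add_mul, add_mul, hf, hg, map_add, poly_add, poly_add, mul_add, add_mul, add_mul]
    abel
  have halg : ∀ a, p (algebraMap k _ a) := by
    intro a
    refine ⟨0, ?_⟩
    rw [AlgHom.commutes, poly_algebraMap, Algebra.commutes, poly_eq q Q 0, map_zero, zero_mul,
      add_zero]
  let A : Subalgebra k (Laurent k d) :=
    { carrier := {f | p f}
      mul_mem' := fun {f g} hf hg => hmul f g hf hg
      add_mem' := fun {f g} hf hg => hadd f g hf hg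
      algebraMap_mem' := halg }
  have hx : ∀ i, p (x i) := by
    intro i
    obtain ⟨g, hg⟩ := exists_x_mul_tau q Q r c (σ i)
    refine ⟨g, ?_⟩
    rw [permute_x]
    have e : c.blackPerm (simpleRefl r) (σ i) = i := Equiv.apply_symm_apply _ _
    rwa [e] at hg
  obtain ⟨g, hg⟩ : p f := by
    refine laurent_mem (A := A) hx (fun i => ?_) f
    -- the claim for `x_i⁻¹` is that for `x_i`, multiplied by the inverses on both sides
    obtain ⟨g, hg⟩ := hx i
    set y : Laurent k d := AddMonoidAlgebra.single (-Pi.single i 1) 1 with hy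
    have e1 : poly d q Q y * poly d q Q (x i) = 1 := by
      rw [← poly_mul, mul_comm, x_mul_inv, poly_one]
    have e2 : poly d q Q (permute σ (x i)) * poly d q Q (permute σ y) = 1 := by
      rw [← poly_mul, ← map_mul, x_mul_inv, map_one, poly_one]
    refine ⟨-(y * g * permute σ y), ?_⟩
    have h1 : poly d q Q y * (poly d q Q (x i) * tau q Q r * E q Q c) * poly d q Q (permute σ y) =
        tau q Q r * poly d q Q (permute σ y) * E q Q c := by
      rw [mul_assoc (poly d q Q (x i)), ← mul_assoc, e1, one_mul, mul_assoc, E_mul_poly, mul_assoc]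
    rw [hg, mul_add, add_mul] at h1
    have h2 : poly d q Q y * (tau q Q r * poly d q Q (permute σ (x i)) * E q Q c) *
        poly d q Q (permute σ y) = poly d q Q y * tau q Q r * E q Q c := by
      have : E q Q c = poly d q Q (permute σ (x i)) * (E q Q c * poly d q Q (permute σ y)) := by
        rw [E_mul_poly, ← mul_assoc, e2, one_mul]
      conv_rhs => rw [this]
      simp only [mul_assoc]
    have h3 : poly d q Q y * (poly d q Q g * E q Q c) * poly d q Q (permute σ y) =
        poly d q Q (y * g * permute σ y) * E q Q c := by
      rw [mul_assoc, mul_assoc (poly d q Q g), E_mul_poly, poly_mul, poly_mul]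
      simp only [mul_assoc]
    rw [h2, h3] at h1
    rw [← h1, add_assoc, ← add_mul, ← poly_add, add_neg_cancel, poly_eq q Q 0, map_zero, zero_mul,
      add_zero]
  exact ⟨_, g, hg⟩

/-- A double crossing is a combination of the crossing and dots. -/
theorem exists_tau_sq (r : Fin (ℓ + d - 1)) (c : Col ℓ d) :
    ∃ f g : Laurent k d, tau q Q r * tau q Q r * E q Q c =
      tau q Q r * poly d q Q f * E q Q c + poly d q Q g * E q Q c := by
  have hz : tau q Q r * poly d q Q 0 * E q Q c = 0 := by
    rw [poly_eq, map_zero, mul_zero, zero_mul]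
  rcases fin_two_cases (c.1 (lo r)) with h | h <;> rcases fin_two_cases (c.1 (hi r)) with h' | h'
  · refine ⟨algebraMap k _ (q - 1), algebraMap k _ q, ?_⟩
    rw [poly_algebraMap, poly_algebraMap, ← Algebra.commutes, mul_assoc (algebraMap _ _ _),
      ← Algebra.smul_def, ← Algebra.smul_def]
    have := mk_eq_of_rel q Q (HRel.T_sq_black (q := q) (Q := Q) r c h h')
    simp only [map_mul, map_add, map_smul] at this
    exact this
  · obtain ⟨t, ht⟩ := Col.exists_red_number h'
    obtain ⟨f, hf⟩ := exists_dot_mul_E q Q c (lo r)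
    refine ⟨0, f - algebraMap k _ (Q t), ?_⟩
    rw [hz, zero_add, poly_eq, map_sub, sub_mul, ← poly_eq, ← poly_eq, ← hf, poly_algebraMap,
      ← Algebra.smul_def]
    have := mk_eq_of_rel q Q (HRel.T_sq_black_red (q := q) (Q := Q) r c t h h' ht)
    simp only [map_mul, map_sub, map_smul] at this
    exact this
  · obtain ⟨t, ht⟩ := Col.exists_red_number h
    obtain ⟨f, hf⟩ := exists_dot_mul_E q Q c (hi r)
    refine ⟨0, f - algebraMap k _ (Q t), ?_⟩
    rw [hz, zero_add, poly_eq, map_sub, sub_mul, ← poly_eq, ← poly_eq, ← hf, poly_algebraMap,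
      ← Algebra.smul_def]
    have := mk_eq_of_rel q Q (HRel.T_sq_red_black (q := q) (Q := Q) r c t h h' ht)
    simp only [map_mul, map_sub, map_smul] at this
    exact this
  · refine ⟨0, 0, ?_⟩
    rw [hz, poly_eq, map_zero, zero_mul, mul_assoc, tau_mul_E_red h h', mul_zero, add_zero]

/-- The braid relation holds up to dots. -/
theorem exists_braid {r s : Fin (ℓ + d - 1)} (hs : (s : ℕ) = r + 1) (c : Col ℓ d) :
    ∃ f : Laurent k d, tau q Q r * tau q Q s * tau q Q r * E q Q c =
      tau q Q s * tau q Q r * tau q Q s * E q Q c + poly d q Q f * E q Q c := by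
  have e : lo s = hi r := Fin.ext hs
  have hz : poly d q Q 0 * E q Q c = 0 := by rw [poly_eq, map_zero, zero_mul]
  obtain ⟨h1, h2, h3, h4, h5, h6, -, -⟩ := adjacent_facts hs
  by_cases h : c.1 (hi r) = 0
  · refine ⟨0, ?_⟩
    have := mk_eq_of_rel q Q (HRel.braid_black (q := q) (Q := Q) r s c hs h)
    simp only [map_mul, map_sub, map_zero, sub_mul] at this
    rw [hz, add_zero]
    exact sub_eq_zero.1 this
  · replace h := fin_two_ne_zero h
    by_cases h0 : c.1 (lo r) = 0 ∧ c.1 (hi s) = 0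
    · obtain ⟨f, hf⟩ := exists_dot_mul_E q Q c (hi s)
      refine ⟨(1 - q) • f, ?_⟩
      have := mk_eq_of_rel q Q (HRel.braid_red (q := q) (Q := Q) r s c hs h h0.1 h0.2)
      simp only [map_mul, map_sub, map_smul, sub_mul] at this
      rw [poly_eq, map_smul, smul_mul_assoc, ← poly_eq, ← hf]
      exact eq_add_of_sub_eq' this
    · refine ⟨0, ?_⟩
      rw [hz, add_zero]
      -- two red strands are among the three, and they cross in both diagrams
      have a1 : tau q Q r * tau q Q s * tau q Q r * E q Q c = 0 ∧
          tau q Q s * tau q Q r * tau q Q s * E q Q c = 0 := by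
        by_cases h0' : c.1 (lo r) = 0
        · have h2' := fin_two_ne_zero fun h2 => h0 ⟨h0', h2⟩
          constructor
          · rw [mul_assoc, tau_mul_E, ← mul_assoc, mul_assoc (tau q Q r), tau_mul_E,
              ← mul_assoc, tau_mul_E_red, zero_mul, zero_mul]
            · rw [Col.swap_apply, Col.swap_apply, h4, h1, e, h]
            · rw [← e, Col.swap_apply, Col.swap_apply, h5, h3, h2']
          · rw [mul_assoc, tau_mul_E_red (by rw [e, h]) h2', mul_zero]
        · replace h0' := fin_two_ne_zero h0'
          constructor
          · rw [mul_assoc, tau_mul_E_red h0' h, mul_zero]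
          · rw [mul_assoc, tau_mul_E, ← mul_assoc, mul_assoc (tau q Q s), tau_mul_E,
              ← mul_assoc, tau_mul_E_red, zero_mul, zero_mul]
            · rw [Col.swap_apply, Col.swap_apply, h2, h4, h0']
            · rw [Col.swap_apply, Col.swap_apply, h3, h6, e, h]
      rw [a1.1, a1.2]

end Span

end Hecke

namespace Hecke

/-! ### The filtration of the Hecke algebra by the number of crossings -/

section Filtration

variable {k : Type*} [Field k] {ℓ d : ℕ} (q : k) (Q : Fin ℓ → k)

/-- The product of crossings along a word. -/
def tauWord (L : List (Fin (ℓ + d - 1))) : Hecke d q Q := (L.map (tau q Q)).prod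

theorem tauWord_nil : tauWord q Q ([] : List (Fin (ℓ + d - 1))) = 1 := rfl

theorem tauWord_cons (r : Fin (ℓ + d - 1)) (L : List (Fin (ℓ + d - 1))) :
    tauWord q Q (r :: L) = tau q Q r * tauWord q Q L := by
  rw [tauWord, List.map_cons, List.prod_cons, tauWord]

theorem tauWord_append (L M : List (Fin (ℓ + d - 1))) :
    tauWord q Q (L ++ M) = tauWord q Q L * tauWord q Q M := by
  rw [tauWord, List.map_append, List.prod_append, tauWord, tauWord]

/-- The span of the diagrams with fewer than `n` crossings and with all dots at the bottom. -/
def few (n : ℕ) : Submodule k (Hecke d q Q) :=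
  Submodule.span k {z | ∃ (L : List (Fin (ℓ + d - 1))) (f : Laurent k d) (c : Col ℓ d),
    L.length < n ∧ z = tauWord q Q L * (poly d q Q f * E q Q c)}

variable {q Q}

theorem few_mono {m n : ℕ} (h : m ≤ n) : few (d := d) q Q m ≤ few q Q n :=
  Submodule.span_mono fun _ ⟨L, f, c, hL, hz⟩ => ⟨L, f, c, hL.trans_le h, hz⟩

theorem mem_few (L : List (Fin (ℓ + d - 1))) (f : Laurent k d) (c : Col ℓ d) {n : ℕ}
    (h : L.length < n) : tauWord q Q L * (poly d q Q f * E q Q c) ∈ few q Q n :=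
  Submodule.subset_span ⟨L, f, c, h, rfl⟩

theorem poly_mul_E_mem_few (f : Laurent k d) (c : Col ℓ d) (n : ℕ) :
    poly d q Q f * E q Q c ∈ few q Q (n + 1) := by
  have := mem_few (q := q) (Q := Q) [] f c (n := n + 1) (Nat.succ_pos n)
  rwa [tauWord_nil, one_mul] at this

theorem tauWord_mem_few (L : List (Fin (ℓ + d - 1))) : tauWord q Q L ∈ few q Q (L.length + 1) := by
  have h : tauWord q Q L = ∑ c, tauWord q Q L * (poly d q Q 1 * E q Q c) := by
    rw [← Finset.mul_sum, ← Finset.mul_sum, sum_E, mul_one, poly_one, mul_one]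
  rw [h]
  exact Submodule.sum_mem _ fun c _ => mem_few L 1 c (Nat.lt_succ_self _)

theorem tauWord_mul_mem_few (M : List (Fin (ℓ + d - 1))) {n : ℕ} {z : Hecke d q Q}
    (hz : z ∈ few q Q n) : tauWord q Q M * z ∈ few q Q (M.length + n) := by
  refine Submodule.span_induction (p := fun z _ => tauWord q Q M * z ∈ few q Q (M.length + n))
    ?_ ?_ ?_ ?_ hz
  · rintro _ ⟨L, f, c, hL, rfl⟩
    rw [← mul_assoc, ← tauWord_append]
    exact mem_few _ f c (by rw [List.length_append]; omega)
  · rw [mul_zero]; exact Submodule.zero_mem _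
  · intro y z _ _ hy hz
    rw [mul_add]; exact Submodule.add_mem _ hy hz
  · intro a z _ hz
    rw [mul_smul_comm]; exact Submodule.smul_mem _ a hz

theorem tau_mul_mem_few (r : Fin (ℓ + d - 1)) {n : ℕ} {z : Hecke d q Q}
    (hz : z ∈ few q Q n) : tau q Q r * z ∈ few q Q (n + 1) := by
  have := tauWord_mul_mem_few [r] hz
  rwa [tauWord_cons, tauWord_nil, mul_one, List.length_singleton, add_comm] at this

theorem mem_few_mul_poly {n : ℕ} {z : Hecke d q Q} (hz : z ∈ few q Q n) (f : Laurent k d)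
    (c : Col ℓ d) : z * (poly d q Q f * E q Q c) ∈ few q Q n := by
  refine Submodule.span_induction (p := fun z _ => z * (poly d q Q f * E q Q c) ∈ few q Q n)
    ?_ ?_ ?_ ?_ hz
  · rintro _ ⟨L, g, b, hL, rfl⟩
    rw [mul_assoc, mul_assoc, ← mul_assoc (E q Q b), E_mul_poly, mul_assoc, E_mul_E]
    split_ifs with h
    · rw [← mul_assoc (poly d q Q g), ← poly_mul]
      exact mem_few L _ c hL
    · rw [mul_zero, mul_zero, mul_zero]; exact Submodule.zero_mem _
  · rw [zero_mul]; exact Submodule.zero_mem _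
  · intro y z _ _ hy hz
    rw [add_mul]; exact Submodule.add_mem _ hy hz
  · intro a z _ hz
    rw [smul_mul_assoc]; exact Submodule.smul_mem _ a hz

/-- Dots move from the top of a diagram to the bottom at the cost of diagrams with fewer crossings.
-/
theorem poly_mul_E_mul_tauWord_mem_few (f : Laurent k d) (c : Col ℓ d)
    (L : List (Fin (ℓ + d - 1))) :
    poly d q Q f * E q Q c * tauWord q Q L ∈ few q Q (L.length + 1) := by
  induction L generalizing f c with
  | nil =>
    rw [tauWord_nil, mul_one]
    exact poly_mul_E_mem_few f c 0
  | cons r L ih =>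
    obtain ⟨f', g, h⟩ := exists_poly_mul_tau q Q r (Col.swap r c) f
    have e : poly d q Q f * E q Q c * tauWord q Q (r :: L) =
        tau q Q r * (poly d q Q f' * E q Q (Col.swap r c) * tauWord q Q L) +
          poly d q Q g * E q Q (Col.swap r c) * tauWord q Q L := by
      rw [tauWord_cons, ← mul_assoc, mul_assoc (poly d q Q f), E_mul_tau, ← mul_assoc, h, add_mul]
      simp only [mul_assoc]
    rw [e, List.length_cons]
    exact Submodule.add_mem _ (tau_mul_mem_few r (ih f' _)) (few_mono (Nat.le_succ _) (ih g _))

theorem mem_few_mul_tauWord {n : ℕ} {z : Hecke d q Q} (hz : z ∈ few q Q n)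
    (L : List (Fin (ℓ + d - 1))) : z * tauWord q Q L ∈ few q Q (n + L.length) := by
  refine Submodule.span_induction (p := fun z _ => z * tauWord q Q L ∈ few q Q (n + L.length))
    ?_ ?_ ?_ ?_ hz
  · rintro _ ⟨M, g, b, hM, rfl⟩
    rw [mul_assoc]
    exact few_mono (by omega) (tauWord_mul_mem_few M (poly_mul_E_mul_tauWord_mem_few g b L))
  · rw [zero_mul]; exact Submodule.zero_mem _
  · intro y z _ _ hy hz
    rw [add_mul]; exact Submodule.add_mem _ hy hz
  · intro a z _ hz
    rw [smul_mul_assoc]; exact Submodule.smul_mem _ a hz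

theorem eq_add_add_neg_one_smul {R : Type*} [Ring R] [Algebra k R] (y z : R) :
    y = y + z + (-1 : k) • z := by
  rw [neg_smul, one_smul, add_neg_cancel_right]

variable (q Q) in
/-- Two words are congruent if they have the same length and their products of crossings are the
same up to diagrams with fewer crossings. Matsumoto's theorem applies to the quotient monoid. -/
def wordCon (d : ℕ) : Con (FreeMonoid (Fin (ℓ + d - 1))) where
  r L M := L.toList.length = M.toList.length ∧ ∃ z ∈ few q Q L.toList.length,
    tauWord q Q L.toList = tauWord q Q M.toList + z
  iseqv :=
    { refl := fun _ => ⟨rfl, 0, Submodule.zero_mem _, (add_zero _).symm⟩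
      symm := by
        rintro L M ⟨h, z, hz, e⟩
        refine ⟨h.symm, (-1 : k) • z, Submodule.smul_mem _ _ (h ▸ hz), ?_⟩
        rw [e]
        exact eq_add_add_neg_one_smul _ z
      trans := by
        rintro L M N ⟨h, z, hz, e⟩ ⟨h', z', hz', e'⟩
        exact ⟨h.trans h', z' + z, Submodule.add_mem _ (h ▸ hz') hz, by rw [e, e', add_assoc]⟩ }
  mul' := by
    rintro L M L' M' ⟨h, z, hz, e⟩ ⟨h', z', hz', e'⟩
    refine ⟨?_, z * tauWord q Q L'.toList + tauWord q Q M.toList * z', ?_, ?_⟩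
    · rw [FreeMonoid.toList_mul, FreeMonoid.toList_mul, List.length_append, List.length_append, h,
        h']
    · rw [FreeMonoid.toList_mul, List.length_append]
      exact Submodule.add_mem _ (mem_few_mul_tauWord hz _) (h ▸ tauWord_mul_mem_few _ hz')
    · rw [FreeMonoid.toList_mul, FreeMonoid.toList_mul, tauWord_append, tauWord_append, e, add_mul]
      nth_rewrite 1 [e']
      rw [mul_add, add_assoc, add_comm (tauWord q Q M.toList * z')]

theorem exists_mem_few_braid {r s : Fin (ℓ + d - 1)} (hs : (s : ℕ) = r + 1) :
    ∃ z ∈ few q Q 3, tauWord q Q [r, s, r] = tauWord q Q [s, r, s] + z := by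
  choose f hf using exists_braid q Q (d := d) hs
  refine ⟨∑ c, poly d q Q (f c) * E q Q c,
    Submodule.sum_mem _ fun c _ => poly_mul_E_mem_few (f c) c 2, ?_⟩
  simp only [tauWord_cons, tauWord_nil, mul_one, ← mul_assoc]
  refine ext_E fun c => ?_
  rw [hf, add_mul, Finset.sum_mul, Finset.sum_eq_single c]
  · rw [mul_assoc (poly d q Q _), E_mul_self]
  · intro b _ hb
    rw [mul_assoc, E_mul_E, if_neg hb, mul_zero]
  · exact fun h => absurd (Finset.mem_univ c) h

theorem exists_mem_few_sq (r : Fin (ℓ + d - 1)) : tauWord q Q [r, r] ∈ few q Q 2 := by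
  have h : tauWord q Q [r, r] = ∑ c, tau q Q r * tau q Q r * E q Q c := by
    simp only [tauWord_cons, tauWord_nil, mul_one]
    rw [← Finset.mul_sum, sum_E, mul_one]
  rw [h]
  refine Submodule.sum_mem _ fun c _ => ?_
  obtain ⟨f, g, hfg⟩ := exists_tau_sq q Q r c
  rw [hfg, mul_assoc]
  exact Submodule.add_mem _ (tau_mul_mem_few r (poly_mul_E_mem_few f c 0))
    (poly_mul_E_mem_few g c 1)

theorem braidRel_wordCon :
    BraidRel fun r => ((FreeMonoid.of r : FreeMonoid (Fin (ℓ + d - 1))) : (wordCon q Q d).Quotient)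
    where
  comm r s h := by
    rw [← Con.coe_mul, ← Con.coe_mul, Con.eq]
    refine ⟨rfl, 0, Submodule.zero_mem _, ?_⟩
    change tauWord q Q [r, s] = tauWord q Q [s, r] + 0
    simp only [tauWord_cons, tauWord_nil, mul_one, add_zero]
    exact tau_mul_tau h
  braid r s h := by
    rw [← Con.coe_mul, ← Con.coe_mul, ← Con.coe_mul, ← Con.coe_mul, Con.eq]
    exact ⟨rfl, exists_mem_few_braid h⟩

/-- Two reduced words of the same permutation give the same product of crossings, up to diagrams
with fewer crossings. -/
theorem exists_mem_few_of_reduced {L M : List (Fin (ℓ + d - 1))}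
    (e : (L.map simpleRefl).prod = (M.map simpleRefl).prod)
    (hL : len (L.map simpleRefl).prod = L.length) (hM : len (M.map simpleRefl).prod = M.length) :
    ∃ z ∈ few q Q L.length, tauWord q Q L = tauWord q Q M + z := by
  have h := (braidRel_wordCon (q := q) (Q := Q) (d := d)).prod_eq e hL.symm hM.symm
  have key : ∀ L : List (Fin (ℓ + d - 1)), (L.map fun r =>
      ((FreeMonoid.of r : FreeMonoid (Fin (ℓ + d - 1))) : (wordCon q Q d).Quotient)).prod =
        ((FreeMonoid.ofList L : FreeMonoid _) : (wordCon q Q d).Quotient) := by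
    intro L
    induction L with
    | nil => rfl
    | cons r L ih => rw [List.map_cons, List.prod_cons, ih, ← Con.coe_mul]; rfl
  rw [key, key, Con.eq] at h
  exact h.2

/-- The product of crossings along a word which is not reduced is a combination of diagrams with
fewer crossings. -/
theorem tauWord_mem_few_of_not_reduced (L : List (Fin (ℓ + d - 1)))
    (h : len (L.map simpleRefl).prod ≠ L.length) : tauWord q Q L ∈ few q Q L.length := by
  induction L with
  | nil => exact absurd len_one h
  | cons r L ih =>
    by_cases hL : len (L.map simpleRefl).prod = L.length
    · rw [List.map_cons, List.prod_cons, List.length_cons] at h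
      set w := (L.map simpleRefl).prod with hw
      have hr : ¬ IsAscent w r := fun hr => h (by rw [len_of_isAscent hr, hL])
      have hlen := len_of_not_isAscent hr
      set M := reducedWord (simpleRefl r * w) with hM
      have e1 : ((r :: M).map simpleRefl).prod = w := by
        rw [List.map_cons, List.prod_cons, hM, reducedWord_prod, ← mul_assoc, simpleRefl_mul_self,
          one_mul]
      have e2 : M.length = len (simpleRefl r * w) := reducedWord_length _
      obtain ⟨z, hz, e⟩ := exists_mem_few_of_reduced (q := q) (Q := Q) (L := L) (M := r :: M)
        (by rw [e1]) hL (by rw [e1, List.length_cons]; omega)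
      -- the reduced word `L` may be replaced by `r M`, so that the square of a crossing appears
      rw [tauWord_cons, e, mul_add, List.length_cons]
      refine Submodule.add_mem _ ?_ (tau_mul_mem_few r hz)
      have e3 : tau q Q r * tauWord q Q (r :: M) = tauWord q Q [r, r] * tauWord q Q M := by
        rw [← tauWord_append, ← tauWord_cons]; rfl
      rw [e3]
      exact few_mono (by omega) (mem_few_mul_tauWord (exists_mem_few_sq r) M)
    · rw [tauWord_cons, List.length_cons]
      exact tau_mul_mem_few r (ih hL)

variable (q Q) in
/-- The span of the diagrams of reduced words, with dots at the bottom. -/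
def reducedSpan (d : ℕ) : Submodule k (Hecke d q Q) :=
  Submodule.span k {z | ∃ (W : Equiv.Perm (Fin (ℓ + d))) (f : Laurent k d) (c : Col ℓ d),
    z = tauWord q Q (reducedWord W) * (poly d q Q f * E q Q c)}

/-- By induction on the number of crossings, words may be replaced by fixed reduced words. -/
theorem few_le_reducedSpan (n : ℕ) : few q Q n ≤ reducedSpan q Q d := by
  induction n with
  | zero =>
    refine Submodule.span_le.2 ?_
    rintro _ ⟨L, f, c, hL, rfl⟩
    omega
  | succ n ih =>
    refine Submodule.span_le.2 ?_
    rintro _ ⟨L, f, c, hL, rfl⟩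
    have hn : few (d := d) q Q L.length ≤ reducedSpan q Q d :=
      (few_mono (by omega)).trans ih
    by_cases h : len (L.map simpleRefl).prod = L.length
    · obtain ⟨z, hz, e⟩ := exists_mem_few_of_reduced (q := q) (Q := Q) (L := L)
        (M := reducedWord (L.map simpleRefl).prod) (by rw [reducedWord_prod]) h
        (by rw [reducedWord_prod, reducedWord_length])
      rw [e, add_mul]
      exact Submodule.add_mem _ (Submodule.subset_span ⟨_, f, c, rfl⟩)
        (hn (mem_few_mul_poly hz f c))
    · exact hn (mem_few_mul_poly (tauWord_mem_few_of_not_reduced L h) f c)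

variable (q Q) in
/-- The diagrams with dots at the bottom span a subalgebra which contains the generators. -/
theorem exists_mem_few (y : Hecke d q Q) : ∃ n, y ∈ few q Q n := by
  let A : Subalgebra k (Hecke d q Q) :=
    { carrier := {y | ∃ n, y ∈ few q Q n}
      mul_mem' := by
        rintro y z ⟨m, hy⟩ ⟨n, hz⟩
        refine ⟨m + n, ?_⟩
        refine Submodule.span_induction (p := fun z _ => y * z ∈ few q Q (m + n)) ?_ ?_ ?_ ?_ hz
        · rintro _ ⟨L, f, c, hL, rfl⟩
          rw [← mul_assoc]
          exact few_mono (by omega) (mem_few_mul_poly (mem_few_mul_tauWord hy L) f c)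
        · rw [mul_zero]; exact Submodule.zero_mem _
        · intro u v _ _ hu hv
          rw [mul_add]; exact Submodule.add_mem _ hu hv
        · intro a u _ hu
          rw [mul_smul_comm]; exact Submodule.smul_mem _ a hu
      add_mem' := by
        rintro y z ⟨m, hy⟩ ⟨n, hz⟩
        exact ⟨max m n, Submodule.add_mem _ (few_mono (le_max_left _ _) hy)
          (few_mono (le_max_right _ _) hz)⟩
      algebraMap_mem' := by
        intro a
        refine ⟨1, ?_⟩
        rw [Algebra.algebraMap_eq_smul_one]
        exact Submodule.smul_mem _ a (tauWord_mem_few []) }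
  have hgen : ∀ g, gen d q Q g ∈ A := by
    rintro (c | r | i | i)
    · have := poly_mul_E_mem_few (q := q) (Q := Q) 1 c 0
      rw [poly_one, one_mul] at this
      exact ⟨1, this⟩
    · have := tauWord_mem_few (q := q) (Q := Q) [r]
      rw [tauWord_cons, tauWord_nil, mul_one] at this
      exact ⟨2, this⟩
    · refine ⟨1, ?_⟩
      change dot q Q i ∈ _
      rw [← mul_one (dot q Q i), ← sum_E, Finset.mul_sum]
      refine Submodule.sum_mem _ fun c _ => ?_
      obtain ⟨f, hf⟩ := exists_dot_mul_E q Q c i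
      rw [hf]
      exact poly_mul_E_mem_few f c 0
    · refine ⟨1, ?_⟩
      change dot' q Q i ∈ _
      rw [← mul_one (dot' q Q i), ← sum_E, Finset.mul_sum]
      refine Submodule.sum_mem _ fun c _ => ?_
      obtain ⟨f, hf⟩ := exists_dot'_mul_E q Q c i
      rw [hf]
      exact poly_mul_E_mem_few f c 0
  obtain ⟨a, rfl⟩ := RingQuot.mkAlgHom_surjective k (HRel d q Q) y
  change RingQuot.mkAlgHom k (HRel d q Q) a ∈ A
  induction a using FreeAlgebra.induction with
  | grade0 r => rw [AlgHom.commutes]; exact A.algebraMap_mem r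
  | grade1 g => exact hgen g
  | mul a b ha hb => rw [map_mul]; exact A.mul_mem ha hb
  | add a b ha hb => rw [map_add]; exact A.add_mem ha hb

/-- The diagrams of reduced words span the Hecke algebra over the Laurent polynomials. -/
theorem exists_eq_sum_tauWord (y : Hecke d q Q) (c : Col ℓ d) :
    ∃ f : Equiv.Perm (Fin (ℓ + d)) → Laurent k d,
      y * E q Q c = ∑ W, tauWord q Q (reducedWord W) * (poly d q Q (f W) * E q Q c) := by
  obtain ⟨n, hn⟩ := exists_mem_few q Q y
  have hy := few_le_reducedSpan n hn
  refine Submodule.span_induction (p := fun y _ => ∃ f : Equiv.Perm (Fin (ℓ + d)) → Laurent k d,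
      y * E q Q c = ∑ W, tauWord q Q (reducedWord W) * (poly d q Q (f W) * E q Q c)) ?_ ?_ ?_ ?_ hy
  · rintro _ ⟨W, f, b, rfl⟩
    refine ⟨Pi.single W (if b = c then f else 0), ?_⟩
    rw [Finset.sum_eq_single W]
    · rw [Pi.single_eq_same, mul_assoc, mul_assoc, E_mul_E]
      split_ifs with h
      · rfl
      · rw [mul_zero, poly_eq, map_zero, zero_mul]
    · intro V _ hV
      rw [Pi.single_eq_of_ne hV, poly_eq, map_zero, zero_mul, mul_zero]
    · exact fun h => absurd (Finset.mem_univ W) h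
  · refine ⟨0, ?_⟩
    simp only [Pi.zero_apply, poly_eq, map_zero, zero_mul, mul_zero, Finset.sum_const_zero]
  · rintro y z _ _ ⟨f, hf⟩ ⟨g, hg⟩
    refine ⟨f + g, ?_⟩
    rw [add_mul, hf, hg, ← Finset.sum_add_distrib]
    refine Finset.sum_congr rfl fun W _ => ?_
    rw [Pi.add_apply, poly_add, add_mul, mul_add]
  · rintro a y _ ⟨f, hf⟩
    refine ⟨a • f, ?_⟩
    rw [smul_mul_assoc, hf, Finset.smul_sum]
    refine Finset.sum_congr rfl fun W _ => ?_
    rw [Pi.smul_apply, poly_eq q Q (a • _), map_smul, ← poly_eq, smul_mul_assoc, mul_smul_comm]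

end Filtration

end Hecke

/-! ### The polynomial representation of the Hecke algebra is faithful -/

section Faithful

variable {k : Type*} [Field k] {ℓ d : ℕ} (q : k) (Q : Fin ℓ → k)

open Hecke

theorem x_sub_algebraMap_ne_zero (i : Fin d) (a : k) :
    (x i - algebraMap k (Laurent k d) a) ≠ 0 := by
  intro e
  have h1 : (Pi.single i 1 : Fin d → ℤ) ≠ 0 := by
    intro e'
    have := congrFun e' i
    simp at this
  rw [sub_eq_zero] at e
  have h2 := congrArg (fun f : Laurent k d => f.coeff (Pi.single i 1)) e
  simp [x] at h2

theorem act_E_single (b c : Col ℓ d) (f : Laurent k d) :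
    act q Q d (E q Q b) (Pi.single c f) = if b = c then Pi.single c f else 0 := by
  rw [E, act_gen, genAct_e_single]

theorem act_tau_single (r : Fin (ℓ + d - 1)) (c : Col ℓ d) (f : Laurent k d) :
    act q Q d (tau q Q r) (Pi.single c f) = Pi.single (Col.swap r c)
      (crossOp q Q d (c.1 (lo r)) (c.1 (hi r)) (c.nb r) (c.nr r) f) := by
  rw [tau, act_gen, genAct_T_single]

theorem act_mul_E_single (y : Hecke d q Q) (c : Col ℓ d) (f : Laurent k d) :
    act q Q d (y * E q Q c) (Pi.single c f) = act q Q d y (Pi.single c f) := by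
  rw [map_mul, Module.End.mul_apply, act_E_single, if_pos rfl]

theorem act_xElt_single (i : Fin d) (c : Col ℓ d) (f : Laurent k d) :
    act q Q d (xElt d q Q i) (Pi.single c f) = Pi.single c (x i * f) := by
  rw [← act_mul_E_single, xElt_mul_E, act_mul_E_single, dot, act_gen, genAct_X_single,
    if_pos (c.blackPos_black i), c.nb_blackPos, xN_eq i.2]

theorem act_xInv_single (i : Fin d) (c : Col ℓ d) (f : Laurent k d) :
    act q Q d (xInv d q Q i) (Pi.single c f) =
      Pi.single c (AddMonoidAlgebra.single (-Pi.single i 1) 1 * f) := by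
  have h : (Pi.single c f : PolRep k ℓ d) = act q Q d (xElt d q Q i)
      (Pi.single c (AddMonoidAlgebra.single (-Pi.single i 1) 1 * f)) := by
    rw [act_xElt_single, ← mul_assoc, x_mul_inv, one_mul]
  rw [h, ← Module.End.mul_apply, ← map_mul, xInv_mul_xElt, map_one, Module.End.one_apply]

theorem act_poly_single (f : Laurent k d) (c : Col ℓ d) (g : Laurent k d) :
    act q Q d (poly d q Q f) (Pi.single c g) = Pi.single c (f * g) := by
  let A : Subalgebra k (Laurent k d) :=
    { carrier := {f | ∀ g, act q Q d (poly d q Q f) (Pi.single c g) = Pi.single c (f * g)}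
      mul_mem' := fun {u v} hu hv g => by
        rw [poly_mul, map_mul, Module.End.mul_apply, hv, hu, mul_assoc]
      add_mem' := fun {u v} hu hv g => by
        rw [poly_add, map_add, LinearMap.add_apply, hv, hu, add_mul, Pi.single_add]
      algebraMap_mem' := fun a g => by
        rw [poly_algebraMap, AlgHom.commutes, Module.algebraMap_end_apply, ← Pi.single_smul,
          Algebra.smul_def] }
  refine laurent_mem (A := A) (fun i g => ?_) (fun i g => ?_) f g
  · rw [poly_x, act_xElt_single]
  · rw [poly_xInv, act_xInv_single]

variable {q Q}

theorem tauWord_mul_E (L : List (Fin (ℓ + d - 1))) (c : Col ℓ d) :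
    tauWord q Q L * E q Q c = E q Q (c.move (L.map simpleRefl).prod) * tauWord q Q L := by
  induction L with
  | nil => rw [tauWord_nil, one_mul, mul_one, List.map_nil, List.prod_nil, Col.move_one]
  | cons r L ih =>
    rw [tauWord_cons, mul_assoc, ih, ← mul_assoc, tau_mul_E, List.map_cons, List.prod_cons,
      Col.move_mul, Col.move_simpleRefl, mul_assoc]

/-- `W` keeps the order of the red strands of `c`. -/
def RedMono (c : Col ℓ d) (W : Equiv.Perm (Fin (ℓ + d))) : Prop :=
  ∀ a b, c.1 a = 1 → c.1 b = 1 → a < b → W a < W b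

/-- A diagram in which red strands cross is zero: in the shortest end of the word with this
property, the last crossing is one of two adjacent red strands. -/
theorem tauWord_mul_E_eq_zero {L : List (Fin (ℓ + d - 1))} {c : Col ℓ d}
    (h : ¬ RedMono c (L.map simpleRefl).prod) : tauWord q Q L * E q Q c = 0 := by
  induction L with
  | nil => exact absurd (fun a b _ _ hab => hab) h
  | cons r L ih =>
    rw [tauWord_cons, mul_assoc]
    by_cases hL : RedMono c (L.map simpleRefl).prod
    · set w := (L.map simpleRefl).prod with hw
      have h1 : ∃ a b, c.1 a = 1 ∧ c.1 b = 1 ∧ w a = lo r ∧ w b = hi r := by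
        by_contra hn
        refine h fun a b ha hb hab => ?_
        rw [List.map_cons, List.prod_cons, ← hw]
        exact simpleRefl_lt (hL a b ha hb hab) fun h => hn ⟨a, b, ha, hb, h.1, h.2⟩
      obtain ⟨a, b, ha, hb, hal, hbh⟩ := h1
      rw [tauWord_mul_E, ← hw, ← mul_assoc, tau_mul_E_red, zero_mul]
      · rw [← hal, Col.move_apply, ha]
      · rw [← hbh, Col.move_apply, hb]
    · rw [ih hL, mul_zero]

theorem IsExpansion.mul_left {O : Laurent k d → Rat k d} {a : Equiv.Perm (Fin d) → Rat k d}
    (h : IsExpansion O a) (m : Rat k d) : IsExpansion (fun f => m * O f) fun w => m * a w := by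
  intro f
  simp only
  rw [h f, Finset.mul_sum]
  exact Finset.sum_congr rfl fun w _ => (mul_assoc _ _ _).symm

/-- The expansion of an operator followed by `T_r`: it involves the coefficients at `w` and `s_r w`,
and the latter with a nonzero factor. -/
theorem IsExpansion.lusztig {O : Laurent k d → Laurent k d} {a : Equiv.Perm (Fin d) → Rat k d}
    (h : IsExpansion (fun f => toRat k d (O f)) a) (r : Fin (d - 1)) :
    ∃ A B : Rat k d, B ≠ 0 ∧ IsExpansion (fun f => toRat k d (lusztig q r (O f)))
      fun w => A * a w + B * ratPermute (simpleRefl r) (a (simpleRefl r * w)) := by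
  refine ⟨(1 - toRat k d (algebraMap k _ q)) * toRat k d (x (hi r)) / ratRoot k r,
    (toRat k d (algebraMap k _ q) * toRat k d (x (lo r)) - toRat k d (x (hi r))) / ratRoot k r,
    ?_, fun f => ?_⟩
  rotate_left
  · have hf : toRat k d (O f) = _ := h f
    simp only
    rw [toRat_lusztig, hf, sum_mul_toRat_simpleRefl, Finset.mul_sum, Finset.mul_sum,
      ← Finset.sum_add_distrib]
    refine Finset.sum_congr rfl fun w _ => ?_
    rw [← mul_assoc, ← mul_assoc, ← add_mul]
  · refine div_ne_zero ?_ (ratRoot_ne_zero r)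
    rw [← map_mul, ← map_sub]
    intro h
    have h1 := toRat_injective (h.trans (map_zero _).symm)
    refine x_sub_smul_x_ne_zero (k := k) (lo_lt_hi r).ne' q ?_
    rw [Algebra.smul_def, ← neg_sub, h1, neg_zero]

theorem Col.blackPerm_eq_one {r : Fin (ℓ + d - 1)} {c : Col ℓ d}
    (h : ¬ (c.1 (lo r) = 0 ∧ c.1 (hi r) = 0)) : c.blackPerm (simpleRefl r) = 1 := by
  refine eq_one_of_strictMono fun i j hij => ?_
  rw [← (c.move (simpleRefl r)).blackPos_strictMono.lt_iff_lt, Col.blackPos_blackPerm,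
    Col.blackPos_blackPerm]
  refine simpleRefl_lt (c.blackPos_strictMono hij) fun h' => h ?_
  rw [← h'.1, ← h'.2]
  exact ⟨c.blackPos_black i, c.blackPos_black j⟩

theorem Col.blackPerm_of_black {r : Fin (ℓ + d - 1)} {c : Col ℓ d} (h : c.1 (lo r) = 0)
    (h' : c.1 (hi r) = 0) : ∃ s : Fin (d - 1), (s : ℕ) = c.nb r ∧
      c.blackPos (lo s) = lo r ∧ c.blackPos (hi s) = hi r ∧
      c.blackPerm (simpleRefl r) = simpleRefl s := by
  have h1 := Col.nb_lt h'
  rw [Col.nb_hi_of_black h] at h1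
  have e1 : c.blackPos (lo ⟨c.nb r, by omega⟩) = lo r := Col.blackPos_eq_iff.2 ⟨h, rfl⟩
  have e2 : c.blackPos (hi ⟨c.nb r, by omega⟩) = hi r :=
    Col.blackPos_eq_iff.2 ⟨h', Col.nb_hi_of_black h⟩
  refine ⟨⟨c.nb r, by omega⟩, rfl, e1, e2, ?_⟩
  have hm : c.move (simpleRefl r) = c := by
    rw [Col.move_simpleRefl, Col.swap_of_eq (h.trans h'.symm)]
  apply Equiv.ext
  intro i
  have h2 := c.blackPos_blackPerm (simpleRefl r) i
  rw [hm] at h2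
  refine c.blackPos_strictMono.injective (h2.trans ?_)
  by_cases hi1 : i = lo ⟨c.nb r, by omega⟩
  · rw [hi1, simpleRefl_lo, e1, e2, simpleRefl_lo]
  · by_cases hi2 : i = hi ⟨c.nb r, by omega⟩
    · rw [hi2, simpleRefl_hi, e1, e2, simpleRefl_hi]
    · rw [simpleRefl_of_ne hi1 hi2, simpleRefl_of_ne]
      · exact fun h => hi1 (c.blackPos_strictMono.injective (h.trans e1.symm))
      · exact fun h => hi2 (c.blackPos_strictMono.injective (h.trans e2.symm))

variable (q Q)

/-- The operator of a reduced diagram in which no red strands cross is a combination of the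
permutation of its black strands, with a nonzero coefficient, and of shorter permutations. -/
theorem exists_expansion_tauWord (c : Col ℓ d) (L : List (Fin (ℓ + d - 1)))
    (hL : L.length = len (L.map simpleRefl).prod) (hred : RedMono c (L.map simpleRefl).prod) :
    ∃ (O : Module.End k (Laurent k d)) (a : Equiv.Perm (Fin d) → Rat k d),
      (∀ f, act q Q d (tauWord q Q L) (Pi.single c f) =
        Pi.single (c.move (L.map simpleRefl).prod) (O f)) ∧
      IsExpansion (fun f => toRat k d (O f)) a ∧ a (c.blackPerm (L.map simpleRefl).prod) ≠ 0 ∧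
      ∀ v, v ≠ c.blackPerm (L.map simpleRefl).prod → a v ≠ 0 →
        len v < len (c.blackPerm (L.map simpleRefl).prod) := by
  induction L with
  | nil =>
    refine ⟨1, Pi.single 1 1, fun f => ?_, fun f => ?_, ?_, ?_⟩
    · rw [tauWord_nil, map_one]; rfl
    · simp [Pi.single_apply, permute_one]
    · rw [List.map_nil, List.prod_nil, Col.blackPerm_one, Pi.single_eq_same]
      exact one_ne_zero
    · rw [List.map_nil, List.prod_nil, Col.blackPerm_one]
      exact fun v hv h => absurd (Pi.single_eq_of_ne hv 1) h
  | cons r L ih =>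
    obtain ⟨hr, hlen⟩ := not_isAscent_of_reduced hL
    rw [List.map_cons, List.prod_cons] at hr hred ⊢
    rw [isAscent_simpleRefl_mul, not_not] at hr
    set w := (L.map simpleRefl).prod with hw
    have hasc : w⁻¹ (lo r) < w⁻¹ (hi r) := hr
    have hww : ∀ i, w (w⁻¹ i) = i := fun i => w.apply_symm_apply i
    have hww' : ∀ i, w⁻¹ (w i) = i := fun i => w.symm_apply_apply i
    have hredw : RedMono c w := by
      intro a b ha hb hab
      by_contra hn
      have h1 : w b < w a := lt_of_le_of_ne (not_lt.1 hn) (w.injective.ne hab.ne')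
      have h2 := hred a b ha hb hab
      refine lt_asymm h2 (simpleRefl_lt h1 fun h => ?_)
      rw [← h.1, ← h.2, hww', hww'] at hasc
      exact lt_asymm hab hasc
    obtain ⟨O, a, hO, hexp, hlead, hlow⟩ := ih hlen hredw
    have hcol : ∀ i, (c.move w).1 i = c.1 (w⁻¹ i) := fun i => rfl
    have hact : ∀ f, act q Q d (tauWord q Q (r :: L)) (Pi.single c f) =
        Pi.single (c.move (simpleRefl r * w)) (crossOp q Q d ((c.move w).1 (lo r))
          ((c.move w).1 (hi r)) ((c.move w).nb r) ((c.move w).nr r) (O f)) := by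
      intro f
      rw [tauWord_cons, map_mul, Module.End.mul_apply, hO, act_tau_single, Col.move_mul,
        Col.move_simpleRefl]
    rw [Col.blackPerm_mul]
    set c' := c.move w with hc'
    set σ := c.blackPerm w with hσ
    -- the cases of the colours of the strands in the last crossing, at the top of the diagram
    rcases fin_two_cases (c'.1 (lo r)) with h | h <;>
      rcases fin_two_cases (c'.1 (hi r)) with h' | h'
    · obtain ⟨s, hs, e1, e2, e3⟩ := Col.blackPerm_of_black h h'
      rw [e3]
      obtain ⟨A, B, hB, hexp'⟩ := hexp.lusztig (q := q) s
      have hs' : IsAscent σ s := by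
        change σ⁻¹ (lo s) < σ⁻¹ (hi s)
        have key : ∀ i, c.blackPos (σ⁻¹ i) = w⁻¹ (c'.blackPos i) := fun i => by
          have h1 := c.blackPos_blackPerm w (σ⁻¹ i)
          have h2 : σ (σ⁻¹ i) = i := σ.apply_symm_apply i
          rw [← hσ, h2, ← hc'] at h1
          rw [h1, hww']
        rw [← c.blackPos_strictMono.lt_iff_lt, key, key, e1, e2]
        exact hasc
      have hl := len_of_isAscent hs'
      have hss : ∀ v, simpleRefl s * (simpleRefl s * v) = v := fun v => by
        rw [← mul_assoc, simpleRefl_mul_self, one_mul]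
      have hne : simpleRefl s * σ ≠ σ := fun h => by rw [h] at hl; omega
      refine ⟨lusztig q s * O, _, fun f => ?_, hexp', ?_, ?_⟩
      · rw [hact, h, h', crossOp_zero_zero, lusztigN, dif_pos (show c'.nb r < d - 1 by
          rw [← hs]; exact s.2)]
        have : (⟨c'.nb r, by rw [← hs]; exact s.2⟩ : Fin (d - 1)) = s := Fin.ext hs.symm
        rw [this]; rfl
      · have h0 : a (simpleRefl s * σ) = 0 := by
          by_contra h0
          have := hlow _ hne h0
          omega
        rw [h0, mul_zero, zero_add, hss]
        exact mul_ne_zero hB ((map_ne_zero _).2 hlead)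
      · intro v hv hav
        by_cases h1 : a v = 0
        · have h2 : a (simpleRefl s * v) ≠ 0 := fun h2 => hav (by simp [h1, h2])
          by_cases h3 : simpleRefl s * v = σ
          · exact absurd (by rw [← h3, hss]) hv
          · have h4 := hlow _ h3 h2
            by_cases h5 : IsAscent v s
            · have := len_of_isAscent h5; omega
            · have := len_of_not_isAscent h5; omega
        · by_cases h3 : v = σ
          · rw [h3]; omega
          · have := hlow v h3 h1; omega
    -- a black and a red strand: a multiplication by a nonzero polynomial
    · rw [Col.blackPerm_eq_one (fun h1 => absurd (h'.symm.trans h1.2) (by decide)), one_mul]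
      have hm : (xN k d (c'.nb r) - algebraMap k _ (paramN Q (c'.nr r))) ≠ 0 := by
        have : c'.nb (lo r) < d := Col.nb_lt h
        rw [xN_eq (show c'.nb r < d from this)]
        exact x_sub_algebraMap_ne_zero _ _
      have hm' := (map_ne_zero_iff (toRat k d) toRat_injective).2 hm
      refine ⟨LinearMap.mulLeft k (xN k d (c'.nb r) - algebraMap k _ (paramN Q (c'.nr r))) * O,
        fun v => toRat k d (xN k d (c'.nb r) - algebraMap k _ (paramN Q (c'.nr r))) * a v,
        fun f => ?_, ?_, ?_, ?_⟩
      rotate_left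
      · have := hexp.mul_left
          (toRat k d (xN k d (c'.nb r) - algebraMap k _ (paramN Q (c'.nr r))))
        intro f
        exact (map_mul (toRat k d) _ _).trans (this f)
      · exact mul_ne_zero hm' hlead
      · exact fun v hv h => hlow v hv (right_ne_zero_of_mul h)
      · rw [hact, h, h', crossOp_zero_one]; rfl
    · rw [Col.blackPerm_eq_one (fun h1 => absurd (h.symm.trans h1.1) (by decide)), one_mul]
      refine ⟨O, a, fun f => ?_, hexp, hlead, hlow⟩
      rw [hact, h, h', crossOp_one_zero]; rfl
    -- two red strands do not cross
    · have h1 := hred _ _ ((hcol _).symm.trans h) ((hcol _).symm.trans h') hasc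
      rw [Equiv.Perm.mul_apply, Equiv.Perm.mul_apply, hww, hww, simpleRefl_lo, simpleRefl_hi] at h1
      exact absurd h1 (lo_lt_hi r).le.not_gt

/-- A permutation which keeps the order of the red strands is determined by the colours at the top
and by the permutation of the black strands. -/
theorem RedMono.eq {c : Col ℓ d} {V W : Equiv.Perm (Fin (ℓ + d))} (hV : RedMono c V)
    (hW : RedMono c W) (hc : c.move V = c.move W) (hb : c.blackPerm V = c.blackPerm W) : V = W := by
  have hWW : ∀ i, W (W⁻¹ i) = i := fun i => W.apply_symm_apply i
  have hVV : ∀ i, V⁻¹ (V i) = i := fun i => V.symm_apply_apply i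
  have hVV' : ∀ i, V (V⁻¹ i) = i := fun i => V.apply_symm_apply i
  have hblack : ∀ i, c.1 i = 0 → V i = W i := by
    intro i hi
    obtain ⟨j, rfl⟩ := Col.exists_blackPos hi
    rw [← c.blackPos_blackPerm, ← c.blackPos_blackPerm, hc, hb]
  have hcol : ∀ i, c.1 (W⁻¹ (V i)) = c.1 i := by
    intro i
    have h1 : (c.move V).1 (V i) = c.1 i := c.move_apply V i
    rw [hc] at h1
    exact h1
  have hcol' : ∀ i, c.1 (V⁻¹ (W i)) = c.1 i := by
    intro i
    have h1 : (c.move W).1 (W i) = c.1 i := c.move_apply W i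
    rw [← hc] at h1
    exact h1
  -- the least strand at which the two permutations differ is red and is sent too far to the right
  have key : ∀ n : ℕ, ∀ i : Fin (ℓ + d), (i : ℕ) = n → V i = W i := by
    intro n
    induction n using Nat.strong_induction_on with
    | _ n ih =>
    intro i hi
    by_cases h0 : c.1 i = 0
    · exact hblack i h0
    replace h0 := fin_two_ne_zero h0
    by_contra hne
    set j := W⁻¹ (V i) with hj
    have hWj : W j = V i := hWW _
    set j' := V⁻¹ (W i) with hj'
    have hVj : V j' = W i := hVV' _
    have h1 : i < j := by
      refine lt_of_le_of_ne (not_lt.1 fun h => ?_) fun h => hne (by rw [← hWj, ← h])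
      have := ih j (by rw [← hi]; exact h) j rfl
      rw [hWj] at this
      exact h.ne (V.injective this)
    have h2 : i < j' := by
      refine lt_of_le_of_ne (not_lt.1 fun h => ?_) fun h => hne (by rw [← hVj, ← h])
      have := ih j' (by rw [← hi]; exact h) j' rfl
      rw [hVj] at this
      exact h.ne' (W.injective this)
    have h3 := hW i j h0 ((hcol i).trans h0) h1
    have h4 := hV i j' h0 ((hcol' i).trans h0) h2
    rw [hWj] at h3
    rw [hVj] at h4
    exact lt_asymm h3 h4
  exact Equiv.ext fun i => key i i rfl

/-- The polynomial representation of the Hecke algebra is faithful. An element is a combination of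
diagrams of reduced words; if it is not zero, then in the expansion of its operator the permutation
of the black strands of a contributing diagram, with as many crossings of black strands as possible,
has a nonzero coefficient. -/
theorem act_injective : Function.Injective (act q Q d) := by
  classical
  rw [injective_iff_map_eq_zero]
  intro y hy
  refine ext_E fun c => ?_
  rw [zero_mul]
  obtain ⟨f, hf⟩ := exists_eq_sum_tauWord y c
  -- only the diagrams without crossings of red strands contribute
  have hred : ∀ W : Equiv.Perm (Fin (ℓ + d)), ((reducedWord W).map simpleRefl).prod = W :=
    reducedWord_prod
  have hzero : ∀ W, ¬ RedMono c W →
      tauWord q Q (reducedWord W) * (poly d q Q (f W) * E q Q c) = 0 := by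
    intro W hW
    rw [← E_mul_poly, ← mul_assoc, tauWord_mul_E_eq_zero (by rwa [hred]), zero_mul]
  by_contra hne
  have hex : ∃ W, RedMono c W ∧ f W ≠ 0 := by
    by_contra hn
    refine hne ?_
    rw [hf]
    refine Finset.sum_eq_zero fun W _ => ?_
    by_cases hW : RedMono c W
    · have : f W = 0 := by by_contra h; exact hn ⟨W, hW, h⟩
      rw [this, poly_eq, map_zero, zero_mul, mul_zero]
    · exact hzero W hW
  -- choose a contributing diagram with as many crossings of black strands as possible
  obtain ⟨W₀, hW₀, hmax⟩ := Finset.exists_max_image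
    (Finset.univ.filter fun W : Equiv.Perm (Fin (ℓ + d)) => RedMono c W ∧ f W ≠ 0)
    (fun W => len (c.blackPerm W))
    (by obtain ⟨W, h⟩ := hex; exact ⟨W, by simpa using h⟩)
  simp only [Finset.mem_filter, Finset.mem_univ, true_and] at hW₀ hmax
  have hex2 : ∀ W, ∃ (O : Module.End k (Laurent k d)) (a : Equiv.Perm (Fin d) → Rat k d),
      RedMono c W → (∀ f, act q Q d (tauWord q Q (reducedWord W)) (Pi.single c f) =
        Pi.single (c.move W) (O f)) ∧
      IsExpansion (fun f => toRat k d (O f)) a ∧ a (c.blackPerm W) ≠ 0 ∧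
      ∀ v, v ≠ c.blackPerm W → a v ≠ 0 → len v < len (c.blackPerm W) := by
    intro W
    by_cases hW : RedMono c W
    · obtain ⟨O, a, h⟩ := exists_expansion_tauWord q Q c (reducedWord W)
        (by rw [reducedWord_length, hred]) (by rwa [hred])
      rw [hred] at h
      exact ⟨O, a, fun _ => h⟩
    · exact ⟨0, 0, fun h => absurd h hW⟩
  choose O a hOa using hex2
  have hsum : ∀ v, ∑ W ∈ Finset.univ.filter
      (fun W : Equiv.Perm (Fin (ℓ + d)) => RedMono c W ∧ c.move W = c.move W₀),
        O W (f W * v) = 0 := by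
    intro v
    have h1 : act q Q d (y * E q Q c) (Pi.single c v) = 0 := by
      rw [map_mul, hy, zero_mul, LinearMap.zero_apply]
    rw [hf, map_sum, LinearMap.sum_apply] at h1
    have h2 := congrFun h1 (c.move W₀)
    rw [Finset.sum_apply, Pi.zero_apply] at h2
    rw [← h2, Finset.sum_filter]
    refine Finset.sum_congr rfl fun W _ => ?_
    by_cases hW : RedMono c W
    · rw [map_mul (act q Q d), Module.End.mul_apply, act_mul_E_single, act_poly_single,
        (hOa W hW).1]
      by_cases hm : c.move W = c.move W₀
      · rw [if_pos ⟨hW, hm⟩, hm, Pi.single_eq_same]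
      · rw [if_neg fun h => hm h.2, Pi.single_eq_of_ne (Ne.symm hm)]
    · rw [if_neg fun h => hW h.1, hzero W hW, map_zero]; rfl
  have hexp : IsExpansion (fun _ : Laurent k d => (0 : Rat k d)) fun v =>
      ∑ W ∈ Finset.univ.filter
        (fun W : Equiv.Perm (Fin (ℓ + d)) => RedMono c W ∧ c.move W = c.move W₀),
        a W v * toRat k d (permute v (f W)) := by
    intro g
    simp only
    rw [← map_zero (toRat k d), ← hsum g, map_sum]
    simp only [Finset.sum_mul]
    rw [Finset.sum_comm]
    refine Finset.sum_congr rfl fun W hW => ?_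
    simp only [Finset.mem_filter, Finset.mem_univ, true_and] at hW
    have := (hOa W hW.1).2.1 (f W * g)
    simp only at this
    rw [this]
    refine Finset.sum_congr rfl fun v _ => ?_
    rw [map_mul, map_mul, mul_assoc]
  have hexp0 : IsExpansion (fun _ : Laurent k d => (0 : Rat k d)) 0 := fun g => by simp
  -- the coefficient at the black permutation of `W₀` comes from `W₀` alone
  have h3 := congrFun (hexp.unique hexp0) (c.blackPerm W₀)
  simp only [Pi.zero_apply] at h3
  rw [Finset.sum_eq_single W₀] at h3
  · have h4 := toRat_injective (k := k) (d := d)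
    rcases mul_eq_zero.1 h3 with h5 | h5
    · exact (hOa W₀ hW₀.1).2.2.1 h5
    · have h6 := h4 (h5.trans (map_zero _).symm)
      exact hW₀.2 (permute_injective _ (h6.trans (map_zero _).symm))
  · intro W hW hWne
    simp only [Finset.mem_filter, Finset.mem_univ, true_and] at hW
    by_cases hfW : f W = 0
    · rw [hfW, map_zero, map_zero, mul_zero]
    · have h5 : c.blackPerm W₀ ≠ c.blackPerm W := fun h =>
        hWne (RedMono.eq hW.1 hW₀.1 hW.2 h.symm)
      have h6 : a W (c.blackPerm W₀) = 0 := by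
        by_contra h6
        have := (hOa W hW.1).2.2.2 _ h5 h6
        have := hmax W ⟨hW.1, hfW⟩
        omega
      rw [h6, zero_mul]
  · intro h
    exact absurd (by simpa using hW₀.1) h

end Faithful

/-! ### Surjectivity of Demazure operators -/

section Surjective

variable {k : Type*} [Field k] {d : ℕ} {κ : Composition d}

/-- For `q = 1` the operators `T_w` are the permutations. -/
theorem wordProd_lusztig_one (w : Equiv.Perm (Fin d)) (f : Laurent k d) :
    wordProd (lusztig 1) w f = permute w f := by
  induction w using perm_induction with
  | one => rw [wordProd_one, Module.End.one_apply, permute_one]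
  | mul r w hr ih =>
    rw [(braidRel_lusztig 1).wordProd_simpleRefl_mul hr, Module.End.mul_apply, ih, permute_mul,
      lusztig_apply, one_smul, one_smul]
    linear_combination -sub_mul_demazure r (permute w f)

theorem sign_eq (w : Equiv.Perm (Fin d)) : Equiv.Perm.sign w = (-1) ^ len w := by
  induction w using perm_induction with
  | one => rw [len_one, pow_zero, Equiv.Perm.sign_one]
  | mul r w hr ih =>
    rw [len_of_isAscent hr, Equiv.Perm.sign_mul, ih, pow_succ', simpleRefl, Equiv.Perm.sign_swap]
    exact (lo_lt_hi r).ne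

/-- For `q = 1` the formula for the antisymmetrizer says that the alternating sum of the
permutations is the Demazure operator followed by the multiplication by the Vandermonde determinant.
As the alternating sum of the staircase monomial is this determinant up to sign, the Demazure
operator takes the monomial to `1` up to sign. -/
theorem exists_youngDemazure_eq_one_of_top (h : ∀ i j, κ.index i = κ.index j) :
    ∃ g : Laurent k d, youngDemazure κ g = 1 := by
  have htop : ∀ w, w ∈ young κ := fun w i => h _ _
  have hp : pLeft (1 : k) κ = (Matrix.vandermonde fun i : Fin d => (x i : Laurent k d)).det := by
    rw [Matrix.det_vandermonde, pLeft, Finset.prod_sigma']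
    refine Finset.prod_bij' (fun p _ => ⟨p.1, p.2⟩) (fun p _ => (p.1, p.2)) ?_ ?_ ?_ ?_ ?_
    · rintro ⟨i, j⟩ hij
      simpa using (mem_blockPairs.1 hij).1
    · rintro ⟨i, j⟩ hij
      exact mem_blockPairs.2 ⟨by simpa using hij, h _ _⟩
    · exact fun _ _ => rfl
    · exact fun _ _ => rfl
    · exact fun p _ => by rw [one_smul]
  have h1 := antisym_apply (1 : k) κ (∏ i : Fin d, x i ^ (i : ℕ))
  have h2 : antisym (1 : k) κ (∏ i : Fin d, x i ^ (i : ℕ)) =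
      (-1) ^ youngMaxLen κ * pLeft (1 : k) κ := by
    rw [hp, Matrix.det_apply, antisym, LinearMap.sum_apply, Finset.mul_sum]
    refine Finset.sum_congr (Finset.filter_true_of_mem fun w _ => htop w) fun w _ => ?_
    rw [LinearMap.smul_apply, wordProd_lusztig_one, map_prod, sign_eq]
    have e : youngMaxLen κ = (youngMaxLen κ - len w) + len w :=
      (Nat.sub_add_cancel (len_le_youngMaxLen (htop w))).symm
    have e1 : ∀ n, ((-1 : Laurent k d) ^ n) * (-1) ^ n = 1 := fun n => by
      rw [← mul_pow, neg_mul_neg, one_mul, one_pow]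
    have e2 : ∏ i, permute w (x i ^ (i : ℕ)) = ∏ i : Fin d,
        Matrix.vandermonde (fun i : Fin d => (x i : Laurent k d)) (w i) i :=
      Finset.prod_congr rfl fun i _ => by rw [map_pow, permute_x, Matrix.vandermonde_apply]
    rw [e2, Units.smul_def, zsmul_eq_mul, e, pow_add, Nat.add_sub_cancel, Algebra.smul_def]
    push_cast
    rw [mul_assoc, ← mul_assoc ((-1) ^ len w), e1, one_mul]
  rw [h2, mul_comm] at h1
  have h3 := mul_left_cancel₀ (pLeft_ne_zero (1 : k) κ) h1
  refine ⟨(-1) ^ youngMaxLen κ * ∏ i : Fin d, x i ^ (i : ℕ), ?_⟩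
  rw [youngDemazure_mul fun w _ => by rw [map_pow, map_neg, map_one], ← h3, ← mul_pow, neg_mul_neg,
    one_mul, one_pow]

theorem IsShortest.inv_lt {v : Equiv.Perm (Fin d)} (hv : IsShortest κ v) {i j : Fin d}
    (hij : i < j) (h : κ.index i = κ.index j) : v⁻¹ i < v⁻¹ j := by
  refine rel_of_adjacent (fun a b => v⁻¹ a < v⁻¹ b) (fun _ _ _ h h' => lt_trans h h') hij
    fun r hr hr' => ?_
  refine isShortest_iff.1 hv r ?_
  rw [index_eq_of_mem_Icc h hr ((lo_lt_hi r).le.trans hr'),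
    index_eq_of_mem_Icc h (hr.trans (lo_lt_hi r).le) hr']

/-- The general case follows from that of a single block, as the Demazure operator of the longest
permutation factors through that of the longest element of the Young subgroup. -/
theorem exists_youngDemazure_eq_one (κ : Composition d) :
    ∃ g : Laurent k d, youngDemazure κ g = 1 := by
  rcases Nat.eq_zero_or_pos d with rfl | hd
  · refine ⟨1, ?_⟩
    rw [youngDemazure, Subsingleton.elim (longest κ) 1, wordProd_one]; rfl
  have htop := index_single hd
  obtain ⟨g, hg⟩ := exists_youngDemazure_eq_one_of_top (k := k) htop
  -- the longest permutation is the product of the longest element of the Young subgroup and a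
  -- shortest representative
  obtain ⟨u, hu, hv⟩ := exists_isShortest κ (longest (Composition.single d hd))
  set w := longest (Composition.single d hd) with hw
  have e : w = u⁻¹ * (u * w) := by rw [inv_mul_cancel_left]
  have hrev : Reverses κ u⁻¹ := by
    intro i j hij h
    by_contra hn
    have hu' : ∀ a, κ.index (u a) = κ.index a := hu
    rw [inv_inv] at hn
    have h1 : u i < u j := lt_of_le_of_ne (not_lt.1 hn) (u.injective.ne hij.ne)
    have h2 := hv.inv_lt h1 (by rw [hu', hu', h])
    have h3 : ∀ a, (u * w)⁻¹ (u a) = w⁻¹ a := fun a => by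
      rw [mul_inv_rev, Equiv.Perm.mul_apply]
      exact congrArg _ (u.symm_apply_apply a)
    rw [h3, h3] at h2
    exact lt_asymm h2 (longest_reverses _ i j hij (htop i j))
  have hul : u⁻¹ = longest κ := hrev.eq (longest_reverses κ) (inv_mem hu) (longest_mem κ)
  have hlen := hv.len_mul (inv_mem hu)
  rw [youngDemazure, ← hw, e, braidRel_demazureL.wordProd_mul hlen, hul] at hg
  exact ⟨_, hg⟩

/-- The Demazure operator of the longest element maps onto the invariants. -/
theorem exists_youngDemazure_eq_of_invariant {f : Laurent k d}
    (hf : ∀ w ∈ young κ, permute w f = f) : ∃ g, youngDemazure κ g = f := by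
  obtain ⟨g, hg⟩ := exists_youngDemazure_eq_one (k := k) κ
  exact ⟨f * g, by rw [youngDemazure_mul hf, hg, mul_one]⟩

end Surjective

/-! ### Blocks of multicompositions -/

section Boundaries

/-- `n` is a sum of the entries of an initial segment of the list. -/
def IsBdry : List ℕ → ℕ → Prop
  | [], n => n = 0
  | a :: l, n => n = 0 ∨ ∃ m, IsBdry l m ∧ n = a + m

theorem isBdry_nil {n : ℕ} : IsBdry [] n ↔ n = 0 := Iff.rfl

theorem isBdry_cons {a : ℕ} {l : List ℕ} {n : ℕ} :
    IsBdry (a :: l) n ↔ n = 0 ∨ ∃ m, IsBdry l m ∧ n = a + m := Iff.rfl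

theorem isBdry_zero (l : List ℕ) : IsBdry l 0 := by
  cases l
  · rfl
  · exact Or.inl rfl

theorem isBdry_append {A B : List ℕ} {n : ℕ} :
    IsBdry (A ++ B) n ↔ IsBdry A n ∨ ∃ m, IsBdry B m ∧ n = A.sum + m := by
  induction A generalizing n with
  | nil =>
    simp only [List.nil_append, isBdry_nil, List.sum_nil, zero_add]
    constructor
    · exact fun h => Or.inr ⟨n, h, rfl⟩
    · rintro (rfl | ⟨m, h, rfl⟩)
      · exact isBdry_zero B
      · exact h
  | cons a A ih =>
    simp only [List.cons_append, isBdry_cons, ih, List.sum_cons]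
    constructor
    · rintro (h | ⟨m, h | ⟨m', h, rfl⟩, rfl⟩)
      · exact Or.inl (Or.inl h)
      · exact Or.inl (Or.inr ⟨m, h, rfl⟩)
      · exact Or.inr ⟨m', h, (add_assoc _ _ _).symm⟩
    · rintro ((h | ⟨m, h, rfl⟩) | ⟨m', h, rfl⟩)
      · exact Or.inl h
      · exact Or.inr ⟨m, Or.inl h, rfl⟩
      · exact Or.inr ⟨_, Or.inr ⟨m', h, rfl⟩, add_assoc _ _ _⟩

theorem IsBdry.le_sum {l : List ℕ} {n : ℕ} (h : IsBdry l n) : n ≤ l.sum := by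
  induction l generalizing n with
  | nil => exact le_of_eq h
  | cons a l ih =>
    rw [List.sum_cons]
    rcases h with rfl | ⟨m, hm, rfl⟩
    · exact Nat.zero_le _
    · exact Nat.add_le_add_left (ih hm) a

theorem isBdry_sum (l : List ℕ) : IsBdry l l.sum := by
  induction l with
  | nil => rfl
  | cons a l ih => exact Or.inr ⟨_, ih, List.sum_cons⟩

theorem isBdry_iff_take {l : List ℕ} {n : ℕ} : IsBdry l n ↔ ∃ m, (l.take m).sum = n := by
  induction l generalizing n with
  | nil => simp [isBdry_nil, eq_comm]
  | cons a l ih =>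
    rw [isBdry_cons]
    constructor
    · rintro (rfl | ⟨m, hm, rfl⟩)
      · exact ⟨0, rfl⟩
      · obtain ⟨i, rfl⟩ := ih.1 hm
        exact ⟨i + 1, by simp⟩
    · rintro ⟨i, rfl⟩
      cases i with
      | zero => exact Or.inl rfl
      | succ i => exact Or.inr ⟨_, ih.2 ⟨i, rfl⟩, by simp⟩

variable {d : ℕ}

/-- Two entries are in different blocks if and only if a block ends between them. -/
theorem index_ne_iff {κ : Composition d} {i j : Fin d} (h : i < j) :
    κ.index i ≠ κ.index j ↔ ∃ n, IsBdry κ.blocks n ∧ (i : ℕ) < n ∧ n ≤ j := by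
  constructor
  · intro hne
    have h1 : (κ.index i : ℕ) + 1 ≤ κ.index j :=
      Nat.succ_le_of_lt (Fin.lt_def.1 (lt_of_le_of_ne (index_mono κ h.le) hne))
    refine ⟨κ.sizeUpTo (κ.index j), isBdry_iff_take.2 ⟨_, rfl⟩, ?_, κ.sizeUpTo_index_le j⟩
    exact (κ.lt_sizeUpTo_index_succ i).trans_le (κ.monotone_sizeUpTo h1)
  · rintro ⟨n, hn, h1, h2⟩ he
    obtain ⟨m, rfl⟩ := isBdry_iff_take.1 hn
    change (i : ℕ) < κ.sizeUpTo m at h1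
    change κ.sizeUpTo m ≤ j at h2
    have h3 : (κ.index i : ℕ) + 1 ≤ m := by
      by_contra h3
      have := κ.monotone_sizeUpTo (show m ≤ κ.index i by omega)
      have := κ.sizeUpTo_index_le i
      omega
    have h4 := κ.monotone_sizeUpTo h3
    have h5 : (j : ℕ) < κ.sizeUpTo ((κ.index i : ℕ) + 1) := by
      rw [he]; exact κ.lt_sizeUpTo_index_succ j
    omega

theorem index_eq_iff {κ : Composition d} {i j : Fin d} (h : i < j) :
    κ.index i = κ.index j ↔ ∀ n, IsBdry κ.blocks n → (i : ℕ) < n → ¬ n ≤ j := by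
  rw [← not_iff_not, ← ne_eq, index_ne_iff h]
  push Not
  rfl

/-- A permutation in the Young subgroup does not move anything past the end of a block. -/
theorem young_lt_iff {κ : Composition d} {w : Equiv.Perm (Fin d)} (hw : w ∈ young κ) {n : ℕ}
    (hn : IsBdry κ.blocks n) (i : Fin d) : (w i : ℕ) < n ↔ (i : ℕ) < n := by
  have key : ∀ i j : Fin d, κ.index i = κ.index j → (i : ℕ) < n → (j : ℕ) < n := by
    intro i j h hi
    by_contra hj
    have hij : i < j := by rw [Fin.lt_def]; omega
    exact (index_ne_iff hij).2 ⟨n, hn, hi, by omega⟩ h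
  exact ⟨key _ _ (hw i), key _ _ (hw i).symm⟩

end Boundaries

section Flatten

/-- Two sequences of lists which only differ in the `t`-th list have flattenings with the same parts
before and after this list. -/
theorem exists_flatten_eq {n : ℕ} (parts parts' : Fin n → List ℕ) (t : Fin n)
    (h : ∀ s, s ≠ t → parts' s = parts s) : ∃ A B : List ℕ,
      (List.ofFn parts).flatten = A ++ (parts t ++ B) ∧
      (List.ofFn parts').flatten = A ++ (parts' t ++ B) ∧
      A.sum = ∑ s ∈ Finset.Iio t, (parts s).sum := by
  have hsum : ∀ {n : ℕ} (t : Fin n) (F : Fin n → ℕ), ∑ s ∈ Finset.Iio t, F s =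
      ∑ s, if s < t then F s else 0 := fun t F => by
    rw [← Finset.sum_filter]
    exact Finset.sum_congr (by ext; simp) fun _ _ => rfl
  rw [hsum]
  induction n with
  | zero => exact t.elim0
  | succ n ih =>
    rw [List.ofFn_succ, List.ofFn_succ, List.flatten_cons, List.flatten_cons, Fin.sum_univ_succ]
    revert h
    refine Fin.cases ?_ (fun t => ?_) t
    · intro h
      refine ⟨[], (List.ofFn fun i : Fin n => parts i.succ).flatten, rfl, ?_, by simp⟩
      simp only [h _ (Fin.succ_ne_zero _), List.nil_append]
    · intro h
      obtain ⟨A, B, h1, h2, h3⟩ := ih (fun i => parts i.succ) (fun i => parts' i.succ) t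
        fun s hs => h _ fun e => hs (Fin.succ_injective _ e)
      refine ⟨parts 0 ++ A, B, ?_, ?_, ?_⟩
      · rw [h1, List.append_assoc]
      · rw [h2, h _ (Fin.succ_ne_zero t).symm, List.append_assoc]
      · rw [List.sum_append, h3]
        simp [Fin.succ_lt_succ_iff]

/-- Moving the first entry of a list to the end of the list before it does not change the
flattening. -/
theorem flatten_eq_of_move {n : ℕ} (parts parts' : Fin (n + 1) → List ℕ) (t : Fin n) (a : ℕ)
    (h1 : parts t.succ = a :: parts' t.succ) (h2 : parts' t.castSucc = parts t.castSucc ++ [a])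
    (h3 : ∀ s, s ≠ t.castSucc → s ≠ t.succ → parts' s = parts s) :
    (List.ofFn parts).flatten = (List.ofFn parts').flatten := by
  induction n with
  | zero => exact t.elim0
  | succ n ih =>
    rw [List.ofFn_succ (f := parts), List.ofFn_succ (f := parts'), List.flatten_cons,
      List.flatten_cons]
    revert h1 h2 h3
    refine Fin.cases ?_ (fun t => ?_) t
    · intro h1 h2 h3
      rw [List.ofFn_succ (f := fun i => parts (Fin.succ i)),
        List.ofFn_succ (f := fun i => parts' (Fin.succ i)), List.flatten_cons, List.flatten_cons]
      have e1 : parts (Fin.succ 0) = a :: parts' (Fin.succ 0) := h1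
      have e2 : parts' 0 = parts 0 ++ [a] := h2
      have e3 : ∀ i : Fin n, parts' i.succ.succ = parts i.succ.succ := fun i =>
        h3 _ (Fin.succ_ne_zero _) fun e => Fin.succ_ne_zero i (Fin.succ_injective _ e)
      simp only [e3]
      rw [e1, e2]
      simp
    · intro h1 h2 h3
      have e0 : parts' 0 = parts 0 := by
        refine h3 0 ?_ (Fin.succ_ne_zero _).symm
        rw [← Fin.succ_castSucc]
        exact (Fin.succ_ne_zero _).symm
      rw [e0, ih (fun i => parts i.succ) (fun i => parts' i.succ) t h1
        (by rw [Fin.succ_castSucc]; exact h2) fun s hs hs' => h3 _ ?_ ?_]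
      · rw [← Fin.succ_castSucc]; exact fun e => hs (Fin.succ_injective _ e)
      · exact fun e => hs' (Fin.succ_injective _ e)

end Flatten

section MultiComps

variable {ℓ d : ℕ}

theorem MultiComp.isBdry_before (lam : MultiComp ℓ d) (t : Fin (ℓ + 1)) :
    IsBdry lam.concat.blocks (lam.before t) := by
  obtain ⟨A, B, h1, -, h3⟩ := exists_flatten_eq lam.parts lam.parts t fun _ _ => rfl
  change IsBdry (List.ofFn lam.parts).flatten _
  rw [h1, isBdry_append]
  refine Or.inl ?_
  rw [MultiComp.before, ← h3]
  exact isBdry_sum A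

theorem MultiComp.isBdry_blacksLeft (lam : MultiComp ℓ d) (t : Fin ℓ) :
    IsBdry lam.concat.blocks (lam.blacksLeft t) := lam.isBdry_before t.succ

theorem MultiComp.col_eq_one {lam : MultiComp ℓ d} {i : Fin (ℓ + d)} :
    lam.col.1 i = 1 ↔ ∃ t, lam.redPos t = i := by
  change (if ∃ t, lam.redPos t = i then (1 : Fin 2) else 0) = 1 ↔ _
  split_ifs with h
  · exact iff_of_true rfl h
  · exact iff_of_false (by decide) h

/-- The red positions before that of the `t`-th red strand are those of the strands `s < t`. -/
theorem MultiComp.nr_redPos (lam : MultiComp ℓ d) (t : Fin ℓ) :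
    lam.col.nr (lam.redPos t) = t := by
  have h : (Finset.univ.filter fun j : Fin (ℓ + d) => (j : ℕ) < lam.redPos t).filter
      (fun j : Fin (ℓ + d) => ∃ s, lam.redPos s = j) =
      (Finset.Iio t).image fun s : Fin ℓ => (⟨lam.redPos s, lam.redPos_lt s⟩ : Fin (ℓ + d)) := by
    ext i
    simp only [Finset.mem_filter, Finset.mem_univ, true_and, Finset.mem_image, Finset.mem_Iio,
      Fin.ext_iff]
    constructor
    · rintro ⟨h1, s, hs⟩
      exact ⟨s, lam.redPos_strictMono.lt_iff_lt.1 (by rw [hs]; exact h1), hs⟩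
    · rintro ⟨s, hs, hi⟩
      exact ⟨by rw [← hi]; exact lam.redPos_strictMono hs, s, hi⟩
  rw [Col.nr]
  calc _ = ((Finset.univ.filter fun j : Fin (ℓ + d) => (j : ℕ) < lam.redPos t).filter
      (fun j : Fin (ℓ + d) => ∃ s, lam.redPos s = j)).card := by
        rw [Finset.card_filter]
        refine Finset.sum_congr rfl fun i _ => ?_
        change ((if ∃ s, lam.redPos s = i then (1 : Fin 2) else 0 : Fin 2) : ℕ) = _
        split_ifs <;> rfl
    _ = t := by
        rw [h, Finset.card_image_of_injective, Fin.card_Iio]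
        intro s s' hs
        exact lam.redPos_strictMono.injective (Fin.ext_iff.1 hs)

theorem MultiComp.nb_redPos (lam : MultiComp ℓ d) (t : Fin ℓ) :
    lam.col.nb (lam.redPos t) = lam.blacksLeft t := by
  have h := lam.col.nb_add_nr (lam.redPos_lt t).le
  rw [lam.nr_redPos] at h
  have : lam.redPos t = t + lam.blacksLeft t := rfl
  omega

theorem Col.blackPos_hi_eq {c : Col ℓ d} (r : Fin (d - 1))
    (h : ∀ p : Fin (ℓ + d), (p : ℕ) = c.blackPos (lo r) + 1 → c.1 p = 0) :
    (c.blackPos (hi r) : ℕ) = c.blackPos (lo r) + 1 := by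
  have h1 : c.blackPos (lo r) < c.blackPos (hi r) := c.blackPos_strictMono (lo_lt_hi r)
  have h2 : (c.blackPos (lo r) : ℕ) + 1 < ℓ + d := by
    have := (c.blackPos (hi r)).2
    have h1' : (c.blackPos (lo r) : ℕ) < c.blackPos (hi r) := h1
    omega
  have h3 : c.blackPos (hi r) = ⟨c.blackPos (lo r) + 1, h2⟩ := by
    rw [Col.blackPos_eq_iff]
    refine ⟨h _ rfl, ?_⟩
    have := Col.nb_succ_of_black (c.blackPos_black (lo r))
    rw [c.nb_blackPos] at this
    exact this
  exact congrArg Fin.val h3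

/-- Black strands which are adjacent in a block of the concatenation are adjacent in the colour
sequence, as red strands only stand at the ends of blocks. -/
theorem MultiComp.blackPos_hi_eq (lam : MultiComp ℓ d) {r : Fin (d - 1)}
    (h : lam.concat.index (lo r) = lam.concat.index (hi r)) :
    (lam.col.blackPos (hi r) : ℕ) = lam.col.blackPos (lo r) + 1 := by
  refine Col.blackPos_hi_eq r fun p hp => ?_
  by_contra hne
  obtain ⟨t, ht⟩ := MultiComp.col_eq_one.1 (fin_two_ne_zero hne)
  have h1 := lam.nb_redPos t
  rw [ht, hp, Col.nb_succ_of_black (lam.col.blackPos_black _), lam.col.nb_blackPos] at h1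
  refine (index_ne_iff (lo_lt_hi r)).2 ⟨_, lam.isBdry_blacksLeft t, ?_, ?_⟩ h
  · rw [← h1]; exact Nat.lt_succ_self _
  · rw [← h1]; exact le_rfl

theorem omega_eq_one {i : Fin (ℓ + d)} : (omega ℓ d).1 i = 1 ↔ (i : ℕ) < ℓ := by
  change (if (i : ℕ) < ℓ then (1 : Fin 2) else 0) = 1 ↔ _
  split_ifs with h
  · exact iff_of_true rfl h
  · exact iff_of_false (by decide) h

theorem omega_blackPos_hi_eq (r : Fin (d - 1)) :
    ((omega ℓ d).blackPos (hi r) : ℕ) = (omega ℓ d).blackPos (lo r) + 1 := by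
  refine Col.blackPos_hi_eq r fun p hp => ?_
  by_contra hne
  have h1 := omega_eq_one.1 (fin_two_ne_zero hne)
  have h2 : (omega ℓ d).1 ((omega ℓ d).blackPos (lo r)) = 1 := omega_eq_one.2 (by omega)
  rw [Col.blackPos_black] at h2
  exact absurd h2 (by decide)

/-- In `ω` the black strands stand to the right of the `ℓ` red strands. -/
theorem omega_blackPos (i : Fin d) : ((omega ℓ d).blackPos i : ℕ) = ℓ + i := by
  have h : (omega ℓ d).blackPos i = ⟨ℓ + i, by omega⟩ := by
    rw [Col.blackPos_eq_iff]
    have key : ∀ n, n ≤ d → (omega ℓ d).nb (ℓ + n) = n := by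
      intro n
      induction n with
      | zero =>
        intro _
        rw [Col.nb, Finset.card_eq_zero, Finset.filter_eq_empty_iff]
        rintro j - ⟨h1, h2⟩
        exact absurd (h2.symm.trans (omega_eq_one.2 h1)) (by decide)
      | succ n ih =>
        intro hn
        rw [← add_assoc, ← ih (by omega)]
        have := Col.nb_succ_of_black (c := omega ℓ d) (i := ⟨ℓ + n, by omega⟩) (by
          by_contra hne
          have := omega_eq_one.1 (fin_two_ne_zero hne)
          simp at this)
        rw [ih (by omega)] at this ⊢
        exact this.trans (by simp)
    refine ⟨?_, key i i.2.le⟩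
    by_contra hne
    have := omega_eq_one.1 (fin_two_ne_zero hne)
    simp at this
  rw [h]

end MultiComps

/-! ### Splits and crossings of multicompositions -/

section SplitBlocks

variable {d : ℕ}

/-- The composition `κ'` is obtained from `κ` by cutting the block with the entries
`o, …, o + a + b - 1` after its first `a` entries; expressed by the ends of the blocks. -/
structure IsBlockSplit (κ κ' : Composition d) (o a b : ℕ) : Prop where
  bdry : ∀ n, IsBdry κ'.blocks n ↔ IsBdry κ.blocks n ∨ n = o + a
  gap : ∀ n, IsBdry κ.blocks n → n ≤ o ∨ o + a + b ≤ n
  left : IsBdry κ.blocks o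
  right : IsBdry κ.blocks (o + a + b)

variable {κ κ' : Composition d} {o a b : ℕ}

namespace IsBlockSplit

theorem le (h : IsBlockSplit κ κ' o a b) : o + a + b ≤ d := by
  have := h.right.le_sum
  rwa [κ.blocks_sum] at this

theorem index_eq_iff (h : IsBlockSplit κ κ' o a b) {i j : Fin d} (hij : i < j) :
    κ.index i = κ.index j ↔ κ'.index i = κ'.index j ∨
      ((o ≤ (i : ℕ) ∧ (i : ℕ) < o + a) ∧ (o + a ≤ (j : ℕ) ∧ (j : ℕ) < o + a + b)) := by
  rw [AffineSchur.index_eq_iff hij, AffineSchur.index_eq_iff hij]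
  constructor
  · intro h1
    by_cases h2 : (i : ℕ) < o + a ∧ o + a ≤ j
    · refine Or.inr ⟨⟨?_, h2.1⟩, h2.2, ?_⟩
      · by_contra h3
        exact h1 o h.left (by omega) (by omega)
      · by_contra h3
        exact h1 _ h.right (by omega) (by omega)
    · refine Or.inl fun n hn h3 h4 => ?_
      rcases (h.bdry n).1 hn with h5 | rfl
      · exact h1 n h5 h3 h4
      · exact h2 ⟨h3, h4⟩
  · rintro (h1 | h1) n hn h2 h3
    · exact h1 n ((h.bdry n).2 (Or.inl hn)) h2 h3
    · rcases h.gap n hn with h4 | h4 <;> omega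

theorem index_ne (h : IsBlockSplit κ κ' o a b) {i j : Fin d} (hi : (i : ℕ) < o + a)
    (hj : o + a ≤ (j : ℕ)) : κ'.index i < κ'.index j := by
  have hij : i < j := by rw [Fin.lt_def]; omega
  exact lt_of_le_of_ne (index_mono κ' hij.le)
    ((index_ne_iff hij).2 ⟨_, (h.bdry _).2 (Or.inr rfl), hi, hj⟩)

theorem index_eq_of_eq (h : IsBlockSplit κ κ' o a b) {i j : Fin d}
    (hij : κ'.index i = κ'.index j) : κ.index i = κ.index j := by
  rcases lt_trichotomy i j with h1 | rfl | h1
  · exact (h.index_eq_iff h1).2 (Or.inl hij)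
  · rfl
  · exact ((h.index_eq_iff h1).2 (Or.inl hij.symm)).symm

theorem young_le (h : IsBlockSplit κ κ' o a b) : young κ' ≤ young κ :=
  fun _ hw i => h.index_eq_of_eq (hw i)

theorem pLeft_eq {k : Type*} [Field k] (q : k) (h : IsBlockSplit κ κ' o a b) :
    pLeft q κ = pLeft q κ' * pLeftPrime q o a b := by
  rw [pLeft, pLeft, pLeftPrime, ← Finset.prod_union]
  · refine Finset.prod_congr ?_ fun _ _ => rfl
    ext ⟨i, j⟩
    simp only [Finset.mem_union, mem_blockPairs, Finset.mem_filter, Finset.mem_univ, true_and]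
    constructor
    · rintro ⟨hij, h1⟩
      exact ((h.index_eq_iff hij).1 h1).imp (fun h2 => ⟨hij, h2⟩) fun h2 => h2
    · rintro (⟨hij, h1⟩ | h1)
      · exact ⟨hij, h.index_eq_of_eq h1⟩
      · have hij : i < j := by rw [Fin.lt_def]; omega
        exact ⟨hij, (h.index_eq_iff hij).2 (Or.inr h1)⟩
  · rw [Finset.disjoint_left]
    rintro ⟨i, j⟩ h1 h2
    simp only [mem_blockPairs, Finset.mem_filter, Finset.mem_univ, true_and] at h1 h2
    exact (h.index_ne h2.1.2 h2.2.1).ne h1.2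

theorem blockSwap_val (h : IsBlockSplit κ κ' o a b) (i : Fin d) : (blockSwap d o a b i : ℕ) =
    if o ≤ (i : ℕ) ∧ (i : ℕ) < o + a then (i : ℕ) + b
    else if o + a ≤ (i : ℕ) ∧ (i : ℕ) < o + a + b then (i : ℕ) - a else i := by
  have h0 := h.le
  change ((if h : o + a + b ≤ d ∧ o ≤ (i : ℕ) ∧ (i : ℕ) < o + a then (⟨i + b, by omega⟩ : Fin d)
    else if o + a + b ≤ d ∧ o + a ≤ (i : ℕ) ∧ (i : ℕ) < o + a + b then ⟨i - a, by omega⟩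
      else i : Fin d) : ℕ) = _
  split_ifs <;> first | rfl | omega

theorem blockSwap_inv_val (h : IsBlockSplit κ κ' o a b) (i : Fin d) :
    ((blockSwap d o a b)⁻¹ i : ℕ) =
    if o ≤ (i : ℕ) ∧ (i : ℕ) < o + b then (i : ℕ) + a
    else if o + b ≤ (i : ℕ) ∧ (i : ℕ) < o + a + b then (i : ℕ) - b else i := by
  have h0 := h.le
  change ((if h : o + a + b ≤ d ∧ o ≤ (i : ℕ) ∧ (i : ℕ) < o + b then (⟨i + a, by omega⟩ : Fin d)
    else if o + a + b ≤ d ∧ o + b ≤ (i : ℕ) ∧ (i : ℕ) < o + a + b then ⟨i - b, by omega⟩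
      else i : Fin d) : ℕ) = _
  split_ifs <;> first | rfl | omega

/-- All entries of the block which is cut are in the same block of `κ`. -/
theorem index_eq_of_mem (h : IsBlockSplit κ κ' o a b) {i j : Fin d} (hi : o ≤ (i : ℕ))
    (hi' : (i : ℕ) < o + a + b) (hj : o ≤ (j : ℕ)) (hj' : (j : ℕ) < o + a + b) :
    κ.index i = κ.index j := by
  have key : ∀ {i j : Fin d}, i < j → o ≤ (i : ℕ) → (j : ℕ) < o + a + b →
      κ.index i = κ.index j := fun hij h1 h2 =>
    (AffineSchur.index_eq_iff hij).2 fun n hn h3 h4 => by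
      rcases h.gap n hn with h5 | h5 <;> omega
  rcases lt_trichotomy i j with h1 | rfl | h1
  · exact key h1 hi hj'
  · rfl
  · exact (key h1 hj hi').symm

theorem blockSwap_mem (h : IsBlockSplit κ κ' o a b) : blockSwap d o a b ∈ young κ := by
  intro i
  by_cases hi : o ≤ (i : ℕ) ∧ (i : ℕ) < o + a + b
  · have hv := h.blockSwap_val i
    refine h.index_eq_of_mem ?_ ?_ hi.1 hi.2 <;> rw [hv] <;> split_ifs <;> omega
  · have hv : blockSwap d o a b i = i := by
      apply Fin.ext
      rw [h.blockSwap_val]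
      split_ifs <;> omega
    rw [hv]

/-- The permutation `w_{a,b}` takes the longest element of the smaller Young subgroup to that of the
larger one, because their product reverses the order in every block. -/
theorem blockSwap_mul_longest (h : IsBlockSplit κ κ' o a b) :
    blockSwap d o a b * longest κ' = longest κ := by
  refine Reverses.eq ?_ (longest_reverses κ)
    (mul_mem h.blockSwap_mem (h.young_le (longest_mem κ'))) (longest_mem κ)
  intro i j hij hidx
  rw [mul_inv_rev, Equiv.Perm.mul_apply, Equiv.Perm.mul_apply]
  have vi := h.blockSwap_inv_val i
  have vj := h.blockSwap_inv_val j
  set i' := (blockSwap d o a b)⁻¹ i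
  set j' := (blockSwap d o a b)⁻¹ j
  have hij' : (i : ℕ) < j := hij
  -- both entries are in the block which is cut, or both are outside of it
  have hblock : o ≤ (i : ℕ) ↔ o ≤ (j : ℕ) := by
    refine ⟨fun h1 => by omega, fun h1 => ?_⟩
    by_contra h2
    exact (AffineSchur.index_eq_iff hij).1 hidx o h.left (by omega) h1
  have hblock' : (i : ℕ) < o + a + b ↔ (j : ℕ) < o + a + b := by
    refine ⟨fun h1 => ?_, fun h1 => by omega⟩
    by_contra h2
    exact (AffineSchur.index_eq_iff hij).1 hidx _ h.right h1 (by omega)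
  by_cases h1 : i' < j'
  · refine longest_reverses κ' i' j' h1 ?_
    have hidx' : κ.index i' = κ.index j' := by
      have := inv_mem h.blockSwap_mem
      have e1 := this i
      have e2 := this j
      exact e1.trans (hidx.trans e2.symm)
    refine ((h.index_eq_iff h1).1 hidx').resolve_right fun h2 => ?_
    split_ifs at vi vj <;> omega
  · have h2 : (j' : ℕ) ≤ i' := not_lt.1 h1
    refine lt_of_mem_young (inv_mem (longest_mem κ')) (h.index_ne ?_ ?_) <;>
      split_ifs at vi vj <;> omega

theorem isShortest_blockSwap (h : IsBlockSplit κ κ' o a b) :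
    IsShortest κ' (blockSwap d o a b)⁻¹ := by
  rw [isShortest_iff]
  intro r hr
  change ((blockSwap d o a b)⁻¹)⁻¹ (lo r) < ((blockSwap d o a b)⁻¹)⁻¹ (hi r)
  rw [inv_inv, Fin.lt_def, h.blockSwap_val, h.blockSwap_val]
  have h1 : ((lo r : Fin d) : ℕ) = r := rfl
  have h2 : ((hi r : Fin d) : ℕ) = r + 1 := rfl
  have h3 : ¬ ((r : ℕ) < o + a ∧ o + a ≤ r + 1) := fun h3 => (h.index_ne h3.1 h3.2).ne hr
  rw [h1, h2]
  split_ifs <;> omega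

end IsBlockSplit

end SplitBlocks

section MultiSplit

variable {ℓ d : ℕ} {lam mu : MultiComp ℓ d}

/-- A split adds one end of a block, as is seen from the concatenated lists. -/
theorem IsSplit.isBlockSplit {t l₁ a b l₂} (h : IsSplit lam mu t l₁ a b l₂) :
    IsBlockSplit lam.concat mu.concat (lam.before t + l₁.sum) a b := by
  obtain ⟨h1, h2, h3⟩ := h
  obtain ⟨A, B, e1, e2, e3⟩ := exists_flatten_eq lam.parts mu.parts t h3
  have eL : lam.concat.blocks = (A ++ l₁) ++ (a + b) :: (l₂ ++ B) := by
    change (List.ofFn lam.parts).flatten = _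
    rw [e1, h1]; simp
  have eM : mu.concat.blocks = (A ++ l₁) ++ a :: b :: (l₂ ++ B) := by
    change (List.ofFn mu.parts).flatten = _
    rw [e2, h2]; simp
  have eS : lam.before t + l₁.sum = (A ++ l₁).sum := by
    rw [List.sum_append, e3]; rfl
  rw [eS]
  have hL : ∀ n, IsBdry lam.concat.blocks n ↔ IsBdry (A ++ l₁) n ∨ ∃ m, (m = 0 ∨
      ∃ m', IsBdry (l₂ ++ B) m' ∧ m = a + b + m') ∧ n = (A ++ l₁).sum + m := by
    intro n
    rw [eL, isBdry_append]; rfl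
  have hM : ∀ n, IsBdry mu.concat.blocks n ↔ IsBdry (A ++ l₁) n ∨ ∃ m, (m = 0 ∨
      ∃ m', (m' = 0 ∨ ∃ m'', IsBdry (l₂ ++ B) m'' ∧ m' = b + m'') ∧ m = a + m') ∧
        n = (A ++ l₁).sum + m := by
    intro n
    rw [eM, isBdry_append]; rfl
  refine ⟨fun n => ?_, fun n hn => ?_, ?_, ?_⟩
  · rw [hL, hM]
    constructor
    · rintro (h | ⟨m, rfl | ⟨m', rfl | ⟨m'', h, rfl⟩, rfl⟩, rfl⟩)
      · exact Or.inl (Or.inl h)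
      · exact Or.inl (Or.inr ⟨0, Or.inl rfl, rfl⟩)
      · exact Or.inr rfl
      · exact Or.inl (Or.inr ⟨_, Or.inr ⟨m'', h, rfl⟩, by omega⟩)
    · rintro ((h | ⟨m, rfl | ⟨m', h, rfl⟩, rfl⟩) | rfl)
      · exact Or.inl h
      · exact Or.inr ⟨0, Or.inl rfl, rfl⟩
      · exact Or.inr ⟨_, Or.inr ⟨_, Or.inr ⟨m', h, rfl⟩, rfl⟩, by omega⟩
      · exact Or.inr ⟨a, Or.inr ⟨0, Or.inl rfl, rfl⟩, rfl⟩
  · rcases (hL n).1 hn with h | ⟨m, rfl | ⟨m', h, rfl⟩, rfl⟩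
    · exact Or.inl h.le_sum
    · exact Or.inl le_rfl
    · exact Or.inr (by omega)
  · exact (hL _).2 (Or.inr ⟨0, Or.inl rfl, rfl⟩)
  · exact (hL _).2 (Or.inr ⟨a + b, Or.inr ⟨0, isBdry_zero _, rfl⟩, (add_assoc _ _ _)⟩)

theorem MultiComp.redPos_eq_of_sum_eq (h : ∀ s, (mu.parts s).sum = (lam.parts s).sum)
    (t : Fin ℓ) : mu.redPos t = lam.redPos t := by
  unfold MultiComp.redPos MultiComp.blacksLeft MultiComp.before
  simp only [h]

theorem MultiComp.col_eq_of_redPos_eq (h : ∀ t, mu.redPos t = lam.redPos t) :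
    mu.col = lam.col := by
  apply Subtype.ext
  funext i
  change (if ∃ t, mu.redPos t = i then (1 : Fin 2) else 0) =
    if ∃ t, lam.redPos t = i then (1 : Fin 2) else 0
  simp only [h]

theorem IsSplit.col_eq {t l₁ a b l₂} (h : IsSplit lam mu t l₁ a b l₂) : mu.col = lam.col := by
  refine MultiComp.col_eq_of_redPos_eq (MultiComp.redPos_eq_of_sum_eq fun s => ?_)
  by_cases hs : s = t
  · rw [hs, h.1, h.2.1]
    simp [add_assoc]
  · rw [h.2.2 s hs]

theorem IsLeftCrossing.concat_eq {t a} (h : IsLeftCrossing lam mu t a) :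
    lam.concat = mu.concat :=
  Composition.ext (flatten_eq_of_move lam.parts mu.parts t a h.1 h.2.1 h.2.2)

/-- A left crossing moves `a` strands from one component to the one before it. -/
theorem IsLeftCrossing.sum_eq {t a} (h : IsLeftCrossing lam mu t a) (s : Fin (ℓ + 1)) :
    (mu.parts s).sum + (if s = t.succ then a else 0) =
      (lam.parts s).sum + if s = t.castSucc then a else 0 := by
  have hne : t.castSucc ≠ t.succ := Fin.castSucc_lt_succ.ne
  by_cases h1 : s = t.castSucc
  · subst h1
    rw [h.2.1, if_neg hne, if_pos rfl, List.sum_append, List.sum_singleton, add_zero]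
  · by_cases h2 : s = t.succ
    · subst h2
      rw [h.1, if_pos rfl, if_neg h1, List.sum_cons, add_zero, add_comm]
    · rw [h.2.2 s h1 h2, if_neg h1, if_neg h2]

theorem IsLeftCrossing.blacksLeft_eq {t a} (h : IsLeftCrossing lam mu t a) (s : Fin ℓ) :
    mu.blacksLeft s = lam.blacksLeft s + if s = t then a else 0 := by
  have h1 := Finset.sum_congr (rfl : Finset.Iio s.succ = Finset.Iio s.succ)
    fun u (_ : u ∈ Finset.Iio s.succ) => h.sum_eq u
  rw [Finset.sum_add_distrib, Finset.sum_add_distrib, Finset.sum_ite_eq', Finset.sum_ite_eq'] at h1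
  simp only [Finset.mem_Iio, Fin.lt_def, Fin.val_succ, Fin.val_castSucc] at h1
  unfold MultiComp.blacksLeft MultiComp.before
  simp only [Fin.ext_iff]
  split_ifs at h1 ⊢ <;> omega

theorem IsLeftCrossing.redPos_eq {t a} (h : IsLeftCrossing lam mu t a) (s : Fin ℓ) :
    mu.redPos s = lam.redPos s + if s = t then a else 0 := by
  rw [MultiComp.redPos, h.blacksLeft_eq, MultiComp.redPos, add_assoc]

/-- The strands crossed by a left crossing are black. -/
theorem IsLeftCrossing.black {t a} (h : IsLeftCrossing lam mu t a) {i : Fin (ℓ + d)}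
    (h1 : lam.redPos t < i) (h2 : (i : ℕ) ≤ lam.redPos t + a) : lam.col.1 i = 0 := by
  by_contra hne
  obtain ⟨s, hs⟩ := MultiComp.col_eq_one.1 (fin_two_ne_zero hne)
  have hts : t < s := lam.redPos_strictMono.lt_iff_lt.1 (by rw [hs]; exact h1)
  have h3 := mu.redPos_strictMono hts
  rw [h.redPos_eq, h.redPos_eq, if_pos rfl, if_neg hts.ne', hs] at h3
  omega

theorem IsLeftCrossing.isBdry {t a} (h : IsLeftCrossing lam mu t a) :
    IsBdry lam.concat.blocks (lam.blacksLeft t + a) := by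
  have h1 := mu.isBdry_blacksLeft t
  rwa [h.blacksLeft_eq, if_pos rfl, ← h.concat_eq] at h1

end MultiSplit

/-! ### The operators of the elements of the Hecke algebra -/

namespace Hecke

section Operators

variable {k : Type*} [Field k] {ℓ d : ℕ} {q : k} {Q : Fin ℓ → k}

/-- In the polynomial representation, `y` sends `f e(c)` to `F(f) e(c')` and vanishes on the other
summands. -/
def IsOp (y : Hecke d q Q) (c c' : Col ℓ d) (F : Module.End k (Laurent k d)) : Prop :=
  ∀ b f, act q Q d y (Pi.single b f) = if b = c then Pi.single c' (F f) else 0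

namespace IsOp

variable {y z : Hecke d q Q} {c c' c'' : Col ℓ d} {F G : Module.End k (Laurent k d)}

theorem apply (h : IsOp y c c' F) (f : Laurent k d) :
    act q Q d y (Pi.single c f) = Pi.single c' (F f) := by rw [h, if_pos rfl]

theorem of_mul_E (h : ∀ f, act q Q d y (Pi.single c f) = Pi.single c' (F f)) :
    IsOp (y * E q Q c) c c' F := by
  intro b f
  rw [map_mul, Module.End.mul_apply, act_E_single]
  by_cases hb : b = c
  · rw [if_pos hb.symm, if_pos hb, hb, h]
  · rw [if_neg (Ne.symm hb), if_neg hb, map_zero]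

/-- Since the polynomial representation is faithful, an element is determined by its operator. -/
theorem eq (hy : IsOp y c c' F) (hz : IsOp z c c' F) : y = z :=
  act_injective q Q (LinearMap.pi_ext fun b f => (hy b f).trans (hz b f).symm)

theorem mul (hy : IsOp y c' c'' G) (hz : IsOp z c c' F) : IsOp (y * z) c c'' (G * F) := by
  intro b f
  rw [map_mul, Module.End.mul_apply, hz]
  split_ifs
  · exact hy.apply _
  · exact map_zero _

theorem mul_of_apply (hy : ∀ f, act q Q d y (Pi.single c' f) = Pi.single c'' (G f))
    (hz : IsOp z c c' F) : IsOp (y * z) c c'' (G * F) := by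
  intro b f
  rw [map_mul, Module.End.mul_apply, hz]
  split_ifs
  · exact hy _
  · exact map_zero _

theorem smul (hy : IsOp y c c' F) (a : k) : IsOp (a • y) c c' (a • F) := by
  intro b f
  rw [map_smul, LinearMap.smul_apply, hy]
  split_ifs
  · exact (Pi.single_smul _ _ _).symm
  · exact smul_zero _

theorem sum {ι : Type*} {s : Finset ι} {y : ι → Hecke d q Q}
    {F : ι → Module.End k (Laurent k d)} (h : ∀ i ∈ s, IsOp (y i) c c' (F i)) :
    IsOp (∑ i ∈ s, y i) c c' (∑ i ∈ s, F i) := by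
  classical
  intro b f
  rw [map_sum, LinearMap.sum_apply, LinearMap.sum_apply,
    Finset.sum_congr rfl fun i hi => h i hi b f]
  split_ifs
  · exact (map_sum (AddMonoidHom.single (fun _ : Col ℓ d => Laurent k d) c') _ _).symm
  · exact Finset.sum_const_zero

theorem poly_mul (f : Laurent k d) (h : IsOp y c c' F) :
    IsOp (poly d q Q f * y) c c' (LinearMap.mulLeft k f * F) :=
  h.mul_of_apply fun g => act_poly_single q Q f c' g

theorem mul_poly (f : Laurent k d) (h : IsOp y c c' F) :
    IsOp (y * poly d q Q f) c c' (F * LinearMap.mulLeft k f) := by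
  intro b g
  rw [map_mul, Module.End.mul_apply, act_poly_single, h]
  rfl

theorem mul_E (h : IsOp y c c' F) : y * E q Q c = y :=
  IsOp.eq (of_mul_E h.apply) h

end IsOp

theorem isOp_E (c : Col ℓ d) : IsOp (E q Q c) c c 1 := by
  intro b f
  rw [act_E_single]
  by_cases hb : b = c
  · rw [if_pos hb.symm, if_pos hb, hb]; rfl
  · rw [if_neg (Ne.symm hb), if_neg hb]

theorem T_eq {n : ℕ} (h : n < ℓ + d - 1) : T d q Q n = tau q Q ⟨n, h⟩ := dif_pos h

/-- On black strands which are adjacent in `c`, the diagram of a permutation acts by a product of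
Demazure–Lusztig operators. -/
theorem isOp_Tw {c : Col ℓ d} {w : Equiv.Perm (Fin d)}
    (h : ∀ r ∈ reducedWord w, (c.blackPos (hi r) : ℕ) = c.blackPos (lo r) + 1) :
    IsOp (Tw d q Q c w) c c (wordProd (lusztig q) w) := by
  refine IsOp.of_mul_E fun f => ?_
  unfold wordProd
  revert h
  generalize reducedWord w = L
  induction L with
  | nil => intro _; simp
  | cons r L ih =>
    intro h
    rw [List.map_cons, List.prod_cons, map_mul, Module.End.mul_apply,
      ih fun s hs => h s (List.mem_cons_of_mem _ hs), List.map_cons, List.prod_cons,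
      Module.End.mul_apply]
    have h1 := h r (List.mem_cons_self ..)
    have h2 : (c.blackPos (lo r) : ℕ) < ℓ + d - 1 := by
      have := (c.blackPos (hi r)).2
      omega
    have e1 : lo ⟨c.blackPos (lo r), h2⟩ = c.blackPos (lo r) := rfl
    have e2 : hi ⟨c.blackPos (lo r), h2⟩ = c.blackPos (hi r) := Fin.ext h1.symm
    have e3 : c.nb (c.blackPos (lo r)) = r := c.nb_blackPos (lo r)
    change act q Q d (T d q Q (c.blackPos (lo r))) _ = _
    rw [T_eq h2, act_tau_single, e1, e2, Col.blackPos_black, Col.blackPos_black,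
      crossOp_zero_zero, Col.swap_of_eq (by rw [e1, e2, Col.blackPos_black, Col.blackPos_black])]
    simp only [e3]
    rw [lusztigN, dif_pos r.2]

theorem isOp_Tw_omega (w : Equiv.Perm (Fin d)) :
    IsOp (Tw d q Q (omega ℓ d) w) (omega ℓ d) (omega ℓ d) (wordProd (lusztig q) w) :=
  isOp_Tw fun r _ => omega_blackPos_hi_eq r

theorem isOp_Tw_col (lam : MultiComp ℓ d) {w : Equiv.Perm (Fin d)} (hw : w ∈ young lam.concat) :
    IsOp (Tw d q Q lam.col w) lam.col lam.col (wordProd (lusztig q) w) :=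
  isOp_Tw fun _ hr => lam.blackPos_hi_eq (index_eq_of_mem_reducedWord hw hr)

theorem isOp_mSum_omega (κ : Composition d) :
    IsOp (mSum d q Q (omega ℓ d) κ) (omega ℓ d) (omega ℓ d) (antisym q κ) :=
  IsOp.sum fun w _ => (isOp_Tw_omega w).smul _

/-- `m_λ` acts as the antisymmetrizer of the Young subgroup of `λ`. -/
theorem isOp_m (lam : MultiComp ℓ d) : IsOp (m q Q lam) lam.col lam.col (antisym q lam.concat) :=
  IsOp.sum fun _ hw => (isOp_Tw_col lam (Finset.mem_filter.1 hw).2).smul _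

theorem isOp_nPrime_omega (κ : Composition d) :
    IsOp (nPrime d q Q (omega ℓ d) κ) (omega ℓ d) (omega ℓ d) (symCoset q κ) :=
  IsOp.sum fun w _ => isOp_Tw_omega w

variable (d q Q) in
/-- The sum of all the diagrams `T_w` on the black strands of `ω`. -/
def nAll : Hecke d q Q := ∑ w, Tw d q Q (omega ℓ d) w

theorem isOp_nAll : IsOp (nAll d q Q) (omega ℓ d) (omega ℓ d) (symAll k d q) :=
  IsOp.sum fun w _ => isOp_Tw_omega w

/-- A red strand crosses `n` black strands to its right. -/
theorem act_moveRed_right (n p : ℕ) (c : Col ℓ d) (hp : p + n < ℓ + d)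
    (hred : ∀ i : Fin (ℓ + d), (i : ℕ) = p → c.1 i = 1)
    (hblack : ∀ i : Fin (ℓ + d), p < (i : ℕ) → (i : ℕ) ≤ p + n → c.1 i = 0) :
    ∃ c' : Col ℓ d, (∀ i, c'.1 i = 1 ↔ (i : ℕ) = p + n ∨ ((i : ℕ) ≠ p ∧ c.1 i = 1)) ∧
      ∀ f, act q Q d ((List.range n).reverse.map fun j => T d q Q (p + j)).prod (Pi.single c f) =
        Pi.single c' f := by
  induction n with
  | zero =>
    refine ⟨c, fun i => ?_, fun f => by simp⟩
    by_cases hi : (i : ℕ) = p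
    · simp [hi, hred i hi]
    · simp [hi]
  | succ n ih =>
    obtain ⟨c', h1, h2⟩ := ih (by omega) fun i hi hi' => hblack i hi (by omega)
    have hlt : p + n < ℓ + d - 1 := by omega
    set r : Fin (ℓ + d - 1) := ⟨p + n, hlt⟩ with hr
    have el : ((lo r : Fin (ℓ + d)) : ℕ) = p + n := rfl
    have eh : ((hi r : Fin (ℓ + d)) : ℕ) = p + n + 1 := rfl
    have hlo : c'.1 (lo r) = 1 := (h1 _).2 (Or.inl el)
    have hhi : c'.1 (hi r) = 0 := by
      by_contra hne
      rcases (h1 _).1 (fin_two_ne_zero hne) with h | ⟨_, h⟩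
      · omega
      · rw [hblack _ (by omega) (by omega)] at h
        exact absurd h (by decide)
    refine ⟨Col.swap r c', fun i => ?_, fun f => ?_⟩
    · by_cases hi1 : i = lo r
      · rw [hi1, Col.swap_lo, hhi]
        refine iff_of_false (by decide) ?_
        rintro (h | ⟨h, h'⟩)
        · omega
        · rw [hblack _ (by omega) (by omega)] at h'
          exact absurd h' (by decide)
      · by_cases hi2 : i = hi r
        · rw [hi2, Col.swap_hi, hlo]
          exact iff_of_true rfl (Or.inl eh)
        · have hi1' : (i : ℕ) ≠ p + n := fun h => hi1 (Fin.ext h)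
          have hi2' : (i : ℕ) ≠ p + (n + 1) := fun h => hi2 (Fin.ext h)
          rw [Col.swap_apply, simpleRefl_of_ne hi1 hi2, h1]
          simp [hi1', hi2']
    · rw [List.range_succ, List.reverse_append, List.reverse_singleton, List.singleton_append,
        List.map_cons, List.prod_cons, map_mul, Module.End.mul_apply, h2, T_eq hlt,
        act_tau_single, hlo, hhi, crossOp_one_zero]
      rfl

theorem _root_.AffineSchur.Col.nb_add_of_black {c : Col ℓ d} {p n : ℕ} (hp : p + n ≤ ℓ + d)
    (h : ∀ i : Fin (ℓ + d), p ≤ (i : ℕ) → (i : ℕ) < p + n → c.1 i = 0) :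
    c.nb (p + n) = c.nb p + n := by
  induction n with
  | zero => rfl
  | succ n ih =>
    have h1 := Col.nb_succ_of_black (h ⟨p + n, by omega⟩ (by simp) (by simp))
    rw [← add_assoc, ← add_assoc, ← ih (by omega) fun i hi hi' => h i hi (by omega)]
    exact h1

/-- A red strand crosses `n` black strands to its left. -/
theorem act_moveRed_left (n p : ℕ) (c : Col ℓ d) (hp : p + n < ℓ + d)
    (hred : ∀ i : Fin (ℓ + d), (i : ℕ) = p + n → c.1 i = 1)
    (hblack : ∀ i : Fin (ℓ + d), p ≤ (i : ℕ) → (i : ℕ) < p + n → c.1 i = 0) :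
    ∃ c' : Col ℓ d, (∀ i, c'.1 i = 1 ↔ (i : ℕ) = p ∨ ((i : ℕ) ≠ p + n ∧ c.1 i = 1)) ∧
      ∀ f, act q Q d ((List.range n).map fun j => T d q Q (p + j)).prod (Pi.single c f) =
        Pi.single c' ((∏ j ∈ Finset.range n,
          (xN k d (c.nb p + j) - algebraMap k (Laurent k d) (paramN Q (c.nr p)))) * f) := by
  induction n generalizing c with
  | zero =>
    refine ⟨c, fun i => ?_, fun f => by simp⟩
    by_cases hi : (i : ℕ) = p
    · simp [hi, hred i hi]
    · simp [hi]
  | succ n ih =>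
    have hlt : p + n < ℓ + d - 1 := by omega
    set r : Fin (ℓ + d - 1) := ⟨p + n, hlt⟩ with hr
    have el : ((lo r : Fin (ℓ + d)) : ℕ) = p + n := rfl
    have eh : ((hi r : Fin (ℓ + d)) : ℕ) = p + n + 1 := rfl
    have hlo : c.1 (lo r) = 0 := hblack _ (by omega) (by omega)
    have hhi : c.1 (hi r) = 1 := hred _ eh
    have hr' : p ≤ (r : ℕ) := Nat.le_add_right p n
    obtain ⟨c', h1, h2⟩ := ih (Col.swap r c) (by omega)
      (fun i hi => by rw [show i = lo r from Fin.ext hi, Col.swap_lo, hhi])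
      (fun i hi hi' => by
        rw [Col.swap_apply, simpleRefl_of_ne, hblack i hi (by omega)]
        · exact fun h => by rw [h] at hi'; omega
        · exact fun h => by rw [h] at hi'; omega)
    rw [Col.nb_swap_of_le c hr', Col.nr_swap_of_le c hr'] at h2
    have hnb : c.nb (r : ℕ) = c.nb p + n :=
      Col.nb_add_of_black (by omega) fun i hi hi' => hblack i hi (by omega)
    have hnr : c.nr (r : ℕ) = c.nr p := by
      have e1 := c.nb_add_nr (i := r) (by change p + n ≤ _; omega)
      have e2 := c.nb_add_nr (i := p) (by omega)
      have e3 : (r : ℕ) = p + n := rfl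
      omega
    refine ⟨c', fun i => ?_, fun f => ?_⟩
    · rw [h1]
      by_cases hi1 : i = lo r
      · rw [hi1, hlo]
        simp only [el]
        refine or_congr_right (iff_of_false (fun h => h.1 rfl) fun h => absurd h.2 (by decide))
      · by_cases hi2 : i = hi r
        · rw [hi2, Col.swap_hi, hlo]
          simp only [eh]
          refine or_congr_right (iff_of_false (fun h => absurd h.2 (by decide)) fun h => h.1 rfl)
        · have hi1' : (i : ℕ) ≠ p + n := fun h => hi1 (Fin.ext h)
          have hi2' : (i : ℕ) ≠ p + (n + 1) := fun h => hi2 (Fin.ext h)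
          rw [Col.swap_apply, simpleRefl_of_ne hi1 hi2]
          simp [hi1', hi2']
    · rw [List.range_succ, List.map_append, List.prod_append, List.map_singleton,
        List.prod_singleton, map_mul, Module.End.mul_apply, T_eq hlt, act_tau_single, hlo, hhi,
        crossOp_zero_one, LinearMap.mulLeft_apply, h2, Finset.prod_range_succ, hnb, hnr, mul_assoc]

theorem _root_.AffineSchur.Col.ext_red {c c' : Col ℓ d} (h : ∀ i, c.1 i = 1 ↔ c'.1 i = 1) :
    c = c' := by
  refine Subtype.ext (funext fun i => ?_)
  have := h i
  rcases fin_two_cases (c.1 i) with e | e <;> rcases fin_two_cases (c'.1 i) with e' | e' <;>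
    simp_all

/-- `𝔯_λ` moves the red strands from their positions in `ω` to their positions in `c_λ`. In every
crossing a red strand passes a black one from the left to the right, and such crossings act
trivially on polynomials. -/
theorem isOp_rElt (lam : MultiComp ℓ d) : IsOp (rElt q Q lam) (omega ℓ d) lam.col 1 := by
  refine IsOp.of_mul_E ?_
  set L : List (Hecke d q Q) := List.ofFn fun t : Fin ℓ =>
    ((List.range (lam.blacksLeft t)).reverse.map fun j => T d q Q (t + j)).prod with hL
  have hlen : L.length = ℓ := List.length_ofFn
  -- Downward induction on `n`: after the factors `R_{n+1}, …, R_ℓ` have acted, the red strands from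
  -- the `n`-th on (counted from zero) are in their places in `c_λ`, and the others are still at the
  -- far left.
  have key : ∀ n ≤ ℓ, ∃ c : Col ℓ d, (∀ i, c.1 i = 1 ↔ (i : ℕ) < n ∨
      ∃ t : Fin ℓ, n ≤ (t : ℕ) ∧ lam.redPos t = i) ∧
      ∀ f, act q Q d (L.drop n).prod (Pi.single (omega ℓ d) f) = Pi.single c f := by
    intro n hn
    induction hn using Nat.decreasingInduction with
    | self =>
      refine ⟨omega ℓ d, fun i => ?_, fun f => ?_⟩
      · rw [omega_eq_one]
        refine ⟨Or.inl, fun h => h.resolve_right ?_⟩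
        rintro ⟨t, ht, _⟩
        exact absurd t.2 (not_lt.2 ht)
      · rw [List.drop_eq_nil_of_le hlen.le, List.prod_nil, map_one]
        rfl
    | of_succ n hn ih =>
      obtain ⟨c, h1, h2⟩ := ih
      have hred : lam.redPos ⟨n, hn⟩ = n + lam.blacksLeft ⟨n, hn⟩ := rfl
      have hpos := lam.redPos_lt ⟨n, hn⟩
      obtain ⟨c', h3, h4⟩ := act_moveRed_right (q := q) (Q := Q) (lam.blacksLeft ⟨n, hn⟩) n c
        (by omega) (fun i hi => (h1 i).2 (Or.inl (by omega))) (fun i hi hi' => by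
          by_contra hne
          rcases (h1 i).1 (fin_two_ne_zero hne) with h | ⟨t, ht, ht'⟩
          · omega
          · have := lam.redPos_strictMono (show (⟨n, hn⟩ : Fin ℓ) < t from ht)
            omega)
      refine ⟨c', fun i => ?_, fun f => ?_⟩
      · rw [h3, h1]
        constructor
        · rintro (h | ⟨h, h' | ⟨t, ht, ht'⟩⟩)
          · exact Or.inr ⟨⟨n, hn⟩, le_rfl, by omega⟩
          · exact Or.inl (by omega)
          · exact Or.inr ⟨t, by omega, ht'⟩
        · rintro (h | ⟨t, ht, ht'⟩)
          · exact Or.inr ⟨by omega, Or.inl (by omega)⟩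
          · rcases ht.eq_or_lt with e | e
            · have : t = ⟨n, hn⟩ := Fin.ext e.symm
              subst this
              exact Or.inl (by omega)
            · refine Or.inr ⟨?_, Or.inr ⟨t, e, ht'⟩⟩
              have := lam.redPos_strictMono (show (⟨n, hn⟩ : Fin ℓ) < t from e)
              omega
      · rw [List.drop_eq_getElem_cons (by omega), List.prod_cons, map_mul, Module.End.mul_apply,
          h2, ← h4]
        simp only [hL, List.getElem_ofFn]
  obtain ⟨c, h1, h2⟩ := key 0 (Nat.zero_le _)
  have hc : c = lam.col := Col.ext_red fun i => by
    rw [h1, MultiComp.col_eq_one]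
    simp
  intro f
  rw [← hc, ← h2]
  rfl

section Crossings

variable {lam mu : MultiComp ℓ d} {t : Fin ℓ} {a : ℕ}

/-- A left crossing acts as the identity on polynomials. -/
theorem isOp_leftCrossing (h : IsLeftCrossing lam mu t a) :
    IsOp (leftCrossing q Q lam t a) lam.col mu.col 1 := by
  refine IsOp.of_mul_E fun f => ?_
  have h1 := h.redPos_eq t
  rw [if_pos rfl] at h1
  have h2 := mu.redPos_lt t
  obtain ⟨c', h3, h4⟩ := act_moveRed_right (q := q) (Q := Q) a (lam.redPos t) lam.col (by omega)
    (fun i hi => MultiComp.col_eq_one.2 ⟨t, hi.symm⟩) (fun i hi hi' => h.black hi hi')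
  have hc : c' = mu.col := Col.ext_red fun i => by
    rw [h3, MultiComp.col_eq_one, MultiComp.col_eq_one]
    constructor
    · rintro (h5 | ⟨h5, s, hs⟩)
      · exact ⟨t, by omega⟩
      · refine ⟨s, ?_⟩
        rw [h.redPos_eq, if_neg, hs, add_zero]
        rintro rfl
        exact h5 hs.symm
    · rintro ⟨s, hs⟩
      rw [h.redPos_eq] at hs
      by_cases hst : s = t
      · subst hst
        rw [if_pos rfl] at hs
        exact Or.inl hs.symm
      · rw [if_neg hst, add_zero] at hs
        refine Or.inr ⟨fun h5 => hst (lam.redPos_strictMono.injective (hs.trans h5)), s, hs⟩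
  rw [h4, hc]
  rfl

theorem _root_.AffineSchur.IsLeftCrossing.black_right (h : IsLeftCrossing lam mu t a)
    {i : Fin (ℓ + d)} (h1 : lam.redPos t ≤ i) (h2 : (i : ℕ) < lam.redPos t + a) :
    mu.col.1 i = 0 := by
  by_contra hne
  obtain ⟨s, hs⟩ := MultiComp.col_eq_one.1 (fin_two_ne_zero hne)
  have h3 := h.redPos_eq t
  rw [if_pos rfl] at h3
  have hst : s < t := mu.redPos_strictMono.lt_iff_lt.1 (by omega)
  have h4 := lam.redPos_strictMono hst
  rw [h.redPos_eq, if_neg hst.ne] at hs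
  omega

theorem _root_.AffineSchur.crossPoly_eq (hd : lam.blacksLeft t + a ≤ d) :
    crossPoly Q lam t a = ∏ j ∈ Finset.range a,
      (xN k d (lam.blacksLeft t + j) - algebraMap k (Laurent k d) (Q t)) := by
  unfold crossPoly
  symm
  refine Finset.prod_bij' (fun j hj => ⟨lam.blacksLeft t + j, by
      have := Finset.mem_range.1 hj; omega⟩) (fun i _ => i - lam.blacksLeft t) ?_ ?_ ?_ ?_ ?_
  · intro j hj
    have := Finset.mem_range.1 hj
    simp only [Finset.mem_filter, Finset.mem_univ, true_and]
    omega
  · intro i hi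
    simp only [Finset.mem_filter, Finset.mem_univ, true_and] at hi
    rw [Finset.mem_range]
    omega
  · intro j _
    simp
  · intro i hi
    simp only [Finset.mem_filter, Finset.mem_univ, true_and] at hi
    apply Fin.ext
    simp only
    omega
  · intro j hj
    have := Finset.mem_range.1 hj
    rw [xN_eq (by omega)]

theorem _root_.AffineSchur.IsLeftCrossing.blacksLeft_add_le (h : IsLeftCrossing lam mu t a) :
    lam.blacksLeft t + a ≤ d := by
  have h1 := h.isBdry.le_sum
  rwa [lam.concat.blocks_sum] at h1

/-- A right crossing multiplies by `∏ (x_i - Q_t)`, one factor for each black strand that it moves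
through the red strand. -/
theorem isOp_rightCrossing (h : IsLeftCrossing lam mu t a) :
    IsOp (rightCrossing q Q lam mu t a) mu.col lam.col
      (LinearMap.mulLeft k (crossPoly Q lam t a)) := by
  refine IsOp.of_mul_E fun f => ?_
  have h1 := h.redPos_eq t
  rw [if_pos rfl] at h1
  have h2 := mu.redPos_lt t
  obtain ⟨c', h3, h4⟩ := act_moveRed_left (q := q) (Q := Q) a (lam.redPos t) mu.col (by omega)
    (fun i hi => MultiComp.col_eq_one.2 ⟨t, h1.trans hi.symm⟩)
    (fun i hi hi' => h.black_right hi hi')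
  -- the strand which moves is the red strand with parameter `Q_t`, and it crosses the black strands
  -- of the moved block
  have hnb : mu.col.nb (lam.redPos t) = lam.blacksLeft t := by
    have e1 := mu.nb_redPos t
    rw [h1, Col.nb_add_of_black (by omega) fun i hi hi' => h.black_right hi hi', h.blacksLeft_eq,
      if_pos rfl] at e1
    omega
  have hnr : mu.col.nr (lam.redPos t) = t := by
    have e1 := mu.col.nb_add_nr (i := lam.redPos t) (by omega)
    have e2 : lam.redPos t = t + lam.blacksLeft t := rfl
    omega
  have hc : c' = lam.col := Col.ext_red fun i => by
    rw [h3, MultiComp.col_eq_one, MultiComp.col_eq_one]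
    constructor
    · rintro (h5 | ⟨h5, s, hs⟩)
      · exact ⟨t, by omega⟩
      · refine ⟨s, ?_⟩
        rw [h.redPos_eq] at hs
        rwa [if_neg, add_zero] at hs
        rintro rfl
        rw [if_pos rfl] at hs
        exact h5 hs.symm
    · rintro ⟨s, hs⟩
      by_cases hst : s = t
      · subst hst
        exact Or.inl hs.symm
      · refine Or.inr ⟨fun h5 => hst (mu.redPos_strictMono.injective ?_), s, ?_⟩
        · rw [h.redPos_eq, if_neg hst]
          omega
        · rw [h.redPos_eq, if_neg hst, hs, add_zero]
  rw [h4, hc, hnb, hnr, paramN_eq, LinearMap.mulLeft_apply, crossPoly_eq h.blacksLeft_add_le]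

/-- A right crossing multiplies with an invariant polynomial. -/
theorem _root_.AffineSchur.IsLeftCrossing.permute_crossPoly (h : IsLeftCrossing lam mu t a)
    {w : Equiv.Perm (Fin d)} (hw : w ∈ young lam.concat) :
    permute w (crossPoly Q lam t a) = crossPoly Q lam t a := by
  unfold crossPoly
  rw [map_prod]
  refine Finset.prod_bij (fun i _ => w i) ?_ ?_ ?_ ?_
  · intro i hi
    simp only [Finset.mem_filter, Finset.mem_univ, true_and] at hi ⊢
    rw [young_lt_iff hw h.isBdry, ← not_lt, young_lt_iff hw (lam.isBdry_blacksLeft t), not_lt]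
    exact hi
  · intro i _ j _ hij
    exact w.injective hij
  · intro i hi
    refine ⟨w.symm i, ?_, w.apply_symm_apply i⟩
    simp only [Finset.mem_filter, Finset.mem_univ, true_and] at hi ⊢
    rw [← not_lt, ← young_lt_iff hw h.isBdry, ← young_lt_iff hw (lam.isBdry_blacksLeft t),
      w.apply_symm_apply, not_lt]
    exact hi
  · intro i _
    rw [map_sub, permute_x, AlgHom.commutes]

end Crossings

end Operators

end Hecke

/-! ### Homomorphisms between the summands -/

section Maps

open Hecke MulOpposite

variable {k : Type*} [Field k] {ℓ d : ℕ} {q : k} {Q : Fin ℓ → k}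

theorem mem_mIdeal {lam : MultiComp ℓ d} {u : Hecke d q Q} :
    u ∈ mIdeal q Q lam ↔ ∃ h, u = m q Q lam * h := by
  rw [Submodule.mem_span_singleton]
  exact ⟨fun ⟨a, ha⟩ => ⟨unop a, ha.symm⟩, fun ⟨h, hh⟩ => ⟨op h, hh.symm⟩⟩

theorem m_mul_mem (lam : MultiComp ℓ d) (h : Hecke d q Q) : m q Q lam * h ∈ mIdeal q Q lam :=
  mem_mIdeal.2 ⟨h, rfl⟩

/-- `m_λ`, as an element of `m_λ H`. -/
def mGen (q : k) (Q : Fin ℓ → k) (lam : MultiComp ℓ d) : mIdeal q Q lam :=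
  ⟨m q Q lam, mem_mIdeal.2 ⟨1, (mul_one _).symm⟩⟩

theorem exists_smul_mGen (lam : MultiComp ℓ d) (u : mIdeal q Q lam) :
    ∃ h : Hecke d q Q, u = op h • mGen q Q lam := by
  obtain ⟨h, hh⟩ := mem_mIdeal.1 u.2
  exact ⟨h, Subtype.ext hh⟩

/-- An element of the Schur algebra is determined by its values on the generators `m_λ`. -/
theorem schur_ext {φ ψ : Schur d q Q}
    (h : ∀ lam, φ (inMod d q Q lam (mGen q Q lam)) = ψ (inMod d q Q lam (mGen q Q lam))) :
    φ = ψ := by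
  refine DirectSum.linearMap_ext _ fun lam => LinearMap.ext fun u => ?_
  obtain ⟨a, rfl⟩ := exists_smul_mGen lam u
  simp only [LinearMap.comp_apply, map_smul, h lam]

theorem mul_mem_mIdeal {lam mu : MultiComp ℓ d} {z : Hecke d q Q}
    (h : z * m q Q lam ∈ mIdeal q Q mu) {u : Hecke d q Q} (hu : u ∈ mIdeal q Q lam) :
    z * u ∈ mIdeal q Q mu := by
  obtain ⟨a, rfl⟩ := mem_mIdeal.1 hu
  obtain ⟨b, hb⟩ := mem_mIdeal.1 h
  rw [← mul_assoc, hb, mul_assoc]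
  exact m_mul_mem mu _

/-- Left multiplication by `z`, as a homomorphism from `m_λ H` to `m_μ H`, extended by zero. -/
def leftMul (lam mu : MultiComp ℓ d) (z : Hecke d q Q) (h : z * m q Q lam ∈ mIdeal q Q mu) :
    Schur d q Q :=
  inMod d q Q mu ∘ₗ
    (LinearMap.mulLeft (Hecke d q Q)ᵐᵒᵖ z).restrict (fun _ hu => mul_mem_mIdeal h hu) ∘ₗ
    DirectSum.component (Hecke d q Q)ᵐᵒᵖ (MultiComp ℓ d) (fun lam => mIdeal q Q lam) lam

section LeftMul

variable {lam mu : MultiComp ℓ d} {z : Hecke d q Q} {y : Hecke d q Q} {φ ψ : Schur d q Q}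

theorem leftMul_inMod (h : z * m q Q lam ∈ mIdeal q Q mu) (u : mIdeal q Q lam) :
    leftMul lam mu z h (inMod d q Q lam u) = inMod d q Q mu ⟨z * u, mul_mem_mIdeal h u.2⟩ := by
  rw [leftMul, LinearMap.comp_apply, LinearMap.comp_apply, DirectSum.component.lof_self]
  rfl

theorem leftMul_inMod_of_ne (h : z * m q Q lam ∈ mIdeal q Q mu) {nu : MultiComp ℓ d}
    (hnu : nu ≠ lam) (u : mIdeal q Q nu) : leftMul lam mu z h (inMod d q Q nu u) = 0 := by
  rw [leftMul, LinearMap.comp_apply, LinearMap.comp_apply, DirectSum.component.of, dif_neg hnu,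
    map_zero, map_zero]

theorem isMap_leftMul (h : z * m q Q lam ∈ mIdeal q Q mu) :
    IsMap d q Q lam mu (z * m q Q lam) (leftMul lam mu z h) := by
  refine ⟨fun u a hu => ⟨⟨z * u, mul_mem_mIdeal h u.2⟩, ?_, leftMul_inMod h u⟩,
    fun nu hnu u => leftMul_inMod_of_ne h hnu u⟩
  simp only [hu, mul_assoc]

theorem isMap_unique (hφ : IsMap d q Q lam mu y φ) (hψ : IsMap d q Q lam mu y ψ) : φ = ψ := by
  refine schur_ext fun nu => ?_
  by_cases hnu : nu = lam
  · subst hnu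
    obtain ⟨v, hv, e⟩ := hφ.1 (mGen q Q nu) 1 (mul_one _).symm
    obtain ⟨v', hv', e'⟩ := hψ.1 (mGen q Q nu) 1 (mul_one _).symm
    rw [e, e', Subtype.ext (hv.trans hv'.symm)]
  · rw [hφ.2 nu hnu, hψ.2 nu hnu]

theorem existsUnique_isMap (h : z * m q Q lam ∈ mIdeal q Q mu) (hy : y = z * m q Q lam) :
    ∃! φ, IsMap d q Q lam mu y φ :=
  hy ▸ ⟨_, isMap_leftMul h, fun _ hφ => isMap_unique hφ (isMap_leftMul h)⟩

theorem IsMap.eq_leftMul (hφ : IsMap d q Q lam mu y φ) (h : z * m q Q lam ∈ mIdeal q Q mu)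
    (hy : y = z * m q Q lam) : φ = leftMul lam mu z h :=
  isMap_unique hφ (hy ▸ isMap_leftMul h)

end LeftMul

theorem one_mul_m_mem (lam : MultiComp ℓ d) : 1 * m q Q lam ∈ mIdeal q Q lam := by
  rw [one_mul]
  exact (mGen q Q lam).2

theorem idem_eq_leftMul (lam : MultiComp ℓ d) :
    idem d q Q lam = leftMul lam lam 1 (one_mul_m_mem lam) := by
  refine DirectSum.linearMap_ext _ fun nu => LinearMap.ext fun u => ?_
  by_cases hnu : nu = lam
  · subst hnu
    rw [LinearMap.comp_apply, LinearMap.comp_apply, leftMul_inMod, idem, LinearMap.comp_apply,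
      DirectSum.component.lof_self]
    exact congrArg _ (Subtype.ext (one_mul _).symm)
  · rw [LinearMap.comp_apply, LinearMap.comp_apply, leftMul_inMod_of_ne _ hnu, idem,
      LinearMap.comp_apply, DirectSum.component.of, dif_neg hnu, map_zero]

section Elements

variable {lam mu : MultiComp ℓ d}

theorem mem_invariants {f : Laurent k d} :
    f ∈ invariants k lam ↔ ∀ w ∈ young lam.concat, permute w f = f := Iff.rfl

theorem antisym_mul_mulLeft {f : Laurent k d} (hf : f ∈ invariants k lam) :
    antisym q lam.concat * LinearMap.mulLeft k f =
      LinearMap.mulLeft k f * antisym q lam.concat :=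
  LinearMap.ext fun g => antisym_mul q hf g

/-- Antisymmetrizers are linear over invariant polynomials. -/
theorem poly_mul_m {f : Laurent k d} (hf : f ∈ invariants k lam) :
    poly d q Q f * m q Q lam = m q Q lam * poly d q Q f := by
  refine ((isOp_m lam).poly_mul f).eq ?_
  rw [← antisym_mul_mulLeft hf]
  exact (isOp_m lam).mul_poly f

theorem poly_mul_m_mem {f : Laurent k d} (hf : f ∈ invariants k lam) :
    poly d q Q f * m q Q lam ∈ mIdeal q Q lam := by
  rw [poly_mul_m hf]
  exact m_mul_mem _ _

section Split

variable {t : Fin (ℓ + 1)} {l₁ l₂ : List ℕ} {a b : ℕ}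

theorem IsSplit.isOp_m (h : IsSplit lam mu t l₁ a b l₂) :
    IsOp (m q Q mu) lam.col lam.col (antisym q mu.concat) := by
  have := Hecke.isOp_m (q := q) (Q := Q) mu
  rwa [h.col_eq] at this

/-- The antisymmetrizer of a Young subgroup factors through that of a smaller one, with the sum over
the shortest coset representatives on the right; so `m_λ H ⊆ m_μ H`. -/
theorem IsSplit.m_mem (h : IsSplit lam mu t l₁ a b l₂) :
    1 * m q Q lam ∈ mIdeal q Q mu := by
  rw [one_mul]
  have h1 := h.isOp_m (q := q) (Q := Q).mul
    (IsOp.sum fun v (hv : v ∈ cosetTerms mu.concat lam.concat) =>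
      (isOp_Tw_col lam (mem_cosetTerms.1 hv).1).smul
        ((-q) ^ (youngMaxLen lam.concat - youngMaxLen mu.concat - len v)))
  rw [← antisym_eq_mul h.isBlockSplit.young_le] at h1
  rw [(Hecke.isOp_m lam).eq h1]
  exact m_mul_mem _ _

/-- The factorization of the antisymmetrizer with the sum over the coset representatives on the
left; so the merge is the left multiplication by an element `z` of the Hecke algebra. -/
theorem IsSplit.exists_mul_m (h : IsSplit lam mu t l₁ a b l₂) :
    ∃ z, m q Q lam = z * m q Q mu := by
  have h1 := (IsOp.sum fun v (hv : v ∈ cosetTerms mu.concat lam.concat) =>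
    (isOp_Tw_col (q := q) (Q := Q) lam (inv_mem (mem_cosetTerms.1 hv).1)).smul
      ((-q) ^ (youngMaxLen lam.concat - youngMaxLen mu.concat - len v))).mul h.isOp_m
  rw [← antisym_eq_mul' h.isBlockSplit.young_le] at h1
  exact ⟨_, (Hecke.isOp_m lam).eq h1⟩

end Split

section Crossing

variable {t : Fin ℓ} {a : ℕ}

/-- A left crossing acts trivially on polynomials, and `λ` and `μ` have the same Young subgroup, so
both sides act as its antisymmetrizer. -/
theorem IsLeftCrossing.crossing_mul_m (h : IsLeftCrossing lam mu t a) :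
    leftCrossing q Q lam t a * m q Q lam = m q Q mu * leftCrossing q Q lam t a := by
  have h1 := (isOp_leftCrossing (q := q) (Q := Q) h).mul (isOp_m lam)
  have h2 := (isOp_m mu).mul (isOp_leftCrossing (q := q) (Q := Q) h)
  rw [← h.concat_eq] at h2
  rw [mul_one] at h2
  rw [one_mul] at h1
  exact h1.eq h2

theorem IsLeftCrossing.crossPoly_mem (h : IsLeftCrossing lam mu t a) :
    crossPoly Q lam t a ∈ invariants k lam := fun _ hw => h.permute_crossPoly hw

/-- A right crossing acts as multiplication by an invariant polynomial, which commutes with the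
antisymmetrizer. -/
theorem IsLeftCrossing.rightCrossing_mul_m (h : IsLeftCrossing lam mu t a) :
    rightCrossing q Q lam mu t a * m q Q mu = m q Q lam * rightCrossing q Q lam mu t a := by
  have h1 := (isOp_rightCrossing (q := q) (Q := Q) h).mul (isOp_m mu)
  have h2 := (isOp_m lam).mul (isOp_rightCrossing (q := q) (Q := Q) h)
  rw [← h.concat_eq] at h1
  rw [antisym_mul_mulLeft h.crossPoly_mem] at h2
  exact h1.eq h2

theorem IsLeftCrossing.crossing_mul_m_mem (h : IsLeftCrossing lam mu t a) :
    leftCrossing q Q lam t a * m q Q lam ∈ mIdeal q Q mu := by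
  rw [h.crossing_mul_m]
  exact m_mul_mem _ _

theorem IsLeftCrossing.rightCrossing_mul_m_mem (h : IsLeftCrossing lam mu t a) :
    rightCrossing q Q lam mu t a * m q Q mu ∈ mIdeal q Q lam := by
  rw [h.rightCrossing_mul_m]
  exact m_mul_mem _ _

end Crossing

end Elements

variable (d q Q) in
/-- Each of the special elements is the left multiplication by some `z` with `z m_λ ∈ m_μ H`, which
is well defined on `m_λ H`. -/
theorem generatorsExist : GeneratorsExist d q Q where
  poly _ g := existsUnique_isMap (poly_mul_m_mem g.2) rfl
  split _ _ _ _ _ _ _ h := existsUnique_isMap h.m_mem (one_mul _).symm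
  merge lam _ _ _ _ _ _ h := by
    obtain ⟨z, hz⟩ := h.exists_mul_m (q := q) (Q := Q)
    exact existsUnique_isMap (hz ▸ (mGen q Q lam).2) hz
  left _ _ _ _ h := existsUnique_isMap h.crossing_mul_m_mem rfl
  right _ _ _ _ h := existsUnique_isMap h.rightCrossing_mul_m_mem rfl

end Maps

/-! ### The embedding of the polynomial representation -/

section Symmetric

variable {k : Type*} [Field k] {ℓ d : ℕ} (q : k) (Q : Fin ℓ → k)

theorem crossOp_mul_of_symmetric {s : Laurent k d} (hs : ∀ w, permute w s = s) (a b : Fin 2)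
    (n m : ℕ) (g : Laurent k d) :
    crossOp q Q d a b n m (s * g) = s * crossOp q Q d a b n m g := by
  rcases fin_two_cases a with rfl | rfl <;> rcases fin_two_cases b with rfl | rfl
  · exact lusztigN_mul q (fun h => hs _) g
  · simp only [crossOp_zero_one, LinearMap.mulLeft_apply, mul_left_comm]
  · rfl
  · simp

/-- The symmetric Laurent polynomials are central in the Hecke algebra. -/
theorem act_smul_of_symmetric {s : Laurent k d} (hs : ∀ w, permute w s = s) (y : Hecke d q Q)
    (p : PolRep k ℓ d) : act q Q d y (s • p) = s • act q Q d y p := by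
  obtain ⟨a, rfl⟩ := RingQuot.mkAlgHom_surjective k (HRel d q Q) y
  induction a using FreeAlgebra.induction generalizing p with
  | grade0 c =>
    rw [AlgHom.commutes, AlgHom.commutes, Module.algebraMap_end_apply,
      Module.algebraMap_end_apply, smul_comm]
  | grade1 g =>
    change act q Q d (Hecke.gen d q Q g) _ = s • act q Q d (Hecke.gen d q Q g) p
    rw [act_gen]
    funext c
    cases g with
    | e b =>
      by_cases hc : c = b
      · subst hc; simp [genAct]
      · simp [genAct, Pi.single_eq_of_ne hc]
    | T r =>
      simp only [genAct, LinearMap.pi_apply, LinearMap.comp_apply, LinearMap.proj_apply,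
        Pi.smul_apply, smul_eq_mul]
      exact crossOp_mul_of_symmetric q Q hs _ _ _ _ _
    | X i =>
      simp only [genAct, LinearMap.pi_apply, LinearMap.comp_apply, LinearMap.proj_apply,
        Pi.smul_apply, smul_eq_mul]
      split_ifs
      · simp only [LinearMap.mulLeft_apply, mul_left_comm]
      · simp
    | X' i =>
      simp only [genAct, LinearMap.pi_apply, LinearMap.comp_apply, LinearMap.proj_apply,
        Pi.smul_apply, smul_eq_mul]
      split_ifs
      · simp only [LinearMap.mulLeft_apply, mul_left_comm]
      · simp
  | mul a b ha hb => rw [map_mul, map_mul, Module.End.mul_apply, Module.End.mul_apply, hb, ha]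
  | add a b ha hb =>
    rw [map_add, map_add, LinearMap.add_apply, LinearMap.add_apply, ha, hb, smul_add]

end Symmetric

section Embedding

open Hecke MulOpposite

variable {k : Type*} [Field k] {ℓ d : ℕ} {q : k} {Q : Fin ℓ → k}

theorem Hecke.IsOp.add {y z : Hecke d q Q} {c c' : Col ℓ d} {F G : Module.End k (Laurent k d)}
    (hy : IsOp y c c' F) (hz : IsOp z c c' G) : IsOp (y + z) c c' (F + G) := by
  intro b f
  rw [map_add, LinearMap.add_apply, hy, hz]
  split_ifs
  · exact (Pi.single_add _ _ _).symm
  · exact add_zero _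

theorem Hecke.IsOp.congr {y : Hecke d q Q} {c c' : Col ℓ d} {F G : Module.End k (Laurent k d)}
    (hy : IsOp y c c' F) (h : ∀ f, F f = G f) : IsOp y c c' G :=
  LinearMap.ext h ▸ hy

theorem Hecke.IsOp.apply_eq {y : Hecke d q Q} {c c' : Col ℓ d} {F : Module.End k (Laurent k d)}
    (hy : IsOp y c c' F) (p : PolRep k ℓ d) : act q Q d y p = Pi.single c' (F (p c)) := by
  have h : act q Q d y = LinearMap.single k (fun _ => Laurent k d) c' ∘ₗ F ∘ₗ LinearMap.proj c := by
    refine LinearMap.pi_ext fun b f => ?_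
    rw [hy]
    split_ifs with hb
    · subst hb
      simp
    · simp [Pi.single_eq_of_ne (Ne.symm hb)]
  rw [h]
  rfl

/-- `Φ_λ(f)` acts as `v ↦ p f (∑_w T_w)(v)` with `p = ∏ (x_j - q x_i)` over the pairs `i < j` in a
block of `λ` and all permutations `w`: the antisymmetrizer is `p ∂`, and by the formula for the
symmetrizer, `∂` applied to `∏ (x_i - q x_j)` times the sum over the coset representatives is the
sum over all permutations. -/
theorem isOp_Phi {lam : MultiComp ℓ d} {f : Laurent k d} (hf : f ∈ invariants k lam) :
    IsOp (Phi q Q lam f) (omega ℓ d) lam.col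
      (LinearMap.mulLeft k (pLeft q lam.concat * f) * symAll k d q) := by
  have h := (isOp_rElt (q := q) (Q := Q) lam).mul (((isOp_mSum_omega (q := q) (Q := Q)
    lam.concat).mul_poly (pRight q lam.concat * f)).mul (isOp_nPrime_omega lam.concat))
  refine h.congr fun v => ?_
  rw [symAll_eq q lam.concat]
  simp only [Module.End.mul_apply, Module.End.one_apply, LinearMap.mulLeft_apply]
  rw [antisym_apply, mul_comm (pRight q lam.concat) f, mul_assoc, mul_assoc,
    youngDemazure_mul hf, sym_apply]

theorem youngDemazure_mem (lam : MultiComp ℓ d) (g : Laurent k d) :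
    youngDemazure lam.concat g ∈ invariants k lam :=
  fun _ hw => permute_youngDemazure _ hw g

/-- The image of an element of `m_λ H` under right multiplication with the sum of all the diagrams
`T_w` on `ω`. This is the reason why the image of the embedding is stable under the Schur
algebra. -/
theorem m_mul_mul_nAll (lam : MultiComp ℓ d) (h : Hecke d q Q) :
    m q Q lam * h * nAll d q Q = Phi q Q lam (youngDemazure lam.concat
      (act q Q d h (Pi.single (omega ℓ d) 1) lam.col)) := by
  refine act_injective q Q (LinearMap.pi_ext fun b v => ?_)
  rw [isOp_Phi (youngDemazure_mem _ _), map_mul, Module.End.mul_apply, isOp_nAll]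
  split_ifs
  · have e : (Pi.single (omega ℓ d) (symAll k d q v) : PolRep k ℓ d) =
        symAll k d q v • Pi.single (omega ℓ d) 1 := by
      rw [← Pi.single_smul, smul_eq_mul, mul_one]
    rw [e, act_smul_of_symmetric q Q fun w => permute_symAll q w v, map_mul, Module.End.mul_apply,
      (isOp_m lam).apply_eq, ← Pi.single_smul, antisym_apply]
    congr 1
    simp only [Module.End.mul_apply, LinearMap.mulLeft_apply, smul_eq_mul]
    ring
  · exact map_zero _

/-- As `∂` maps onto the invariants, every `Φ_λ(f)` is of this form, and hence in `m_λ H`. -/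
theorem Phi_youngDemazure (lam : MultiComp ℓ d) (g : Laurent k d) :
    Phi q Q lam (youngDemazure lam.concat g) =
      m q Q lam * (poly d q Q g * rElt q Q lam) * nAll d q Q := by
  rw [m_mul_mul_nAll, map_mul, Module.End.mul_apply, (isOp_rElt lam).apply, act_poly_single]
  simp

theorem Phi_mem {lam : MultiComp ℓ d} {f : Laurent k d} (hf : f ∈ invariants k lam) :
    Phi q Q lam f ∈ mIdeal q Q lam := by
  obtain ⟨g, rfl⟩ := exists_youngDemazure_eq_of_invariant hf
  rw [Phi_youngDemazure, mul_assoc]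
  exact m_mul_mem _ _

variable (q Q) in
/-- The map `f e(λ) ↦ Φ_λ(f)`. -/
def phiMap (lam : MultiComp ℓ d) : invariants k lam →ₗ[k] mIdeal q Q lam where
  toFun f := ⟨Phi q Q lam f, Phi_mem f.2⟩
  map_add' f g := Subtype.ext <| by
    refine (isOp_Phi (f + g).2).eq (((isOp_Phi f.2).add (isOp_Phi g.2)).congr fun v => ?_)
    simp only [Module.End.mul_apply, LinearMap.add_apply, LinearMap.mulLeft_apply]
    push_cast
    ring
  map_smul' a f := Subtype.ext <| by
    refine (isOp_Phi (a • f).2).eq (((isOp_Phi f.2).smul a).congr fun v => ?_)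
    simp only [Module.End.mul_apply, LinearMap.smul_apply, LinearMap.mulLeft_apply]
    rw [Subalgebra.coe_smul, mul_smul_comm, smul_mul_assoc]

/-- The operator of `Φ_λ(f)` is `∑ T_w` followed by a multiplication, and `∑ T_w` is not zero. -/
theorem phiMap_injective (lam : MultiComp ℓ d) : Function.Injective (phiMap q Q lam) := by
  rw [injective_iff_map_eq_zero]
  intro f hf
  have h1 : Phi q Q lam f = 0 := congrArg Subtype.val hf
  obtain ⟨v, hv⟩ := exists_symAll_ne_zero (k := k) (d := d) q
  have h2 := (isOp_Phi (q := q) (Q := Q) f.2).apply v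
  rw [h1, map_zero, LinearMap.zero_apply] at h2
  have h3 := congrFun h2 lam.col
  rw [Pi.single_eq_same, Module.End.mul_apply, LinearMap.mulLeft_apply] at h3
  have h4 := (mul_eq_zero.1 h3.symm).resolve_right hv
  exact Subtype.ext ((mul_eq_zero.1 h4).resolve_left (pLeft_ne_zero q _))

variable (d q Q) in
/-- The embedding of the polynomial representation into `⨁_λ m_λ H`. -/
def embedding : PolSpace k ℓ d →ₗ[k] DefMod d q Q := DirectSum.lmap (phiMap q Q)

theorem embedding_inPol (lam : MultiComp ℓ d) (f : invariants k lam) :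
    embedding d q Q (inPol lam f) = inMod d q Q lam (phiMap q Q lam f) :=
  DirectSum.lmap_lof _ _ _

theorem embedding_injective : Function.Injective (embedding d q Q) :=
  (DirectSum.lmap_injective _).2 phiMap_injective

/-- Right multiplication by `∑ T_w` maps `⨁_λ m_λ H` into the image of the embedding. -/
theorem exists_embedding_eq (x : DefMod d q Q) : ∃ v, embedding d q Q v = op (nAll d q Q) • x := by
  induction x using DirectSum.induction_on with
  | zero => exact ⟨0, by rw [map_zero, smul_zero]⟩
  | of lam u =>
    obtain ⟨h, hh⟩ := mem_mIdeal.1 u.2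
    refine ⟨inPol lam ⟨_, youngDemazure_mem lam
      (act q Q d h (Pi.single (omega ℓ d) 1) lam.col)⟩, ?_⟩
    rw [embedding_inPol]
    change _ = op (nAll d q Q) • inMod d q Q lam u
    rw [← map_smul]
    refine congrArg _ (Subtype.ext ?_)
    change Phi q Q lam _ = (u : Hecke d q Q) * nAll d q Q
    rw [hh, m_mul_mul_nAll]
  | add x y hx hy =>
    obtain ⟨v, hv⟩ := hx
    obtain ⟨w, hw⟩ := hy
    exact ⟨v + w, by rw [map_add, hv, hw, smul_add]⟩

/-- Right multiplication by `∑ T_w` maps `⨁_λ m_λ H` onto the image of the embedding. -/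
theorem exists_smul_eq_embedding (v : PolSpace k ℓ d) :
    ∃ x, op (nAll d q Q) • x = embedding d q Q v := by
  induction v using DirectSum.induction_on with
  | zero => exact ⟨0, by rw [map_zero, smul_zero]⟩
  | of lam f =>
    obtain ⟨g, hg⟩ := exists_youngDemazure_eq_of_invariant f.2
    refine ⟨inMod d q Q lam ⟨m q Q lam * (poly d q Q g * rElt q Q lam), m_mul_mem _ _⟩, ?_⟩
    change _ = embedding d q Q (inPol lam f)
    rw [embedding_inPol, ← map_smul]
    refine congrArg _ (Subtype.ext ?_)
    change m q Q lam * (poly d q Q g * rElt q Q lam) * nAll d q Q = Phi q Q lam f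
    rw [← Phi_youngDemazure, hg]
  | add v w hv hw =>
    obtain ⟨x, hx⟩ := hv
    obtain ⟨y, hy⟩ := hw
    exact ⟨x + y, by rw [map_add, ← hx, ← hy, smul_add]⟩

/-- The image of the embedding is stable under the Schur algebra, whose elements commute with right
multiplications. -/
theorem exists_embedding_eq_apply (φ : Schur d q Q) (v : PolSpace k ℓ d) :
    ∃ w, embedding d q Q w = φ (embedding d q Q v) := by
  obtain ⟨x, hx⟩ := exists_smul_eq_embedding (q := q) (Q := Q) v
  rw [← hx, map_smul]
  exact exists_embedding_eq _

end Embedding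

/-- The image of an injective map is a subrepresentation as soon as it is stable under the
algebra. -/
theorem exists_algHom_of_injective {k S V M : Type*} [Field k] [Semiring S] [Algebra k S]
    [AddCommMonoid V] [Module k V] [AddCommMonoid M] [Module k M] (A : S →ₐ[k] Module.End k M)
    (Θ : V →ₗ[k] M) (hΘ : Function.Injective Θ) (h : ∀ s v, ∃ w, Θ w = A s (Θ v)) :
    ∃ ρ : S →ₐ[k] Module.End k V, ∀ s v, Θ (ρ s v) = A s (Θ v) := by
  choose F hF using h
  refine ⟨AlgHom.ofLinearMap
    { toFun := fun s =>
        { toFun := F s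
          map_add' := fun v w => hΘ (by rw [map_add, hF, hF, hF, map_add, map_add])
          map_smul' := fun a v => hΘ (by
            rw [RingHom.id_apply, map_smul, hF, hF, map_smul, map_smul]) }
      map_add' := fun s s' => LinearMap.ext fun v => hΘ (by
        simp only [LinearMap.coe_mk, AddHom.coe_mk, LinearMap.add_apply, map_add, hF])
      map_smul' := fun a s => LinearMap.ext fun v => hΘ (by
        simp only [LinearMap.coe_mk, AddHom.coe_mk, LinearMap.smul_apply, map_smul, hF,
          RingHom.id_apply]) }
    (LinearMap.ext fun v => hΘ (by
      simp only [LinearMap.coe_mk, AddHom.coe_mk, hF, map_one, Module.End.one_apply]))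
    (fun s s' => LinearMap.ext fun v => hΘ (by
      simp only [LinearMap.coe_mk, AddHom.coe_mk, hF, map_mul, Module.End.mul_apply])), hF⟩

section Representation

open Hecke MulOpposite

variable {k : Type*} [Field k] {ℓ d : ℕ} {q : k} {Q : Fin ℓ → k}

variable (d q Q) in
theorem exists_polAction : ∃ ρ : Schur d q Q →ₐ[k] Module.End k (PolSpace k ℓ d),
    ∀ φ v, embedding d q Q (ρ φ v) = φ (embedding d q Q v) :=
  exists_algHom_of_injective (Algebra.lsmul k k (DefMod d q Q)) (embedding d q Q)
    embedding_injective exists_embedding_eq_apply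

section

variable {ρ : Schur d q Q →ₐ[k] Module.End k (PolSpace k ℓ d)}
  (hρ : ∀ φ v, embedding d q Q (ρ φ v) = φ (embedding d q Q v))
include hρ

/-- An endomorphism which vanishes on the image of the embedding vanishes: if the values `y`, `z` of
two endomorphisms at `m_λ` agree after right multiplication with all `g 𝔯_λ ∑ T_w`, then the
operators of `y` and `z` agree on all multiples of a nonzero symmetric polynomial, with which they
commute. -/
theorem polAction_injective : Function.Injective ρ := by
  intro φ ψ hφψ
  refine schur_ext fun lam => DFinsupp.ext fun mu => Subtype.ext ?_
  have key : ∀ (χ : Schur d q Q) (h : Hecke d q Q),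
      (χ (inMod d q Q lam (op h • mGen q Q lam)) mu : Hecke d q Q) =
        (χ (inMod d q Q lam (mGen q Q lam)) mu : Hecke d q Q) * h := by
    intro χ h
    rw [map_smul, map_smul, DirectSum.smul_apply]
    rfl
  -- `y` and `z` only act on the summand of the colours of `λ`, since `m_λ e(c_λ) = m_λ`
  have hE : op (E q Q lam.col) • mGen q Q lam = mGen q Q lam :=
    Subtype.ext (isOp_m lam).mul_E
  obtain ⟨v, hv⟩ := exists_symAll_ne_zero (k := k) (d := d) q
  have hy := key φ
  have hz := key ψ
  have hyE := hy (E q Q lam.col)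
  have hzE := hz (E q Q lam.col)
  rw [hE] at hyE hzE
  -- `m_λ g 𝔯_λ ∑ T_w` is in the image of the embedding, on which `φ` and `ψ` agree
  have h0 : ∀ g, (φ (inMod d q Q lam (mGen q Q lam)) mu : Hecke d q Q) *
      (poly d q Q g * rElt q Q lam * nAll d q Q) =
      (ψ (inMod d q Q lam (mGen q Q lam)) mu : Hecke d q Q) *
      (poly d q Q g * rElt q Q lam * nAll d q Q) := by
    intro g
    have e : op (poly d q Q g * rElt q Q lam * nAll d q Q) • mGen q Q lam =
        phiMap q Q lam ⟨_, youngDemazure_mem lam g⟩ := by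
      apply Subtype.ext
      change m q Q lam * (poly d q Q g * rElt q Q lam * nAll d q Q) = Phi q Q lam _
      rw [Phi_youngDemazure, ← mul_assoc]
    have h1 := hρ φ (inPol lam ⟨_, youngDemazure_mem lam g⟩)
    rw [hφψ, hρ, embedding_inPol] at h1
    rw [← hy, ← hz, e, h1]
  generalize (φ (inMod d q Q lam (mGen q Q lam)) mu : Hecke d q Q) = y at *
  generalize (ψ (inMod d q Q lam (mGen q Q lam)) mu : Hecke d q Q) = z at *
  rw [hyE, hzE]
  refine act_injective q Q (LinearMap.pi_ext fun b g => ?_)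
  rw [map_mul, Module.End.mul_apply, map_mul, Module.End.mul_apply, act_E_single]
  split_ifs with hb
  -- `g 𝔯_λ ∑ T_w` maps `v` to `g` times the symmetric polynomial `(∑ T_w)(v)`
  · have e : act q Q d (poly d q Q g * rElt q Q lam * nAll d q Q) (Pi.single (omega ℓ d) v) =
        symAll k d q v • Pi.single lam.col g := by
      rw [map_mul, map_mul, Module.End.mul_apply, Module.End.mul_apply, isOp_nAll.apply,
        (isOp_rElt lam).apply, act_poly_single, ← Pi.single_smul, smul_eq_mul, mul_comm]
      rfl
    have h3 := LinearMap.congr_fun (congrArg (act q Q d) (h0 g)) (Pi.single (omega ℓ d) v)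
    rw [map_mul (act q Q d) y, map_mul (act q Q d) z, Module.End.mul_apply,
      Module.End.mul_apply, e, act_smul_of_symmetric q Q fun w => permute_symAll q w v,
      act_smul_of_symmetric q Q fun w => permute_symAll q w v] at h3
    funext c
    have h4 := congrFun h3 c
    rw [Pi.smul_apply, Pi.smul_apply, smul_eq_mul, smul_eq_mul] at h4
    rw [← hb]
    exact mul_left_cancel₀ hv h4
  · rw [map_zero, map_zero]

/-- The action of left multiplication by `z` can be read off from its effect on the elements
`Φ_λ(f)`. -/
theorem actsAs_of_mul_Phi {lam mu : MultiComp ℓ d} {y z : Hecke d q Q} {φ : Schur d q Q}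
    (hφ : IsMap d q Q lam mu y φ) (h : z * m q Q lam ∈ mIdeal q Q mu) (hy : y = z * m q Q lam)
    {F : Laurent k d → Laurent k d}
    (hF : ∀ f ∈ invariants k lam, F f ∈ invariants k mu)
    (hz : ∀ f ∈ invariants k lam, z * Phi q Q lam f = Phi q Q mu (F f)) :
    ActsAs (ρ φ) lam mu F := by
  obtain rfl := hφ.eq_leftMul h hy
  refine ⟨fun f => ⟨⟨F f, hF f f.2⟩, rfl, embedding_injective (q := q) (Q := Q) ?_⟩,
    fun nu hnu f => embedding_injective (q := q) (Q := Q) ?_⟩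
  · rw [hρ, embedding_inPol, embedding_inPol, leftMul_inMod]
    exact congrArg _ (Subtype.ext (hz f f.2))
  · rw [hρ, embedding_inPol, leftMul_inMod_of_ne h hnu, map_zero]

end

/-- The longest element of the Young subgroup of `λ` is the longest element of that of `μ` followed
by the permutation `w_{a,b}`, so a merge maps `∂(g)` for `μ` to `∂(g)` for `λ`. -/
theorem blockDemazure_youngDemazure {lam mu : MultiComp ℓ d} {t l₁ a b l₂}
    (h : IsSplit lam mu t l₁ a b l₂) (g : Laurent k d) :
    blockDemazure (lam.before t + l₁.sum) a b (youngDemazure mu.concat g) =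
      youngDemazure lam.concat g :=
  demazurePerm_youngDemazure h.isBlockSplit.isShortest_blockSwap
    h.isBlockSplit.blockSwap_mul_longest g

theorem IsBlockSplit.permute_pLeftPrime {κ κ' : Composition d} {o a b : ℕ}
    (h : IsBlockSplit κ κ' o a b) (q : k) {w : Equiv.Perm (Fin d)} (hw : w ∈ young κ') :
    permute w (pLeftPrime q o a b) = pLeftPrime q o a b := by
  have h1 : ∀ i : Fin d, (w i : ℕ) < o ↔ (i : ℕ) < o :=
    young_lt_iff hw ((h.bdry _).2 (Or.inl h.left))
  have h2 : ∀ i : Fin d, (w i : ℕ) < o + a ↔ (i : ℕ) < o + a :=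
    young_lt_iff hw ((h.bdry _).2 (Or.inr rfl))
  have h3 : ∀ i : Fin d, (w i : ℕ) < o + a + b ↔ (i : ℕ) < o + a + b :=
    young_lt_iff hw ((h.bdry _).2 (Or.inl h.right))
  unfold pLeftPrime
  rw [map_prod]
  refine Finset.prod_bij (fun p _ => (w p.1, w p.2)) ?_ ?_ ?_ ?_
  · intro p hp
    simp only [Finset.mem_filter, Finset.mem_univ, true_and] at hp ⊢
    rw [← not_lt, h1, h2, ← not_lt (b := o + a), h2, h3, not_lt, not_lt]
    exact hp
  · intro p _ p' _ hpp
    exact Prod.ext (w.injective (congrArg Prod.fst hpp)) (w.injective (congrArg Prod.snd hpp))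
  · intro p hp
    refine ⟨(w.symm p.1, w.symm p.2), ?_,
      Prod.ext (w.apply_symm_apply p.1) (w.apply_symm_apply p.2)⟩
    simp only [Finset.mem_filter, Finset.mem_univ, true_and] at hp ⊢
    have e1 := h1 (w.symm p.1)
    have e2 := h2 (w.symm p.1)
    have e3 := h2 (w.symm p.2)
    have e4 := h3 (w.symm p.2)
    rw [w.apply_symm_apply] at e1 e2 e3 e4
    omega
  · intro p _
    rw [map_sub, map_smul, permute_x, permute_x]

theorem IsSplit.pLeftPrime_mul_mem {lam mu : MultiComp ℓ d} {t l₁ a b l₂}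
    (h : IsSplit lam mu t l₁ a b l₂) (q : k) {f : Laurent k d} (hf : f ∈ invariants k lam) :
    pLeftPrime q (lam.before t + l₁.sum) a b * f ∈ invariants k mu := by
  intro w hw
  rw [map_mul, h.isBlockSplit.permute_pLeftPrime q hw, hf w (h.isBlockSplit.young_le hw)]

/-- Each special element is the left multiplication by some `z`, and the operators of `z Φ_λ(f)` and
`Φ_μ(F(f))` are the same. -/
theorem isPolRep_of_embedding {ρ : Schur d q Q →ₐ[k] Module.End k (PolSpace k ℓ d)}
    (hρ : ∀ φ v, embedding d q Q (ρ φ v) = φ (embedding d q Q v)) : IsPolRep q Q ρ where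
  idem lam := by
    rw [idem_eq_leftMul]
    exact actsAs_of_mul_Phi hρ (isMap_leftMul _) (one_mul_m_mem lam) rfl (fun _ hf => hf)
      fun _ _ => one_mul _
  poly lam g φ hφ := by
    refine actsAs_of_mul_Phi hρ hφ (poly_mul_m_mem g.2) rfl (fun f hf => mul_mem g.2 hf)
      fun f hf => ?_
    refine ((isOp_Phi hf).poly_mul (g : Laurent k d)).eq
      ((isOp_Phi (mul_mem g.2 hf)).congr fun v => ?_)
    simp only [Module.End.mul_apply, LinearMap.mulLeft_apply]
    ring
  split lam mu t l₁ a b l₂ h φ hφ := by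
    refine actsAs_of_mul_Phi hρ hφ h.m_mem (one_mul _).symm (fun f hf => h.pLeftPrime_mul_mem q hf)
      fun f hf => ?_
    rw [one_mul]
    have h1 := isOp_Phi (q := q) (Q := Q) (h.pLeftPrime_mul_mem q hf)
    rw [h.col_eq] at h1
    refine (isOp_Phi hf).eq (h1.congr fun v => ?_)
    -- the products over the pairs in a block of `λ` and of `μ` differ by the factor of the split
    rw [h.isBlockSplit.pLeft_eq q, mul_assoc]
  merge lam mu t l₁ a b l₂ h φ hφ := by
    obtain ⟨z, hz⟩ := h.exists_mul_m (q := q) (Q := Q)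
    refine actsAs_of_mul_Phi hρ hφ (hz ▸ (mGen q Q lam).2) hz (fun f hf => ?_) fun f hf => ?_
    · obtain ⟨g, rfl⟩ := exists_youngDemazure_eq_of_invariant hf
      rw [blockDemazure_youngDemazure h]
      exact youngDemazure_mem _ _
    -- for `f = ∂(g)` both sides are `m_λ g 𝔯_λ ∑ T_w`
    · obtain ⟨g, rfl⟩ := exists_youngDemazure_eq_of_invariant hf
      have hr : rElt q Q mu = rElt q Q lam := by
        have h1 := isOp_rElt (q := q) (Q := Q) mu
        rw [h.col_eq] at h1
        exact h1.eq (isOp_rElt lam)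
      rw [blockDemazure_youngDemazure h, Phi_youngDemazure, Phi_youngDemazure, ← mul_assoc,
        ← mul_assoc, ← hz, hr]
  left lam mu t a h φ hφ := by
    have hinv : ∀ f ∈ invariants k lam, f ∈ invariants k mu := fun f hf => by
      rw [mem_invariants, ← h.concat_eq]
      exact hf
    refine actsAs_of_mul_Phi hρ hφ h.crossing_mul_m_mem rfl hinv fun f hf => ?_
    refine ((isOp_leftCrossing h).mul (isOp_Phi hf)).eq ((isOp_Phi (hinv f hf)).congr fun v => ?_)
    rw [h.concat_eq, one_mul]
  right lam mu t a h φ hφ := by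
    have hinv : ∀ f ∈ invariants k mu, f ∈ invariants k lam := fun f hf => by
      rw [mem_invariants, h.concat_eq]
      exact hf
    refine actsAs_of_mul_Phi hρ hφ h.rightCrossing_mul_m_mem rfl
      (fun f hf => mul_mem h.crossPoly_mem (hinv f hf)) fun f hf => ?_
    refine ((isOp_rightCrossing h).mul (isOp_Phi hf)).eq
      ((isOp_Phi (mul_mem h.crossPoly_mem (hinv f hf))).congr fun v => ?_)
    simp only [Module.End.mul_apply, LinearMap.mulLeft_apply]
    rw [h.concat_eq]
    ring

end Representation

/-! ### Refining multicompositions -/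

section Refine

variable {ℓ d : ℕ}

variable (ℓ d) in
/-- The multicomposition `(∅, …, ∅, (1, …, 1))`, whose colour sequence is `ω`. -/
def finest : MultiComp ℓ d where
  parts t := if t = Fin.last ℓ then List.replicate d 1 else []
  parts_pos t n hn := by
    split_ifs at hn
    · rw [List.eq_of_mem_replicate hn]; exact one_pos
    · exact absurd hn List.not_mem_nil
  sum_parts := by
    rw [Fin.sum_univ_castSucc]
    simp [(Fin.castSucc_lt_last _).ne]

/-- The multicomposition `(∅, …, ∅, (1, …, 1, 2, 1, …, 1))`, where the entry `2` comes after `r`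
entries `1`. -/
def withPair (r : Fin (d - 1)) : MultiComp ℓ d where
  parts t := if t = Fin.last ℓ then
    List.replicate r 1 ++ 2 :: List.replicate (d - r - 2) 1 else []
  parts_pos t n hn := by
    split_ifs at hn
    · rcases List.mem_append.1 hn with h | h
      · rw [List.eq_of_mem_replicate h]; exact one_pos
      · rcases List.mem_cons.1 h with rfl | h
        · exact two_pos
        · rw [List.eq_of_mem_replicate h]; exact one_pos
    · exact absurd hn List.not_mem_nil
  sum_parts := by
    have := r.2
    rw [Fin.sum_univ_castSucc]
    simp [(Fin.castSucc_lt_last _).ne]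
    omega

theorem isSplit_withPair (r : Fin (d - 1)) : IsSplit (withPair r : MultiComp ℓ d) (finest ℓ d)
    (Fin.last ℓ) (List.replicate r 1) 1 1 (List.replicate (d - r - 2) 1) := by
  have hr := r.2
  refine ⟨if_pos rfl, (if_pos rfl).trans ?_, fun s hs => (if_neg hs).trans (if_neg hs).symm⟩
  change List.replicate d 1 =
    List.replicate r 1 ++ (List.replicate 2 1 ++ List.replicate (d - r - 2) 1)
  rw [← List.replicate_add, ← List.replicate_add]
  congr 1
  omega

theorem before_withPair (r : Fin (d - 1)) :
    (withPair r : MultiComp ℓ d).before (Fin.last ℓ) = 0 := by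
  refine Finset.sum_eq_zero fun s hs => ?_
  have h : (withPair r : MultiComp ℓ d).parts s = [] := if_neg (Finset.mem_Iio.1 hs).ne
  rw [h, List.sum_nil]

theorem col_finest : (finest ℓ d).col = omega ℓ d := by
  have h : ∀ t, (finest ℓ d).redPos t = t := by
    intro t
    have h0 : (finest ℓ d).before t.succ = 0 := Finset.sum_eq_zero fun s hs => by
      have h : (finest ℓ d).parts s = [] :=
        if_neg ((Finset.mem_Iio.1 hs).trans_le (Fin.le_last _)).ne
      rw [h, List.sum_nil]
    rw [MultiComp.redPos, MultiComp.blacksLeft, h0, add_zero]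
  refine Col.ext_red fun i => ?_
  rw [MultiComp.col_eq_one, omega_eq_one]
  constructor
  · rintro ⟨t, ht⟩
    rw [← ht, h]
    exact t.2
  · intro hi
    exact ⟨⟨i, hi⟩, h _⟩

theorem concat_finest : (finest ℓ d).concat = Composition.ones d := by
  rw [Composition.eq_ones_iff]
  intro n hn
  obtain ⟨l, hl, hn⟩ := List.mem_flatten.1 hn
  obtain ⟨t, rfl⟩ := (List.mem_ofFn' _ _).1 hl
  change n ∈ (if t = Fin.last ℓ then List.replicate d 1 else []) at hn
  split_ifs at hn
  · exact List.eq_of_mem_replicate hn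
  · exact absurd hn List.not_mem_nil

theorem eq_one_of_mem_young_ones {w : Equiv.Perm (Fin d)} (hw : w ∈ young (Composition.ones d)) :
    w = 1 := by
  have hb : ∀ n ≤ d, IsBdry (Composition.ones d).blocks n := fun n hn =>
    isBdry_iff_take.2 ⟨n, by
      have := Composition.ones_sizeUpTo d n
      rw [Composition.sizeUpTo] at this
      rw [this, min_eq_left hn]⟩
  have key : ∀ i j : Fin d, i < j →
      (Composition.ones d).index i ≠ (Composition.ones d).index j := fun i j hij =>
    (index_ne_iff hij).2 ⟨j, hb _ j.2.le, hij, le_rfl⟩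
  refine Equiv.ext fun i => ?_
  rcases lt_trichotomy (w i) i with h | h | h
  · exact absurd (hw i) (key _ _ h)
  · exact h
  · exact absurd (hw i).symm (key _ _ h)

theorem mem_young_finest {w : Equiv.Perm (Fin d)} : w ∈ young (finest ℓ d).concat ↔ w = 1 := by
  rw [concat_finest]
  exact ⟨eq_one_of_mem_young_ones, fun h => h ▸ one_mem _⟩

theorem mem_invariants_finest {k : Type*} [Field k] (f : Laurent k d) :
    f ∈ invariants k (finest ℓ d) := by
  intro w hw
  rw [mem_young_finest.1 hw, permute_one]

theorem youngDemazure_finest {k : Type*} [Field k] (f : Laurent k d) :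
    youngDemazure (finest ℓ d).concat f = f := by
  rw [youngDemazure, mem_young_finest.1 (longest_mem _), wordProd_one, Module.End.one_apply]

theorem antisym_finest {k : Type*} [Field k] (q : k) : antisym q (finest ℓ d).concat = 1 := by
  have hm : youngMaxLen (finest ℓ d).concat = 0 := by
    rw [← len_longest, mem_young_finest.1 (longest_mem _), len_one]
  rw [antisym, Finset.sum_eq_single_of_mem (1 : Equiv.Perm (Fin d))
    (Finset.mem_filter.2 ⟨Finset.mem_univ _, one_mem _⟩), wordProd_one, hm, Nat.zero_sub, pow_zero,
    one_smul]
  intro w hw hne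
  exact absurd (mem_young_finest.1 (Finset.mem_filter.1 hw).2) hne

theorem pLeft_finest {k : Type*} [Field k] (q : k) : pLeft q (finest ℓ d).concat = 1 := by
  have h := antisym_apply q (finest ℓ d).concat (1 : Laurent k d)
  rw [antisym_finest, youngDemazure_finest, mul_one] at h
  exact h.symm

theorem blockSwap_one_one (r : Fin (d - 1)) : blockSwap d r 1 1 = simpleRefl r := by
  have hr := r.2
  refine Equiv.ext fun i => Fin.ext ?_
  rw [simpleRefl_val]
  have h0 : (r : ℕ) + 1 + 1 ≤ d := by omega
  simp only [blockSwap, Equiv.coe_fn_mk]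
  split_ifs <;> first | omega | (dsimp only; omega)

/-- Merging two adjacent blocks of size one antisymmetrizes by `T_r - q`. -/
theorem antisym_withPair {k : Type*} [Field k] (q : k) (r : Fin (d - 1)) (f : Laurent k d) :
    antisym q (withPair r : MultiComp ℓ d).concat f = lusztig q r f - q • f := by
  have h := isSplit_withPair (ℓ := ℓ) r
  have ho : (withPair r : MultiComp ℓ d).before (Fin.last ℓ) +
      (List.replicate (r : ℕ) 1).sum = r := by
    rw [before_withPair]; simp
  have h1 := blockDemazure_youngDemazure h f
  have h2 := h.isBlockSplit.pLeft_eq q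
  rw [ho] at h1 h2
  rw [pLeft_finest, one_mul] at h2
  rw [youngDemazure_finest, blockDemazure, blockSwap_one_one, demazurePerm_eq,
    wordProd_simpleRefl] at h1
  have h3 : pLeftPrime q r 1 1 = (x (hi r) - q • x (lo r) : Laurent k d) := by
    unfold pLeftPrime
    rw [Finset.prod_eq_single_of_mem (lo r, hi r)]
    · simp [lo, hi]
    · intro p hp hne
      simp only [Finset.mem_filter, Finset.mem_univ, true_and] at hp
      refine absurd (Prod.ext (Fin.ext ?_) (Fin.ext ?_)) hne
      · simp only [lo]; omega
      · simp only [hi]; omega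
  rw [antisym_apply, h2, h3, ← h1, lusztig_apply, add_sub_cancel_left]
  rfl

/-- A multicomposition is obtained from the finest one by merging entries and by moving entries to
the left. -/
theorem multiComp_induction {p : MultiComp ℓ d → Prop} (finest : p (finest ℓ d))
    (split : ∀ lam nu t l₁ a b l₂, IsSplit lam nu t l₁ a b l₂ → p nu → p lam)
    (cross : ∀ nu lam t a, IsLeftCrossing nu lam t a → p nu → p lam) (lam : MultiComp ℓ d) :
    p lam := by
  -- both steps decrease the sum of the numbers of black strands to the left of the red strands,
  -- plus the difference of `d` and the number of entries
  obtain ⟨N, hN⟩ : ∃ N, ∑ t, lam.blacksLeft t + (d - lam.concat.blocks.length) = N := ⟨_, rfl⟩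
  induction N using Nat.strong_induction_on generalizing lam with
  | _ N ih =>
    -- an entry `n ≠ 1` is split into `1` and `n - 1`
    by_cases h1 : ∃ t, ∃ n ∈ lam.parts t, n ≠ 1
    · obtain ⟨t, n, hn, hn1⟩ := h1
      obtain ⟨l₁, l₂, hl⟩ := List.append_of_mem hn
      have hn0 := lam.parts_pos t n hn
      have hsum : ∀ s, (Function.update lam.parts t (l₁ ++ 1 :: (n - 1) :: l₂) s).sum =
          (lam.parts s).sum := by
        intro s
        by_cases hs : s = t
        · subst hs
          rw [Function.update_self, hl]
          simp only [List.sum_append, List.sum_cons]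
          omega
        · rw [Function.update_of_ne hs]
      let nu : MultiComp ℓ d :=
        { parts := Function.update lam.parts t (l₁ ++ 1 :: (n - 1) :: l₂)
          parts_pos := fun s m hm => by
            by_cases hs : s = t
            · subst hs
              rw [Function.update_self] at hm
              have hpos := lam.parts_pos s
              rw [hl] at hpos
              simp only [List.mem_append, List.mem_cons] at hm hpos
              rcases hm with h | h | h | h
              · exact hpos m (Or.inl h)
              · omega
              · omega
              · exact hpos m (Or.inr (Or.inr h))
            · rw [Function.update_of_ne hs] at hm
              exact lam.parts_pos s m hm
          sum_parts := (Finset.sum_congr rfl fun s _ => hsum s).trans lam.sum_parts }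
      have hsplit : IsSplit lam nu t l₁ 1 (n - 1) l₂ := by
        refine ⟨by rw [hl]; congr 2; omega, Function.update_self .., fun s hs =>
          Function.update_of_ne hs ..⟩
      refine split lam nu t l₁ 1 (n - 1) l₂ hsplit (ih _ ?_ nu rfl)
      have hbl : ∀ s, nu.blacksLeft s = lam.blacksLeft s := fun s => by
        have := MultiComp.redPos_eq_of_sum_eq (lam := lam) (mu := nu) hsum s
        unfold MultiComp.redPos at this
        omega
      have hlen : nu.concat.blocks.length = lam.concat.blocks.length + 1 := by
        obtain ⟨A, B, e1, e2, _⟩ := exists_flatten_eq lam.parts nu.parts t hsplit.2.2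
        change (List.ofFn nu.parts).flatten.length = (List.ofFn lam.parts).flatten.length + 1
        rw [e1, e2, hsplit.1, hsplit.2.1]
        simp only [List.length_append, List.length_cons]
        omega
      have := nu.concat.length_le
      rw [Composition.length] at this
      simp only [hbl]
      omega
    -- the last entry of a component other than the last one is moved to the next component
    · by_cases h2 : ∃ t : Fin ℓ, lam.parts t.castSucc ≠ []
      · obtain ⟨t, ht⟩ := h2
        have hne : t.succ ≠ t.castSucc := Fin.castSucc_lt_succ.ne'
        obtain ⟨l, a, hl⟩ := (List.eq_nil_or_concat' (lam.parts t.castSucc)).resolve_left ht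
        set P : Fin (ℓ + 1) → List ℕ := Function.update
          (Function.update lam.parts t.castSucc l) t.succ (a :: lam.parts t.succ) with hP
        have hP1 : P t.succ = a :: lam.parts t.succ := Function.update_self ..
        have hP2 : P t.castSucc = l := by
          rw [hP, Function.update_of_ne hne.symm, Function.update_self]
        have hP3 : ∀ s, s ≠ t.castSucc → s ≠ t.succ → P s = lam.parts s := fun s h h' => by
          rw [hP, Function.update_of_ne h', Function.update_of_ne h]
        have ha : 0 < a := lam.parts_pos t.castSucc a (by rw [hl]; simp)
        have hsum : ∀ s, (P s).sum + (if s = t.castSucc then a else 0) =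
            (lam.parts s).sum + if s = t.succ then a else 0 := by
          intro s
          by_cases h : s = t.castSucc
          · subst h
            rw [hP2, hl, if_pos rfl, if_neg hne.symm]
            simp
          · by_cases h' : s = t.succ
            · subst h'
              rw [hP1, if_neg h, if_pos rfl, List.sum_cons]
              omega
            · rw [hP3 s h h', if_neg h, if_neg h']
        let nu : MultiComp ℓ d :=
          { parts := P
            parts_pos := fun s m hm => by
              by_cases h : s = t.castSucc
              · subst h
                rw [hP2] at hm
                exact lam.parts_pos t.castSucc m (by rw [hl]; simp [hm])
              · by_cases h' : s = t.succ
                · subst h'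
                  rw [hP1] at hm
                  rcases List.mem_cons.1 hm with rfl | hm
                  · exact ha
                  · exact lam.parts_pos _ m hm
                · rw [hP3 s h h'] at hm
                  exact lam.parts_pos s m hm
            sum_parts := by
              have h := Finset.sum_congr (rfl : (Finset.univ : Finset (Fin (ℓ + 1))) = _)
                fun s _ => hsum s
              rw [Finset.sum_add_distrib, Finset.sum_add_distrib, Finset.sum_ite_eq',
                Finset.sum_ite_eq', if_pos (Finset.mem_univ _), if_pos (Finset.mem_univ _),
                lam.sum_parts] at h
              omega }
        have hcross : IsLeftCrossing nu lam t a :=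
          ⟨hP1, by rw [hl]; exact congrArg (· ++ [a]) hP2.symm, fun s h h' => (hP3 s h h').symm⟩
        refine cross nu lam t a hcross (ih _ ?_ nu rfl)
        have h3 : ∑ s, lam.blacksLeft s = ∑ s, nu.blacksLeft s + a := by
          simp only [hcross.blacksLeft_eq]
          rw [Finset.sum_add_distrib, Finset.sum_ite_eq', if_pos (Finset.mem_univ _)]
        rw [hcross.concat_eq]
        omega
      -- all entries are `1` and only the last component is not empty
      · push Not at h1 h2
        have h3 : lam.parts (Fin.last ℓ) = List.replicate d 1 := by
          have h4 := List.eq_replicate_of_mem (h1 (Fin.last ℓ))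
          have h5 := lam.sum_parts
          rw [Fin.sum_univ_castSucc, Finset.sum_eq_zero fun t _ => by rw [h2 t, List.sum_nil],
            zero_add, h4] at h5
          simp only [List.sum_replicate, smul_eq_mul, mul_one] at h5
          rw [h4, h5]
        have h4 : lam = AffineSchur.finest ℓ d := by
          refine MultiComp.ext (funext fun t => ?_)
          refine Fin.lastCases (h3.trans (if_pos rfl).symm) (fun t => ?_) t
          exact (h2 t).trans (if_neg (Fin.castSucc_lt_last t).ne).symm
        exact h4 ▸ finest

end Refine

/-! ### Uniqueness of the action -/

section WordsFixingReds

open Hecke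

variable {ℓ d : ℕ}

/-- The letters of a reduced word of a permutation which fixes the first `ℓ` positions only involve
the other positions. -/
theorem le_of_mem_reduced {L : List (Fin (ℓ + d - 1))} (hL : L.length = len (L.map simpleRefl).prod)
    (h : ∀ i : Fin (ℓ + d), (i : ℕ) < ℓ → (L.map simpleRefl).prod i = i) :
    ∀ r ∈ L, ℓ ≤ (r : ℕ) := by
  induction L with
  | nil => exact fun r hr => absurd hr List.not_mem_nil
  | cons r L ih =>
    obtain ⟨h1, h2⟩ := not_isAscent_of_reduced hL
    set W := ((r :: L).map simpleRefl).prod with hW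
    have hinv : ∀ i : Fin (ℓ + d), (i : ℕ) < ℓ → W⁻¹ i = i := fun i hi => by
      have := W.symm_apply_apply i
      rw [h i hi] at this
      exact this
    have el : ((lo r : Fin (ℓ + d)) : ℕ) = r := rfl
    have eh : ((hi r : Fin (ℓ + d)) : ℕ) = r + 1 := rfl
    have hr : ℓ ≤ (r : ℕ) := by
      by_contra hr
      refine h1 ?_
      change W⁻¹ (lo r) < W⁻¹ (hi r)
      rw [hinv (lo r) (by omega)]
      by_cases hr' : ((hi r : Fin (ℓ + d)) : ℕ) < ℓ
      · rw [hinv _ hr']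
        exact lo_lt_hi r
      · by_contra hle
        have h3 : ((W⁻¹ (hi r) : Fin (ℓ + d)) : ℕ) ≤ lo r := not_lt.1 hle
        have h4 := h (W⁻¹ (hi r)) (by omega)
        have h5 : W (W⁻¹ (hi r)) = hi r := W.apply_symm_apply _
        rw [h5] at h4
        rw [← h4] at h3
        omega
    intro s hs
    rcases List.mem_cons.1 hs with rfl | hs
    · exact hr
    · refine ih h2 (fun i hi => ?_) s hs
      have h3 := h i hi
      rw [hW, List.map_cons, List.prod_cons, Equiv.Perm.mul_apply] at h3
      have h4 := congrArg (simpleRefl r) h3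
      rw [simpleRefl_simpleRefl] at h4
      rw [h4, simpleRefl_of_ne]
      · exact fun h => by rw [h] at hi; omega
      · exact fun h => by rw [h] at hi; omega

/-- A permutation which preserves the colours of `ω` and the order of the red strands fixes the red
strands. -/
theorem RedMono.fix {W : Equiv.Perm (Fin (ℓ + d))} (hW : RedMono (omega ℓ d) W)
    (h : (omega ℓ d).move W = omega ℓ d) (i : Fin (ℓ + d)) (hi : (i : ℕ) < ℓ) : W i = i := by
  have hlt : ∀ i : Fin (ℓ + d), (i : ℕ) < ℓ → (W i : ℕ) < ℓ := fun i hi => by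
    have h1 := (omega ℓ d).move_apply W i
    rw [h, omega_eq_one.2 hi, omega_eq_one] at h1
    exact h1
  let F : Fin ℓ → Fin ℓ := fun j =>
    ⟨W ⟨j, Nat.lt_add_right d j.2⟩, hlt ⟨j, Nat.lt_add_right d j.2⟩ j.2⟩
  have hF : StrictMono F := fun a b hab =>
    hW _ _ (omega_eq_one.2 a.2) (omega_eq_one.2 b.2) (show (⟨a, _⟩ : Fin (ℓ + d)) < ⟨b, _⟩ from hab)
  have h2 : Equiv.ofBijective F (Finite.injective_iff_bijective.1 hF.injective) = 1 :=
    eq_one_of_strictMono hF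
  exact Fin.ext (congrArg (fun a : Fin ℓ => (a : ℕ)) (Equiv.congr_fun h2 ⟨i, hi⟩))

end WordsFixingReds

section Unique

open Hecke MulOpposite

variable {k : Type*} [Field k] {ℓ d : ℕ} {q : k} {Q : Fin ℓ → k}

section

variable {lam mu : MultiComp ℓ d} {y : Hecke d q Q} {φ : Schur d q Q}

/-- The formula for an element on one summand determines its operator. -/
theorem ActsAs.eq {A B : Module.End k (PolSpace k ℓ d)} {F : Laurent k d → Laurent k d}
    (hA : ActsAs A lam mu F) (hB : ActsAs B lam mu F) : A = B := by
  refine DirectSum.linearMap_ext _ fun nu => LinearMap.ext fun f => ?_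
  rw [LinearMap.comp_apply, LinearMap.comp_apply]
  by_cases hnu : nu = lam
  · subst hnu
    obtain ⟨g, hg, e⟩ := hA.1 f
    obtain ⟨g', hg', e'⟩ := hB.1 f
    rw [e, e', Subtype.ext (hg.trans hg'.symm)]
  · rw [hA.2 nu hnu, hB.2 nu hnu]

theorem idem_inMod (lam : MultiComp ℓ d) (u : mIdeal q Q lam) :
    idem d q Q lam (inMod d q Q lam u) = inMod d q Q lam u := by
  rw [idem, LinearMap.comp_apply, DirectSum.component.lof_self]

theorem idem_inMod_of_ne {nu : MultiComp ℓ d} (h : nu ≠ lam) (u : mIdeal q Q nu) :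
    idem d q Q lam (inMod d q Q nu u) = 0 := by
  rw [idem, LinearMap.comp_apply, DirectSum.component.of, dif_neg h, map_zero]

theorem idem_mul_idem (lam : MultiComp ℓ d) :
    idem d q Q lam * idem d q Q lam = idem d q Q lam :=
  LinearMap.ext fun _ => idem_inMod lam _

theorem IsMap.idem_mul (h : IsMap d q Q lam mu y φ) : idem d q Q mu * φ = φ := by
  refine schur_ext fun nu => ?_
  rw [Module.End.mul_apply]
  by_cases hnu : nu = lam
  · subst hnu
    obtain ⟨v, _, e⟩ := h.1 (mGen q Q nu) 1 (mul_one _).symm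
    rw [e, idem_inMod]
  · rw [h.2 nu hnu, map_zero]

theorem IsMap.mul_idem (h : IsMap d q Q lam mu y φ) : φ * idem d q Q lam = φ := by
  refine schur_ext fun nu => ?_
  rw [Module.End.mul_apply]
  by_cases hnu : nu = lam
  · subst hnu
    rw [idem_inMod]
  · rw [idem_inMod_of_ne hnu, h.2 nu hnu, map_zero]

theorem IsPolRep.idem_apply {ρ : Schur d q Q →ₐ[k] Module.End k (PolSpace k ℓ d)}
    (h : IsPolRep q Q ρ) (lam : MultiComp ℓ d) (v : PolSpace k ℓ d) :
    ρ (AffineSchur.idem d q Q lam) v = inPol lam (v lam) := by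
  have e : ρ (AffineSchur.idem d q Q lam) = inPol lam ∘ₗ
      DirectSum.component k (MultiComp ℓ d) (fun lam => invariants k lam) lam := by
    refine DirectSum.linearMap_ext _ fun nu => LinearMap.ext fun f => ?_
    rw [LinearMap.comp_apply, LinearMap.comp_apply, LinearMap.comp_apply]
    by_cases hnu : nu = lam
    · subst hnu
      obtain ⟨g, hg, e⟩ := (h.idem nu).1 f
      rw [e, DirectSum.component.lof_self, Subtype.ext hg]
    · rw [(h.idem lam).2 nu hnu, DirectSum.component.of, dif_neg hnu, map_zero]
  rw [e]
  rfl

end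

/-- Two representations are the same on the homomorphisms from `m_λ H` to `m_μ H`. -/
def AgreeOn (ρ ρ' : Schur d q Q →ₐ[k] Module.End k (PolSpace k ℓ d)) (lam mu : MultiComp ℓ d) :
    Prop :=
  ∀ φ, idem d q Q mu * φ = φ → φ * idem d q Q lam = φ → ρ φ = ρ' φ

variable {ρ ρ' : Schur d q Q →ₐ[k] Module.End k (PolSpace k ℓ d)}

theorem inPol_injective (lam : MultiComp ℓ d) :
    Function.Injective (inPol lam : invariants k lam →ₗ[k] PolSpace k ℓ d) := fun f g h => by
  have := congrArg (DirectSum.component k (MultiComp ℓ d) (fun lam => invariants k lam) lam) h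
  rwa [DirectSum.component.lof_self, DirectSum.component.lof_self] at this

/-- An endomorphism is determined by its matrix entries, the homomorphisms between two summands. -/
theorem eq_of_agreeOn (h : IsPolRep q Q ρ) (h' : IsPolRep q Q ρ')
    (hag : ∀ lam mu, AgreeOn ρ ρ' lam mu) : ρ = ρ' := by
  refine AlgHom.ext fun φ => DirectSum.linearMap_ext _ fun lam => LinearMap.ext fun f =>
    DFinsupp.ext fun mu => inPol_injective mu ?_
  have e := LinearMap.congr_fun (hag lam mu (idem d q Q mu * φ * idem d q Q lam)
    (by rw [← mul_assoc, ← mul_assoc, idem_mul_idem]) (by rw [mul_assoc, idem_mul_idem]))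
    (inPol lam f)
  simp only [map_mul, Module.End.mul_apply, h.idem_apply, h'.idem_apply] at e
  have hf : inPol lam ((inPol lam f) lam) = inPol lam f :=
    congrArg _ (DirectSum.component.lof_self k _ _)
  rw [hf] at e
  exact e

/-- An injective operator between the summands of the target reduces one summand to the other. -/
theorem AgreeOn.of_injective (h : IsPolRep q Q ρ) (h' : IsPolRep q Q ρ')
    {lam mu nu : MultiComp ℓ d} {y : Hecke d q Q} {σ : Schur d q Q}
    (hσ : IsMap d q Q mu nu y σ) {F : Laurent k d → Laurent k d} (hF : Function.Injective F)
    (hA : ActsAs (ρ σ) mu nu F) (hA' : ActsAs (ρ' σ) mu nu F) (hag : AgreeOn ρ ρ' lam nu) :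
    AgreeOn ρ ρ' lam mu := by
  intro φ h1 h2
  refine LinearMap.ext fun v => ?_
  have e := LinearMap.congr_fun (hag (σ * φ) (by rw [← mul_assoc, hσ.idem_mul])
    (by rw [mul_assoc, h2])) v
  rw [map_mul, map_mul, ← hA.eq hA', Module.End.mul_apply, Module.End.mul_apply] at e
  have e1 : ρ φ v = inPol mu (ρ φ v mu) := by
    rw [← h.idem_apply, ← Module.End.mul_apply, ← map_mul, h1]
  have e2 : ρ' φ v = inPol mu (ρ' φ v mu) := by
    rw [← h'.idem_apply, ← Module.End.mul_apply, ← map_mul, h1]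
  rw [e1, e2] at e ⊢
  obtain ⟨g, hg, e3⟩ := hA.1 (ρ φ v mu)
  obtain ⟨g', hg', e4⟩ := hA.1 (ρ' φ v mu)
  rw [e3, e4] at e
  have e5 := inPol_injective nu e
  rw [e5, hg'] at hg
  exact congrArg _ (Subtype.ext (hF hg).symm)

/-- A surjective operator between the summands of the source reduces one summand to the other. -/
theorem AgreeOn.of_surjective (h : IsPolRep q Q ρ) (h' : IsPolRep q Q ρ')
    {lam mu nu : MultiComp ℓ d} {y : Hecke d q Q} {σ : Schur d q Q}
    (hσ : IsMap d q Q nu lam y σ) {F : Laurent k d → Laurent k d}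
    (hF : ∀ f ∈ invariants k lam, ∃ g ∈ invariants k nu, F g = f)
    (hA : ActsAs (ρ σ) nu lam F) (hA' : ActsAs (ρ' σ) nu lam F) (hag : AgreeOn ρ ρ' nu mu) :
    AgreeOn ρ ρ' lam mu := by
  intro φ h1 h2
  refine LinearMap.ext fun v => ?_
  have e := hag (φ * σ) (by rw [← mul_assoc, h1]) (by rw [mul_assoc, hσ.mul_idem])
  rw [map_mul, map_mul, ← hA.eq hA'] at e
  have e1 : ρ φ v = ρ φ (inPol lam (v lam)) := by
    rw [← h.idem_apply, ← Module.End.mul_apply, ← map_mul, h2]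
  have e2 : ρ' φ v = ρ' φ (inPol lam (v lam)) := by
    rw [← h'.idem_apply, ← Module.End.mul_apply, ← map_mul, h2]
  obtain ⟨g, hg, hgF⟩ := hF (v lam) (v lam).2
  obtain ⟨g', hg', e3⟩ := hA.1 ⟨g, hg⟩
  have e4 : inPol lam (v lam) = ρ σ (inPol nu ⟨g, hg⟩) := by
    rw [e3]
    exact congrArg _ (Subtype.ext (hgF.symm.trans hg'.symm))
  rw [e1, e2, e4]
  exact LinearMap.congr_fun e _

section Finest

/-- The two representations agree on left multiplication by `z` on `m_λ H`, for the finest `λ`. -/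
def AgreeAt (ρ ρ' : Schur d q Q →ₐ[k] Module.End k (PolSpace k ℓ d)) (z : Hecke d q Q) : Prop :=
  ∃ h : z * m q Q (finest ℓ d) ∈ mIdeal q Q (finest ℓ d),
    ρ (leftMul (finest ℓ d) (finest ℓ d) z h) = ρ' (leftMul (finest ℓ d) (finest ℓ d) z h)

theorem m_finest : m q Q (finest ℓ d) = E q Q (omega ℓ d) := by
  have h := isOp_m (q := q) (Q := Q) (finest ℓ d)
  rw [antisym_finest, col_finest] at h
  exact h.eq (isOp_E _)

theorem AgreeAt.of_isMap {z y : Hecke d q Q} {φ : Schur d q Q}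
    (hφ : IsMap d q Q (finest ℓ d) (finest ℓ d) y φ) (hy : y = z * m q Q (finest ℓ d))
    (h : ρ φ = ρ' φ) : AgreeAt ρ ρ' z := by
  have hz : z * m q Q (finest ℓ d) ∈ mIdeal q Q (finest ℓ d) := by
    obtain ⟨v, hv, _⟩ := hφ.1 (mGen q Q _) 1 (mul_one _).symm
    rw [← hy, ← mul_one y, ← hv]
    exact v.2
  refine ⟨hz, ?_⟩
  rw [← hφ.eq_leftMul hz hy, h]

theorem AgreeAt.congr {z z' : Hecke d q Q} (h : AgreeAt ρ ρ' z)
    (hz : z * m q Q (finest ℓ d) = z' * m q Q (finest ℓ d)) : AgreeAt ρ ρ' z' :=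
  AgreeAt.of_isMap (isMap_leftMul h.1) hz h.2

theorem AgreeAt.mul {z z' : Hecke d q Q} (h : AgreeAt ρ ρ' z) (h' : AgreeAt ρ ρ' z') :
    AgreeAt ρ ρ' (z * z') := by
  have hmem : z * z' * m q Q (finest ℓ d) ∈ mIdeal q Q (finest ℓ d) := by
    rw [mul_assoc]
    exact mul_mem_mIdeal h.1 h'.1
  refine ⟨hmem, ?_⟩
  have e : leftMul (finest ℓ d) (finest ℓ d) (z * z') hmem =
      leftMul (finest ℓ d) (finest ℓ d) z h.1 * leftMul (finest ℓ d) (finest ℓ d) z' h'.1 := by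
    refine schur_ext fun nu => ?_
    rw [Module.End.mul_apply]
    by_cases hnu : nu = finest ℓ d
    · subst hnu
      rw [leftMul_inMod, leftMul_inMod, leftMul_inMod]
      exact congrArg _ (Subtype.ext (mul_assoc _ _ _))
    · rw [leftMul_inMod_of_ne _ hnu, leftMul_inMod_of_ne _ hnu, map_zero]
  rw [e, map_mul, map_mul, h.2, h'.2]

theorem AgreeAt.add {z z' : Hecke d q Q} (h : AgreeAt ρ ρ' z) (h' : AgreeAt ρ ρ' z') :
    AgreeAt ρ ρ' (z + z') := by
  have hmem : (z + z') * m q Q (finest ℓ d) ∈ mIdeal q Q (finest ℓ d) := by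
    rw [add_mul]
    exact add_mem h.1 h'.1
  refine ⟨hmem, ?_⟩
  have e : leftMul (finest ℓ d) (finest ℓ d) (z + z') hmem =
      leftMul (finest ℓ d) (finest ℓ d) z h.1 + leftMul (finest ℓ d) (finest ℓ d) z' h'.1 := by
    refine schur_ext fun nu => ?_
    rw [LinearMap.add_apply]
    by_cases hnu : nu = finest ℓ d
    · subst hnu
      rw [leftMul_inMod, leftMul_inMod, leftMul_inMod, ← map_add]
      exact congrArg _ (Subtype.ext (add_mul _ _ _))
    · rw [leftMul_inMod_of_ne _ hnu, leftMul_inMod_of_ne _ hnu, leftMul_inMod_of_ne _ hnu,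
        add_zero]
  rw [e, map_add, map_add, h.2, h'.2]

variable (h : IsPolRep q Q ρ) (h' : IsPolRep q Q ρ')
include h h'

theorem agreeAt_poly (f : Laurent k d) : AgreeAt ρ ρ' (poly d q Q f) := by
  obtain ⟨φ, hφ, _⟩ := (generatorsExist d q Q).poly (finest ℓ d) ⟨f, mem_invariants_finest f⟩
  exact AgreeAt.of_isMap hφ rfl ((h.poly _ _ φ hφ).eq (h'.poly _ _ φ hφ))

/-- A crossing of two black strands is a merge followed by a split, up to the constant `q`. -/
theorem agreeAt_tau {s : Fin (ℓ + d - 1)} (hs : ℓ ≤ (s : ℕ)) : AgreeAt ρ ρ' (tau q Q s) := by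
  have hs2 := s.2
  set r : Fin (d - 1) := ⟨s - ℓ, by omega⟩ with hr
  have hsp := isSplit_withPair (ℓ := ℓ) r
  obtain ⟨σ, hσ, _⟩ := (generatorsExist d q Q).split _ _ _ _ _ _ _ hsp
  obtain ⟨τ, hτ, _⟩ := (generatorsExist d q Q).merge _ _ _ _ _ _ _ hsp
  have hcol : (withPair r : MultiComp ℓ d).col = omega ℓ d := by rw [← hsp.col_eq, col_finest]
  have hmE : m q Q (withPair r : MultiComp ℓ d) * m q Q (finest ℓ d) = m q Q (withPair r) := by
    rw [m_finest, ← hcol]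
    exact (isOp_m _).mul_E
  have hmem : m q Q (withPair r : MultiComp ℓ d) * m q Q (finest ℓ d) ∈
      mIdeal q Q (finest ℓ d) := by
    rw [hmE, ← one_mul (m q Q (withPair r))]
    exact hsp.m_mem
  -- the merge followed by the split is the left multiplication by `m_λ`, where `λ` has the entry
  -- `2`
  have e : leftMul (finest ℓ d) (finest ℓ d) (m q Q (withPair r)) hmem = σ * τ := by
    refine schur_ext fun nu => ?_
    rw [Module.End.mul_apply]
    by_cases hnu : nu = finest ℓ d
    · subst hnu
      obtain ⟨v, hv, ev⟩ := hτ.1 (mGen q Q _) 1 (mul_one _).symm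
      obtain ⟨w, hw, ew⟩ := hσ.1 v 1 hv
      rw [ev, ew, leftMul_inMod]
      refine congrArg _ (Subtype.ext ?_)
      rw [hw, mul_one]
      exact hmE
    · rw [leftMul_inMod_of_ne _ hnu, hτ.2 nu hnu, map_zero]
  have h1 : AgreeAt ρ ρ' (m q Q (withPair r)) := by
    refine ⟨hmem, ?_⟩
    rw [e, map_mul, map_mul, (h.split _ _ _ _ _ _ _ hsp σ hσ).eq (h'.split _ _ _ _ _ _ _ hsp σ hσ),
      (h.merge _ _ _ _ _ _ _ hsp τ hτ).eq (h'.merge _ _ _ _ _ _ _ hsp τ hτ)]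
  -- `m_λ = (T_s - q) e(ω)`, as can be seen from the operators
  refine (h1.add (agreeAt_poly h h' (algebraMap k _ q))).congr ?_
  rw [add_mul, hmE, m_finest]
  have h2 := (isOp_m (q := q) (Q := Q) (withPair r : MultiComp ℓ d)).add
    ((isOp_E (withPair r : MultiComp ℓ d).col).poly_mul (algebraMap k (Laurent k d) q))
  rw [hcol] at h2
  refine h2.eq (IsOp.of_mul_E fun f => ?_)
  have hb : ∀ i : Fin (ℓ + d), ℓ ≤ (i : ℕ) → (omega ℓ d).1 i = 0 := fun i hi => by
    by_contra hne
    exact absurd (omega_eq_one.1 (fin_two_ne_zero hne)) (not_lt.2 hi)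
  have hlo : (omega ℓ d).1 (lo s) = 0 := hb _ hs
  have hhi : (omega ℓ d).1 (hi s) = 0 := hb _ (hs.trans (Nat.le_succ _))
  have hnb : (omega ℓ d).nb s = r := by
    have e1 := (omega ℓ d).nb_blackPos (lo r)
    have e2 := omega_blackPos (ℓ := ℓ) (lo r)
    have e3 : ((lo r : Fin d) : ℕ) = s - ℓ := rfl
    rw [e2, e3, Nat.add_sub_cancel' hs] at e1
    exact e1
  rw [act_tau_single, hlo, hhi, crossOp_zero_zero, hnb, Col.swap_of_eq (hlo.trans hhi.symm)]
  rw [LinearMap.add_apply, antisym_withPair, Module.End.mul_apply, Module.End.one_apply,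
    LinearMap.mulLeft_apply, ← Algebra.smul_def, sub_add_cancel, lusztigN, dif_pos r.2]

theorem agreeAt_tauWord {L : List (Fin (ℓ + d - 1))} (hL : ∀ s ∈ L, ℓ ≤ (s : ℕ)) :
    AgreeAt ρ ρ' (tauWord q Q L) := by
  induction L with
  | nil =>
    rw [tauWord_nil, ← poly_one]
    exact agreeAt_poly h h' 1
  | cons s L ih =>
    rw [tauWord_cons]
    exact (agreeAt_tau h h' (hL s (List.mem_cons_self ..))).mul
      (ih fun r hr => hL r (List.mem_cons_of_mem _ hr))

/-- An endomorphism of `e(ω) H` is the left multiplication by an element of `e(ω) H e(ω)`, which is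
a combination of diagrams that fix the red strands, with dots at the bottom; such diagrams are
products of crossings of black strands. -/
theorem agreeOn_finest : AgreeOn ρ ρ' (finest ℓ d) (finest ℓ d) := by
  classical
  intro φ h1 h2
  set o := omega ℓ d with ho
  obtain ⟨u, hu⟩ : ∃ u : mIdeal q Q (finest ℓ d),
      φ (inMod d q Q _ (mGen q Q (finest ℓ d))) = inMod d q Q _ u := by
    rw [← h1]
    exact ⟨_, rfl⟩
  have hEu : E q Q o * (u : Hecke d q Q) = u := by
    obtain ⟨a, ha⟩ := mem_mIdeal.1 u.2
    rw [ha, m_finest, ← mul_assoc, E_mul_self]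
  have huE : (u : Hecke d q Q) * E q Q o = u := by
    have e : op (E q Q o) • mGen q Q (finest ℓ d) = mGen q Q (finest ℓ d) := by
      refine Subtype.ext ?_
      change m q Q (finest ℓ d) * E q Q o = m q Q (finest ℓ d)
      rw [m_finest, E_mul_self]
    have e1 : inMod d q Q _ (op (E q Q o) • u) = inMod d q Q (finest ℓ d) u := by
      rw [map_smul, ← hu, ← map_smul, ← map_smul, e]
    have e2 := congrArg (DirectSum.component (Hecke d q Q)ᵐᵒᵖ (MultiComp ℓ d)
      (fun lam => mIdeal q Q lam) (finest ℓ d)) e1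
    rw [DirectSum.component.lof_self, DirectSum.component.lof_self] at e2
    exact congrArg Subtype.val e2
  -- hence `φ` is the left multiplication by `u`
  have hmap : IsMap d q Q (finest ℓ d) (finest ℓ d) ((u : Hecke d q Q) * m q Q (finest ℓ d)) φ := by
    refine ⟨fun v a hv => ⟨op a • u, ?_, ?_⟩, fun nu hnu v => ?_⟩
    · rw [m_finest, huE]
      rfl
    · rw [show v = op a • mGen q Q (finest ℓ d) from Subtype.ext hv, map_smul, map_smul, hu,
        map_smul]
    · rw [← h2, Module.End.mul_apply, idem_inMod_of_ne hnu, map_zero]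
  suffices hag : AgreeAt ρ ρ' (u : Hecke d q Q) by
    rw [hmap.eq_leftMul hag.1 rfl]
    exact hag.2
  obtain ⟨f, hf⟩ := exists_eq_sum_tauWord (u : Hecke d q Q) o
  have hred : ∀ W : Equiv.Perm (Fin (ℓ + d)), ((reducedWord W).map simpleRefl).prod = W :=
    reducedWord_prod
  -- the diagrams which do not fix the red strands are killed by the idempotents
  have hsum : (u : Hecke d q Q) = ∑ W, E q Q o *
      (tauWord q Q (reducedWord W) * (poly d q Q (f W) * E q Q o)) := by
    rw [← Finset.mul_sum, ← hf, huE, hEu]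
  have hadd : ∀ s : Finset (Equiv.Perm (Fin (ℓ + d))), AgreeAt ρ ρ' (∑ W ∈ s, E q Q o *
      (tauWord q Q (reducedWord W) * (poly d q Q (f W) * E q Q o))) := by
    have h0 : AgreeAt ρ ρ' (0 : Hecke d q Q) := by
      have := agreeAt_poly h h' (0 : Laurent k d)
      rwa [poly_eq, map_zero] at this
    intro s
    induction s using Finset.induction_on with
    | empty => rwa [Finset.sum_empty]
    | insert W s hW ih =>
      rw [Finset.sum_insert hW]
      refine AgreeAt.add ?_ ih
      have e1 : E q Q o * (tauWord q Q (reducedWord W) * (poly d q Q (f W) * E q Q o)) =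
          E q Q o * E q Q (o.move W) * tauWord q Q (reducedWord W) * poly d q Q (f W) := by
        rw [← E_mul_poly, ← mul_assoc (tauWord q Q _), tauWord_mul_E, hred, ← mul_assoc,
          ← mul_assoc]
      by_cases hm : o.move W = o
      · by_cases hR : RedMono o W
        · have e2 : E q Q o * tauWord q Q (reducedWord W) =
              tauWord q Q (reducedWord W) * E q Q o := by
            rw [tauWord_mul_E, hred, hm]
          refine ((agreeAt_tauWord h h' (le_of_mem_reduced (L := reducedWord W)
            (by rw [hred, reducedWord_length]) fun i hi => ?_)).mul
            (agreeAt_poly h h' (f W))).congr ?_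
          · rw [hred]
            exact hR.fix hm i hi
          · rw [e1, hm, E_mul_self, e2, m_finest, mul_assoc _ (E q Q o), E_mul_poly,
              mul_assoc _ _ (E q Q o), mul_assoc _ _ (E q Q o), mul_assoc _ _ (E q Q o), E_mul_self]
        · have e3 := tauWord_mul_E_eq_zero (q := q) (Q := Q) (L := reducedWord W) (c := o)
            (by rwa [hred])
          rw [← E_mul_poly, ← mul_assoc (tauWord q Q _), e3, zero_mul, mul_zero]
          exact h0
      · rw [e1, E_mul_E, if_neg (Ne.symm hm), zero_mul, zero_mul]
        exact h0
  rw [hsum]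
  exact hadd _

end Finest

theorem mul_left_injective_of_ne_zero {f : Laurent k d} (hf : f ≠ 0) :
    Function.Injective fun g => f * g := fun _ _ h => mul_left_cancel₀ hf h

/-- The idempotents, polynomials, splits, merges and crossings determine the action. Splits and
right crossings act injectively and lead from any summand towards the finest one; merges and left
crossings act surjectively and lead from the finest summand to any other. This reduces the claim to
the endomorphisms of the finest summand. -/
theorem IsPolRep.unique (h : IsPolRep q Q ρ) (h' : IsPolRep q Q ρ') : ρ = ρ' := by
  have hE := generatorsExist d q Q
  refine eq_of_agreeOn h h' fun lam mu => ?_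
  have h1 : AgreeOn ρ ρ' (finest ℓ d) mu := by
    refine multiComp_induction (p := fun mu => AgreeOn ρ ρ' (finest ℓ d) mu)
      (agreeOn_finest h h') ?_ ?_ mu
    · intro mu nu t l₁ a b l₂ hs hag
      obtain ⟨σ, hσ, _⟩ := hE.split _ _ _ _ _ _ _ hs
      refine AgreeOn.of_injective h h' hσ (mul_left_injective_of_ne_zero fun h0 => ?_)
        (h.split _ _ _ _ _ _ _ hs σ hσ) (h'.split _ _ _ _ _ _ _ hs σ hσ) hag
      have := hs.isBlockSplit.pLeft_eq q
      rw [h0, mul_zero] at this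
      exact pLeft_ne_zero q _ this
    · intro nu mu t a hc hag
      obtain ⟨σ, hσ, _⟩ := hE.right _ _ _ _ hc
      refine AgreeOn.of_injective h h' hσ (mul_left_injective_of_ne_zero ?_)
        (h.right _ _ _ _ hc σ hσ) (h'.right _ _ _ _ hc σ hσ) hag
      exact Finset.prod_ne_zero_iff.2 fun i _ => x_sub_algebraMap_ne_zero i _
  refine multiComp_induction (p := fun lam => AgreeOn ρ ρ' lam mu) h1 ?_ ?_ lam
  · intro lam nu t l₁ a b l₂ hs hag
    obtain ⟨σ, hσ, _⟩ := hE.merge _ _ _ _ _ _ _ hs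
    refine AgreeOn.of_surjective h h' hσ (fun f hf => ?_)
      (h.merge _ _ _ _ _ _ _ hs σ hσ) (h'.merge _ _ _ _ _ _ _ hs σ hσ) hag
    obtain ⟨g, rfl⟩ := exists_youngDemazure_eq_of_invariant hf
    exact ⟨_, youngDemazure_mem nu g, blockDemazure_youngDemazure hs g⟩
  · intro nu lam t a hc hag
    obtain ⟨σ, hσ, _⟩ := hE.left _ _ _ _ hc
    refine AgreeOn.of_surjective h h' hσ (fun f hf => ⟨f, ?_, rfl⟩)
      (h.left _ _ _ _ hc σ hσ) (h'.left _ _ _ _ hc σ hσ) hag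
    rw [mem_invariants, hc.concat_eq]
    exact hf

end Unique

end AffineSchur

end

theorem mainTheorem6 {k : Type*} [Field k] [IsAlgClosed k] {ℓ : ℕ} (d : ℕ) (q : k)
    (hq0 : q ≠ 0) (hq1 : q ≠ 1) (Q : Fin ℓ → k) (hQ : ∀ t, Q t ≠ 0) :
    AffineSchur.GeneratorsExist d q Q ∧
    ∃ ρ : AffineSchur.Schur d q Q →ₐ[k] Module.End k (AffineSchur.PolSpace k ℓ d),
      AffineSchur.IsPolRep q Q ρ ∧
      (∀ ρ', AffineSchur.IsPolRep q Q ρ' → ρ' = ρ) ∧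
      Function.Injective ρ ∧
      ∃ Θ : AffineSchur.PolSpace k ℓ d →ₗ[k] AffineSchur.DefMod d q Q,
        (∀ (lam : AffineSchur.MultiComp ℓ d) (f : AffineSchur.invariants k lam),
          ∃ y : AffineSchur.Hecke.mIdeal q Q lam,
            (y : AffineSchur.Hecke d q Q) = AffineSchur.Hecke.Phi q Q lam f ∧
            Θ (AffineSchur.inPol lam f) = AffineSchur.inMod d q Q lam y) ∧
        Function.Injective Θ ∧
        ∀ (φ : AffineSchur.Schur d q Q) (v : AffineSchur.PolSpace k ℓ d),
          Θ (ρ φ v) = φ (Θ v) := by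
  obtain ⟨ρ, hρ⟩ := AffineSchur.exists_polAction d q Q
  have hrep := AffineSchur.isPolRep_of_embedding hρ
  exact ⟨AffineSchur.generatorsExist d q Q, ρ, hrep, fun _ h => h.unique hrep,
    AffineSchur.polAction_injective hρ, AffineSchur.embedding d q Q,
    fun lam f => ⟨AffineSchur.phiMap q Q lam f, rfl, AffineSchur.embedding_inPol lam f⟩,
    AffineSchur.embedding_injective, hρ⟩
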